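/- **Setting.** Let $\pi$ be a finite groupoid with at most one morphism between any two objects; $s,t$ denote source and target. Let $\Gamma=\pi^2$ be the double groupoid of commutative squares of $\pi$ (vertical composition $\circ$, horizontal composition $\bullet$, identity squares $\mathrm{id}^\circ_f$ with both horizontal sides $f$, identity squares $\mathrm{id}^\bullet_u$ with both vertical sides $u$, double inverse $\iota$). Let $V$ be a finite dimensional $\pi$-graded complex vector space with homogeneous basis $(e_i)_{i\in X}$ of degrees $\deg i\in\pi_1$, and $V^*$ its dual with dual basis $e^i$ of degree $(\deg i)^{-1}$. Let $L\in\mathbb C^\times$, $\lambda\in\mathbb C$. Suppose given: * for every $\tau$ in the upper half-plane an $R$-matrix $\check R_{VV}(u)=\check R_{VV}(u,\tau)\in\mathrm{End}(V\otimes V)$, i.e. a meromorphic function of $u\in\mathbb C$ with values in degree-preserving endomorphisms such that, for generic $u,v$, $\check R^{(23)}(u-v)\check R^{(12)}(u)\check R^{(23)}(v)=\check R^{(12)}(v)\check R^{(23)}(u)\check R^{(12)}(u-v)$ and $\check R(u)\check R(-u)=\mathrm{Id}$; * a nondegenerate morphism $\omega\colon V\otimes V^*\to\mathbf 1$ with dual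 $\sigma\colon\mathbf 1\to V^*\otimes V$, and a function $G\colon\pi_0\to\mathbb C$, nonzero at the end points of the degrees of $V$; put $\omega^*(e^i\otimes e_j)=\frac{G(s(\deg j))}{G(t(\deg j))}\,\omega(e_j\otimes e^i)$ and let $\sigma^*\colon\mathbf 1\to V\otimes V^*$ be dual to $\omega^*$. Define the rotations $\check R_{V^*V}(u)=\omega^{*(12)}\check R_{VV}^{(23)}(\lambda-u)\,\sigma^{*(34)}$, $\check R_{VV^*}(u)=\omega^{(34)}\check R_{VV}^{(23)}(\lambda-u)\,\sigma^{(12)}$, $\check R_{V^*V^*}(u)=\omega^{(34)}\check R_{VV^*}^{(23)}(\lambda-u)\,\sigma^{(12)}$, and assume crossing symmetry: for every $\tau$ there is a meromorphic function $\alpha$ with $\omega^{(23)}\check R_{VV}^{(12)}(u+\lambda)\check R_{V^*V}^{(23)}(u)=\alpha(u)\,\omega^{(12)}$ and $\check R_{V^*V}^{(12)}(u)\check R_{VV}^{(23)}(u+\lambda)\sigma^{(12)}=\alpha(u)\,\sigma^{(23)}$. Assume that the matrix elements of $\check R_{VV}$, $\check R_{V^*V}$, $\check R_{V^*V^*}$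 have power series expansions $\sum_{n,m\ge0}c[n,m]\,z^n(p/z)^m$, $z=e^{2\pi iu/L}$, $p=e^{2\pi i\tau}$, convergent for small $z$ and $p/z$. Let $K$ be a commutative $\mathbb C$-algebra (for instance $\mathbb C$ or $\mathbb C[p]$). **The algebra.** $A=A_{R,\omega,\omega^*}=\bigoplus_{\alpha\in\pi^2}A_\alpha$ is the $\pi^2$-graded unital $K$-algebra (for the vertical product $A_\alpha\otimes A_\beta\to A_{\beta\circ\alpha}$, with unit components $\eta_f\in A_{\mathrm{id}^\circ_f}$) generated by the coefficients of the formal series $T_i^j(u)$, $(T^*)_{-i}^{-j}(u)$, $\xi_2^\pm(u)$ in $z$ and $p/z$. Here the coefficients of $T_i^j(u)$ have as degree the square with vertical sides $\deg i,\deg j$, those of $(T^*)^{-j}_{-i}(u)$ the square with vertical sides $(\deg i)^{-1},(\deg j)^{-1}$ (these series are $0$ if there is no such square), and those of $\xi_2^\pm(u)$ are central elements of $\bigoplus_fA_{\mathrm{id}^\circ_f}$. The relations are $\xi_2^\pm(u)\xi_2^\mp(u)=1$, $$\check R_{VV}^{(23)}(u_{12})T^{(1)}(u_1)T^{(2)}(u_2)=T^{(1)}(u_2)T^{(2)}(u_1)\check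 R_{VV}^{(12)}(u_{12}),$$ $$\check R_{V^*V^*}^{(23)}(u_{12})T^{*(1)}(u_1)T^{*(2)}(u_2)=T^{*(1)}(u_2)T^{*(2)}(u_1)\check R_{V^*V^*}^{(12)}(u_{12}),$$ $$\check R_{V^*V}^{(23)}(u_{12})T^{*(1)}(u_1)T^{(2)}(u_2)=T^{(1)}(u_2)T^{*(2)}(u_1)\check R_{V^*V}^{(12)}(u_{12}),$$ $$\omega^{(23)}T^{(1)}(u+\lambda)T^{*(2)}(u)=\omega^{(12)}\xi_2^+(u),\qquad \omega^{*(23)}T^{*(1)}(u+\lambda)T^{(2)}(u)=\omega^{*(12)},$$ $$T^{*(1)}(u)T^{(2)}(u+\lambda)\sigma^{(12)}=\xi_2^+(u)\sigma^{(23)},\qquad T^{(1)}(u)T^{*(2)}(u+\lambda)\sigma^{*(12)}=\sigma^{*(23)},$$ with $u_{12}=u_1-u_2$, understood as identities of formal power series, in $e^{2\pi iu_{12}/L}$, $e^{2\pi iu_2/L}$, $p\,e^{-2\pi iu_1/L}$ for the first three and in $e^{2\pi iu/L}$, $p\,e^{-2\pi iu/L}$ for the others. **Graded Hopf algebras.**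 Let $I_h$ have basis $1_u$, $u\in\pi_1$, with $1_u$ of degree $\mathrm{id}^\bullet_u$. A $\pi^2$-graded Hopf algebra is a $\pi^2$-graded unital algebra $A$ for the vertical tensor product with a degree-preserving coproduct $\Delta\colon A\to A\otimes_hA$ and counit $\epsilon\colon A\to I_h$, coassociative and counital for the horizontal tensor product, such that $\Delta(xy)=\Delta(x)\Delta(y)$, $\Delta(\eta_f)=\sum_{h\circ g=f}\eta_g\otimes\eta_h$, $\epsilon(xy)=\epsilon(x)\epsilon(y)$ (with $1_u1_v=1_{v\circ u}$ for composable $u,v$ and $0$ otherwise), $\epsilon(\eta_f)=1_f$ if $f$ is an identity and $0$ otherwise, and with an algebra isomorphism $S\colon A\to A^{op}$ onto the opposite algebra, $S(A_\alpha)\subseteq A_{\iota(\alpha)}$, such that, for $\epsilon(x)=\sum_u\epsilon_u(x)1_u$ and with $p$ the projection $A\otimes A\to A\otimes_vA$, $$\nabla\, p\,(S\otimes\mathrm{id})\Delta(x)=\sum_u\epsilon_u(x)\sum_{t(f)=t(u)}\eta_f,\qquad \nabla\, p\,(\mathrm{id}\otimes S)\Delta(x)=\sum_u\epsilon_u(x)\sum_{s(f)=s(u)}\eta_f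 .$$ **Theorem.** $A_{R,\omega,\omega^*}$, with its grading, product and unit, is a $\pi^2$-graded Hopf algebra with structure maps satisfying * $\Delta(T_i^j(u))=\sum_kT_i^k(u)\otimes T_k^j(u)$, $\Delta((T^*)_{-i}^{-j}(u))=\sum_k(T^*)_{-i}^{-k}(u)\otimes(T^*)_{-k}^{-j}(u)$, $\Delta(\xi_{2,f}^\pm(u))=\sum_{h\circ g=f}\xi^\pm_{2,g}(u)\otimes\xi^\pm_{2,h}(u)$, where $\xi_{2,f}^{\pm}$ is the component in $A_{\mathrm{id}_f^\circ}$; * $\epsilon(T_i^j(u))=\delta_{ij}1_{\deg i}$, $\epsilon((T^*)_{-i}^{-j}(u))=\delta_{ij}1_{(\deg i)^{-1}}$, $\epsilon(\xi_{2,f}^\pm(u))=1_f$ if $f$ is an identity and $0$ otherwise; * $S(T_i^j(u))=\xi_2^-(u-\lambda)\sum_{k,l}\omega(e_i\otimes e^k)\,(T^*)_{-l}^{-k}(u-\lambda)\,\sigma^{lj}$, $S((T^*)_{-i}^{-j}(u))=\sum_{k,l}\omega^*(e^i\otimes e_k)\,T_l^k(u-\lambda)\,\sigma^{*lj}$, $S(\xi_2^\pm(u))=\xi_2^\mp(u)$,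 $S(\eta_f)=\eta_{f^{-1}}$, where $\sigma(1)=\sum\sigma^{ij}e^i\otimes e_j$ and $\sigma^*(1)=\sum\sigma^{*ij}e_i\otimes e^j$. -/

import Mathlib

open CategoryTheory TensorProduct

namespace DG

/-! ### Arrows and commutative squares of a groupoid -/

section Squares

/-- The set `π₁` of all arrows of a groupoid `π`. -/
abbrev Arr (π : Type*) [Groupoid π] := Σ a : π, Σ b : π, (a ⟶ b)

variable {π : Type*} [Groupoid π]

/-- Source of an arrow. -/
abbrev Arr.src (f : Arr π) : π := f.1

/-- Target of an arrow. -/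
abbrev Arr.tgt (f : Arr π) : π := f.2.1

/-- The underlying morphism of an arrow. -/
abbrev Arr.hom (f : Arr π) : f.src ⟶ f.tgt := f.2.2

/-- The identity arrow at an object. -/
def Arr.one (a : π) : Arr π := ⟨a, a, 𝟙 a⟩

/-- The inverse arrow. -/
def Arr.inv (f : Arr π) : Arr π := ⟨f.tgt, f.src, Groupoid.inv f.hom⟩

/-- `Arr.IsComp f g h`: the arrow `h` is the composition "first `f`, then `g`". -/
inductive Arr.IsComp : Arr π → Arr π → Arr π → Prop
  | mk {a b c : π} (f : a ⟶ b) (g : b ⟶ c) : Arr.IsComp ⟨a, b, f⟩ ⟨b, c, g⟩ ⟨a, c, f ≫ g⟩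

/-- Commutative squares of `π`, the 2-cells of the double groupoid `π²`:
```
  tl --top--> tr
  |           |
 left       right
  v           v
  bl -bottom-> br
```
-/
structure Sq (π : Type*) [Groupoid π] where
  (tl tr bl br : π)
  (left : tl ⟶ bl)
  (top : tl ⟶ tr)
  (right : tr ⟶ br)
  (bottom : bl ⟶ br)
  (comm : left ≫ bottom = top ≫ right)

/-- `IsHComp α β γ`: `γ` is the horizontal composition `β • α` (`α` on the left, `β` on the right). -/
inductive IsHComp : Sq π → Sq π → Sq π → Prop
  | mk {a a' a'' b b' b'' : π} (u : a ⟶ b) (v : a' ⟶ b') (w : a'' ⟶ b'')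
      (f : a ⟶ a') (f' : a' ⟶ a'') (g : b ⟶ b') (g' : b' ⟶ b'')
      (h : u ≫ g = f ≫ v) (h' : v ≫ g' = f' ≫ w) (h'' : u ≫ g ≫ g' = (f ≫ f') ≫ w) :
      IsHComp ⟨a, a', b, b', u, f, v, g, h⟩ ⟨a', a'', b', b'', v, f', w, g', h'⟩
        ⟨a, a'', b, b'', u, f ≫ f', w, g ≫ g', h''⟩

/-- `IsVComp α β γ`: `γ` is the vertical composition `β ∘ α` (`α` on top, `β` below). -/
inductive IsVComp : Sq π → Sq π → Sq π → Prop
  | mk {a a' b b' c c' : π} (u : a ⟶ b) (u' : b ⟶ c) (v : a' ⟶ b') (v' : b' ⟶ c')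
      (f : a ⟶ a') (g : b ⟶ b') (k : c ⟶ c')
      (h : u ≫ g = f ≫ v) (h' : u' ≫ k = g ≫ v') (h'' : (u ≫ u') ≫ k = f ≫ v ≫ v') :
      IsVComp ⟨a, a', b, b', u, f, v, g, h⟩ ⟨b, b', c, c', u', g, v', k, h'⟩
        ⟨a, a', c, c', u ≫ u', f, v ≫ v', k, h''⟩

/-- The identity 2-cell `id^•_u` of the horizontal groupoid (both vertical sides are `u`). -/
def Sq.hid (u : Arr π) : Sq π :=
  ⟨u.src, u.src, u.tgt, u.tgt, u.hom, 𝟙 _, u.hom, 𝟙 _, by simp⟩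

/-- The identity 2-cell `id^∘_f` of the vertical groupoid (both horizontal sides are `f`). -/
def Sq.vid (f : Arr π) : Sq π :=
  ⟨f.src, f.tgt, f.src, f.tgt, 𝟙 _, f.hom, 𝟙 _, f.hom, by simp⟩

/-- The double inverse `ι`. -/
def Sq.iota (α : Sq π) : Sq π :=
  ⟨α.br, α.bl, α.tr, α.tl, Groupoid.inv α.right, Groupoid.inv α.bottom,
    Groupoid.inv α.left, Groupoid.inv α.top, by
      have h := congrArg Groupoid.inv α.comm
      simpa [Groupoid.inv_eq_inv] using h.symm⟩

/-- The square with left side `i`, right side `j` and top side `l`. -/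
def Sq.ofTop (i j : Arr π) (l : i.src ⟶ j.src) : Sq π :=
  ⟨i.src, j.src, i.tgt, j.tgt, i.hom, l, j.hom, Groupoid.inv i.hom ≫ l ≫ j.hom, by simp⟩

end Squares

/-! ### Graded Hopf algebras

As `π` is finite, a `π²`-graded vector space `(A_α)` is the same thing as its total space
`A = ⨁ A_α` with this decomposition, and a unital algebra for the vertical tensor product is a
unital ring structure on `A` such that `A_α A_β ⊆ A_{β∘α}` for vertically composable squares,
`A_α A_β = 0` otherwise, and `1 = ∑_f η_f` with `η_f ∈ A_{id_f^∘}`. The horizontal tensor product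
`A ⊗_h A` is the part of `A ⊗ A` spanned by the `A_α ⊗ A_β` with horizontally composable `α, β`, and
its vertical product is the restriction of the product of `A ⊗ A`.
The unit `I_h` has total space `π₁ → K`, the basis vector at `u` having degree `id_u^•`; the unit
`I_v` has total space `π₁ → K` as well, the basis vector at `f` having degree `id_f^∘`. -/

section Hopf

variable (K : Type*) [CommRing K] (π : Type*) [Groupoid π] [Fintype π]
  [∀ a b : π, Fintype (a ⟶ b)] (A : Type*) [Ring A] [Algebra K A]

variable {K π A} in
/-- The component of degree `γ` of `A ⊗_h A`, inside `A ⊗ A`. -/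
def tensorH (grading : Sq π → Submodule K A) (γ : Sq π) : Submodule K (A ⊗[K] A) :=
  ⨆ (α : Sq π) (β : Sq π) (_ : IsHComp α β γ),
    LinearMap.range (TensorProduct.map (grading α).subtype (grading β).subtype)

variable {π} in
/-- The linear form on `I_h` that adds up all components. On `I_h ⊗_h A` and `A ⊗_h I_h` it induces
the unit isomorphisms with `A`. -/
def sumForm : (Arr π → K) →ₗ[K] K := ∑ u : Arr π, LinearMap.proj u

open scoped Classical in
/-- `π²`-graded bialgebras over `K`. -/
structure GradedBialgebra where
  /-- the homogeneous components `A_α` -/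
  grading : Sq π → Submodule K A
  /-- the components `η_f ∈ A_{id_f^∘}` of the unit -/
  eta : Arr π → A
  /-- the coproduct `Δ : A → A ⊗_h A` -/
  comul : A →ₗ[K] A ⊗[K] A
  /-- the counit `ε : A → I_h` -/
  counit : A →ₗ[K] (Arr π → K)
  isInternal : DirectSum.IsInternal grading
  -- (H1): unital algebra for the vertical monoidal structure
  mul_mem : ∀ {α β γ x y}, IsVComp α β γ → x ∈ grading α → y ∈ grading β → x * y ∈ grading γ
  mul_eq_zero : ∀ {α β x y}, (∀ γ, ¬ IsVComp α β γ) → x ∈ grading α → y ∈ grading β → x * y = 0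
  eta_mem : ∀ f, eta f ∈ grading (Sq.vid f)
  sum_eta : ∑ f, eta f = 1
  -- (H2): counital coalgebra for the horizontal monoidal structure
  comul_mem : ∀ {γ x}, x ∈ grading γ → comul x ∈ tensorH grading γ
  counit_eq_zero : ∀ {γ x u}, x ∈ grading γ → γ ≠ Sq.hid u → counit x u = 0
  coassoc : ∀ x, TensorProduct.assoc K A A A (comul.rTensor A (comul x)) =
    comul.lTensor A (comul x)
  counit_comul : ∀ x, TensorProduct.lid K A ((sumForm K ∘ₗ counit).rTensor A (comul x)) = x
  comul_counit : ∀ x, TensorProduct.rid K A ((sumForm K ∘ₗ counit).lTensor A (comul x)) = x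
  -- (H3): the coproduct is compatible with the product
  comul_mul : ∀ x y, comul (x * y) = comul x * comul y
  -- (H4): compatibility of the coproduct with the unit and of the counit with the product
  comul_eta : ∀ f, comul (eta f) =
    ∑ g : Arr π, ∑ h : Arr π, if Arr.IsComp g h f then eta g ⊗ₜ[K] eta h else 0
  counit_mul : ∀ x y w, counit (x * y) w =
    ∑ u : Arr π, ∑ v : Arr π, if Arr.IsComp u v w then counit x u * counit y v else 0
  -- (H5): `ε ∘ η = σ`
  counit_eta : ∀ f, counit (eta f) = if f = Arr.one f.src then Pi.single f 1 else 0

variable {K A} in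
/-- A linear map to the opposite algebra as a linear endomorphism. -/
def opLin (S : A ≃ₐ[K] Aᵐᵒᵖ) : A →ₗ[K] A :=
  (MulOpposite.opLinearEquiv K).symm.toLinearMap ∘ₗ S.toLinearMap

open scoped Classical in
/-- `π²`-graded Hopf algebras over `K`. The antipode is an isomorphism from `A` to the opposite
algebra and maps `A_α` to `A_{ι(α)}` (H6). In the antipode axioms (H7), the multiplication of `A`
applied to `A ⊗ A` vanishes on pairs of components whose horizontal sides do not match, hence is
`∇ ∘ p`. The right-hand sides are `η` applied to the images of `ε x` under the two maps
`I_h → I_v` that send the basis vector at `u` to the sum of the basis vectors at all arrows with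
the same target as `u`, respectively with the same source as `u`. -/
structure GradedHopfAlgebra extends GradedBialgebra K π A where
  antipode : A ≃ₐ[K] Aᵐᵒᵖ
  antipode_mem : ∀ {α x}, x ∈ grading α → opLin antipode x ∈ grading α.iota
  antipode_left : ∀ x, LinearMap.mul' K A ((opLin antipode).rTensor A (comul x)) =
    ∑ u : Arr π, counit x u • ∑ f : Arr π, if f.tgt = u.tgt then eta f else 0
  antipode_right : ∀ x, LinearMap.mul' K A ((opLin antipode).lTensor A (comul x)) =
    ∑ u : Arr π, counit x u • ∑ f : Arr π, if f.src = u.src then eta f else 0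

end Hopf

/-! ### `R`-matrices and their rotations

A finite dimensional `π`-graded vector space `V` over `ℂ` is given by a finite homogeneous basis
`(e_i)`, `i ∈ X`, and the degrees `deg i` of the basis vectors; the dual basis `(e^i)` of `V^*` has
degrees `(deg i)⁻¹`. In `Vect_π` the vector space `V ⊗ V` has the basis of the `e_i ⊗ e_j` with
composable degrees. -/

section RMatrix

/-- Matrix entries `M i j k l = M_{ij}^{kl}` of a map `e_i ⊗ e_j ↦ ∑ M_{ij}^{kl} e_k ⊗ e_l`. -/
abbrev Coeff (X : Type*) (B : Type*) := X → X → X → X → B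

variable {π : Type*} [Groupoid π] {X : Type*} [Fintype X]

open scoped Classical in
/-- `R` is an `R`-matrix on `V ⊗ V`: meromorphic in the spectral parameter, a morphism of `π`-graded
vector spaces, with the Yang-Baxter equation and the inversion relation for generic parameters. -/
structure IsRMatrix (deg : X → Arr π) (R : ℂ → Coeff X ℂ) : Prop where
  meromorphic : ∀ i j k l, Meromorphic (fun u => R u i j k l)
  graded : ∀ u i j k l, R u i j k l ≠ 0 →
    ∃ w, Arr.IsComp (deg i) (deg j) w ∧ Arr.IsComp (deg k) (deg l) w
  yangBaxter : ∀ᶠ u in Filter.codiscrete ℂ, ∀ᶠ v in Filter.codiscrete ℂ, ∀ i j k l m n,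
    ∑ a, ∑ b, ∑ c, R (u - v) c b m n * R u i a l c * R v j k a b =
      ∑ a, ∑ b, ∑ c, R v a c l m * R u b k c n * R (u - v) i j a b
  inversion : ∀ᶠ u in Filter.codiscrete ℂ, ∀ i j m n, (deg i).tgt = (deg j).src →
    ∑ k, ∑ l, R u k l m n * R (-u) i j k l = if i = m ∧ j = n then 1 else 0

open scoped Classical in
/-- The maps `ω : V ⊗ V^* → 1`, `σ : 1 → V^* ⊗ V` with `ω(e_i ⊗ e^j) = om i j` and
`σ(1) = ∑ sg i j e^i ⊗ e_j`, and the function `G` on the objects (needed only at the end points of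
the degrees of `V`). -/
structure Pairing (deg : X → Arr π) where
  om : X → X → ℂ
  sg : X → X → ℂ
  G : π → ℂ
  graded : ∀ i j, om i j ≠ 0 → deg i = deg j
  zigzag_dual : ∀ i j, ∑ k, sg i k * om k j = if i = j then 1 else 0
  zigzag : ∀ i j, ∑ k, om i k * sg k j = if i = j then 1 else 0
  G_src_ne : ∀ i, G (deg i).src ≠ 0
  G_tgt_ne : ∀ i, G (deg i).tgt ≠ 0

namespace Pairing

variable {deg : X → Arr π} (P : Pairing deg)

/-- `ω^*(e^i ⊗ e_j)`. -/
noncomputable def omStar (i j : X) : ℂ := P.G (deg j).src / P.G (deg j).tgt * P.om j i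

/-- `σ^*(1) = ∑ σ^*(i, j) e_i ⊗ e^j`. -/
noncomputable def sgStar (i j : X) : ℂ := P.G (deg i).tgt / P.G (deg i).src * P.sg j i

variable (lam : ℂ) (R : ℂ → Coeff X ℂ)

/-- `R_{V^*V}(u) : V^* ⊗ V → V ⊗ V^*`. -/
noncomputable def rotVsV : ℂ → Coeff X ℂ := fun u i j k l =>
  ∑ a, ∑ b, P.omStar i a * R (lam - u) j b a k * P.sgStar b l

/-- `R_{VV^*}(u) : V ⊗ V^* → V^* ⊗ V`. -/
noncomputable def rotVVs : ℂ → Coeff X ℂ := fun u i j k l =>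
  ∑ a, ∑ b, P.sg k a * R (lam - u) a i l b * P.om b j

/-- `R_{V^*V^*}(u) : V^* ⊗ V^* → V^* ⊗ V^*`. -/
noncomputable def rotVsVs : ℂ → Coeff X ℂ := fun u i j k l =>
  ∑ a, ∑ b, P.sg k a * P.rotVVs lam R (lam - u) a i l b * P.om b j

open scoped Classical in
/-- Crossing symmetry with crossing parameter `lam`: equality of maps `V ⊗ V^* ⊗ V → V` and
`V → V ⊗ V^* ⊗ V`. -/
def IsCrossingSymmetric : Prop :=
  ∃ α : ℂ → ℂ, Meromorphic α ∧ ∀ᶠ u in Filter.codiscrete ℂ,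
    (∀ i j k l, (deg j).src = (deg k).src →
      ∑ a, ∑ b, ∑ c, P.om c b * R (u + lam) i a l c * P.rotVsV lam R u j k a b =
        α u * (P.om i j * if l = k then 1 else 0)) ∧
    (∀ k c d b, (deg c).tgt = (deg d).tgt →
      ∑ p, ∑ q, ∑ a, P.rotVsV lam R u p a c d * R (u + lam) q k a b * P.sg p q =
        α u * ((if c = k then 1 else 0) * P.sg d b))

end Pairing

/-- `f(u, τ) = ∑ c[n, m] z^n (p/z)^m` with `z = exp(2πiu/L)`, `p = exp(2πiτ)`, the series being
convergent for small `z` and `p/z`. -/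
def HasExpansion (L : ℂ) (f : UpperHalfPlane → ℂ → ℂ) (c : MvPowerSeries (Fin 2) ℂ) : Prop :=
  ∃ r : ℝ, 0 < r ∧ ∀ τ : UpperHalfPlane, ∀ᶠ u in Filter.codiscrete ℂ,
    ‖Complex.exp (2 * Real.pi * Complex.I * (u / L))‖ < r →
    ‖Complex.exp (2 * Real.pi * Complex.I * (τ - u / L))‖ < r →
    HasSum (fun d : Fin 2 →₀ ℕ => MvPowerSeries.coeff d c *
      Complex.exp (2 * Real.pi * Complex.I * (u / L)) ^ d 0 *
      Complex.exp (2 * Real.pi * Complex.I * (τ - u / L)) ^ d 1) (f τ u)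

end RMatrix

/-! ### Formal Fourier series

A formal Fourier series `f(u) = ∑ f[n, m] z^n (p/z)^m` with coefficients in `B` is an element of
`B[[z, w]]`, `w = p/z`. For two spectral parameters `u₁, u₂` put `z₁ = exp(2πi(u₁-u₂)/L)`,
`z₂ = exp(2πiu₂/L)`, `w = p exp(-2πiu₁/L)`. -/

section Series

variable {B : Type*}

/-- The exponent `(n, m)`. -/
noncomputable def expo (n m : ℕ) : Fin 2 →₀ ℕ := Finsupp.single 0 n + Finsupp.single 1 m

/-- `f(u₁ - u₂) = f(z₁, z₂ w)`. -/
noncomputable def at12 [Zero B] (f : MvPowerSeries (Fin 2) B) : MvPowerSeries (Fin 3) B :=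
  fun d => if d 1 = d 2 then f (expo (d 0) (d 1)) else 0

/-- `f(u₁) = f(z₁ z₂, w)`. -/
noncomputable def at1 [Zero B] (f : MvPowerSeries (Fin 2) B) : MvPowerSeries (Fin 3) B :=
  fun d => if d 0 = d 1 then f (expo (d 0) (d 2)) else 0

/-- `f(u₂) = f(z₂, z₁ w)`. -/
noncomputable def at2 [Zero B] (f : MvPowerSeries (Fin 2) B) : MvPowerSeries (Fin 3) B :=
  fun d => if d 0 = d 2 then f (expo (d 1) (d 0)) else 0

/-- `f(u + μ)`. -/
noncomputable def shift (K : Type*) [CommRing K] [Algebra ℂ K] [Ring B] [Algebra K B] (L μ : ℂ)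
    (f : MvPowerSeries (Fin 2) B) : MvPowerSeries (Fin 2) B :=
  fun d => algebraMap ℂ K (Complex.exp (2 * Real.pi * Complex.I * (μ / L)) ^ d 0 *
    Complex.exp (-(2 * Real.pi * Complex.I * (μ / L))) ^ d 1) • f d

/-- A complex number as an element of a `K`-algebra. -/
noncomputable def scal (K : Type*) [CommRing K] [Algebra ℂ K] (B : Type*) [Ring B] [Algebra K B] :
    ℂ →+* B := (algebraMap K B).comp (algebraMap ℂ K)

/-- The series `f(u) ⊗ f'(u)` with coefficients in `B ⊗ B`. -/
noncomputable def tensorSer (K : Type*) [CommRing K] [Ring B] [Algebra K B]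
    (f f' : MvPowerSeries (Fin 2) B) : MvPowerSeries (Fin 2) (B ⊗[K] B) :=
  f.map (Algebra.TensorProduct.includeLeft (R := K) (S := K) (A := B) (B := B)).toRingHom *
    f'.map (Algebra.TensorProduct.includeRight (R := K) (A := B) (B := B)).toRingHom

end Series

/-! ### The restricted quantum algebra -/

section Algebra

variable {π : Type*} [Groupoid π] {X : Type*}

/-- Generators: the units `η_f`, the Fourier coefficients of the matrix elements of `T(u)` and
`T^*(u)` (one for each square with the given vertical sides, which is determined by its top side)
and of `ξ₂^+(u)` (`true`), `ξ₂^-(u)` (`false`). -/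
inductive Gen (deg : X → Arr π)
  | e (f : Arr π)
  | T (i j : X) (l : (deg i).src ⟶ (deg j).src) (n m : ℕ)
  | Ts (i j : X) (l : (deg i).inv.src ⟶ (deg j).inv.src) (n m : ℕ)
  | xi (s : Bool) (n m : ℕ)

variable {deg : X → Arr π} {B : Type*} [Ring B] (g : Gen deg → B)

section
variable [∀ a b : π, Fintype (a ⟶ b)]

/-- The series `T_i^j(u)`. If `π` has at most one arrow between two objects, there is at most one
square with vertical sides `deg i` and `deg j`, and the sum has at most one term. -/
def serT (i j : X) : MvPowerSeries (Fin 2) B := fun d => ∑ l, g (.T i j l (d 0) (d 1))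

/-- The series `(T^*)_{-i}^{-j}(u)`. -/
def serTs (i j : X) : MvPowerSeries (Fin 2) B := fun d => ∑ l, g (.Ts i j l (d 0) (d 1))

/-- The series `ξ₂^±(u)`. -/
def serXi (s : Bool) : MvPowerSeries (Fin 2) B := fun d => g (.xi s (d 0) (d 1))

variable [Fintype π]

open scoped Classical in
/-- The part of the unit with components `η_f`, `f` of source `a`. -/
noncomputable def unitSrc (a : π) : B := ∑ f : Arr π, if f.src = a then g (.e f) else 0

open scoped Classical in
/-- The part of the unit with components `η_f`, `f` of target `a`. -/
noncomputable def unitTgt (a : π) : B := ∑ f : Arr π, if f.tgt = a then g (.e f) else 0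

end

variable [Fintype X] (K : Type*) [CommRing K] [Algebra ℂ K] [Algebra K B]

/-- `M^{(23)}(u₁-u₂) F^{(1)}(u₁) F'^{(2)}(u₂)`, matrix element from `(i, j)` to `(m, n)`. -/
noncomputable def rttL (c : Coeff X (MvPowerSeries (Fin 2) ℂ))
    (F F' : X → X → MvPowerSeries (Fin 2) B) (i j m n : X) : MvPowerSeries (Fin 3) B :=
  ∑ k, ∑ l, at12 ((c k l m n).map (scal K B)) * at1 (F i k) * at2 (F' j l)

/-- `F'^{(1)}(u₂) F^{(2)}(u₁) M^{(12)}(u₁-u₂)`, matrix element from `(i, j)` to `(m, n)`. -/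
noncomputable def rttR (c : Coeff X (MvPowerSeries (Fin 2) ℂ))
    (F F' : X → X → MvPowerSeries (Fin 2) B) (i j m n : X) : MvPowerSeries (Fin 3) B :=
  ∑ k, ∑ l, at2 (F' k m) * at1 (F l n) * at12 ((c i j k l).map (scal K B))

variable [Fintype π] [∀ a b : π, Fintype (a ⟶ b)]

open MvPowerSeries (coeff C) in
/-- The defining relations, for the crossing parameter `lam` and the period `L`. The series `cVV`,
`cVsV`, `cVsVs` are the expansions of `R_{VV}`, `R_{V^*V}`, `R_{V^*V^*}`. -/
inductive Rel (P : Pairing deg) (L lam : ℂ) (cVV cVsV cVsVs : Coeff X (MvPowerSeries (Fin 2) ℂ)) :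
    FreeAlgebra K (Gen deg) → FreeAlgebra K (Gen deg) → Prop
  -- the `η_f` are the components of the unit, and each generator has the degree of its square
  | unit_mul (f) : Rel P L lam cVV cVsV cVsVs
      (FreeAlgebra.ι K (.e f) * FreeAlgebra.ι K (.e f)) (FreeAlgebra.ι K (.e f))
  | unit_orth (f f') (h : f ≠ f') : Rel P L lam cVV cVsV cVsVs
      (FreeAlgebra.ι K (.e f) * FreeAlgebra.ι K (.e f')) 0
  | unit_sum : Rel P L lam cVV cVsV cVsVs (∑ f : Arr π, FreeAlgebra.ι K (.e f)) 1
  | T_top (i j l n m) : Rel P L lam cVV cVsV cVsVs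
      (FreeAlgebra.ι K (.e ⟨_, _, (Sq.ofTop (deg i) (deg j) l).top⟩) *
        FreeAlgebra.ι K (.T i j l n m)) (FreeAlgebra.ι K (.T i j l n m))
  | T_bottom (i j l n m) : Rel P L lam cVV cVsV cVsVs
      (FreeAlgebra.ι K (.T i j l n m) *
        FreeAlgebra.ι K (.e ⟨_, _, (Sq.ofTop (deg i) (deg j) l).bottom⟩))
      (FreeAlgebra.ι K (.T i j l n m))
  | Ts_top (i j l n m) : Rel P L lam cVV cVsV cVsVs
      (FreeAlgebra.ι K (.e ⟨_, _, (Sq.ofTop (deg i).inv (deg j).inv l).top⟩) *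
        FreeAlgebra.ι K (.Ts i j l n m)) (FreeAlgebra.ι K (.Ts i j l n m))
  | Ts_bottom (i j l n m) : Rel P L lam cVV cVsV cVsVs
      (FreeAlgebra.ι K (.Ts i j l n m) *
        FreeAlgebra.ι K (.e ⟨_, _, (Sq.ofTop (deg i).inv (deg j).inv l).bottom⟩))
      (FreeAlgebra.ι K (.Ts i j l n m))
  -- the coefficients of `ξ₂^±(u)` are central
  | central (s n m) (y : Gen deg) : Rel P L lam cVV cVsV cVsVs
      (FreeAlgebra.ι K (.xi s n m) * FreeAlgebra.ι K y)
      (FreeAlgebra.ι K y * FreeAlgebra.ι K (.xi s n m))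
  -- `ξ₂^±(u) ξ₂^∓(u) = η(1)`
  | xi_mul (s d) : Rel P L lam cVV cVsV cVsVs
      (coeff d (serXi (FreeAlgebra.ι K (X := Gen deg)) s * serXi (FreeAlgebra.ι K) (!s)))
      (coeff d (1 : MvPowerSeries (Fin 2) (FreeAlgebra K (Gen deg))))
  -- `R_{VV}^{(23)}(u₁-u₂) T^{(1)}(u₁) T^{(2)}(u₂) = T^{(1)}(u₂) T^{(2)}(u₁) R_{VV}^{(12)}(u₁-u₂)`
  | rtt_VV (i j m n d) : Rel P L lam cVV cVsV cVsVs
      (coeff d (rttL K cVV (serT (FreeAlgebra.ι K)) (serT (FreeAlgebra.ι K)) i j m n))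
      (coeff d (rttR K cVV (serT (FreeAlgebra.ι K)) (serT (FreeAlgebra.ι K)) i j m n))
  -- the same for `R_{V^*V^*}`, `T^*`, `T^*`
  | rtt_VsVs (i j m n d) : Rel P L lam cVV cVsV cVsVs
      (coeff d (rttL K cVsVs (serTs (FreeAlgebra.ι K)) (serTs (FreeAlgebra.ι K)) i j m n))
      (coeff d (rttR K cVsVs (serTs (FreeAlgebra.ι K)) (serTs (FreeAlgebra.ι K)) i j m n))
  -- the same for `R_{V^*V}`, `T^*`, `T`
  | rtt_VsV (i j m n d) : Rel P L lam cVV cVsV cVsVs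
      (coeff d (rttL K cVsV (serTs (FreeAlgebra.ι K)) (serT (FreeAlgebra.ι K)) i j m n))
      (coeff d (rttR K cVsV (serTs (FreeAlgebra.ι K)) (serT (FreeAlgebra.ι K)) i j m n))
  -- `ω^{(23)} T^{(1)}(u+λ) T^{*(2)}(u) = ω^{(12)} ξ₂^+(u)`
  | om_inv (i j d) : Rel P L lam cVV cVsV cVsVs
      (coeff d (∑ k, ∑ l, C (scal K _ (P.om k l)) *
        (shift K L lam (serT (FreeAlgebra.ι K) i k) * serTs (FreeAlgebra.ι K) j l)))
      (coeff d (C (scal K _ (P.om i j)) *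
        (C (unitSrc (FreeAlgebra.ι K) (deg i).src) * serXi (FreeAlgebra.ι K (X := Gen deg)) true)))
  -- `ω^{*(23)} T^{*(1)}(u+λ) T^{(2)}(u) = ω^{*(12)}`
  | omStar_inv (i j d) : Rel P L lam cVV cVsV cVsVs
      (coeff d (∑ k, ∑ l, C (scal K _ (P.omStar k l)) *
        (shift K L lam (serTs (FreeAlgebra.ι K) i k) * serT (FreeAlgebra.ι K) j l)))
      (coeff d (C (scal K _ (P.omStar i j)) *
        C (unitSrc (FreeAlgebra.ι K (X := Gen deg)) (deg i).inv.src)))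
  -- `T^{*(1)}(u) T^{(2)}(u+λ) σ^{(12)} = ξ₂^+(u) σ^{(23)}`
  | sg_inv (i j d) : Rel P L lam cVV cVsV cVsVs
      (coeff d (∑ k, ∑ l, C (scal K _ (P.sg k l)) *
        (serTs (FreeAlgebra.ι K) k i * shift K L lam (serT (FreeAlgebra.ι K) l j))))
      (coeff d (C (scal K _ (P.sg i j)) *
        (C (unitTgt (FreeAlgebra.ι K) (deg i).inv.src) *
          serXi (FreeAlgebra.ι K (X := Gen deg)) true)))
  -- `T^{(1)}(u) T^{*(2)}(u+λ) σ^{*(12)} = σ^{*(23)}`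
  | sgStar_inv (i j d) : Rel P L lam cVV cVsV cVsVs
      (coeff d (∑ k, ∑ l, C (scal K _ (P.sgStar k l)) *
        (serT (FreeAlgebra.ι K) k i * shift K L lam (serTs (FreeAlgebra.ι K) l j))))
      (coeff d (C (scal K _ (P.sgStar i j)) *
        C (unitTgt (FreeAlgebra.ι K (X := Gen deg)) (deg i).src)))

variable (P : Pairing deg) (L lam : ℂ) (cVV cVsV cVsVs : Coeff X (MvPowerSeries (Fin 2) ℂ))

/-- The restricted quantum algebra of general linear type. -/
abbrev RQA : Type _ := RingQuot (Rel K P L lam cVV cVsV cVsVs)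

namespace RQA

/-- The generators of the restricted quantum algebra. -/
noncomputable def gen (y : Gen deg) : RQA K P L lam cVV cVsV cVsVs :=
  RingQuot.mkAlgHom K (Rel K P L lam cVV cVsV cVsVs) (FreeAlgebra.ι K y)

/-- `HasDegree a α`: `a` is a product of (homogeneous components of) generators that has degree `α`. -/
inductive HasDegree : RQA K P L lam cVV cVsV cVsVs → Sq π → Prop
  | e (f) : HasDegree (gen K P L lam cVV cVsV cVsVs (.e f)) (Sq.vid f)
  | T (i j l n m) :
      HasDegree (gen K P L lam cVV cVsV cVsVs (.T i j l n m)) (Sq.ofTop (deg i) (deg j) l)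
  | Ts (i j l n m) :
      HasDegree (gen K P L lam cVV cVsV cVsVs (.Ts i j l n m))
        (Sq.ofTop (deg i).inv (deg j).inv l)
  | xi (f s n m) :
      HasDegree (gen K P L lam cVV cVsV cVsVs (.e f) * gen K P L lam cVV cVsV cVsVs (.xi s n m))
        (Sq.vid f)
  | mul (a b α β γ) : HasDegree a α → HasDegree b β → IsVComp α β γ → HasDegree (a * b) γ

/-- The homogeneous components `A_α` of the restricted quantum algebra. -/
def component (α : Sq π) : Submodule K (RQA K P L lam cVV cVsV cVsVs) :=
  Submodule.span K {a | HasDegree K P L lam cVV cVsV cVsVs a α}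

end RQA

end Algebra

end DG

/-!
The algebra `A = RQA` is given by generators and relations, and every structure map comes from its
universal property: a homomorphism from `A` to an algebra `B` is the same as a family of series over
`B` that satisfies the defining relations (`IsRep`, `IsRep.exists_lift`). The unit of `A` is allowed
to go to an idempotent `E` of `B`. This is needed for the coproduct, because `Δ 1` is the unit of
`A ⊗_h A`, which is only an idempotent of `A ⊗ A`.

*Grading.* The components `η_f` of the unit are orthogonal idempotents with sum `1`. There is at
most one morphism between two objects, so a square is determined by its top and bottom sides, and
the component of `A` at a square with these sides `f` and `f'` is the Peirce component `η_f A η_f'`.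
Hence the components form a direct sum decomposition (`boundary_eq`, `RQA.isInternal_component`),
and a homomorphism respects the degrees as soon as it is correct on the `η_f`.

*Coproduct.* The exchange relations are identities of matrices over `X × X`, the inversion relations
identities of matrices over `X`. Both are stable under `F ↦ ∑_k F_i^k ⊗ F_k^j`, because the two
tensor factors commute (`exchange_copMat`, `inversion_copMat`, `inversion_copMat'`).

*Counit.* It takes values in the matrices over the objects, the convolution algebra of the pair
groupoid, and sends `T_i^j` to `δ_ij` times the matrix unit at `deg i`. The relations hold because
the coefficients `c` of the exchange relations preserve the degree (`isRep_counitData`). They do so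
because the values of the `R`-matrix and of its rotations preserve the degree and because an
expansion in `z` and `p/z` of the zero function vanishes (`HasExpansion.eq_zero`).
The counit axioms say that evaluating one tensor factor of `Δ x` gives the Peirce matrix of `x`
(`RQA.IsCounit.evalLeft_cop`, `RQA.IsCounit.evalRight_cop`).

*Antipode.* By the inversion relations the matrices `S(T)` and `S(T^*)` are inverse to `T` and `T^*`
up to parts of the unit (`IsRep.isWeakInverse_antT`, `IsRep.isWeakInverse_antTs`). Multiplying an
exchange relation by these inverses on both sides gives the relation for the inverses with reversed
products (`IsWeakInverse.exchange`), and each inversion relation for `T` and `T^*` gives another one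
for `S(T)` and `S(T^*)`. So there is an algebra homomorphism `S : A → A^op` (`IsRep.antipode`).
Its square translates the spectral parameter by `-2λ` and rescales the matrix entries by central
series and by quotients of the numbers `G(s(deg i)) / G(t(deg i))`
(`IsAntipode.pmap_pmap_T`, `IsAntipode.pmap_pmap_Ts`). The opposite translation and rescaling
respects the relations too (`IsRep.sqInv`), so `S` is bijective (`RQA.bijective_antipode`).

*Antipode axioms.* The axioms are not stable under products, but the refined identity
`∑ S(x') 1_c x'' = ∑_b ε(x)_{c b} 1_b`, where `Δ x = ∑ x' ⊗ x''` and `1_c` is the part of the unit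
of target `c`, is: contraction of a product is iterated contraction (`contractLeft_mul`) and `ε` is
multiplicative. It holds on generators by the weak inverse property (`RQA.contractLeft_cop`), and
the axiom is its sum over `c`. The other axiom is similar (`RQA.contractRight_cop`).
-/

namespace DG

/-! ### Power series with coefficients in an algebra -/

section SeriesTools

open MvPowerSeries (coeff C)

variable {σ τ : Type*} {B B' : Type*}

/-- Apply a map to every coefficient of a power series. -/
def pmap (ψ : B → B') (F : MvPowerSeries σ B) : MvPowerSeries σ B' := fun d => ψ (F d)

theorem coeff_pmap [Semiring B] [Semiring B'] (ψ : B → B') (F : MvPowerSeries σ B) (d : σ →₀ ℕ) :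
    coeff d (pmap ψ F) = ψ (coeff d F) := rfl

theorem pmap_sum [Semiring B] [Semiring B'] {F : Type*} [FunLike F B B'] [AddMonoidHomClass F B B']
    (ψ : F) {ι : Type*} (s : Finset ι) (x : ι → MvPowerSeries σ B) :
    pmap ψ (∑ i ∈ s, x i) = ∑ i ∈ s, pmap ψ (x i) := by
  ext d
  simp only [coeff_pmap, map_sum]

theorem pmap_mul [Semiring B] [Semiring B'] {F : Type*} [FunLike F B B']
    [NonUnitalRingHomClass F B B'] (ψ : F) (x y : MvPowerSeries σ B) :
    pmap ψ (x * y) = pmap ψ x * pmap ψ y := by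
  classical
  ext d
  simp only [coeff_pmap, MvPowerSeries.coeff_mul, map_sum, map_mul]

theorem pmap_C [Semiring B] [Semiring B'] {F : Type*} [FunLike F B B'] [AddMonoidHomClass F B B']
    (ψ : F) (x : B) : pmap ψ (C x : MvPowerSeries σ B) = C (ψ x) := by
  classical
  ext d
  simp only [coeff_pmap, MvPowerSeries.coeff_C]
  split_ifs <;> simp

/-- Reversing the multiplication of the coefficients reverses products of power series. -/
theorem pmap_unop_mul [Semiring B] (x y : MvPowerSeries σ Bᵐᵒᵖ) :
    pmap MulOpposite.unop (x * y) = pmap MulOpposite.unop y * pmap MulOpposite.unop x := by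
  classical
  ext d
  simp only [coeff_pmap, MvPowerSeries.coeff_mul, Finset.unop_sum, MulOpposite.unop_mul]
  exact Finsupp.sum_antidiagonal_swap d fun a b =>
    MulOpposite.unop (coeff b y) * MulOpposite.unop (coeff a x)

/-- Series whose coefficients commute pairwise commute. -/
theorem commute_of_coeff [Semiring B] {x y : MvPowerSeries σ B}
    (h : ∀ a b, Commute (x a) (y b)) : Commute x y := by
  classical
  ext d
  rw [MvPowerSeries.coeff_mul, MvPowerSeries.coeff_mul]
  refine (Finset.sum_congr rfl fun p _ => h _ _).trans ?_
  exact (Finsupp.sum_antidiagonal_swap d fun a b => coeff a y * coeff b x).symm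

/-- If `x', y'` arise from `x, y` by an injective additive substitution of exponents, then the same
substitution maps `x * y` to `x' * y'`. -/
theorem mul_of_reindex [Semiring B] (φ : (σ →₀ ℕ) →+ (τ →₀ ℕ)) (hφ : Function.Injective φ)
    {x y : MvPowerSeries σ B} {x' y' z' : MvPowerSeries τ B}
    (hx : ∀ a, x' (φ a) = x a) (hx0 : ∀ d, d ∉ Set.range φ → x' d = 0)
    (hy : ∀ a, y' (φ a) = y a) (hy0 : ∀ d, d ∉ Set.range φ → y' d = 0)
    (hz : ∀ a, z' (φ a) = (x * y) a) (hz0 : ∀ d, d ∉ Set.range φ → z' d = 0) :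
    z' = x' * y' := by
  classical
  ext d
  rw [MvPowerSeries.coeff_mul]
  simp only [MvPowerSeries.coeff_apply]
  by_cases hd : d ∈ Set.range φ
  · obtain ⟨a, rfl⟩ := hd
    rw [hz, ← MvPowerSeries.coeff_apply (x * y), MvPowerSeries.coeff_mul]
    symm
    refine Finset.sum_of_injOn (fun p => (φ p.1, φ p.2)) ?_ ?_ ?_ ?_ |>.symm
    · intro p _ q _ h
      simp only [Prod.mk.injEq] at h
      exact Prod.ext (hφ h.1) (hφ h.2)
    · intro p hp
      simp only [Finset.mem_coe, Finset.HasAntidiagonal.mem_antidiagonal] at hp ⊢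
      rw [← map_add, hp]
    · intro q hq hq'
      by_cases h1 : q.1 ∈ Set.range φ
      · by_cases h2 : q.2 ∈ Set.range φ
        · obtain ⟨b, hb⟩ := h1
          obtain ⟨c, hc⟩ := h2
          refine absurd ⟨(b, c), ?_, Prod.ext hb hc⟩ hq'
          simp only [Finset.mem_coe, Finset.HasAntidiagonal.mem_antidiagonal] at hq ⊢
          apply hφ
          rw [map_add, hb, hc, hq]
        · rw [hy0 _ h2, mul_zero]
      · rw [hx0 _ h1, zero_mul]
    · intro p _
      simp only [hx, hy, MvPowerSeries.coeff_apply]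
  · rw [hz0 _ hd]
    symm
    refine Finset.sum_eq_zero fun p hp => ?_
    rw [Finset.HasAntidiagonal.mem_antidiagonal] at hp
    by_cases h1 : p.1 ∈ Set.range φ
    · by_cases h2 : p.2 ∈ Set.range φ
      · obtain ⟨b, hb⟩ := h1
        obtain ⟨c, hc⟩ := h2
        exact absurd ⟨b + c, by rw [map_add, hb, hc, hp]⟩ hd
      · rw [hy0 _ h2, mul_zero]
    · rw [hx0 _ h1, zero_mul]

theorem expo_eta (a : Fin 2 →₀ ℕ) : expo (a 0) (a 1) = a := by
  ext i
  fin_cases i <;> simp [expo]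

@[simp] theorem expo_zero' (n m : ℕ) : expo n m 0 = n := by simp [expo]

@[simp] theorem expo_one' (n m : ℕ) : expo n m 1 = m := by simp [expo]

/-- The exponent of `z₁, z₂, w` with the given entries, as an additive map. -/
noncomputable def expHom (i j k : Fin 2) : (Fin 2 →₀ ℕ) →+ (Fin 3 →₀ ℕ) where
  toFun a := Finsupp.equivFunOnFinite.symm ![a i, a j, a k]
  map_zero' := by ext t; fin_cases t <;> simp
  map_add' a b := by ext t; fin_cases t <;> simp

@[simp] theorem expHom_zero' (i j k a) : expHom i j k a 0 = a i := rfl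
@[simp] theorem expHom_one' (i j k a) : expHom i j k a 1 = a j := rfl
@[simp] theorem expHom_two' (i j k a) : expHom i j k a 2 = a k := rfl

theorem expHom_eq_iff (i j k a d) : expHom i j k a = d ↔ a i = d 0 ∧ a j = d 1 ∧ a k = d 2 := by
  constructor
  · rintro rfl
    simp
  · rintro ⟨h0, h1, h2⟩
    ext t
    fin_cases t
    · exact h0
    · exact h1
    · exact h2

theorem at1_expHom [Zero B] (F : MvPowerSeries (Fin 2) B) (a) :
    at1 F (expHom 0 0 1 a) = F a := by
  simp [at1, expo_eta]

theorem at2_expHom [Zero B] (F : MvPowerSeries (Fin 2) B) (a) :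
    at2 F (expHom 1 0 1 a) = F a := by
  simp [at2, expo_eta]

theorem at1_eq_zero [Zero B] (F : MvPowerSeries (Fin 2) B) (d) (h : d ∉ Set.range (expHom 0 0 1)) :
    at1 F d = 0 :=
  if_neg fun h' => h ⟨expo (d 0) (d 2), by simp [expHom_eq_iff, h']⟩

theorem at2_eq_zero [Zero B] (F : MvPowerSeries (Fin 2) B) (d) (h : d ∉ Set.range (expHom 1 0 1)) :
    at2 F d = 0 :=
  if_neg fun h' => h ⟨expo (d 1) (d 0), by simp [expHom_eq_iff, h']⟩

theorem expHom_injective {i j k : Fin 2} (h : (i = 0 ∧ k = 1) ∨ (i = 1 ∧ j = 0)) :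
    Function.Injective (expHom i j k) := by
  intro a b hab
  rw [expHom_eq_iff] at hab
  ext t
  rcases h with ⟨rfl, rfl⟩ | ⟨rfl, rfl⟩ <;> fin_cases t <;> simp_all

variable [Semiring B]

/-- Substitution of exponents preserves constants. -/
theorem C_of_reindex (φ : (σ →₀ ℕ) →+ (τ →₀ ℕ)) (hφ : Function.Injective φ) {b : B}
    {x' : MvPowerSeries τ B} (hx : ∀ a, x' (φ a) = (C b : MvPowerSeries σ B) a)
    (hx0 : ∀ d, d ∉ Set.range φ → x' d = 0) : x' = C b := by
  classical
  ext d
  rw [MvPowerSeries.coeff_C, MvPowerSeries.coeff_apply]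
  by_cases hd : d ∈ Set.range φ
  · obtain ⟨a, rfl⟩ := hd
    rw [hx, ← MvPowerSeries.coeff_apply (C b), MvPowerSeries.coeff_C]
    congr 1
    rw [← map_zero φ, hφ.eq_iff]
  · rw [hx0 d hd, if_neg]
    rintro rfl
    exact hd ⟨0, map_zero φ⟩

theorem at1_C (b : B) : at1 (C b) = C b :=
  C_of_reindex _ (expHom_injective (by decide)) (at1_expHom _) (at1_eq_zero _)

theorem at2_C (b : B) : at2 (C b) = C b :=
  C_of_reindex _ (expHom_injective (by decide)) (at2_expHom _) (at2_eq_zero _)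

theorem at1_mul (x y : MvPowerSeries (Fin 2) B) : at1 (x * y) = at1 x * at1 y :=
  mul_of_reindex (expHom 0 0 1) (expHom_injective (by decide)) (at1_expHom _) (at1_eq_zero _)
    (at1_expHom _) (at1_eq_zero _) (at1_expHom _) (at1_eq_zero _)

theorem at2_mul (x y : MvPowerSeries (Fin 2) B) : at2 (x * y) = at2 x * at2 y :=
  mul_of_reindex (expHom 1 0 1) (expHom_injective (by decide)) (at2_expHom _) (at2_eq_zero _)
    (at2_expHom _) (at2_eq_zero _) (at2_expHom _) (at2_eq_zero _)

theorem at1_add (x y : MvPowerSeries (Fin 2) B) : at1 (x + y) = at1 x + at1 y := by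
  ext d
  rw [map_add]
  simp only [MvPowerSeries.coeff_apply, at1]
  split_ifs
  · rfl
  · simp

theorem at2_add (x y : MvPowerSeries (Fin 2) B) : at2 (x + y) = at2 x + at2 y := by
  ext d
  rw [map_add]
  simp only [MvPowerSeries.coeff_apply, at2]
  split_ifs
  · rfl
  · simp

theorem at12_zero : at12 (0 : MvPowerSeries (Fin 2) B) = 0 := by
  funext d
  exact ite_self (0 : B)

/-- `f(u₁)` as a ring homomorphism in `f`. -/
noncomputable def at1Hom : MvPowerSeries (Fin 2) B →+* MvPowerSeries (Fin 3) B where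
  toFun := at1
  map_one' := at1_C 1
  map_mul' := at1_mul
  map_zero' := funext fun _ => ite_self (0 : B)
  map_add' := at1_add

/-- `f(u₂)` as a ring homomorphism in `f`. -/
noncomputable def at2Hom : MvPowerSeries (Fin 2) B →+* MvPowerSeries (Fin 3) B where
  toFun := at2
  map_one' := at2_C 1
  map_mul' := at2_mul
  map_zero' := funext fun _ => ite_self (0 : B)
  map_add' := at2_add

theorem at1_sum {ι : Type*} (s : Finset ι) (x : ι → MvPowerSeries (Fin 2) B) :
    at1 (∑ i ∈ s, x i) = ∑ i ∈ s, at1 (x i) := map_sum at1Hom x s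

theorem at2_sum {ι : Type*} (s : Finset ι) (x : ι → MvPowerSeries (Fin 2) B) :
    at2 (∑ i ∈ s, x i) = ∑ i ∈ s, at2 (x i) := map_sum at2Hom x s

theorem at12_pmap [Semiring B'] (ψ : B → B') (h : ψ 0 = 0) (F : MvPowerSeries (Fin 2) B) :
    at12 (pmap ψ F) = pmap ψ (at12 F) := by
  funext d
  simp only [at12, pmap, apply_ite ψ, h]

theorem at1_pmap [Semiring B'] (ψ : B → B') (h : ψ 0 = 0) (F : MvPowerSeries (Fin 2) B) :
    at1 (pmap ψ F) = pmap ψ (at1 F) := by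
  funext d
  simp only [at1, pmap, apply_ite ψ, h]

theorem at2_pmap [Semiring B'] (ψ : B → B') (h : ψ 0 = 0) (F : MvPowerSeries (Fin 2) B) :
    at2 (pmap ψ F) = pmap ψ (at2 F) := by
  funext d
  simp only [at2, pmap, apply_ite ψ, h]

end SeriesTools

/-! ### Translation of the spectral parameter -/

section Shift

open MvPowerSeries (coeff C)

variable {B B' : Type*} [Ring B] [Ring B'] (K : Type*) [CommRing K] [Algebra ℂ K] [Algebra K B]
  [Algebra K B'] (L : ℂ)

theorem scal_comm (c : ℂ) (b : B) : Commute (scal K B c) b := Algebra.commutes _ _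

theorem commute_C_scal {σ : Type*} (c : ℂ) (x : MvPowerSeries σ B) :
    Commute (C (scal K B c)) x :=
  commute_of_coeff fun a b => by
    classical
    rw [← MvPowerSeries.coeff_apply (C _), MvPowerSeries.coeff_C]
    split_ifs
    · exact scal_comm K c _
    · exact Commute.zero_left _

theorem commute_at12_scal (c : MvPowerSeries (Fin 2) ℂ) (x : MvPowerSeries (Fin 3) B) :
    Commute (at12 (c.map (scal K B))) x :=
  commute_of_coeff fun a b => by
    simp only [at12]
    split_ifs
    · exact scal_comm K _ _
    · exact Commute.zero_left _

/-- The factor by which the translation `u ↦ u + μ` multiplies `z^n (p/z)^m`. -/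
noncomputable def shiftFactor (μ : ℂ) (n m : ℕ) : ℂ :=
  Complex.exp (2 * Real.pi * Complex.I * (μ / L)) ^ n *
    Complex.exp (-(2 * Real.pi * Complex.I * (μ / L))) ^ m

theorem shiftFactor_add (μ : ℂ) (n m n' m' : ℕ) :
    shiftFactor L μ (n + n') (m + m') = shiftFactor L μ n m * shiftFactor L μ n' m' := by
  simp only [shiftFactor, pow_add]
  ring

theorem shiftFactor_mul (μ ν : ℂ) (n m : ℕ) :
    shiftFactor L μ n m * shiftFactor L ν n m = shiftFactor L (μ + ν) n m := by
  have h : ∀ x y : ℂ, ∀ k : ℕ, Complex.exp (x + y) ^ k = Complex.exp x ^ k * Complex.exp y ^ k :=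
    fun x y k => by rw [Complex.exp_add, mul_pow]
  simp only [shiftFactor, add_div, mul_add, neg_add, h]
  ring

@[simp] theorem shiftFactor_zero (n m : ℕ) : shiftFactor L 0 n m = 1 := by simp [shiftFactor]

@[simp] theorem shiftFactor_zero_zero (μ : ℂ) : shiftFactor L μ 0 0 = 1 := by simp [shiftFactor]

theorem shiftFactor_self (μ : ℂ) (n : ℕ) : shiftFactor L μ n n = 1 := by
  rw [shiftFactor, ← mul_pow, ← Complex.exp_add, add_neg_cancel, Complex.exp_zero, one_pow]

theorem coeff_shift (μ : ℂ) (F : MvPowerSeries (Fin 2) B) (d) :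
    coeff d (shift K L μ F) = algebraMap ℂ K (shiftFactor L μ (d 0) (d 1)) • coeff d F := rfl

theorem shift_mul (μ : ℂ) (x y : MvPowerSeries (Fin 2) B) :
    shift K L μ (x * y) = shift K L μ x * shift K L μ y := by
  classical
  ext d
  simp only [coeff_shift, MvPowerSeries.coeff_mul, Finset.smul_sum, smul_mul_smul_comm, ← map_mul]
  refine Finset.sum_congr rfl fun p hp => ?_
  rw [← Finset.HasAntidiagonal.mem_antidiagonal.mp hp, ← shiftFactor_add]
  rfl

theorem shift_C (μ : ℂ) (b : B) : shift K L μ (C b) = C b := by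
  classical
  ext d
  rw [coeff_shift, MvPowerSeries.coeff_C]
  split_ifs with h
  · simp [h]
  · simp

/-- Translation of the spectral parameter as a ring homomorphism. -/
noncomputable def shiftHom (μ : ℂ) : MvPowerSeries (Fin 2) B →+* MvPowerSeries (Fin 2) B where
  toFun := shift K L μ
  map_one' := shift_C K L μ 1
  map_mul' := shift_mul K L μ
  map_zero' := funext fun _ => smul_zero _
  map_add' _ _ := funext fun _ => smul_add _ _ _

theorem shift_sum (μ : ℂ) {ι : Type*} (s : Finset ι) (x : ι → MvPowerSeries (Fin 2) B) :
    shift K L μ (∑ i ∈ s, x i) = ∑ i ∈ s, shift K L μ (x i) := map_sum (shiftHom K L μ) x s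

theorem shift_shift (μ ν : ℂ) (x : MvPowerSeries (Fin 2) B) :
    shift K L μ (shift K L ν x) = shift K L (μ + ν) x := by
  ext d
  simp only [coeff_shift, smul_smul, ← map_mul, shiftFactor_mul]

theorem shift_zero (x : MvPowerSeries (Fin 2) B) : shift K L 0 x = x := by
  ext d
  simp [coeff_shift]

theorem shift_pmap {F : Type*} [FunLike F B B'] [LinearMapClass F K B B'] (ψ : F) (μ : ℂ)
    (x : MvPowerSeries (Fin 2) B) : shift K L μ (pmap ψ x) = pmap ψ (shift K L μ x) :=
  funext fun _ => (map_smul ψ _ _).symm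

/-- Simultaneous translation of both spectral parameters of a series in `z₁, z₂, w`. -/
noncomputable def shift₃ (μ : ℂ) (F : MvPowerSeries (Fin 3) B) : MvPowerSeries (Fin 3) B :=
  fun d => algebraMap ℂ K (shiftFactor L μ (d 1) (d 2)) • F d

theorem coeff_shift₃ (μ : ℂ) (F : MvPowerSeries (Fin 3) B) (d) :
    coeff d (shift₃ K L μ F) = algebraMap ℂ K (shiftFactor L μ (d 1) (d 2)) • coeff d F := rfl

theorem shift₃_mul (μ : ℂ) (x y : MvPowerSeries (Fin 3) B) :
    shift₃ K L μ (x * y) = shift₃ K L μ x * shift₃ K L μ y := by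
  classical
  ext d
  simp only [coeff_shift₃, MvPowerSeries.coeff_mul, Finset.smul_sum, smul_mul_smul_comm, ← map_mul]
  refine Finset.sum_congr rfl fun p hp => ?_
  rw [← Finset.HasAntidiagonal.mem_antidiagonal.mp hp, ← shiftFactor_add]
  rfl

theorem shift₃_sum (μ : ℂ) {ι : Type*} (s : Finset ι) (x : ι → MvPowerSeries (Fin 3) B) :
    shift₃ K L μ (∑ i ∈ s, x i) = ∑ i ∈ s, shift₃ K L μ (x i) := by
  ext d
  simp only [coeff_shift₃, map_sum, Finset.smul_sum]

theorem at1_shift (μ : ℂ) (x : MvPowerSeries (Fin 2) B) :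
    at1 (shift K L μ x) = shift₃ K L μ (at1 x) := by
  funext d
  change at1 (shift K L μ x) d = algebraMap ℂ K (shiftFactor L μ (d 1) (d 2)) • at1 x d
  simp only [at1]
  split_ifs with h
  · rw [← h]
    change algebraMap ℂ K (shiftFactor L μ _ _) • _ = _
    simp
  · simp

theorem at2_shift (μ : ℂ) (x : MvPowerSeries (Fin 2) B) :
    at2 (shift K L μ x) = shift₃ K L μ (at2 x) := by
  funext d
  change at2 (shift K L μ x) d = algebraMap ℂ K (shiftFactor L μ (d 1) (d 2)) • at2 x d
  simp only [at2]
  split_ifs with h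
  · rw [← h]
    change algebraMap ℂ K (shiftFactor L μ _ _) • _ = _
    simp
  · simp

/-- Functions of `u₁ - u₂` are invariant under simultaneous translation of `u₁` and `u₂`. -/
theorem shift₃_at12 (μ : ℂ) (x : MvPowerSeries (Fin 2) B) :
    shift₃ K L μ (at12 x) = at12 x := by
  funext d
  change algebraMap ℂ K (shiftFactor L μ (d 1) (d 2)) • at12 x d = at12 x d
  simp only [at12]
  split_ifs with h
  · rw [← h, shiftFactor_self, map_one, one_smul]
  · simp

end Shift

open scoped Classical

theorem Arr.ext_of_thin {π : Type*} [Groupoid π] [Quiver.IsThin π] {f g : Arr π}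
    (h₁ : f.src = g.src) (h₂ : f.tgt = g.tgt) :
    f = g := by
  obtain ⟨a, b, f⟩ := f
  obtain ⟨a', b', g⟩ := g
  change a = a' at h₁
  change b = b' at h₂
  subst h₁ h₂
  rw [Subsingleton.elim f g]

/-! ### The components of the unit -/

section Units

variable {π : Type*} [Groupoid π] [Fintype π] [∀ a b : π, Fintype (a ⟶ b)]
  {B : Type*} [Ring B]

/-- The sum of the `e f` over the arrows `f` with source `a`. -/
noncomputable def srcU (e : Arr π → B) (a : π) : B := ∑ f : Arr π, if f.src = a then e f else 0

/-- The sum of the `e f` over the arrows `f` with target `a`. -/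
noncomputable def tgtU (e : Arr π → B) (a : π) : B := ∑ f : Arr π, if f.tgt = a then e f else 0

/-- The `e f` are orthogonal idempotents with sum `E`. -/
structure IsUnits (E : B) (e : Arr π → B) : Prop where
  mul_self : ∀ f, e f * e f = e f
  orth : ∀ f f', f ≠ f' → e f * e f' = 0
  sum : ∑ f, e f = E

namespace IsUnits

variable {E : B} {e : Arr π → B} (h : IsUnits E e)
include h

theorem mul_eq (f f' : Arr π) : e f * e f' = if f = f' then e f else 0 := by
  split_ifs with hf
  · rw [← hf, h.mul_self]
  · exact h.orth f f' hf

theorem sum_mul (p : Arr π → Prop) (f : Arr π) :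
    (∑ f', if p f' then e f' else 0) * e f = if p f then e f else 0 := by
  rw [Finset.sum_mul, Finset.sum_eq_single f]
  · split_ifs <;> simp [h.mul_self]
  · intro f' _ hf
    split_ifs
    · exact h.orth _ _ hf
    · exact zero_mul _
  · simp

theorem mul_sum (p : Arr π → Prop) (f : Arr π) :
    e f * (∑ f', if p f' then e f' else 0) = if p f then e f else 0 := by
  rw [Finset.mul_sum, Finset.sum_eq_single f]
  · split_ifs <;> simp [h.mul_self]
  · intro f' _ hf
    split_ifs
    · exact h.orth _ _ hf.symm
    · exact mul_zero _
  · simp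

theorem srcU_mul (a : π) (f : Arr π) : srcU e a * e f = if f.src = a then e f else 0 :=
  h.sum_mul _ f

theorem tgtU_mul (a : π) (f : Arr π) : tgtU e a * e f = if f.tgt = a then e f else 0 :=
  h.sum_mul _ f

theorem mul_srcU (a : π) (f : Arr π) : e f * srcU e a = if f.src = a then e f else 0 :=
  h.mul_sum _ f

theorem mul_tgtU (a : π) (f : Arr π) : e f * tgtU e a = if f.tgt = a then e f else 0 :=
  h.mul_sum _ f

theorem E_mul (f : Arr π) : E * e f = e f := by
  have := h.sum_mul (fun _ => True) f
  simpa [h.sum] using this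

theorem mul_E (f : Arr π) : e f * E = e f := by
  have := h.mul_sum (fun _ => True) f
  simpa [h.sum] using this

theorem E_mul_E : E * E = E := by
  conv_lhs => rw [← h.sum, Finset.sum_mul]
  simp only [h.sum, h.mul_E]

theorem srcU_mul_srcU (a b : π) : srcU e a * srcU e b = if a = b then srcU e a else 0 := by
  conv_lhs => rw [srcU, Finset.sum_mul]
  simp only [ite_mul, zero_mul, h.mul_srcU]
  split_ifs with hab
  · subst hab
    exact Finset.sum_congr rfl fun f _ => by split_ifs <;> rfl
  · exact Finset.sum_eq_zero fun f _ => by grind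

theorem tgtU_mul_tgtU (a b : π) : tgtU e a * tgtU e b = if a = b then tgtU e a else 0 := by
  conv_lhs => rw [tgtU, Finset.sum_mul]
  simp only [ite_mul, zero_mul, h.mul_tgtU]
  split_ifs with hab
  · subst hab
    exact Finset.sum_congr rfl fun f _ => by split_ifs <;> rfl
  · exact Finset.sum_eq_zero fun f _ => by grind

theorem sum_srcU : ∑ a, srcU e a = E := by
  simp only [srcU]
  rw [Finset.sum_comm]
  simp [h.sum]

theorem sum_tgtU : ∑ a, tgtU e a = E := by
  simp only [tgtU]
  rw [Finset.sum_comm]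
  simp [h.sum]

theorem E_mul_srcU (a : π) : E * srcU e a = srcU e a := by
  simp only [srcU, Finset.mul_sum, mul_ite, mul_zero, h.E_mul]

theorem srcU_mul_E (a : π) : srcU e a * E = srcU e a := by
  simp only [srcU, Finset.sum_mul, ite_mul, zero_mul, h.mul_E]

theorem tgtU_mul_E (a : π) : tgtU e a * E = tgtU e a := by
  simp only [tgtU, Finset.sum_mul, ite_mul, zero_mul, h.mul_E]

theorem srcU_mul_tgtU_eq_sum (a b : π) :
    srcU e a * tgtU e b = ∑ f : Arr π, if f.src = a ∧ f.tgt = b then e f else 0 := by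
  conv_lhs => rw [srcU, Finset.sum_mul]
  simp only [ite_mul, zero_mul, h.mul_tgtU]
  exact Finset.sum_congr rfl fun f _ => by grind

/-- In a thin groupoid an arrow is determined by its ends, so `e f` is the product of the part of
the unit with its source and the part of the unit with its target. -/
theorem srcU_mul_tgtU [Quiver.IsThin π] (f : Arr π) : srcU e f.src * tgtU e f.tgt = e f := by
  rw [h.srcU_mul_tgtU_eq_sum, Finset.sum_eq_single f]
  · simp
  · intro g _ hg
    exact if_neg fun h' => hg (Arr.ext_of_thin h'.1 h'.2)
  · simp

theorem srcU_mul_tgtU_of_isEmpty (a b : π) [IsEmpty (a ⟶ b)] : srcU e a * tgtU e b = 0 := by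
  rw [h.srcU_mul_tgtU_eq_sum]
  refine Finset.sum_eq_zero fun f _ => if_neg ?_
  rintro ⟨rfl, rfl⟩
  exact isEmptyElim f.hom

theorem commute (f f' : Arr π) : Commute (e f) (e f') := by
  rw [Commute, SemiconjBy, h.mul_eq, h.mul_eq]
  grind

theorem commute_srcU_tgtU (a b : π) : Commute (srcU e a) (tgtU e b) := by
  refine Commute.sum_left _ _ _ fun f _ => Commute.sum_right _ _ _ fun f' _ => ?_
  split_ifs <;> simp [h.commute]

end IsUnits

theorem srcU_map {B' : Type*} [Ring B'] {F : Type*} [FunLike F B B'] [AddMonoidHomClass F B B']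
    (ψ : F) (e : Arr π → B) (a : π) : ψ (srcU e a) = srcU (fun f => ψ (e f)) a := by
  simp only [srcU, map_sum, apply_ite ψ, map_zero]

theorem tgtU_map {B' : Type*} [Ring B'] {F : Type*} [FunLike F B B'] [AddMonoidHomClass F B B']
    (ψ : F) (e : Arr π → B) (a : π) : ψ (tgtU e a) = tgtU (fun f => ψ (e f)) a := by
  simp only [tgtU, map_sum, apply_ite ψ, map_zero]

end Units

/-! ### Homogeneous matrices of series -/

section Homogeneous

open MvPowerSeries (C)

variable {π : Type*} [Groupoid π] [Fintype π] [∀ a b : π, Fintype (a ⟶ b)] {X : Type*}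
  {B : Type*} [Ring B]

/-- The entry `F i j` has as degree the square with vertical sides `d i` and `d j`; this is a
condition on the end points of its horizontal sides. -/
structure IsHomog (e : Arr π → B) (d : X → Arr π) (F : Matrix X X (MvPowerSeries (Fin 2) B)) :
    Prop where
  src_mul : ∀ i j, C (srcU e (d i).src) * F i j = F i j
  tgt_mul : ∀ i j, C (tgtU e (d j).src) * F i j = F i j
  mul_src : ∀ i j, F i j * C (srcU e (d i).tgt) = F i j
  mul_tgt : ∀ i j, F i j * C (tgtU e (d j).tgt) = F i j

namespace IsHomog

variable {e : Arr π → B} {d : X → Arr π} {F : Matrix X X (MvPowerSeries (Fin 2) B)} {E : B}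
  (hF : IsHomog e d F) (h : IsUnits E e)
include hF h

theorem eq_zero (i j : X) [IsEmpty ((d i).src ⟶ (d j).src)] : F i j = 0 := by
  rw [← hF.src_mul, ← hF.tgt_mul, ← mul_assoc, ← map_mul, h.srcU_mul_tgtU_of_isEmpty, map_zero,
    zero_mul]

theorem tgt_mul_eq (i j : X) (a : π) :
    C (tgtU e a) * F i j = if a = (d j).src then F i j else 0 := by
  rw [← hF.tgt_mul, ← mul_assoc, ← map_mul, h.tgtU_mul_tgtU]
  split_ifs with ha <;> simp [ha]

theorem src_mul_eq (i j : X) (a : π) :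
    C (srcU e a) * F i j = if a = (d i).src then F i j else 0 := by
  rw [← hF.src_mul, ← mul_assoc, ← map_mul, h.srcU_mul_srcU]
  split_ifs with ha <;> simp [ha]

theorem mul_src_eq (i j : X) (a : π) :
    F i j * C (srcU e a) = if (d i).tgt = a then F i j else 0 := by
  rw [← hF.mul_src, mul_assoc, ← map_mul, h.srcU_mul_srcU]
  split_ifs <;> simp

theorem mul_tgt_eq (i j : X) (a : π) :
    F i j * C (tgtU e a) = if (d j).tgt = a then F i j else 0 := by
  rw [← hF.mul_tgt, mul_assoc, ← map_mul, h.tgtU_mul_tgtU]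
  split_ifs <;> simp

theorem E_mul (i j : X) : C E * F i j = F i j := by
  rw [← hF.src_mul, ← mul_assoc, ← map_mul, h.E_mul_srcU]

theorem mul_E (i j : X) : F i j * C E = F i j := by
  rw [← hF.mul_src, mul_assoc, ← map_mul, h.srcU_mul_E]

theorem unit_mul [Quiver.IsThin π] (i j : X) (f : Arr π) (h₁ : f.src = (d i).src)
    (h₂ : f.tgt = (d j).src) : C (e f) * F i j = F i j := by
  rw [← h.srcU_mul_tgtU, h₁, h₂, map_mul, mul_assoc, hF.tgt_mul, hF.src_mul]

theorem mul_unit [Quiver.IsThin π] (i j : X) (f : Arr π) (h₁ : f.src = (d i).tgt)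
    (h₂ : f.tgt = (d j).tgt) : F i j * C (e f) = F i j := by
  rw [← h.srcU_mul_tgtU, h₁, h₂, map_mul, ← mul_assoc, hF.mul_src, hF.mul_tgt]

end IsHomog

end Homogeneous

/-! ### The defining relations in matrix form -/

section Matrices

open MvPowerSeries (C)

variable {X : Type*} {B B' : Type*} [Ring B] [Ring B'] (K : Type*) [CommRing K]
  [Algebra ℂ K] [Algebra K B] [Algebra K B']

/-- A complex matrix as a matrix of constant series. -/
noncomputable def scalMat (w : X → X → ℂ) : Matrix X X (MvPowerSeries (Fin 2) B) :=
  Matrix.of fun i j => C (scal K B (w i j))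

/-- The matrix of `M(u₁ - u₂)` acting on a tensor product. -/
noncomputable def coeffMat (c : Coeff X (MvPowerSeries (Fin 2) ℂ)) :
    Matrix (X × X) (X × X) (MvPowerSeries (Fin 3) B) :=
  Matrix.of fun p q => at12 ((c p.1 p.2 q.1 q.2).map (scal K B))

/-- The matrix of `F^{(1)}(u₁) F'^{(2)}(u₂)`. -/
noncomputable def pairMat (F F' : Matrix X X (MvPowerSeries (Fin 2) B)) :
    Matrix (X × X) (X × X) (MvPowerSeries (Fin 3) B) :=
  Matrix.of fun p q => at1 (F p.1 q.1) * at2 (F' p.2 q.2)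

/-- The matrix of `F'^{(1)}(u₂) F^{(2)}(u₁)`. -/
noncomputable def pairMat' (F F' : Matrix X X (MvPowerSeries (Fin 2) B)) :
    Matrix (X × X) (X × X) (MvPowerSeries (Fin 3) B) :=
  Matrix.of fun p q => at2 (F' p.1 q.1) * at1 (F p.2 q.2)

theorem scalMat_one (w : X → X → ℂ) (hw : ∀ i j, w i j = if i = j then 1 else 0) :
    (scalMat K w : Matrix X X (MvPowerSeries (Fin 2) B)) = 1 := by
  ext1 i j
  rw [scalMat, Matrix.of_apply, hw, Matrix.one_apply]
  split_ifs <;> simp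

variable [Fintype X]

/-- The left hand sides of the exchange relations are the entries of a product of matrices over `X ×
X`. -/
theorem rttL_eq (c : Coeff X (MvPowerSeries (Fin 2) ℂ))
    (F F' : Matrix X X (MvPowerSeries (Fin 2) B)) (i j m n : X) :
    rttL K c F F' i j m n = (pairMat F F' * coeffMat K c : Matrix _ _ _) (i, j) (m, n) := by
  rw [Matrix.mul_apply, Fintype.sum_prod_type]
  refine Finset.sum_congr rfl fun k _ => Finset.sum_congr rfl fun l _ => ?_
  rw [mul_assoc]
  exact (commute_at12_scal K _ _).eq

/-- The right hand sides of the exchange relations are the entries of a product of matrices over `X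
× X`. -/
theorem rttR_eq (c : Coeff X (MvPowerSeries (Fin 2) ℂ))
    (F F' : Matrix X X (MvPowerSeries (Fin 2) B)) (i j m n : X) :
    rttR K c F F' i j m n = (coeffMat K c * pairMat' F F' : Matrix _ _ _) (i, j) (m, n) := by
  rw [Matrix.mul_apply, Fintype.sum_prod_type]
  refine Finset.sum_congr rfl fun k _ => Finset.sum_congr rfl fun l _ => ?_
  exact (commute_at12_scal K _ _).eq.symm

theorem mul_scalMat_mul_apply (M N : Matrix X X (MvPowerSeries (Fin 2) B)) (w : X → X → ℂ)
    (i j : X) : (M * scalMat K w * N : Matrix _ _ _) i j =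
      ∑ k, ∑ l, C (scal K B (w k l)) * (M i k * N l j) := by
  simp only [Matrix.mul_apply, Finset.sum_mul]
  rw [Finset.sum_comm]
  refine Finset.sum_congr rfl fun k _ => Finset.sum_congr rfl fun l _ => ?_
  rw [← mul_assoc, scalMat, Matrix.of_apply, (commute_C_scal K _ _).eq]

theorem scalMat_mul (w w' : X → X → ℂ) : (scalMat K w * scalMat K w' :
    Matrix X X (MvPowerSeries (Fin 2) B)) = scalMat K fun i j => ∑ k, w i k * w' k j := by
  ext1 i j
  simp only [Matrix.mul_apply, scalMat, Matrix.of_apply, map_sum, map_mul]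

theorem scal_mul_eq_smul (c : ℂ) (b : B) : scal K B c * b = algebraMap ℂ K c • b :=
  (Algebra.smul_def _ _).symm

variable {K}

theorem pmap_C_scal_mul {σ : Type*} (ψ : B →ₙₐ[K] B') (c : ℂ) (x : MvPowerSeries σ B) :
    pmap ψ (C (scal K B c) * x) = C (scal K B' c) * pmap ψ x := by
  ext d
  rw [coeff_pmap, MvPowerSeries.coeff_C_mul, MvPowerSeries.coeff_C_mul, coeff_pmap,
    scal_mul_eq_smul, scal_mul_eq_smul, map_smul]

theorem pmap_at12_scal_mul (ψ : B →ₙₐ[K] B') (c : MvPowerSeries (Fin 2) ℂ)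
    (x : MvPowerSeries (Fin 3) B) :
    pmap ψ (at12 (c.map (scal K B)) * x) = at12 (c.map (scal K B')) * pmap ψ x := by
  ext d
  simp only [coeff_pmap, MvPowerSeries.coeff_mul, map_sum]
  refine Finset.sum_congr rfl fun p _ => ?_
  simp only [MvPowerSeries.coeff_apply, at12]
  split_ifs
  · rw [← MvPowerSeries.coeff_apply (c.map _), ← MvPowerSeries.coeff_apply (c.map _),
      MvPowerSeries.coeff_map, MvPowerSeries.coeff_map, scal_mul_eq_smul, scal_mul_eq_smul,
      map_smul]
  · rw [zero_mul, zero_mul, map_zero]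

theorem pmap_mul_at12_scal (ψ : B →ₙₐ[K] B') (c : MvPowerSeries (Fin 2) ℂ)
    (x : MvPowerSeries (Fin 3) B) :
    pmap ψ (x * at12 (c.map (scal K B))) = pmap ψ x * at12 (c.map (scal K B')) := by
  rw [← (commute_at12_scal K c x).eq, pmap_at12_scal_mul, (commute_at12_scal K c _).eq]

theorem pmap_rttL (ψ : B →ₙₐ[K] B') (c : Coeff X (MvPowerSeries (Fin 2) ℂ))
    (F F' : X → X → MvPowerSeries (Fin 2) B) (i j m n : X) :
    pmap ψ (rttL K c F F' i j m n) =
      rttL K c (fun i j => pmap ψ (F i j)) (fun i j => pmap ψ (F' i j)) i j m n := by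
  simp only [rttL, pmap_sum, mul_assoc, pmap_at12_scal_mul]
  simp only [pmap_mul, at1_pmap ψ (map_zero ψ),
    at2_pmap ψ (map_zero ψ)]

theorem pmap_rttR (ψ : B →ₙₐ[K] B') (c : Coeff X (MvPowerSeries (Fin 2) ℂ))
    (F F' : X → X → MvPowerSeries (Fin 2) B) (i j m n : X) :
    pmap ψ (rttR K c F F' i j m n) =
      rttR K c (fun i j => pmap ψ (F i j)) (fun i j => pmap ψ (F' i j)) i j m n := by
  simp only [rttR, pmap_sum, pmap_mul_at12_scal]
  simp only [pmap_mul, at1_pmap ψ (map_zero ψ), at2_pmap ψ (map_zero ψ)]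

end Matrices

/-- In a thin groupoid a sum over the arrows from `a` to `b` has at most one term. The hypothesis on
`x` covers the case of no term. -/
theorem sum_hom_const {π : Type*} [Groupoid π] [Quiver.IsThin π]
    [∀ a b : π, Fintype (a ⟶ b)] {B : Type*} [Ring B] {a b : π} (x : B)
    (hx : IsEmpty (a ⟶ b) → x = 0) :
    ∑ _l : a ⟶ b, x = x := by
  rcases isEmpty_or_nonempty (a ⟶ b) with h | ⟨⟨l⟩⟩
  · rw [hx h, Finset.sum_const_zero]
  · exact Fintype.sum_subsingleton _ l

/-! ### Corner algebras -/

section Corner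

variable {K : Type*} [CommRing K] {B : Type*} [Ring B] [Algebra K B] {E : B}

/-- The corner `E B E` of an idempotent `E` as an algebra. -/
noncomputable abbrev cornerAlgebra (hE : IsIdempotentElem E) : Algebra K hE.Corner :=
  RingHom.toAlgebra'
    { toFun := fun r => ⟨r • E, (Subsemigroup.mem_corner_iff hE).mpr
        ⟨by rw [mul_smul_comm, hE.eq], by rw [smul_mul_assoc, hE.eq]⟩⟩
      map_one' := Subtype.ext (one_smul K E)
      map_mul' := fun r s => Subtype.ext (by
        change (r * s) • E = (r • E) * (s • E)
        rw [smul_mul_smul_comm, hE.eq])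
      map_zero' := Subtype.ext (zero_smul K E)
      map_add' := fun r s => Subtype.ext (add_smul r s E) }
    fun r x => Subtype.ext (by
      have hx := (Subsemigroup.mem_corner_iff hE).mp x.2
      change (r • E) * x.1 = x.1 * (r • E)
      rw [mul_smul_comm, smul_mul_assoc, hx.1, hx.2])

/-- The inclusion of the corner `E B E` into `B`. It does not preserve the unit, which is `E`. -/
noncomputable def cornerVal (hE : IsIdempotentElem E) :
    letI := cornerAlgebra (K := K) hE
    hE.Corner →ₙₐ[K] B :=
  letI := cornerAlgebra (K := K) hE
  { toFun := fun x => x.1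
    map_smul' := fun r x => by
      have hx := (Subsemigroup.mem_corner_iff hE).mp x.2
      change (r • E) * x.1 = r • x.1
      rw [smul_mul_assoc, hx.1]
    map_zero' := rfl
    map_add' := fun _ _ => rfl
    map_mul' := fun _ _ => rfl }

end Corner

/-! ### The universal property of the restricted quantum algebra -/

section Rep

open MvPowerSeries (coeff C)

variable {π : Type*} [Groupoid π] {X : Type*}

/-- Candidates in an algebra `B` for the images of the unit, of the components of the unit and of
the generating series of the restricted quantum algebra. -/
structure RepData (π : Type*) [Groupoid π] (X B : Type*) where
  /-- the image of the unit, which may differ from the unit of `B` -/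
  E : B
  /-- the images of the components of the unit -/
  e : Arr π → B
  /-- the image of `T_i^j(u)` -/
  T : Matrix X X (MvPowerSeries (Fin 2) B)
  /-- the image of `(T^*)_{-i}^{-j}(u)` -/
  Ts : Matrix X X (MvPowerSeries (Fin 2) B)
  /-- the image of `ξ₂^±(u)` -/
  xi : Bool → MvPowerSeries (Fin 2) B

/-- The images of the generators. A series for which there is no square of the required degree
vanishes, and otherwise the square is unique, so `l` does not matter. -/
noncomputable def RepData.gen {B : Type*} {deg : X → Arr π} (D : RepData π X B) : Gen deg → B
  | .e f => D.e f
  | .T i j _ n m => D.T i j (expo n m)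
  | .Ts i j _ n m => D.Ts i j (expo n m)
  | .xi s n m => D.xi s (expo n m)

theorem serXi_gen {B : Type*} {deg : X → Arr π} (D : RepData π X B) (s : Bool) :
    serXi (D.gen (deg := deg)) s = D.xi s := by
  funext d
  simp only [serXi, RepData.gen, expo_eta]

variable [Fintype π] [∀ a b : π, Fintype (a ⟶ b)] [Fintype X] {deg : X → Arr π}
  (K : Type*) [CommRing K] [Algebra ℂ K] (P : Pairing deg) (L lam : ℂ)
  (cVV cVsV cVsVs : Coeff X (MvPowerSeries (Fin 2) ℂ)) {B : Type*} [Ring B] [Algebra K B]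

/-- The defining relations of the restricted quantum algebra, with `1` replaced by `E`. The
exchange relations and the inversion relations are written as identities of matrices of series. -/
structure IsRep (D : RepData π X B) : Prop where
  units : IsUnits D.E D.e
  homT : IsHomog D.e deg D.T
  homTs : IsHomog D.e (fun i => (deg i).inv) D.Ts
  E_xi : ∀ s, C D.E * D.xi s = D.xi s
  comm_e : ∀ s a f, Commute (D.xi s a) (D.e f)
  comm_T : ∀ s a i j b, Commute (D.xi s a) (D.T i j b)
  comm_Ts : ∀ s a i j b, Commute (D.xi s a) (D.Ts i j b)
  comm_xi : ∀ s a s' b, Commute (D.xi s a) (D.xi s' b)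
  xi_mul : ∀ s, D.xi s * D.xi (!s) = C D.E
  rtt_VV : pairMat D.T D.T * coeffMat K cVV = coeffMat K cVV * pairMat' D.T D.T
  rtt_VsVs : pairMat D.Ts D.Ts * coeffMat K cVsVs = coeffMat K cVsVs * pairMat' D.Ts D.Ts
  rtt_VsV : pairMat D.Ts D.T * coeffMat K cVsV = coeffMat K cVsV * pairMat' D.Ts D.T
  om_inv : D.T.map (shift K L lam) * scalMat K P.om * D.Ts.transpose =
    Matrix.of fun i j => C (scal K B (P.om i j)) * (C (srcU D.e (deg i).src) * D.xi true)
  omStar_inv : D.Ts.map (shift K L lam) * scalMat K P.omStar * D.T.transpose =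
    Matrix.of fun i j => C (scal K B (P.omStar i j)) * C (srcU D.e (deg i).tgt)
  sg_inv : D.Ts.transpose * scalMat K P.sg * D.T.map (shift K L lam) =
    Matrix.of fun i j => C (scal K B (P.sg i j)) * (C (tgtU D.e (deg i).tgt) * D.xi true)
  sgStar_inv : D.T.transpose * scalMat K P.sgStar * D.Ts.map (shift K L lam) =
    Matrix.of fun i j => C (scal K B (P.sgStar i j)) * C (tgtU D.e (deg i).src)

variable {K P L lam cVV cVsV cVsVs}

namespace IsRep

variable {D : RepData π X B} (hD : IsRep K P L lam cVV cVsV cVsVs D)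
include hD

theorem serT_gen [Quiver.IsThin π] (i j : X) : serT (D.gen (deg := deg)) i j = D.T i j := by
  funext d
  simp only [serT, RepData.gen, expo_eta]
  exact sum_hom_const _ fun h => congrFun (hD.homT.eq_zero hD.units i j) d

theorem serTs_gen [Quiver.IsThin π] (i j : X) : serTs (D.gen (deg := deg)) i j = D.Ts i j := by
  funext d
  simp only [serTs, RepData.gen, expo_eta]
  exact sum_hom_const _ fun h => congrFun (hD.homTs.eq_zero hD.units i j) d

theorem E_mul_gen [Quiver.IsThin π] (y : Gen deg) : D.E * D.gen y = D.gen y := by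
  have key : ∀ {F : MvPowerSeries (Fin 2) B}, C D.E * F = F → ∀ d, D.E * F d = F d := by
    intro F hF d
    conv_rhs => rw [← hF]
    rw [← MvPowerSeries.coeff_apply (C _ * F), MvPowerSeries.coeff_C_mul]
    rfl
  cases y with
  | e f => exact hD.units.E_mul f
  | T i j l n m => exact key (hD.homT.E_mul hD.units i j) _
  | Ts i j l n m => exact key (hD.homTs.E_mul hD.units i j) _
  | xi s n m => exact key (hD.E_xi s) _

theorem commute_E_xi (s : Bool) (a) : Commute D.E (D.xi s a) := by
  rw [← hD.units.sum]
  exact Commute.sum_left _ _ _ fun f _ => (hD.comm_e s a f).symm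

theorem gen_mul_E [Quiver.IsThin π] (y : Gen deg) : D.gen y * D.E = D.gen y := by
  have key : ∀ {F : MvPowerSeries (Fin 2) B}, F * C D.E = F → ∀ d, F d * D.E = F d := by
    intro F hF d
    conv_rhs => rw [← hF]
    rw [← MvPowerSeries.coeff_apply (F * C _), MvPowerSeries.coeff_mul_C]
    rfl
  cases y with
  | e f => exact hD.units.mul_E f
  | T i j l n m => exact key (hD.homT.mul_E hD.units i j) _
  | Ts i j l n m => exact key (hD.homTs.mul_E hD.units i j) _
  | xi s n m =>
    exact (hD.commute_E_xi s _).eq.symm.trans (hD.E_mul_gen (.xi s n m))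

end IsRep

/-- If the images `ψ (ι y)` of the generators are the coefficients of series that satisfy the
defining relations, then `ψ` respects the defining relations. -/
theorem map_eq_of_rel [Quiver.IsThin π] {D : RepData π X B}
    (hD : IsRep K P L lam cVV cVsV cVsVs D) (ψ : FreeAlgebra K (Gen deg) →ₙₐ[K] B)
    (hψ : ∀ y, ψ (FreeAlgebra.ι K y) = D.gen y) (hψ1 : ψ 1 = D.E)
    {x y : FreeAlgebra K (Gen deg)} (hxy : Rel K P L lam cVV cVsV cVsVs x y) : ψ x = ψ y := by
  have hT : ∀ i j, pmap ψ (serT (FreeAlgebra.ι K (X := Gen deg)) i j) = D.T i j := fun i j => by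
    rw [← hD.serT_gen]
    funext d
    simp only [pmap, serT, map_sum, hψ]
  have hTs : ∀ i j, pmap ψ (serTs (FreeAlgebra.ι K (X := Gen deg)) i j) = D.Ts i j := fun i j => by
    rw [← hD.serTs_gen]
    funext d
    simp only [pmap, serTs, map_sum, hψ]
  have hxi : ∀ s, pmap ψ (serXi (FreeAlgebra.ι K (X := Gen deg)) s) = D.xi s := fun s => by
    rw [← serXi_gen (deg := deg)]
    funext d
    simp only [pmap, serXi, hψ]
  have hsrc : ∀ a, ψ (unitSrc (FreeAlgebra.ι K (X := Gen deg)) a) = srcU D.e a := fun a => by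
    refine (srcU_map ψ (fun f => FreeAlgebra.ι K (.e f)) a).trans ?_
    simp only [hψ, RepData.gen]
  have htgt : ∀ a, ψ (unitTgt (FreeAlgebra.ι K (X := Gen deg)) a) = tgtU D.e a := fun a => by
    refine (tgtU_map ψ (fun f => FreeAlgebra.ι K (.e f)) a).trans ?_
    simp only [hψ, RepData.gen]
  have hC : ∀ {F : MvPowerSeries (Fin 2) B} {b : B}, C b * F = F → ∀ d, b * F d = F d := by
    intro F b hF d
    conv_rhs => rw [← hF]
    rw [← MvPowerSeries.coeff_apply (C _ * F), MvPowerSeries.coeff_C_mul]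
    rfl
  have hC' : ∀ {F : MvPowerSeries (Fin 2) B} {b : B}, F * C b = F → ∀ d, F d * b = F d := by
    intro F b hF d
    conv_rhs => rw [← hF]
    rw [← MvPowerSeries.coeff_apply (F * C _), MvPowerSeries.coeff_mul_C]
    rfl
  cases hxy with
  | unit_mul f => simpa only [map_mul, hψ, RepData.gen] using hD.units.mul_self f
  | unit_orth f f' h => simpa only [map_mul, hψ, map_zero, RepData.gen] using hD.units.orth f f' h
  | unit_sum => simpa only [map_sum, hψ, hψ1, RepData.gen] using hD.units.sum
  | T_top i j l n m =>
    rw [map_mul, hψ, hψ]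
    exact hC (hD.homT.unit_mul hD.units i j ⟨_, _, l⟩ rfl rfl) _
  | T_bottom i j l n m =>
    rw [map_mul, hψ, hψ]
    exact hC' (hD.homT.mul_unit hD.units i j ⟨_, _, (Sq.ofTop _ _ l).bottom⟩ rfl rfl) _
  | Ts_top i j l n m =>
    rw [map_mul, hψ, hψ]
    exact hC (hD.homTs.unit_mul hD.units i j ⟨_, _, l⟩ rfl rfl) _
  | Ts_bottom i j l n m =>
    rw [map_mul, hψ, hψ]
    exact hC' (hD.homTs.mul_unit hD.units i j ⟨_, _, (Sq.ofTop _ _ l).bottom⟩ rfl rfl) _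
  | central s n m y =>
    rw [map_mul, map_mul, hψ, hψ]
    cases y with
    | e f => exact hD.comm_e s _ f
    | T i j l n m => exact hD.comm_T s _ i j _
    | Ts i j l n m => exact hD.comm_Ts s _ i j _
    | xi s n m => exact hD.comm_xi _ _ s _
  | xi_mul s d =>
    have h := congrArg (coeff d) (hD.xi_mul s)
    rwa [← hxi, ← hxi, ← pmap_mul, ← hψ1, ← pmap_C, map_one] at h
  | rtt_VV i j m n d =>
    rw [← coeff_pmap ψ, ← coeff_pmap ψ, pmap_rttL, pmap_rttR]
    simp only [hT]
    rw [rttL_eq K cVV D.T D.T, rttR_eq K cVV D.T D.T, hD.rtt_VV]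
  | rtt_VsVs i j m n d =>
    rw [← coeff_pmap ψ, ← coeff_pmap ψ, pmap_rttL, pmap_rttR]
    simp only [hTs]
    rw [rttL_eq K cVsVs D.Ts D.Ts, rttR_eq K cVsVs D.Ts D.Ts, hD.rtt_VsVs]
  | rtt_VsV i j m n d =>
    rw [← coeff_pmap ψ, ← coeff_pmap ψ, pmap_rttL, pmap_rttR]
    simp only [hT, hTs]
    rw [rttL_eq K cVsV D.Ts D.T, rttR_eq K cVsV D.Ts D.T, hD.rtt_VsV]
  | om_inv i j d =>
    have h := congrFun (congrFun hD.om_inv i) j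
    rw [mul_scalMat_mul_apply] at h
    rw [← coeff_pmap ψ, ← coeff_pmap ψ]
    simp only [pmap_sum, pmap_C_scal_mul]
    simp only [pmap_mul, ← shift_pmap, hT, hTs, hxi, pmap_C, hsrc]
    exact congrArg (coeff d) h
  | omStar_inv i j d =>
    have h := congrFun (congrFun hD.omStar_inv i) j
    rw [mul_scalMat_mul_apply] at h
    rw [← coeff_pmap ψ, ← coeff_pmap ψ]
    simp only [pmap_sum, pmap_C_scal_mul]
    simp only [pmap_mul, ← shift_pmap, hT, hTs, pmap_C, hsrc]
    exact congrArg (coeff d) h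
  | sg_inv i j d =>
    have h := congrFun (congrFun hD.sg_inv i) j
    rw [mul_scalMat_mul_apply] at h
    rw [← coeff_pmap ψ, ← coeff_pmap ψ]
    simp only [pmap_sum, pmap_C_scal_mul]
    simp only [pmap_mul, ← shift_pmap, hT, hTs, hxi, pmap_C, htgt]
    exact congrArg (coeff d) h
  | sgStar_inv i j d =>
    have h := congrFun (congrFun hD.sgStar_inv i) j
    rw [mul_scalMat_mul_apply] at h
    rw [← coeff_pmap ψ, ← coeff_pmap ψ]
    simp only [pmap_sum, pmap_C_scal_mul]
    simp only [pmap_mul, ← shift_pmap, hT, hTs, pmap_C, htgt]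
    exact congrArg (coeff d) h

/-- A unital algebra homomorphism, seen as a homomorphism of non-unital algebras. -/
abbrev nonUnital {A B : Type*} [Ring A] [Ring B] [Algebra K A] [Algebra K B] (φ : A →ₐ[K] B) :
    A →ₙₐ[K] B := (φ : A →ₙₐ[K] B)

/-- The universal property of the restricted quantum algebra: series that satisfy the defining
relations with unit `E` determine a homomorphism onto a subalgebra of the corner `E B E`. -/
theorem IsRep.exists_lift [Quiver.IsThin π] {D : RepData π X B}
    (hD : IsRep K P L lam cVV cVsV cVsVs D) :
    ∃ φ : RQA K P L lam cVV cVsV cVsVs →ₙₐ[K] B, φ 1 = D.E ∧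
      ∀ y, φ (RQA.gen K P L lam cVV cVsV cVsVs y) = D.gen y := by
  -- A unital homomorphism to the corner `E B E`, whose unit is `E`, becomes a non-unital
  -- homomorphism to `B` that maps `1` to `E`.
  have hE : IsIdempotentElem D.E := hD.units.E_mul_E
  let := cornerAlgebra (K := K) hE
  let c : Gen deg → hE.Corner := fun y =>
    ⟨D.gen y, (Subsemigroup.mem_corner_iff hE).mpr ⟨hD.E_mul_gen y, hD.gen_mul_E y⟩⟩
  let h : FreeAlgebra K (Gen deg) →ₐ[K] hE.Corner := FreeAlgebra.lift K c
  let ψ : FreeAlgebra K (Gen deg) →ₙₐ[K] B := (cornerVal hE).comp (nonUnital h)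
  have hψ : ∀ y, ψ (FreeAlgebra.ι K y) = D.gen y := fun y =>
    congrArg (cornerVal (K := K) hE) (FreeAlgebra.lift_ι_apply (R := K) c y)
  have hψ1 : ψ 1 = D.E := congrArg (cornerVal (K := K) hE) (map_one h)
  have hrel : ∀ ⦃x y⦄, Rel K P L lam cVV cVsV cVsVs x y → h x = h y := fun x y hxy =>
    Subtype.ext (map_eq_of_rel hD ψ hψ hψ1 hxy)
  let H : RQA K P L lam cVV cVsV cVsVs →ₐ[K] hE.Corner := RingQuot.liftAlgHom K ⟨h, hrel⟩
  have hH : ∀ x, H (RingQuot.mkAlgHom K _ x) = h x := fun x =>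
    RingQuot.liftAlgHom_mkAlgHom_apply (S := K) h hrel x
  refine ⟨(cornerVal hE).comp (nonUnital H), ?_, fun y => ?_⟩
  · exact congrArg (cornerVal (K := K) hE) (map_one H)
  · exact (congrArg (cornerVal (K := K) hE) (hH (FreeAlgebra.ι K y))).trans (hψ y)

end Rep

/-- If every term of the sums `F i j` has the degree of its square, then `F` is homogeneous. -/
theorem isHomog_of_sum {π : Type*} [Groupoid π] [Fintype π] [∀ a b : π, Fintype (a ⟶ b)]
    {X B : Type*} [Ring B] {E : B} {e : Arr π → B} (h : IsUnits E e) {d : X → Arr π}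
    {F : Matrix X X (MvPowerSeries (Fin 2) B)} (t : ∀ i j, ((d i).src ⟶ (d j).src) → ℕ → ℕ → B)
    (hF : ∀ i j a, MvPowerSeries.coeff a (F i j) = ∑ l, t i j l (a 0) (a 1))
    (top : ∀ i j l n m, e ⟨_, _, l⟩ * t i j l n m = t i j l n m)
    (bot : ∀ i j l n m, t i j l n m *
      e ⟨(d i).tgt, (d j).tgt, Groupoid.inv (d i).hom ≫ l ≫ (d j).hom⟩ = t i j l n m) :
    IsHomog e d F := by
  refine ⟨fun i j => ?_, fun i j => ?_, fun i j => ?_, fun i j => ?_⟩ <;> ext a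
  · rw [MvPowerSeries.coeff_C_mul, hF]
    refine (Finset.mul_sum _ _ _).trans (Finset.sum_congr rfl fun l _ => ?_)
    rw [← top, ← mul_assoc, h.srcU_mul, if_pos rfl]
  · rw [MvPowerSeries.coeff_C_mul, hF]
    refine (Finset.mul_sum _ _ _).trans (Finset.sum_congr rfl fun l _ => ?_)
    rw [← top, ← mul_assoc, h.tgtU_mul, if_pos rfl]
  · rw [MvPowerSeries.coeff_mul_C, hF]
    refine (Finset.sum_mul _ _ _).trans (Finset.sum_congr rfl fun l _ => ?_)
    rw [← bot, mul_assoc, h.mul_srcU, if_pos rfl]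
  · rw [MvPowerSeries.coeff_mul_C, hF]
    refine (Finset.sum_mul _ _ _).trans (Finset.sum_congr rfl fun l _ => ?_)
    rw [← bot, mul_assoc, h.mul_tgtU, if_pos rfl]

/-! ### The generating series of the restricted quantum algebra -/

section Taut

open MvPowerSeries (coeff C)

variable {π : Type*} [Groupoid π] [Fintype π] [∀ a b : π, Fintype (a ⟶ b)] {X : Type*} [Fintype X]
  {deg : X → Arr π} (K : Type*) [CommRing K] [Algebra ℂ K] (P : Pairing deg) (L lam : ℂ)
  (cVV cVsV cVsVs : Coeff X (MvPowerSeries (Fin 2) ℂ))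

namespace RQA

local notation "𝓐" => RQA K P L lam cVV cVsV cVsVs
local notation "𝔤" => gen K P L lam cVV cVsV cVsVs

/-- The restricted quantum algebra with its own generating series. -/
noncomputable def data : RepData π X (RQA K P L lam cVV cVsV cVsVs) where
  E := 1
  e f := 𝔤 (.e f)
  T := serT 𝔤
  Ts := serTs 𝔤
  xi := serXi 𝔤

variable {K P L lam cVV cVsV cVsVs}

/-- To prove a property of all elements, prove it for the generators and show that it is stable
under linear combinations and products. -/
theorem induction_gen {p : 𝓐 → Prop} (zero : p 0) (add : ∀ x y, p x → p y → p (x + y))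
    (smul : ∀ (r : K) x, p x → p (r • x)) (mul : ∀ x y, p x → p y → p (x * y))
    (gen : ∀ y, p (𝔤 y)) (x : 𝓐) : p x := by
  have one : p 1 := by
    have h := RingQuot.mkAlgHom_rel K (Rel.unit_sum (K := K) (P := P) (L := L) (lam := lam)
      (cVV := cVV) (cVsV := cVsV) (cVsVs := cVsVs))
    rw [map_one, map_sum] at h
    rw [← h]
    exact Finset.sum_induction _ p add zero fun f _ => gen (.e f)
  obtain ⟨y, rfl⟩ := RingQuot.mkAlgHom_surjective K _ x
  induction y using FreeAlgebra.induction with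
  | grade0 r =>
    rw [AlgHom.commutes, Algebra.algebraMap_eq_smul_one]
    exact smul _ _ one
  | grade1 y => exact gen y
  | mul a b ha hb =>
    rw [map_mul]
    exact mul _ _ ha hb
  | add a b ha hb =>
    rw [map_add]
    exact add _ _ ha hb

variable (K P L lam cVV cVsV cVsVs)

/-- The quotient map from the free algebra. -/
noncomputable abbrev quot : FreeAlgebra K (Gen deg) →ₙₐ[K] 𝓐 :=
  nonUnital (RingQuot.mkAlgHom K (Rel K P L lam cVV cVsV cVsVs))

variable {K P L lam cVV cVsV cVsVs}

local notation "𝔮" => quot K P L lam cVV cVsV cVsVs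

theorem quot_eq {x y} (h : Rel K P L lam cVV cVsV cVsVs x y) : 𝔮 x = 𝔮 y :=
  RingQuot.mkAlgHom_rel K h

theorem quot_ι (y : Gen deg) : 𝔮 (FreeAlgebra.ι K y) = 𝔤 y := rfl

theorem pmap_quot_serT (i j : X) : pmap 𝔮 (serT (FreeAlgebra.ι K) i j) = serT 𝔤 i j := by
  funext d
  simp only [pmap, serT, map_sum, quot_ι]

theorem pmap_quot_serTs (i j : X) : pmap 𝔮 (serTs (FreeAlgebra.ι K) i j) = serTs 𝔤 i j := by
  funext d
  simp only [pmap, serTs, map_sum, quot_ι]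

theorem pmap_quot_serXi (s : Bool) : pmap 𝔮 (serXi (FreeAlgebra.ι K) s) = serXi 𝔤 s := rfl

theorem quot_unitSrc (a : π) :
    𝔮 (unitSrc (FreeAlgebra.ι K) a) = srcU (fun f => 𝔤 (.e f)) a :=
  srcU_map 𝔮 (fun f => FreeAlgebra.ι K (Gen.e f : Gen deg)) a

theorem quot_unitTgt (a : π) :
    𝔮 (unitTgt (FreeAlgebra.ι K) a) = tgtU (fun f => 𝔤 (.e f)) a :=
  tgtU_map 𝔮 (fun f => FreeAlgebra.ι K (Gen.e f : Gen deg)) a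

theorem units : IsUnits (1 : 𝓐) (fun f => 𝔤 (.e f)) where
  mul_self f := (map_mul 𝔮 _ _).symm.trans (quot_eq (Rel.unit_mul f))
  orth f f' h := (map_mul 𝔮 _ _).symm.trans ((quot_eq (Rel.unit_orth f f' h)).trans (map_zero 𝔮))
  sum := by
    have h := quot_eq (Rel.unit_sum (K := K) (P := P) (L := L) (lam := lam)
      (cVV := cVV) (cVsV := cVsV) (cVsVs := cVsVs))
    rw [map_sum] at h
    exact h.trans (map_one (RingQuot.mkAlgHom K _))

theorem homT : IsHomog (fun f => 𝔤 (.e f)) deg (serT 𝔤) :=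
  isHomog_of_sum units (fun i j l n m => 𝔤 (.T i j l n m)) (fun _ _ _ => rfl)
    (fun i j l n m => (map_mul 𝔮 _ _).symm.trans (quot_eq (Rel.T_top i j l n m)))
    (fun i j l n m => (map_mul 𝔮 _ _).symm.trans (quot_eq (Rel.T_bottom i j l n m)))

theorem homTs : IsHomog (fun f => 𝔤 (.e f)) (fun i => (deg i).inv) (serTs 𝔤) :=
  isHomog_of_sum (d := fun i => (deg i).inv) units (fun i j l n m => 𝔤 (.Ts i j l n m))
    (fun _ _ _ => rfl)
    (fun i j l n m => (map_mul 𝔮 _ _).symm.trans (quot_eq (Rel.Ts_top i j l n m)))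
    (fun i j l n m => (map_mul 𝔮 _ _).symm.trans (quot_eq (Rel.Ts_bottom i j l n m)))

theorem xi_central (s : Bool) (a) (x : 𝓐) : Commute (serXi 𝔤 s a) x := by
  induction x using induction_gen with
  | zero => exact Commute.zero_right _
  | add x y hx hy => exact hx.add_right hy
  | smul r x hx => exact hx.smul_right r
  | mul x y hx hy => exact hx.mul_right hy
  | gen y =>
    have h := quot_eq (Rel.central (K := K) (P := P) (L := L) (lam := lam)
      (cVV := cVV) (cVsV := cVsV) (cVsVs := cVsVs) s (a 0) (a 1) y)
    rwa [map_mul, map_mul] at h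

/-- The generating series of the restricted quantum algebra satisfy the defining relations. -/
theorem isRep : IsRep K P L lam cVV cVsV cVsVs (data K P L lam cVV cVsV cVsVs) where
  units := units
  homT := homT
  homTs := homTs
  E_xi s := by
    change C 1 * _ = _
    rw [map_one, one_mul]
  comm_e s a f := xi_central s a _
  comm_T s a i j b := xi_central s a _
  comm_Ts s a i j b := xi_central s a _
  comm_xi s a s' b := xi_central s a _
  xi_mul s := by
    ext d
    have h := quot_eq (Rel.xi_mul (K := K) (P := P) (L := L) (lam := lam)
      (cVV := cVV) (cVsV := cVsV) (cVsVs := cVsVs) s d)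
    rw [← coeff_pmap 𝔮, ← coeff_pmap 𝔮, pmap_mul, pmap_quot_serXi, pmap_quot_serXi,
      ← map_one C, pmap_C] at h
    exact h.trans (congrArg (coeff d) (congrArg C (map_one (RingQuot.mkAlgHom K _))))
  rtt_VV := by
    ext ⟨i, j⟩ ⟨m, n⟩ d
    have h := quot_eq (Rel.rtt_VV (K := K) (P := P) (L := L) (lam := lam)
      (cVV := cVV) (cVsV := cVsV) (cVsVs := cVsVs) i j m n d)
    rw [← coeff_pmap 𝔮, ← coeff_pmap 𝔮, pmap_rttL, pmap_rttR] at h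
    simp only [pmap_quot_serT] at h
    exact (congrArg (coeff d) (rttL_eq K cVV (serT 𝔤) (serT 𝔤) i j m n)).symm.trans
      (h.trans (congrArg (coeff d) (rttR_eq K cVV (serT 𝔤) (serT 𝔤) i j m n)))
  rtt_VsVs := by
    ext ⟨i, j⟩ ⟨m, n⟩ d
    have h := quot_eq (Rel.rtt_VsVs (K := K) (P := P) (L := L) (lam := lam)
      (cVV := cVV) (cVsV := cVsV) (cVsVs := cVsVs) i j m n d)
    rw [← coeff_pmap 𝔮, ← coeff_pmap 𝔮, pmap_rttL, pmap_rttR] at h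
    simp only [pmap_quot_serTs] at h
    exact (congrArg (coeff d) (rttL_eq K cVsVs (serTs 𝔤) (serTs 𝔤) i j m n)).symm.trans
      (h.trans (congrArg (coeff d) (rttR_eq K cVsVs (serTs 𝔤) (serTs 𝔤) i j m n)))
  rtt_VsV := by
    ext ⟨i, j⟩ ⟨m, n⟩ d
    have h := quot_eq (Rel.rtt_VsV (K := K) (P := P) (L := L) (lam := lam)
      (cVV := cVV) (cVsV := cVsV) (cVsVs := cVsVs) i j m n d)
    rw [← coeff_pmap 𝔮, ← coeff_pmap 𝔮, pmap_rttL, pmap_rttR] at h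
    simp only [pmap_quot_serT, pmap_quot_serTs] at h
    exact (congrArg (coeff d) (rttL_eq K cVsV (serTs 𝔤) (serT 𝔤) i j m n)).symm.trans
      (h.trans (congrArg (coeff d) (rttR_eq K cVsV (serTs 𝔤) (serT 𝔤) i j m n)))
  om_inv := by
    ext i j d
    rw [mul_scalMat_mul_apply]
    have h := quot_eq (Rel.om_inv (K := K) (P := P) (L := L) (lam := lam)
      (cVV := cVV) (cVsV := cVsV) (cVsVs := cVsVs) i j d)
    rw [← coeff_pmap 𝔮, ← coeff_pmap 𝔮] at h
    simp only [pmap_sum, pmap_C_scal_mul] at h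
    simp only [pmap_mul, ← shift_pmap, pmap_quot_serT, pmap_quot_serTs, pmap_quot_serXi, pmap_C,
      quot_unitSrc] at h
    exact h
  omStar_inv := by
    ext i j d
    rw [mul_scalMat_mul_apply]
    have h := quot_eq (Rel.omStar_inv (K := K) (P := P) (L := L) (lam := lam)
      (cVV := cVV) (cVsV := cVsV) (cVsVs := cVsVs) i j d)
    rw [← coeff_pmap 𝔮, ← coeff_pmap 𝔮] at h
    simp only [pmap_sum, pmap_C_scal_mul] at h
    simp only [pmap_mul, ← shift_pmap, pmap_quot_serT, pmap_quot_serTs, pmap_C, quot_unitSrc] at h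
    exact h
  sg_inv := by
    ext i j d
    rw [mul_scalMat_mul_apply]
    have h := quot_eq (Rel.sg_inv (K := K) (P := P) (L := L) (lam := lam)
      (cVV := cVV) (cVsV := cVsV) (cVsVs := cVsVs) i j d)
    rw [← coeff_pmap 𝔮, ← coeff_pmap 𝔮] at h
    simp only [pmap_sum, pmap_C_scal_mul] at h
    simp only [pmap_mul, ← shift_pmap, pmap_quot_serT, pmap_quot_serTs, pmap_quot_serXi, pmap_C,
      quot_unitTgt] at h
    exact h
  sgStar_inv := by
    ext i j d
    rw [mul_scalMat_mul_apply]
    have h := quot_eq (Rel.sgStar_inv (K := K) (P := P) (L := L) (lam := lam)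
      (cVV := cVV) (cVsV := cVsV) (cVsVs := cVsVs) i j d)
    rw [← coeff_pmap 𝔮, ← coeff_pmap 𝔮] at h
    simp only [pmap_sum, pmap_C_scal_mul] at h
    simp only [pmap_mul, ← shift_pmap, pmap_quot_serT, pmap_quot_serTs, pmap_C, quot_unitTgt] at h
    exact h

theorem gen_xi_eq (s : Bool) (n m : ℕ) : 𝔤 (.xi s n m) = serXi 𝔤 s (expo n m) := by
  simp only [serXi, expo_zero', expo_one']

variable [Quiver.IsThin π]

theorem gen_T_eq (i j : X) (l n m) : 𝔤 (.T i j l n m) = serT 𝔤 i j (expo n m) := by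
  simp only [serT, expo_zero', expo_one']
  exact (Fintype.sum_subsingleton (fun l => 𝔤 (.T i j l n m)) l).symm

theorem gen_Ts_eq (i j : X) (l n m) : 𝔤 (.Ts i j l n m) = serTs 𝔤 i j (expo n m) := by
  simp only [serTs, expo_zero', expo_one']
  exact (Fintype.sum_subsingleton (fun l => 𝔤 (.Ts i j l n m)) l).symm

/-- Induction over the components of the unit and the coefficients of the generating series. -/
theorem induction_ser {p : 𝓐 → Prop} (zero : p 0) (add : ∀ x y, p x → p y → p (x + y))
    (smul : ∀ (r : K) x, p x → p (r • x)) (mul : ∀ x y, p x → p y → p (x * y))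
    (e : ∀ f, p (𝔤 (.e f))) (T : ∀ i j d, p (serT 𝔤 i j d)) (Ts : ∀ i j d, p (serTs 𝔤 i j d))
    (xi : ∀ s d, p (serXi 𝔤 s d)) (x : 𝓐) : p x :=
  induction_gen zero add smul mul (fun y => by
    cases y with
    | e f => exact e f
    | T i j l n m =>
      rw [gen_T_eq]
      exact T _ _ _
    | Ts i j l n m =>
      rw [gen_Ts_eq]
      exact Ts _ _ _
    | xi s n m =>
      rw [gen_xi_eq]
      exact xi _ _) x

/-- Homomorphisms that agree on the components of the unit and on the generating series are equal,
even when they do not preserve the unit. -/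
theorem nonUnital_ext {B : Type*} [Ring B] [Algebra K B] {φ ψ : 𝓐 →ₙₐ[K] B}
    (e : ∀ f, φ (𝔤 (.e f)) = ψ (𝔤 (.e f)))
    (T : ∀ i j, pmap φ (serT 𝔤 i j) = pmap ψ (serT 𝔤 i j))
    (Ts : ∀ i j, pmap φ (serTs 𝔤 i j) = pmap ψ (serTs 𝔤 i j))
    (xi : ∀ s, pmap φ (serXi 𝔤 s) = pmap ψ (serXi 𝔤 s)) (x : 𝓐) : φ x = ψ x := by
  induction x using induction_ser with
  | zero => rw [map_zero, map_zero]
  | add x y hx hy => rw [map_add, map_add, hx, hy]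
  | smul r x hx => rw [map_smul, map_smul, hx]
  | mul x y hx hy => rw [map_mul, map_mul, hx, hy]
  | e f => exact e f
  | T i j d => exact congrFun (T i j) d
  | Ts i j d => exact congrFun (Ts i j) d
  | xi s d => exact congrFun (xi s) d

/-- The homomorphism determined by series that satisfy the defining relations. -/
theorem exists_hom {B : Type*} [Ring B] [Algebra K B] {D : RepData π X B}
    (hD : IsRep K P L lam cVV cVsV cVsVs D) :
    ∃ φ : 𝓐 →ₙₐ[K] B, φ 1 = D.E ∧ (∀ f, φ (𝔤 (.e f)) = D.e f) ∧
      (∀ i j, pmap φ (serT 𝔤 i j) = D.T i j) ∧ (∀ i j, pmap φ (serTs 𝔤 i j) = D.Ts i j) ∧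
      ∀ s, pmap φ (serXi 𝔤 s) = D.xi s := by
  obtain ⟨φ, h1, hφ⟩ := hD.exists_lift
  refine ⟨φ, h1, fun f => hφ _, fun i j => ?_, fun i j => ?_, fun s => ?_⟩
  · rw [← hD.serT_gen]
    funext d
    simp only [pmap, serT, map_sum, hφ]
  · rw [← hD.serTs_gen]
    funext d
    simp only [pmap, serTs, map_sum, hφ]
  · rw [← serXi_gen (deg := deg)]
    funext d
    simp only [pmap, serXi, hφ]

end RQA

end Taut

/-! ### Squares of a thin groupoid -/

section SquareFacts

variable {π : Type*} [Groupoid π]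

/-- The top side of a square as an arrow. -/
abbrev Sq.topArr (α : Sq π) : Arr π := ⟨α.tl, α.tr, α.top⟩

/-- The bottom side of a square as an arrow. -/
abbrev Sq.botArr (α : Sq π) : Arr π := ⟨α.bl, α.br, α.bottom⟩

theorem IsVComp.topArr {α β γ : Sq π} (h : IsVComp α β γ) : γ.topArr = α.topArr := by
  cases h
  rfl

theorem IsVComp.botArr {α β γ : Sq π} (h : IsVComp α β γ) : γ.botArr = β.botArr := by
  cases h
  rfl

theorem exists_isVComp {α β : Sq π} (h : α.botArr = β.topArr) : ∃ γ, IsVComp α β γ := by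
  obtain ⟨a, a', b, b', u, f, v, g, h₁⟩ := α
  obtain ⟨c, c', d, d', u', g', v', k, h₂⟩ := β
  simp only [Sigma.mk.injEq] at h
  obtain ⟨rfl, h⟩ := h
  obtain ⟨rfl, h⟩ := Sigma.mk.inj (eq_of_heq h)
  cases h
  exact ⟨_, .mk u u' v v' f g k h₁ h₂ (by rw [Category.assoc, h₂, ← Category.assoc, h₁,
    Category.assoc])⟩

variable [Quiver.IsThin π]

/-- A square in a thin groupoid is determined by its top and bottom sides, since these contain all
of its corners. -/
theorem Sq.ext_of_thin {α β : Sq π} (h₁ : α.topArr = β.topArr) (h₂ : α.botArr = β.botArr) :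
    α = β := by
  obtain ⟨a, a', b, b', u, f, v, g, h⟩ := α
  obtain ⟨c, c', d, d', u', f', v', g', h'⟩ := β
  obtain ⟨rfl, h₁⟩ := Sigma.mk.inj h₁
  obtain ⟨rfl, h₁⟩ := Sigma.mk.inj (eq_of_heq h₁)
  obtain ⟨rfl, h₂⟩ := Sigma.mk.inj h₂
  obtain ⟨rfl, h₂⟩ := Sigma.mk.inj (eq_of_heq h₂)
  obtain rfl := eq_of_heq h₁
  obtain rfl := eq_of_heq h₂
  obtain rfl := Subsingleton.elim u u'
  obtain rfl := Subsingleton.elim v v'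
  rfl

/-- Two squares with composable top and bottom sides are horizontally composable. -/
theorem isHComp_of_isComp {α β γ : Sq π} (h₁ : Arr.IsComp α.topArr β.topArr γ.topArr)
    (h₂ : Arr.IsComp α.botArr β.botArr γ.botArr) : IsHComp α β γ := by
  obtain ⟨a, a', b, b', u, f, v, g, h⟩ := α
  obtain ⟨c, c', d, d', v', f', w, g', h'⟩ := β
  generalize ht : Sq.topArr γ = t at h₁
  generalize hb : Sq.botArr γ = s at h₂
  cases h₁
  cases h₂
  obtain rfl := Subsingleton.elim v v'
  have h'' : u ≫ g ≫ g' = (f ≫ f') ≫ w := by rw [← Category.assoc, h, Category.assoc, h',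
    Category.assoc]
  have : γ = ⟨_, _, _, _, u, f ≫ f', w, g ≫ g', h''⟩ := Sq.ext_of_thin ht hb
  rw [this]
  exact .mk u v w f f' g g' h h' h''

theorem Arr.isComp_iff {f g h : Arr π} :
    Arr.IsComp f g h ↔ f.tgt = g.src ∧ h.src = f.src ∧ h.tgt = g.tgt := by
  constructor
  · rintro ⟨f, g⟩
    exact ⟨rfl, rfl, rfl⟩
  · obtain ⟨a, b, f⟩ := f
    obtain ⟨b', c, g⟩ := g
    rintro ⟨h₁, h₂, h₃⟩
    change b = b' at h₁
    subst h₁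
    have : h = ⟨a, c, f ≫ g⟩ := Arr.ext_of_thin h₂ h₃
    rw [this]
    exact .mk f g

end SquareFacts

/-! ### The grading -/

section Grading

variable {π : Type*} [Groupoid π] [Fintype π] [∀ a b : π, Fintype (a ⟶ b)] {X : Type*} [Fintype X]
  {deg : X → Arr π} {K : Type*} [CommRing K] [Algebra ℂ K] {P : Pairing deg} {L lam : ℂ}
  {cVV cVsV cVsVs : Coeff X (MvPowerSeries (Fin 2) ℂ)}

namespace RQA

local notation "𝓐" => RQA K P L lam cVV cVsV cVsVs
local notation "𝔤" => gen K P L lam cVV cVsV cVsVs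
local notation "𝓒" => component K P L lam cVV cVsV cVsVs
local notation "𝔡" => HasDegree K P L lam cVV cVsV cVsVs

theorem e_mul_e (f f' : Arr π) : 𝔤 (.e f) * 𝔤 (.e f') = if f = f' then 𝔤 (.e f) else 0 :=
  units.mul_eq f f'

theorem top_mul_of_hasDegree {a : 𝓐} {α : Sq π} (h : 𝔡 a α) :
    𝔤 (.e α.topArr) * a = a := by
  induction h with
  | e f => exact units.mul_self f
  | T i j l n m =>
    exact (map_mul (quot K P L lam cVV cVsV cVsVs) _ _).symm.trans (quot_eq (Rel.T_top i j l n m))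
  | Ts i j l n m =>
    exact (map_mul (quot K P L lam cVV cVsV cVsVs) _ _).symm.trans (quot_eq (Rel.Ts_top i j l n m))
  | xi f s n m => exact (mul_assoc _ _ _).symm.trans (congrArg (· * _) (units.mul_self f))
  | mul a b α β γ ha hb hγ iha ihb => rw [hγ.topArr, ← mul_assoc, iha]

theorem mul_bot_of_hasDegree {a : 𝓐} {α : Sq π} (h : 𝔡 a α) :
    a * 𝔤 (.e α.botArr) = a := by
  induction h with
  | e f => exact units.mul_self f
  | T i j l n m =>
    exact (map_mul (quot K P L lam cVV cVsV cVsVs) _ _).symm.trans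
      (quot_eq (Rel.T_bottom i j l n m))
  | Ts i j l n m =>
    exact (map_mul (quot K P L lam cVV cVsV cVsVs) _ _).symm.trans
      (quot_eq (Rel.Ts_bottom i j l n m))
  | xi f s n m =>
    have h := xi_central (K := K) (P := P) (L := L) (lam := lam) (cVV := cVV) (cVsV := cVsV)
      (cVsVs := cVsVs) s (expo n m) (𝔤 (.e f))
    rw [← gen_xi_eq] at h
    change 𝔤 (.e f) * 𝔤 (.xi s n m) * 𝔤 (.e f) = _
    rw [mul_assoc, h.eq, ← mul_assoc, e_mul_e, if_pos rfl]
  | mul a b α β γ ha hb hγ iha ihb => rw [hγ.botArr, mul_assoc, ihb]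

theorem top_mul_of_mem {x : 𝓐} {α : Sq π} (h : x ∈ 𝓒 α) : 𝔤 (.e α.topArr) * x = x := by
  induction h using Submodule.span_induction with
  | mem x hx => exact top_mul_of_hasDegree hx
  | zero => exact mul_zero _
  | add x y _ _ hx hy => rw [mul_add, hx, hy]
  | smul r x _ hx => rw [mul_smul_comm, hx]

theorem mul_bot_of_mem {x : 𝓐} {α : Sq π} (h : x ∈ 𝓒 α) : x * 𝔤 (.e α.botArr) = x := by
  induction h using Submodule.span_induction with
  | mem x hx => exact mul_bot_of_hasDegree hx
  | zero => exact zero_mul _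
  | add x y _ _ hx hy => rw [add_mul, hx, hy]
  | smul r x _ hx => rw [smul_mul_assoc, hx]

theorem mul_mem_component {α β γ : Sq π} {x y : 𝓐} (h : IsVComp α β γ) (hx : x ∈ 𝓒 α)
    (hy : y ∈ 𝓒 β) : x * y ∈ 𝓒 γ := by
  have := Submodule.mul_mem_mul hx hy
  rw [component, component, Submodule.span_mul_span] at this
  refine Submodule.span_mono ?_ this
  rintro _ ⟨a, ha, b, hb, rfl⟩
  exact .mul a b α β γ ha hb h

theorem mul_eq_zero_of_not_isVComp {α β : Sq π} {x y : 𝓐} (h : ∀ γ, ¬ IsVComp α β γ)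
    (hx : x ∈ 𝓒 α) (hy : y ∈ 𝓒 β) : x * y = 0 := by
  have hne : α.botArr ≠ β.topArr := fun h' => (exists_isVComp h').elim h
  rw [← mul_bot_of_mem hx, ← top_mul_of_mem hy, mul_assoc, ← mul_assoc (𝔤 _), e_mul_e, if_neg hne,
    zero_mul, mul_zero]

variable (K P L lam cVV cVsV cVsVs) in
/-- The elements of all degrees with top side `f` and bottom side `f'`. -/
def boundary (f f' : Arr π) : Submodule K 𝓐 :=
  Submodule.span K {a | ∃ α : Sq π, 𝔡 a α ∧ α.topArr = f ∧ α.botArr = f'}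

local notation "𝓝" => boundary K P L lam cVV cVsV cVsVs

theorem boundary_mul {f f' f'' : Arr π} {x y : 𝓐} (hx : x ∈ 𝓝 f f') (hy : y ∈ 𝓝 f' f'') :
    x * y ∈ 𝓝 f f'' := by
  have := Submodule.mul_mem_mul hx hy
  rw [boundary, boundary, Submodule.span_mul_span] at this
  refine Submodule.span_mono ?_ this
  rintro _ ⟨a, ⟨α, ha, hα, hα'⟩, b, ⟨β, hb, hβ, hβ'⟩, rfl⟩
  obtain ⟨γ, hγ⟩ := exists_isVComp (hα'.trans hβ.symm)
  exact ⟨γ, .mul a b α β γ ha hb hγ, hγ.topArr.trans hα, hγ.botArr.trans hβ'⟩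

theorem e_mul_mul_e_of_hasDegree {a : 𝓐} {α : Sq π} (h : 𝔡 a α) (f f' : Arr π) :
    𝔤 (.e f) * a * 𝔤 (.e f') ∈ 𝓝 f f' := by
  by_cases h₁ : f = α.topArr
  · by_cases h₂ : α.botArr = f'
    · rw [h₁, ← h₂, top_mul_of_hasDegree h, mul_bot_of_hasDegree h]
      exact Submodule.subset_span ⟨α, h, rfl, rfl⟩
    · rw [← mul_bot_of_hasDegree h, mul_assoc, mul_assoc, e_mul_e, if_neg h₂, mul_zero, mul_zero]
      exact zero_mem _
  · rw [← top_mul_of_hasDegree h, ← mul_assoc, e_mul_e, if_neg h₁, zero_mul, zero_mul]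
    exact zero_mem _

theorem mul_e_sum (x y : 𝓐) (f f' : Arr π) :
    𝔤 (.e f) * (x * y) * 𝔤 (.e f') =
      ∑ h, (𝔤 (.e f) * x * 𝔤 (.e h)) * (𝔤 (.e h) * y * 𝔤 (.e f')) := by
  have : ∀ h, (𝔤 (.e f) * x * 𝔤 (.e h)) * (𝔤 (.e h) * y * 𝔤 (.e f')) =
      𝔤 (.e f) * x * 𝔤 (.e h) * (y * 𝔤 (.e f')) := fun h => by
    rw [mul_assoc (𝔤 (.e h)), ← mul_assoc _ (𝔤 (.e h)), mul_assoc _ (𝔤 (.e h)) (𝔤 (.e h)), e_mul_e,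
      if_pos rfl]
  simp only [this]
  rw [← Finset.sum_mul, ← Finset.mul_sum, units.sum, mul_one]
  simp only [mul_assoc]

/-- Cutting by the components of the unit projects to elements of given top and bottom sides. -/
theorem e_mul_mul_e_mem (x : 𝓐) : ∀ f f', 𝔤 (.e f) * x * 𝔤 (.e f') ∈ 𝓝 f f' := by
  induction x using induction_gen with
  | zero => simp
  | add x y hx hy =>
    intro f f'
    rw [mul_add, add_mul]
    exact add_mem (hx f f') (hy f f')
  | smul r x hx =>
    intro f f'
    rw [mul_smul_comm, smul_mul_assoc]
    exact Submodule.smul_mem _ _ (hx f f')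
  | mul x y hx hy =>
    intro f f'
    rw [mul_e_sum]
    exact Submodule.sum_mem _ fun h _ => boundary_mul (hx f h) (hy h f')
  | gen y =>
    intro f f'
    cases y with
    | e f => exact e_mul_mul_e_of_hasDegree (.e f) _ _
    | T i j l n m => exact e_mul_mul_e_of_hasDegree (.T i j l n m) _ _
    | Ts i j l n m => exact e_mul_mul_e_of_hasDegree (.Ts i j l n m) _ _
    | xi s n m =>
      have h := e_mul_mul_e_of_hasDegree (K := K) (P := P) (L := L) (lam := lam) (cVV := cVV)
        (cVsV := cVsV) (cVsVs := cVsVs) (.xi f s n m) f f'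
      rwa [← mul_assoc, e_mul_e, if_pos rfl] at h

theorem boundary_eq_bot {f f' : Arr π} (h : ∀ α : Sq π, ¬ (α.topArr = f ∧ α.botArr = f')) :
    𝓝 f f' = ⊥ := by
  rw [eq_bot_iff, boundary, Submodule.span_le]
  rintro a ⟨α, _, hα⟩
  exact absurd hα (h α)

variable [Quiver.IsThin π]

/-- As a square is determined by its top and bottom sides, `boundary` is a component of the grading.
-/
theorem boundary_eq (α : Sq π) : 𝓝 α.topArr α.botArr = 𝓒 α := by
  refine congrArg (Submodule.span K) (Set.ext fun a => ⟨?_, fun h => ⟨α, h, rfl, rfl⟩⟩)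
  rintro ⟨β, h, h₁, h₂⟩
  obtain rfl := Sq.ext_of_thin h₁ h₂
  exact h

theorem e_mul_mul_e_mem_component (x : 𝓐) (α : Sq π) :
    𝔤 (.e α.topArr) * x * 𝔤 (.e α.botArr) ∈ 𝓒 α := by
  rw [← boundary_eq]
  exact e_mul_mul_e_mem x _ _

theorem iSup_component : ⨆ α, 𝓒 α = ⊤ := by
  rw [eq_top_iff]
  rintro x -
  have hx : x = ∑ f, ∑ f', 𝔤 (.e f) * x * 𝔤 (.e f') := by
    simp only [← Finset.mul_sum, ← Finset.sum_mul, units.sum, mul_one, one_mul]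
  rw [hx]
  refine Submodule.sum_mem _ fun f _ => Submodule.sum_mem _ fun f' _ => ?_
  by_cases h : ∃ α : Sq π, α.topArr = f ∧ α.botArr = f'
  · obtain ⟨α, rfl, rfl⟩ := h
    exact Submodule.mem_iSup_of_mem α (e_mul_mul_e_mem_component x α)
  · have h' := e_mul_mul_e_mem x f f'
    rw [boundary_eq_bot (not_exists.mp h), Submodule.mem_bot] at h'
    rw [h']
    exact zero_mem _

theorem iSupIndep_component : iSupIndep 𝓒 := by
  intro α
  rw [disjoint_iff_inf_le]
  rintro x ⟨hx, hx'⟩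
  let φ : 𝓐 →ₗ[K] 𝓐 :=
    LinearMap.mulRight K (𝔤 (.e α.botArr)) ∘ₗ LinearMap.mulLeft K (𝔤 (.e α.topArr))
  have hφ : ∀ y, φ y = 𝔤 (.e α.topArr) * y * 𝔤 (.e α.botArr) := fun y => rfl
  have h0 : (⨆ β, ⨆ (_ : β ≠ α), 𝓒 β) ≤ LinearMap.ker φ := by
    refine iSup_le fun β => iSup_le fun hβ => fun y hy => ?_
    rw [LinearMap.mem_ker, hφ]
    by_cases h₁ : α.topArr = β.topArr
    · have h₂ : β.botArr ≠ α.botArr := fun h₂ => hβ (Sq.ext_of_thin h₁.symm h₂)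
      rw [← mul_bot_of_mem hy, mul_assoc, mul_assoc, e_mul_e, if_neg h₂, mul_zero, mul_zero]
    · rw [← top_mul_of_mem hy, ← mul_assoc, e_mul_e, if_neg h₁, zero_mul, zero_mul]
  have h := h0 hx'
  rw [LinearMap.mem_ker, hφ, top_mul_of_mem hx, mul_bot_of_mem hx] at h
  exact h

/-- The components are the Peirce components with respect to the orthogonal idempotents `e f`, hence
they form a direct sum decomposition. -/
theorem isInternal_component : DirectSum.IsInternal 𝓒 :=
  DirectSum.isInternal_submodule_of_iSupIndep_of_iSup_eq_top iSupIndep_component iSup_component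

end RQA

end Grading

/-! ### Uniqueness of expansions -/

section Expansion

open Filter Topology

/-- A power series in one variable that sums to zero on a punctured disc vanishes. -/
theorem coeff_eq_zero_of_hasSum {p : ℕ → ℂ} {R : ℝ} (hR : 0 < R)
    (h : ∀ a : ℂ, a ≠ 0 → ‖a‖ < R → HasSum (fun n => p n * a ^ n) 0) (n : ℕ) : p n = 0 := by
  classical
  let f : ℂ → ℂ := fun a => if a = 0 then p 0 else 0
  let s : FormalMultilinearSeries ℂ ℂ ℂ := FormalMultilinearSeries.ofScalars ℂ p
  have hs : ∀ n, s.coeff n = p n := fun n => by simp [s]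
  have hf : HasFPowerSeriesAt f s 0 := by
    rw [hasFPowerSeriesAt_iff]
    filter_upwards [Metric.ball_mem_nhds (0 : ℂ) hR] with a ha
    simp only [hs, smul_eq_mul, zero_add, mul_comm _ (p _)]
    by_cases h0 : a = 0
    · subst h0
      have := hasSum_single (f := fun n => p n * (0 : ℂ) ^ n) 0 (by simp +contextual)
      simpa [f] using this
    · simp only [f, if_neg h0]
      exact h a h0 (by simpa using ha)
  have hp0 : f 0 = 0 := by
    have h1 : Tendsto f (𝓝[≠] 0) (𝓝 (f 0)) := hf.continuousAt.tendsto.mono_left nhdsWithin_le_nhds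
    refine tendsto_nhds_unique h1 (tendsto_const_nhds.congr' ?_)
    filter_upwards [self_mem_nhdsWithin] with a ha
    exact (if_neg ha).symm
  have hf0 : ∀ᶠ z in 𝓝 (0 : ℂ), f z = 0 := Eventually.of_forall fun z => by
    by_cases hz : z = 0
    · rw [hz, hp0]
    · simp only [f, if_neg hz]
  rw [← hs, hf.locally_zero_iff.mp hf0]
  rfl

/-- The exponents of power series in two variables are pairs of natural numbers. -/
noncomputable def expoEquiv : ℕ × ℕ ≃ (Fin 2 →₀ ℕ) where
  toFun p := expo p.1 p.2
  invFun d := (d 0, d 1)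
  left_inv p := by simp
  right_inv d := expo_eta d

/-- A power series in two variables that sums to zero for all small nonzero values of the variables
vanishes. The lemma for one variable is applied to the first variable, then to the second. -/
theorem eq_zero_of_hasSum {c : MvPowerSeries (Fin 2) ℂ} {R : ℝ} (hR : 0 < R)
    (h : ∀ a b : ℂ, a ≠ 0 → b ≠ 0 → ‖a‖ < R → ‖b‖ < R →
      HasSum (fun d : Fin 2 →₀ ℕ => MvPowerSeries.coeff d c * a ^ d 0 * b ^ d 1) 0) : c = 0 := by
  have h' : ∀ a b : ℂ, a ≠ 0 → b ≠ 0 → ‖a‖ < R → ‖b‖ < R →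
      HasSum (fun p : ℕ × ℕ => MvPowerSeries.coeff (expo p.1 p.2) c * a ^ p.1 * b ^ p.2) 0 := by
    intro a b ha hb ha' hb'
    have := (Equiv.hasSum_iff expoEquiv).mpr (h a b ha hb ha' hb')
    simpa [Function.comp_def, expoEquiv] using this
  obtain ⟨a₀, ha₀, ha₀'⟩ : ∃ a : ℂ, a ≠ 0 ∧ ‖a‖ < R :=
    ⟨((R / 2 : ℝ) : ℂ), by simpa using hR.ne', by
      rw [Complex.norm_real, Real.norm_eq_abs, abs_of_pos (half_pos hR)]; linarith⟩
  have hsum : ∀ (b : ℂ), b ≠ 0 → ‖b‖ < R → ∀ n,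
      Summable fun m => MvPowerSeries.coeff (expo n m) c * b ^ m := by
    intro b hb hb' n
    have h1 := (h' a₀ b ha₀ hb ha₀' hb').summable.prod_factor n
    have h2 := h1.mul_left (a₀ ^ n)⁻¹
    refine h2.congr fun m => ?_
    have := pow_ne_zero n ha₀
    field_simp
  have key : ∀ (b : ℂ), b ≠ 0 → ‖b‖ < R → ∀ n,
      HasSum (fun m => MvPowerSeries.coeff (expo n m) c * b ^ m) 0 := by
    intro b hb hb' n
    have h0 := coeff_eq_zero_of_hasSum hR
      (p := fun n => ∑' m, MvPowerSeries.coeff (expo n m) c * b ^ m) (fun a ha ha' => by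
        refine (h' a b ha hb ha' hb').prod_fiberwise fun n => ?_
        refine ((hsum b hb hb' n).hasSum.mul_right (a ^ n)).congr_fun fun m => ?_
        ring) n
    exact h0 ▸ (hsum b hb hb' n).hasSum
  ext d
  rw [← expo_eta d]
  exact coeff_eq_zero_of_hasSum hR (p := fun m => MvPowerSeries.coeff (expo (d 0) m) c)
    (fun b hb hb' => key b hb hb' _) _

/-- An expansion of the zero function vanishes. For a fixed `τ` the series is continuous in `u` and
zero for generic `u`, hence for all `u` near which it converges, and every small pair `(z, p/z)`
with nonzero entries arises from some `(τ, u)`. -/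
theorem HasExpansion.eq_zero {L : ℂ} (hL : L ≠ 0) {f : UpperHalfPlane → ℂ → ℂ}
    (hf : ∀ τ u, f τ u = 0) {c : MvPowerSeries (Fin 2) ℂ} (h : HasExpansion L f c) : c = 0 := by
  obtain ⟨r, hr, h⟩ := h
  simp only [hf] at h
  set z : ℂ → ℂ := fun u => Complex.exp (2 * Real.pi * Complex.I * (u / L)) with hz
  set w : UpperHalfPlane → ℂ → ℂ :=
    fun τ u => Complex.exp (2 * Real.pi * Complex.I * (τ - u / L)) with hw
  have hgen : ∀ τ u, ∀ᶠ v in 𝓝[≠] u, ‖z v‖ < r → ‖w τ v‖ < r →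
      HasSum (fun d : Fin 2 →₀ ℕ => MvPowerSeries.coeff d c * z v ^ d 0 * w τ v ^ d 1) 0 := by
    intro τ u
    have := mem_codiscreteWithin_iff_forall_mem_nhdsNE.mp (h τ) u trivial
    rwa [Set.compl_univ, Set.union_empty] at this
  have hpi : (2 * Real.pi * Complex.I : ℂ) ≠ 0 := by simp [Real.pi_ne_zero]
  have hzc : Continuous z := by fun_prop
  have hwc : ∀ τ, Continuous (w τ) := fun τ => by fun_prop
  -- Every pair `(a, b)` in the punctured unit disc is `(z u, w τ u)` for `2πi u / L = log a` and
  -- `2πi τ = log a + log b`; the imaginary part of this `τ` is positive because `|ab| < 1`.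
  have hpair : ∀ a b : ℂ, a ≠ 0 → b ≠ 0 → ‖a‖ < 1 → ‖b‖ < 1 →
      ∃ τ u, z u = a ∧ w τ u = b := by
    intro a b ha hb ha1 hb1
    have him : 0 < ((Complex.log a + Complex.log b) / (2 * Real.pi * Complex.I)).im := by
      have e : (Complex.log a + Complex.log b) / (2 * Real.pi * Complex.I) =
          ((Complex.log a + Complex.log b) * -Complex.I) * ((2 * Real.pi : ℝ) : ℂ)⁻¹ := by
        have := Complex.I_sq
        push_cast
        field_simp
        linear_combination (Complex.log a + Complex.log b) * this
      rw [e, ← Complex.ofReal_inv, Complex.im_mul_ofReal]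
      have h1 : ((Complex.log a + Complex.log b) * -Complex.I).im =
          -(Real.log ‖a‖ + Real.log ‖b‖) := by
        simp [Complex.log_re]
      rw [h1]
      have h2 := Real.log_neg (norm_pos_iff.mpr ha) ha1
      have h3 := Real.log_neg (norm_pos_iff.mpr hb) hb1
      have : 0 < (2 * Real.pi)⁻¹ := by positivity
      exact mul_pos (by linarith) this
    refine ⟨⟨_, him⟩, L * Complex.log a / (2 * Real.pi * Complex.I), ?_, ?_⟩
    · have : 2 * Real.pi * Complex.I * (L * Complex.log a / (2 * Real.pi * Complex.I) / L) =
          Complex.log a := by field_simp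
      simp only [hz, this, Complex.exp_log ha]
    · have : 2 * Real.pi * Complex.I * ((Complex.log a + Complex.log b) /
          (2 * Real.pi * Complex.I) - L * Complex.log a / (2 * Real.pi * Complex.I) / L) =
          Complex.log b := by
        field_simp
        ring
      change Complex.exp (2 * Real.pi * Complex.I * ((Complex.log a + Complex.log b) /
          (2 * Real.pi * Complex.I) - L * Complex.log a / (2 * Real.pi * Complex.I) / L)) = b
      rw [this, Complex.exp_log hb]
  -- Convergence at one pair with both entries nonzero gives absolute convergence on a bidisc.
  obtain ⟨R, hR, hR1, hRr, hsum⟩ : ∃ R : ℝ, 0 < R ∧ R ≤ 1 ∧ R ≤ r ∧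
      Summable fun d : Fin 2 →₀ ℕ => ‖MvPowerSeries.coeff d c‖ * R ^ d 0 * R ^ d 1 := by
    have hs : 0 < min r 1 / 2 := by positivity
    have hs0 : ((min r 1 / 2 : ℝ) : ℂ) ≠ 0 := by exact_mod_cast hs.ne'
    have hsn : ‖((min r 1 / 2 : ℝ) : ℂ)‖ < min r 1 := by
      rw [Complex.norm_real, Real.norm_eq_abs, abs_of_pos hs]
      linarith
    obtain ⟨τ, u, hu, hwu⟩ := hpair _ _ hs0 hs0 (hsn.trans_le (min_le_right _ _))
      (hsn.trans_le (min_le_right _ _))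
    have hopen : ∀ᶠ v in 𝓝[≠] u, ‖z v‖ < min r 1 ∧ ‖w τ v‖ < min r 1 := by
      refine Filter.Eventually.filter_mono nhdsWithin_le_nhds (Filter.Eventually.and ?_ ?_)
      · exact hzc.norm.continuousAt.eventually_lt continuousAt_const (by rw [hu]; exact hsn)
      · exact (hwc τ).norm.continuousAt.eventually_lt continuousAt_const (by rw [hwu]; exact hsn)
    obtain ⟨v, ⟨hv1, hv2⟩, hv⟩ := (hopen.and (hgen τ u)).exists
    have hv := (hv (hv1.trans_le (min_le_left _ _)) (hv2.trans_le (min_le_left _ _))).summable.norm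
    refine ⟨min ‖z v‖ ‖w τ v‖, lt_min (by simp [hz]) (by simp [hw]),
      (min_le_left _ _).trans (hv1.trans_le (min_le_right _ _)).le,
      (min_le_left _ _).trans (hv1.trans_le (min_le_left _ _)).le, ?_⟩
    refine Summable.of_nonneg_of_le (fun d => by positivity) (fun d => ?_) hv
    rw [norm_mul, norm_mul, norm_pow, norm_pow]
    gcongr
    · exact min_le_left _ _
    · exact min_le_right _ _
  refine eq_zero_of_hasSum hR fun a b ha hb haR hbR => ?_
  obtain ⟨τ, u, rfl, rfl⟩ := hpair a b ha hb (haR.trans_le hR1) (hbR.trans_le hR1)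
  have hbound : ∀ d : Fin 2 →₀ ℕ, ∀ v ∈ {v | ‖z v‖ < R ∧ ‖w τ v‖ < R},
      ‖MvPowerSeries.coeff d c * z v ^ d 0 * w τ v ^ d 1‖ ≤
        ‖MvPowerSeries.coeff d c‖ * R ^ d 0 * R ^ d 1 := by
    rintro d v ⟨hv1, hv2⟩
    rw [norm_mul, norm_mul, norm_pow, norm_pow]
    gcongr
  have hU : IsOpen {v | ‖z v‖ < R ∧ ‖w τ v‖ < R} :=
    (isOpen_lt hzc.norm continuous_const).inter (isOpen_lt (hwc τ).norm continuous_const)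
  -- The sum is continuous near `u` and vanishes at generic points near `u`, hence it vanishes at
  -- `u`.
  have hcont : ContinuousOn (fun v => ∑' d : Fin 2 →₀ ℕ,
      MvPowerSeries.coeff d c * z v ^ d 0 * w τ v ^ d 1) {v | ‖z v‖ < R ∧ ‖w τ v‖ < R} :=
    continuousOn_tsum (fun d => ((continuous_const.mul (hzc.pow _)).mul
      ((hwc τ).pow _)).continuousOn) hsum hbound
  have hu : u ∈ {v | ‖z v‖ < R ∧ ‖w τ v‖ < R} := ⟨haR, hbR⟩
  have hlim := (hcont.continuousAt (hU.mem_nhds hu)).tendsto.mono_left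
    (nhdsWithin_le_nhds (s := {u}ᶜ))
  have hzero : ∑' d : Fin 2 →₀ ℕ, MvPowerSeries.coeff d c * z u ^ d 0 * w τ u ^ d 1 = 0 := by
    refine tendsto_nhds_unique hlim (tendsto_const_nhds.congr' ?_)
    filter_upwards [hgen τ u,
      nhdsWithin_le_nhds (hU.mem_nhds hu)] with v hv hvU
    exact (hv (hvU.1.trans_le hRr) (hvU.2.trans_le hRr)).tsum_eq.symm
  rw [← hzero]
  exact (Summable.of_norm_bounded hsum fun d => hbound d u hu).hasSum

end Expansion

/-! ### Coefficients that preserve the degree -/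

section Graded

variable {π : Type*} [Groupoid π] {X : Type*}

/-- The matrix `c` preserves the degree, as a map `V ⊗ V' → V' ⊗ V` where the basis vectors of `V`
and `V'` have degrees `d` and `d'`; only the end points of the degrees are recorded. -/
def IsGradedCoeff {B : Type*} [Zero B] (d d' : X → Arr π) (c : Coeff X B) : Prop :=
  ∀ i j m n, c i j m n ≠ 0 → (d i).tgt = (d' j).src ∧ (d' m).tgt = (d n).src ∧
    (d i).src = (d' m).src ∧ (d' j).tgt = (d n).tgt

/-- The coefficient matrices of an expansion preserve the degree if all values of the expanded
function do: the remaining entries are expansions of the zero function. -/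
theorem IsGradedCoeff.of_hasExpansion {d d' : X → Arr π} {L : ℂ} (hL : L ≠ 0)
    {R : UpperHalfPlane → ℂ → Coeff X ℂ} (hR : ∀ τ u, IsGradedCoeff d d' (R τ u))
    {c : Coeff X (MvPowerSeries (Fin 2) ℂ)}
    (hc : ∀ i j k l, HasExpansion L (fun τ u => R τ u i j k l) (c i j k l)) :
    IsGradedCoeff d d' c := by
  intro i j m n h
  by_contra hn
  refine h ((hc i j m n).eq_zero hL fun τ u => ?_)
  by_contra hne
  exact hn (hR τ u i j m n hne)

variable [Fintype X]

/-- The degree of a tensor product of basis vectors is the composition of their degrees, so equality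
of degrees compares only the outer end points. -/
theorem IsRMatrix.isGradedCoeff {deg : X → Arr π} {R : ℂ → Coeff X ℂ} (hR : IsRMatrix deg R)
    (u : ℂ) : IsGradedCoeff deg deg (R u) := by
  intro i j m n h
  obtain ⟨v, h₁, h₂⟩ := hR.graded u i j m n h
  have key : ∀ {f g v : Arr π}, Arr.IsComp f g v →
      f.tgt = g.src ∧ v.src = f.src ∧ v.tgt = g.tgt := by
    rintro _ _ _ ⟨f, g⟩
    exact ⟨rfl, rfl, rfl⟩
  obtain ⟨a, b, c⟩ := key h₁
  obtain ⟨a', b', c'⟩ := key h₂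
  exact ⟨a, a', b.symm.trans b', c.symm.trans c'⟩

namespace Pairing

variable {deg : X → Arr π} (P : Pairing deg)

/-- The map `σ` preserves the degree, because its matrix is inverse to a matrix that does. -/
theorem sg_graded (i j : X) (h : P.sg i j ≠ 0) : deg i = deg j := by
  let w : Matrix X X ℂ := Matrix.of P.om
  let s : Matrix X X ℂ := Matrix.of P.sg
  have hsw : s * w = 1 := by
    ext i j
    simpa [s, w, Matrix.mul_apply, Matrix.one_apply] using P.zigzag_dual i j
  have hws : w * s = 1 := by
    ext i j
    simpa [s, w, Matrix.mul_apply, Matrix.one_apply] using P.zigzag i j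
  -- The projection to the basis vectors of degree `deg j` commutes with the matrix of `ω`, and
  -- therefore with its inverse.
  let D : Matrix X X ℂ := Matrix.diagonal fun k => if deg k = deg j then 1 else 0
  have hD : w * D = D * w := by
    ext a b
    simp only [D, Matrix.mul_diagonal, Matrix.diagonal_mul, w, Matrix.of_apply]
    by_cases h0 : P.om a b = 0
    · simp [h0]
    · rw [P.graded a b h0, mul_comm]
  have hD' : s * D = D * s := by
    calc s * D = s * D * (w * s) := by rw [hws, mul_one]
      _ = s * (D * w) * s := by simp only [mul_assoc]
      _ = s * (w * D) * s := by rw [hD]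
      _ = (s * w) * D * s := by simp only [mul_assoc]
      _ = D * s := by rw [hsw, one_mul]
  have hij := congrFun (congrFun hD' i) j
  simp only [D, Matrix.mul_diagonal, Matrix.diagonal_mul, s, Matrix.of_apply, if_true,
    mul_one] at hij
  by_contra hne
  rw [if_neg hne, zero_mul] at hij
  exact h hij

theorem omStar_graded (i j : X) (h : P.omStar i j ≠ 0) : deg i = deg j :=
  (P.graded j i (right_ne_zero_of_mul h)).symm

theorem sgStar_graded (i j : X) (h : P.sgStar i j ≠ 0) : deg i = deg j :=
  (P.sg_graded j i (right_ne_zero_of_mul h)).symm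

variable (lam : ℂ) {R : ℂ → Coeff X ℂ} (hR : ∀ u, IsGradedCoeff deg deg (R u))
include hR

theorem rotVsV_graded (u : ℂ) :
    IsGradedCoeff (fun i => (deg i).inv) deg (P.rotVsV lam R u) := by
  intro i j m n h
  obtain ⟨a, -, h⟩ := Finset.exists_ne_zero_of_sum_ne_zero h
  obtain ⟨b, -, h⟩ := Finset.exists_ne_zero_of_sum_ne_zero h
  have h₁ := P.omStar_graded i a (left_ne_zero_of_mul (left_ne_zero_of_mul h))
  have h₂ := P.sgStar_graded b n (right_ne_zero_of_mul h)
  obtain ⟨h₃, h₄, h₅, h₆⟩ := hR _ _ _ _ _ (right_ne_zero_of_mul (left_ne_zero_of_mul h))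
  rw [← h₁] at h₄ h₅
  rw [h₂] at h₃ h₆
  exact ⟨h₅.symm, h₆.symm, h₄, h₃⟩

theorem rotVVs_graded (u : ℂ) :
    IsGradedCoeff deg (fun i => (deg i).inv) (P.rotVVs lam R u) := by
  intro i j m n h
  obtain ⟨a, -, h⟩ := Finset.exists_ne_zero_of_sum_ne_zero h
  obtain ⟨b, -, h⟩ := Finset.exists_ne_zero_of_sum_ne_zero h
  have h₁ := P.sg_graded m a (left_ne_zero_of_mul (left_ne_zero_of_mul h))
  have h₂ := P.graded b j (right_ne_zero_of_mul h)
  obtain ⟨h₃, h₄, h₅, h₆⟩ := hR _ _ _ _ _ (right_ne_zero_of_mul (left_ne_zero_of_mul h))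
  rw [← h₁] at h₃ h₅
  rw [h₂] at h₄ h₆
  exact ⟨h₆, h₅, h₃.symm, h₄.symm⟩

theorem rotVsVs_graded (u : ℂ) :
    IsGradedCoeff (fun i => (deg i).inv) (fun i => (deg i).inv) (P.rotVsVs lam R u) := by
  intro i j m n h
  obtain ⟨a, -, h⟩ := Finset.exists_ne_zero_of_sum_ne_zero h
  obtain ⟨b, -, h⟩ := Finset.exists_ne_zero_of_sum_ne_zero h
  have h₁ := P.sg_graded m a (left_ne_zero_of_mul (left_ne_zero_of_mul h))
  have h₂ := P.graded b j (right_ne_zero_of_mul h)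
  obtain ⟨h₃, h₄, h₅, h₆⟩ :=
    P.rotVVs_graded lam hR _ _ _ _ _ (right_ne_zero_of_mul (left_ne_zero_of_mul h))
  rw [← h₁] at h₃ h₅
  rw [h₂] at h₄ h₆
  exact ⟨h₆, h₅, h₃.symm, h₄.symm⟩

end Pairing

end Graded

/-! ### Series with coefficients in a tensor product -/

section TensorSeries

open MvPowerSeries (coeff C)

variable {σ : Type*} (K : Type*) [CommRing K] {A A' B B' D : Type*} [Ring A] [Algebra K A]
  [Ring A'] [Algebra K A'] [Ring B] [Algebra K B] [Ring B'] [Algebra K B'] [Ring D] [Algebra K D]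

variable (A B) in
/-- The ring homomorphism `x ↦ x ⊗ 1` on the coefficients of power series. -/
noncomputable def serL : MvPowerSeries σ A →+* MvPowerSeries σ (A ⊗[K] B) :=
  MvPowerSeries.map
    (Algebra.TensorProduct.includeLeft (R := K) (S := K) (A := A) (B := B)).toRingHom

variable (A B) in
/-- The ring homomorphism `y ↦ 1 ⊗ y` on the coefficients of power series. -/
noncomputable def serR : MvPowerSeries σ B →+* MvPowerSeries σ (A ⊗[K] B) :=
  MvPowerSeries.map (Algebra.TensorProduct.includeRight (R := K) (A := A) (B := B)).toRingHom

theorem serL_apply (x : MvPowerSeries σ A) (d) : serL K A B x d = x d ⊗ₜ[K] 1 := rfl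

theorem serR_apply (y : MvPowerSeries σ B) (d) : serR K A B y d = 1 ⊗ₜ[K] y d := rfl

theorem serL_C (x : A) : serL K A B (C x : MvPowerSeries σ A) = C (x ⊗ₜ[K] 1) :=
  MvPowerSeries.map_C _ _

theorem serR_C (y : B) : serR K A B (C y : MvPowerSeries σ B) = C (1 ⊗ₜ[K] y) :=
  MvPowerSeries.map_C _ _

theorem commute_serL_serR (x : MvPowerSeries σ A) (y : MvPowerSeries σ B) :
    Commute (serL K A B x) (serR K A B y) :=
  commute_of_coeff fun a b => by
    rw [serL_apply, serR_apply, Commute, SemiconjBy, Algebra.TensorProduct.tmul_mul_tmul,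
      Algebra.TensorProduct.tmul_mul_tmul, one_mul, one_mul, mul_one, mul_one]

/-- The series `f(u) ⊗ f'(u)` for coefficients in two algebras. -/
noncomputable def tser (x : MvPowerSeries σ A) (y : MvPowerSeries σ B) :
    MvPowerSeries σ (A ⊗[K] B) := serL K A B x * serR K A B y

theorem tensorSer_eq (x y : MvPowerSeries (Fin 2) A) : tensorSer K x y = tser K x y := rfl

theorem coeff_tser (x : MvPowerSeries σ A) (y : MvPowerSeries σ B) (d : σ →₀ ℕ) :
    coeff d (tser K x y) =
      ∑ p ∈ Finset.HasAntidiagonal.antidiagonal d, coeff p.1 x ⊗ₜ[K] coeff p.2 y := by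
  rw [tser, MvPowerSeries.coeff_mul]
  refine Finset.sum_congr rfl fun p _ => ?_
  simp only [MvPowerSeries.coeff_apply]
  rw [serL_apply, serR_apply, Algebra.TensorProduct.tmul_mul_tmul, one_mul, mul_one]

theorem tser_mul (x x' : MvPowerSeries σ A) (y y' : MvPowerSeries σ B) :
    tser K x y * tser K x' y' = tser K (x * x') (y * y') := by
  rw [tser, tser, tser, map_mul, map_mul, mul_assoc, mul_assoc,
    ← mul_assoc (serR K A B y), ← (commute_serL_serR K x' y).eq]
  simp only [mul_assoc]

theorem tser_C (x : A) (y : B) : tser K (C x : MvPowerSeries σ A) (C y) = C (x ⊗ₜ[K] y) := by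
  rw [tser, serL_C, serR_C, ← map_mul, Algebra.TensorProduct.tmul_mul_tmul, one_mul, mul_one]

theorem tser_sum_left {ι : Type*} (s : Finset ι) (x : ι → MvPowerSeries σ A)
    (y : MvPowerSeries σ B) : tser K (∑ i ∈ s, x i) y = ∑ i ∈ s, tser K (x i) y := by
  simp only [tser, map_sum, Finset.sum_mul]

theorem tser_sum_right {ι : Type*} (s : Finset ι) (x : MvPowerSeries σ A)
    (y : ι → MvPowerSeries σ B) : tser K x (∑ i ∈ s, y i) = ∑ i ∈ s, tser K x (y i) := by
  simp only [tser, map_sum, Finset.mul_sum]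

theorem pmap_map_tser (f : A →ₗ[K] A') (g : B →ₗ[K] B') (x : MvPowerSeries σ A)
    (y : MvPowerSeries σ B) :
    pmap (TensorProduct.map f g) (tser K x y) = tser K (pmap f x) (pmap g y) := by
  ext d
  rw [coeff_pmap, coeff_tser, coeff_tser, map_sum]
  rfl

theorem pmap_assoc_tser (x : MvPowerSeries σ A) (y : MvPowerSeries σ B) (z : MvPowerSeries σ D) :
    pmap (Algebra.TensorProduct.assoc K K K A B D) (tser K (tser K x y) z) =
      tser K x (tser K y z) := by
  have h₁ : ∀ x : MvPowerSeries σ A, pmap (Algebra.TensorProduct.assoc K K K A B D)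
      (serL K (A ⊗[K] B) D (serL K A B x)) = serL K A (B ⊗[K] D) x := fun _ => rfl
  have h₂ : ∀ y : MvPowerSeries σ B, pmap (Algebra.TensorProduct.assoc K K K A B D)
      (serL K (A ⊗[K] B) D (serR K A B y)) = serR K A (B ⊗[K] D) (serL K B D y) := fun _ => rfl
  have h₃ : ∀ z : MvPowerSeries σ D, pmap (Algebra.TensorProduct.assoc K K K A B D)
      (serR K (A ⊗[K] B) D z) = serR K A (B ⊗[K] D) (serR K B D z) := fun _ => rfl
  simp only [tser, map_mul, pmap_mul, h₁, h₂, h₃, mul_assoc]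

end TensorSeries

/-! ### The matrix coproduct -/

section Coproduct

open MvPowerSeries (coeff C)

variable {π : Type*} [Groupoid π] [Fintype π] [∀ a b : π, Fintype (a ⟶ b)] {X : Type*} [Fintype X]
  (K : Type*) [CommRing K] {A : Type*} [Ring A] [Algebra K A]

/-- The unit of `A ⊗_h A`, the sum of the `e g ⊗ e h` over all composable pairs. -/
noncomputable def copE (e : Arr π → A) : A ⊗[K] A := ∑ b, tgtU e b ⊗ₜ[K] srcU e b

/-- The component at `f` of the unit of `A ⊗_h A`. -/
noncomputable def copUnit (e : Arr π → A) (f : Arr π) : A ⊗[K] A :=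
  ∑ g : Arr π, ∑ h : Arr π, if Arr.IsComp g h f then e g ⊗ₜ[K] e h else 0

/-- The matrix `∑_k F_i^k(u) ⊗ F_k^j(u)`. -/
noncomputable def copMat (F : Matrix X X (MvPowerSeries (Fin 2) A)) :
    Matrix X X (MvPowerSeries (Fin 2) (A ⊗[K] A)) :=
  F.map (serL K A A) * F.map (serR K A A)

/-- The images of the generating series under the coproduct. -/
noncomputable def RepData.cop (D : RepData π X A) : RepData π X (A ⊗[K] A) where
  E := copE K D.e
  e := copUnit K D.e
  T := copMat K D.T
  Ts := copMat K D.Ts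
  xi s := C (copE K D.e) * tser K (D.xi s) (D.xi s)

theorem copMat_apply (F : Matrix X X (MvPowerSeries (Fin 2) A)) (i j : X) :
    copMat K F i j = ∑ k, tser K (F i k) (F k j) := Matrix.mul_apply

variable {E : A} {e : Arr π → A}

/-- The unit of `A ⊗_h A` is the sum over the pairs of composable arrows. -/
theorem copE_eq_sum : copE K e =
    ∑ g : Arr π, ∑ h : Arr π, if g.tgt = h.src then e g ⊗ₜ[K] e h else 0 := by
  have : ∀ b, tgtU e b ⊗ₜ[K] srcU e b = ∑ g : Arr π, ∑ h : Arr π,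
      if g.tgt = b ∧ h.src = b then e g ⊗ₜ[K] e h else 0 := fun b => by
    simp only [tgtU, srcU, TensorProduct.sum_tmul, TensorProduct.tmul_sum]
    rw [Finset.sum_comm]
    refine Finset.sum_congr rfl fun g _ => Finset.sum_congr rfl fun h _ => ?_
    by_cases h₁ : g.tgt = b <;> by_cases h₂ : h.src = b <;> simp [h₁, h₂]
  simp only [copE, this]
  rw [Finset.sum_comm]
  refine Finset.sum_congr rfl fun g _ => ?_
  rw [Finset.sum_comm]
  refine Finset.sum_congr rfl fun h _ => ?_
  rw [Finset.sum_eq_single g.tgt]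
  · simp only [true_and, eq_comm]
  · intro b _ hb
    exact if_neg fun h' => hb h'.1.symm
  · simp

theorem copUnit_mul (f : Arr π) (x : A ⊗[K] A) : copUnit K e f * x =
    ∑ g : Arr π, ∑ k : Arr π, if Arr.IsComp g k f then (e g ⊗ₜ[K] e k) * x else 0 := by
  simp only [copUnit, Finset.sum_mul, ite_mul, zero_mul]

/-- Summing `copUnit` over the arrows with given ends is summing over the composable pairs with
these outer ends. -/
theorem sum_copUnit [Quiver.IsThin π] (p : π → π → Prop) :
    (∑ f : Arr π, if p f.src f.tgt then copUnit K e f else 0) =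
      ∑ g : Arr π, ∑ h : Arr π, if g.tgt = h.src ∧ p g.src h.tgt then e g ⊗ₜ[K] e h else 0 := by
  simp only [copUnit]
  have : ∀ f : Arr π, (if p f.src f.tgt then
      ∑ g : Arr π, ∑ h : Arr π, (if Arr.IsComp g h f then e g ⊗ₜ[K] e h else 0) else 0) =
      ∑ g : Arr π, ∑ h : Arr π,
        if Arr.IsComp g h f ∧ p f.src f.tgt then e g ⊗ₜ[K] e h else 0 := fun f => by
    by_cases hp : p f.src f.tgt <;> simp [hp]
  simp only [this]
  rw [Finset.sum_comm]
  refine Finset.sum_congr rfl fun g _ => ?_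
  rw [Finset.sum_comm]
  refine Finset.sum_congr rfl fun h _ => ?_
  simp only [Arr.isComp_iff]
  by_cases hgh : g.tgt = h.src
  · obtain ⟨a, b, g⟩ := g
    obtain ⟨b', c, h⟩ := h
    change b = b' at hgh
    subst hgh
    rw [Finset.sum_eq_single ⟨a, c, g ≫ h⟩]
    · simp
    · intro f _ hf
      exact if_neg fun h' => hf (Arr.ext_of_thin h'.1.2.1 h'.1.2.2)
    · simp
  · simp [hgh]

section Thin

variable (h : IsUnits E e)

include h in
theorem tmul_mul_copUnit (g k f : Arr π) : (e g ⊗ₜ[K] e k) * copUnit K e f =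
    if Arr.IsComp g k f then e g ⊗ₜ[K] e k else 0 := by
  simp only [copUnit, Finset.mul_sum, mul_ite, mul_zero, Algebra.TensorProduct.tmul_mul_tmul]
  rw [Finset.sum_eq_single g, Finset.sum_eq_single k]
  · rw [h.mul_self, h.mul_self]
  · intro k' _ hk
    rw [h.orth k k' hk.symm, tmul_zero, ite_self]
  · simp
  · intro g' _ hg
    refine Finset.sum_eq_zero fun k' _ => ?_
    rw [h.orth g g' hg.symm, zero_tmul, ite_self]
  · simp

include h in
theorem commute_copE_srcU (a : π) : Commute (copE K e) (srcU e a ⊗ₜ[K] 1) := by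
  refine Commute.sum_left _ _ _ fun b _ => ?_
  rw [Commute, SemiconjBy, Algebra.TensorProduct.tmul_mul_tmul,
    Algebra.TensorProduct.tmul_mul_tmul, mul_one, one_mul, (h.commute_srcU_tgtU a b).eq]

include h in
theorem commute_copE_tgtU (a : π) : Commute (copE K e) (1 ⊗ₜ[K] tgtU e a) := by
  refine Commute.sum_left _ _ _ fun b _ => ?_
  rw [Commute, SemiconjBy, Algebra.TensorProduct.tmul_mul_tmul,
    Algebra.TensorProduct.tmul_mul_tmul, mul_one, one_mul, (h.commute_srcU_tgtU b a).eq]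

variable [Quiver.IsThin π]

theorem sum_copUnit_eq : ∑ f : Arr π, copUnit K e f = copE K e := by
  have := sum_copUnit K (e := e) fun _ _ => True
  simp only [if_true, and_true] at this
  rw [this, copE_eq_sum]

include h

theorem isUnits_copUnit : IsUnits (copE K e) (copUnit K e) where
  mul_self f := by
    rw [copUnit_mul]
    simp only [tmul_mul_copUnit K h]
    conv_rhs => rw [copUnit]
    exact Finset.sum_congr rfl fun g _ => Finset.sum_congr rfl fun k _ => by split_ifs <;> rfl
  orth f f' hf := by
    rw [copUnit_mul]
    simp only [tmul_mul_copUnit K h]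
    refine Finset.sum_eq_zero fun g _ => Finset.sum_eq_zero fun k _ => ?_
    split_ifs with h₁ h₂
    · rw [Arr.isComp_iff] at h₁ h₂
      exact absurd (Arr.ext_of_thin (h₁.2.1.trans h₂.2.1.symm) (h₁.2.2.trans h₂.2.2.symm)) hf
    · rfl
    · rfl
  sum := sum_copUnit_eq K

theorem srcU_copUnit (a : π) : srcU (copUnit K e) a = (srcU e a ⊗ₜ[K] 1) * copE K e := by
  rw [srcU, sum_copUnit K fun b _ => b = a, copE_eq_sum]
  simp only [Finset.mul_sum, mul_ite, mul_zero, Algebra.TensorProduct.tmul_mul_tmul, h.srcU_mul,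
    one_mul]
  refine Finset.sum_congr rfl fun g _ => Finset.sum_congr rfl fun k _ => ?_
  by_cases h₁ : g.src = a <;> simp [h₁]

theorem tgtU_copUnit (a : π) : tgtU (copUnit K e) a = (1 ⊗ₜ[K] tgtU e a) * copE K e := by
  rw [tgtU, sum_copUnit K fun _ b => b = a, copE_eq_sum]
  simp only [Finset.mul_sum, mul_ite, mul_zero, Algebra.TensorProduct.tmul_mul_tmul, h.tgtU_mul,
    one_mul]
  refine Finset.sum_congr rfl fun g _ => Finset.sum_congr rfl fun k _ => ?_
  by_cases h₁ : k.tgt = a <;> simp [h₁]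

end Thin

section CopE

variable {σ : Type*}

theorem C_copE_mul_tser (x y : MvPowerSeries σ A) : C (copE K e) * tser K x y =
    ∑ b, tser K (C (tgtU e b) * x) (C (srcU e b) * y) := by
  rw [copE, map_sum, Finset.sum_mul]
  simp only [← tser_C, tser_mul]

theorem tser_mul_C_copE (x y : MvPowerSeries σ A) : tser K x y * C (copE K e) =
    ∑ b, tser K (x * C (tgtU e b)) (y * C (srcU e b)) := by
  rw [copE, map_sum, Finset.mul_sum]
  simp only [← tser_C, tser_mul]

variable (h : IsUnits E e)
include h

/-- If `y` lies over the single source `c`, only the summand of `copE` at `c` acts on `x ⊗ y`. -/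
theorem copE_mul_tser_of_right {x y : MvPowerSeries σ A} {c : π} (hy : C (srcU e c) * y = y) :
    C (copE K e) * tser K x y = tser K (C (tgtU e c) * x) y := by
  rw [C_copE_mul_tser, Finset.sum_eq_single c, hy]
  · intro b _ hb
    rw [← hy, ← mul_assoc, ← map_mul, h.srcU_mul_srcU, if_neg hb, map_zero, zero_mul, tser,
      map_zero, mul_zero]
  · simp

/-- If `x` lies over the single target `c`, only the summand of `copE` at `c` acts on `x ⊗ y`. -/
theorem tser_mul_copE_of_left {x y : MvPowerSeries σ A} {c : π} (hx : x * C (tgtU e c) = x) :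
    tser K x y * C (copE K e) = tser K x (y * C (srcU e c)) := by
  rw [tser_mul_C_copE, Finset.sum_eq_single c, hx]
  · intro b _ hb
    rw [← hx, mul_assoc, ← map_mul, h.tgtU_mul_tgtU, if_neg hb.symm, map_zero, mul_zero, tser,
      map_zero, zero_mul]
  · simp

end CopE

/-- The summand of `copMat F i j` at `k` is a tensor product of horizontally composable squares,
with vertical sides `d i`, `d k` and `d k`, `d j`. -/
theorem isHomog_copMat [Quiver.IsThin π] (h : IsUnits E e) {d : X → Arr π}
    {F : Matrix X X (MvPowerSeries (Fin 2) A)} (hF : IsHomog e d F) :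
    IsHomog (copUnit K e) d (copMat K F) := by
  have hl : ∀ i j k, C (copE K e) * tser K (F i k) (F k j) = tser K (F i k) (F k j) :=
    fun i j k => by rw [copE_mul_tser_of_right K h (hF.src_mul k j), hF.tgt_mul]
  have hr : ∀ i j k, tser K (F i k) (F k j) * C (copE K e) = tser K (F i k) (F k j) :=
    fun i j k => by rw [tser_mul_copE_of_left K h (hF.mul_tgt i k), hF.mul_src]
  refine ⟨fun i j => ?_, fun i j => ?_, fun i j => ?_, fun i j => ?_⟩
  · rw [srcU_copUnit K h, copMat_apply, Finset.mul_sum]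
    refine Finset.sum_congr rfl fun k _ => ?_
    rw [map_mul, mul_assoc, hl, ← tser_C, tser_mul, hF.src_mul, map_one, one_mul]
  · rw [tgtU_copUnit K h, copMat_apply, Finset.mul_sum]
    refine Finset.sum_congr rfl fun k _ => ?_
    rw [map_mul, mul_assoc, hl, ← tser_C, tser_mul, hF.tgt_mul, map_one, one_mul]
  · rw [srcU_copUnit K h, ← (commute_copE_srcU K h _).eq, copMat_apply, Finset.sum_mul]
    refine Finset.sum_congr rfl fun k _ => ?_
    rw [map_mul, ← mul_assoc, hr, ← tser_C, tser_mul, hF.mul_src, map_one, mul_one]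
  · rw [tgtU_copUnit K h, ← (commute_copE_tgtU K h _).eq, copMat_apply, Finset.sum_mul]
    refine Finset.sum_congr rfl fun k _ => ?_
    rw [map_mul, ← mul_assoc, hr, ← tser_C, tser_mul, hF.mul_tgt, map_one, mul_one]

theorem at1_tser (x y : MvPowerSeries (Fin 2) A) :
    at1 (tser K x y) = tser K (at1 x) (at1 y) := by
  rw [tser, at1_mul, tser]
  congr 1
  · exact at1_pmap (Algebra.TensorProduct.includeLeft (R := K) (S := K) (A := A) (B := A))
      (map_zero _) x
  · exact at1_pmap (Algebra.TensorProduct.includeRight (R := K) (A := A) (B := A))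
      (map_zero _) y

theorem at2_tser (x y : MvPowerSeries (Fin 2) A) :
    at2 (tser K x y) = tser K (at2 x) (at2 y) := by
  rw [tser, at2_mul, tser]
  congr 1
  · exact at2_pmap (Algebra.TensorProduct.includeLeft (R := K) (S := K) (A := A) (B := A))
      (map_zero _) x
  · exact at2_pmap (Algebra.TensorProduct.includeRight (R := K) (A := A) (B := A))
      (map_zero _) y

/-- The two tensor factors commute, so the tensor product of two matrix coproducts is a product of a
matrix over the first factor and a matrix over the second one. -/
theorem pairMat_copMat (F F' : Matrix X X (MvPowerSeries (Fin 2) A)) :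
    pairMat (copMat K F) (copMat K F') =
      (pairMat F F').map (serL K A A) * (pairMat F F').map (serR K A A) := by
  ext1 p q
  simp only [pairMat, Matrix.of_apply, copMat_apply, at1_sum, at2_sum, Finset.sum_mul_sum, at1_tser,
    at2_tser, tser_mul, Matrix.mul_apply, Matrix.map_apply, Fintype.sum_prod_type]
  rfl

theorem pairMat'_copMat (F F' : Matrix X X (MvPowerSeries (Fin 2) A)) :
    pairMat' (copMat K F) (copMat K F') =
      (pairMat' F F').map (serL K A A) * (pairMat' F F').map (serR K A A) := by
  ext1 p q
  simp only [pairMat', Matrix.of_apply, copMat_apply, at1_sum, at2_sum, Finset.sum_mul_sum,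
    at1_tser, at2_tser, tser_mul, Matrix.mul_apply, Matrix.map_apply, Fintype.sum_prod_type]
  rfl

variable [Algebra ℂ K]

theorem includeLeft_scal (c : ℂ) : scal K A c ⊗ₜ[K] (1 : A) = scal K (A ⊗[K] A) c := rfl

theorem includeRight_scal (c : ℂ) : (1 : A) ⊗ₜ[K] scal K A c = scal K (A ⊗[K] A) c :=
  (Algebra.TensorProduct.includeRight (R := K) (A := A) (B := A)).commutes _

theorem map_serL_coeffMat {X : Type*} (c : Coeff X (MvPowerSeries (Fin 2) ℂ)) :
    (coeffMat K c).map (serL K A A) = coeffMat K c := by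
  ext1 p q
  funext d
  change pmap (Algebra.TensorProduct.includeLeft (R := K) (S := K) (A := A) (B := A)) (at12 _) d = _
  rw [← at12_pmap _ (map_zero _)]
  rfl

theorem map_serR_coeffMat {X : Type*} (c : Coeff X (MvPowerSeries (Fin 2) ℂ)) :
    (coeffMat K c).map (serR K A A) = coeffMat K c := by
  ext1 p q
  funext d
  change pmap (Algebra.TensorProduct.includeRight (R := K) (A := A) (B := A)) (at12 _) d = _
  rw [← at12_pmap _ (map_zero _)]
  refine congrFun (congrArg at12 (funext fun a => ?_)) d
  exact includeRight_scal K (c p.1 p.2 q.1 q.2 a)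

/-- Exchange relations are stable under the matrix coproduct. -/
theorem exchange_copMat {c : Coeff X (MvPowerSeries (Fin 2) ℂ)}
    {F F' : Matrix X X (MvPowerSeries (Fin 2) A)}
    (h : pairMat F F' * coeffMat K c = coeffMat K c * pairMat' F F') :
    pairMat (copMat K F) (copMat K F') * coeffMat K c =
      coeffMat K c * pairMat' (copMat K F) (copMat K F') := by
  rw [pairMat_copMat, pairMat'_copMat, Matrix.mul_assoc]
  conv_lhs => rw [← map_serR_coeffMat, ← Matrix.map_mul, h, Matrix.map_mul, map_serR_coeffMat,
    ← map_serL_coeffMat, ← Matrix.mul_assoc, ← Matrix.map_mul, h, Matrix.map_mul,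
    map_serL_coeffMat, Matrix.mul_assoc]

theorem shift_tser (L μ : ℂ) (x y : MvPowerSeries (Fin 2) A) :
    shift K L μ (tser K x y) = tser K (shift K L μ x) (shift K L μ y) := by
  rw [tser, shift_mul, tser]
  congr 1
  exact shift_pmap K L (Algebra.TensorProduct.includeRight (R := K) (A := A) (B := A)) μ y

theorem map_shift_copMat (L μ : ℂ) (F : Matrix X X (MvPowerSeries (Fin 2) A)) :
    (copMat K F).map (shift K L μ) = copMat K (F.map (shift K L μ)) := by
  ext1 i j
  rw [Matrix.map_apply, copMat_apply, copMat_apply, shift_sum]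
  exact Finset.sum_congr rfl fun k _ => shift_tser K L μ _ _

theorem C_scal_mul_tser_left {σ : Type*} (c : ℂ) (x y : MvPowerSeries σ A) :
    C (scal K _ c) * tser K x y = tser K (C (scal K A c) * x) y := by
  rw [← includeLeft_scal, ← tser_C, tser_mul, map_one, one_mul]

theorem C_scal_mul_tser_right {σ : Type*} (c : ℂ) (x y : MvPowerSeries σ A) :
    C (scal K _ c) * tser K x y = tser K x (C (scal K A c) * y) := by
  rw [← includeRight_scal, ← tser_C, tser_mul, map_one, one_mul]

variable [Quiver.IsThin π] (h : IsUnits E e) (w : X → X → ℂ) (p : X → π)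
  {M N : Matrix X X (MvPowerSeries (Fin 2) A)} {z : MvPowerSeries (Fin 2) A}
  (hz : ∀ x, Commute z x)
include h hz

/-- The inversion relations that involve `ω` and `ω^*` are stable under the matrix coproduct. -/
theorem inversion_copMat (hp : ∀ i j k, w i j ≠ 0 → N k j * C (tgtU e (p i)) = N k j)
    (hMN : M * scalMat K w * N.transpose =
      Matrix.of fun i j => C (scal K A (w i j)) * (C (srcU e (p i)) * z)) :
    copMat K M * scalMat K w * (copMat K N).transpose = Matrix.of fun i j =>
      C (scal K _ (w i j)) * (C (srcU (copUnit K e) (p i)) * (C (copE K e) * tser K z z)) := by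
  have hMN' : ∀ i j, ∑ k, ∑ l, C (scal K A (w k l)) * (M i k * N j l) =
      C (scal K A (w i j)) * (C (srcU e (p i)) * z) := fun i j => by
    have := congrFun (congrFun hMN i) j
    rwa [mul_scalMat_mul_apply] at this
  ext1 i j
  rw [mul_scalMat_mul_apply]
  simp only [Matrix.transpose_apply, Matrix.of_apply, copMat_apply, Finset.sum_mul_sum, tser_mul]
  simp only [Finset.mul_sum, C_scal_mul_tser_right]
  -- The inversion relation is applied in the second tensor factor, where it leaves a part of the
  -- unit that may be replaced by `copE`, and then in the first one.
  calc _ = ∑ a, ∑ b, ∑ k, ∑ l,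
        tser K (M i a * N j b) (C (scal K A (w k l)) * (M a k * N b l)) := by
        refine (Finset.sum_congr rfl fun k _ => (Finset.sum_comm)).trans ?_
        rw [Finset.sum_comm]
        refine Finset.sum_congr rfl fun a _ => ?_
        refine (Finset.sum_congr rfl fun k _ => (Finset.sum_comm)).trans ?_
        rw [Finset.sum_comm]
    _ = ∑ a, ∑ b, tser K (C (scal K A (w a b)) * (M i a * N j b)) 1 *
          (C (copE K e) * tser K 1 z) := by
        refine Finset.sum_congr rfl fun a _ => Finset.sum_congr rfl fun b _ => ?_
        simp only [← tser_sum_right]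
        rw [hMN', ← C_scal_mul_tser_right, C_scal_mul_tser_left]
        by_cases hw : w a b = 0
        · simp only [hw, map_zero, zero_mul, tser]
        · rw [← mul_assoc (tser K _ 1), tser_mul_copE_of_left K h (c := p a), tser_mul, mul_one,
            one_mul]
          rw [mul_assoc, mul_assoc, hp a b j hw]
    _ = _ := by
        simp only [← Finset.sum_mul, ← tser_sum_left]
        rw [hMN', ← C_scal_mul_tser_left, mul_assoc]
        congr 1
        rw [srcU_copUnit K h, map_mul, mul_assoc, ← mul_assoc (C (copE K e)) (C (copE K e)),
          ← map_mul, (isUnits_copUnit K h).E_mul_E, ← one_mul (1 : MvPowerSeries (Fin 2) A),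
          ← tser_mul, one_mul, ← map_one C, tser_C, mul_assoc]
        congr 1
        have hc : Commute (tser K z 1) (C (copE K e)) := by
          rw [Commute, SemiconjBy, C_copE_mul_tser, tser_mul_C_copE]
          exact Finset.sum_congr rfl fun b _ => by rw [(hz _).eq, one_mul, mul_one]
        rw [map_one, ← mul_assoc, hc.eq, mul_assoc, tser_mul, one_mul, mul_one]

/-- The inversion relations that involve `σ` and `σ^*` are stable under the matrix coproduct. -/
theorem inversion_copMat' (hp : ∀ i k, C (srcU e (p i)) * N i k = N i k)
    (hMN : N.transpose * scalMat K w * M =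
      Matrix.of fun i j => C (scal K A (w i j)) * (C (tgtU e (p i)) * z)) :
    (copMat K N).transpose * scalMat K w * copMat K M = Matrix.of fun i j =>
      C (scal K _ (w i j)) * (C (tgtU (copUnit K e) (p i)) * (C (copE K e) * tser K z z)) := by
  have hMN' : ∀ i j, ∑ k, ∑ l, C (scal K A (w k l)) * (N k i * M l j) =
      C (scal K A (w i j)) * (C (tgtU e (p i)) * z) := fun i j => by
    have := congrFun (congrFun hMN i) j
    rwa [mul_scalMat_mul_apply] at this
  ext1 i j
  rw [mul_scalMat_mul_apply]
  simp only [Matrix.transpose_apply, Matrix.of_apply, copMat_apply, Finset.sum_mul_sum, tser_mul]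
  simp only [Finset.mul_sum, C_scal_mul_tser_left]
  -- The inversion relation is applied in the first tensor factor, where it leaves a part of the
  -- unit that may be replaced by `copE`, and then in the second one.
  calc _ = ∑ a, ∑ b, ∑ k, ∑ l,
        tser K (C (scal K A (w k l)) * (N k a * M l b)) (N a i * M b j) := by
        refine (Finset.sum_congr rfl fun k _ => (Finset.sum_comm)).trans ?_
        rw [Finset.sum_comm]
        refine Finset.sum_congr rfl fun a _ => ?_
        refine (Finset.sum_congr rfl fun k _ => (Finset.sum_comm)).trans ?_
        rw [Finset.sum_comm]
    _ = ∑ a, ∑ b, tser K z 1 * (C (copE K e) *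
          tser K 1 (C (scal K A (w a b)) * (N a i * M b j))) := by
        refine Finset.sum_congr rfl fun a _ => Finset.sum_congr rfl fun b _ => ?_
        simp only [← tser_sum_left]
        rw [hMN', ← C_scal_mul_tser_left, C_scal_mul_tser_right, (hz _).symm.eq,
          copE_mul_tser_of_right K h (c := p a), tser_mul, mul_one, one_mul]
        rw [← mul_assoc, ← (commute_C_scal K (w a b) _).eq, mul_assoc, ← mul_assoc _ (N a i), hp]
    _ = _ := by
        simp only [← Finset.mul_sum, ← tser_sum_right]
        have hc : Commute (tser K z 1) (C (copE K e)) := by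
          rw [Commute, SemiconjBy, C_copE_mul_tser, tser_mul_C_copE]
          exact Finset.sum_congr rfl fun b _ => by rw [(hz _).eq, one_mul, mul_one]
        rw [hMN', ← C_scal_mul_tser_right, tgtU_copUnit K h, map_mul, mul_assoc,
          ← mul_assoc (C (copE K e)) (C (copE K e)), ← map_mul, (isUnits_copUnit K h).E_mul_E,
          ← mul_assoc (C (copE K e)) (C (scal K _ _)), ← (commute_C_scal K _ _).eq,
          mul_assoc, ← mul_assoc (tser K z 1), ← (commute_C_scal K _ _).eq, mul_assoc]
        congr 1
        rw [← mul_assoc (tser K z 1), hc.eq, mul_assoc, tser_mul, mul_one, one_mul]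
        have : tser K z (C (tgtU e (p i)) * z) = C (1 ⊗ₜ[K] tgtU e (p i)) * tser K z z := by
          rw [← tser_C, tser_mul, map_one, one_mul]
        rw [this, ← mul_assoc, ← map_mul, (commute_copE_tgtU K h _).eq, map_mul, mul_assoc]

end Coproduct

/-! ### Tensor products of homomorphisms -/

section TensorMap

variable {K : Type*} [CommRing K] {A A' B B' : Type*} [Ring A] [Algebra K A]
  [Ring A'] [Algebra K A'] [Ring B] [Algebra K B] [Ring B'] [Algebra K B']

/-- The tensor product of two homomorphisms of non-unital algebras. -/
noncomputable def tensorMap (φ : A →ₙₐ[K] A') (ψ : B →ₙₐ[K] B') : A ⊗[K] B →ₙₐ[K] A' ⊗[K] B' :=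
  { TensorProduct.map (φ : A →ₗ[K] A') (ψ : B →ₗ[K] B') with
    map_zero' := map_zero _
    map_mul' := fun z w => by
      change TensorProduct.map (φ : A →ₗ[K] A') (ψ : B →ₗ[K] B') (z * w) =
        TensorProduct.map (φ : A →ₗ[K] A') (ψ : B →ₗ[K] B') z *
          TensorProduct.map (φ : A →ₗ[K] A') (ψ : B →ₗ[K] B') w
      induction z using TensorProduct.induction_on with
      | zero => simp
      | add z z' hz hz' => rw [add_mul, map_add, hz, hz', map_add, add_mul]
      | tmul x y =>
        induction w using TensorProduct.induction_on with
        | zero => simp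
        | add w w' hw hw' => rw [mul_add, map_add, hw, hw', map_add, mul_add]
        | tmul x' y' => simp [Algebra.TensorProduct.tmul_mul_tmul] }

theorem tensorMap_tmul (φ : A →ₙₐ[K] A') (ψ : B →ₙₐ[K] B') (x : A) (y : B) :
    tensorMap φ ψ (x ⊗ₜ[K] y) = φ x ⊗ₜ[K] ψ y := rfl

theorem pmap_tensorMap_tser {σ : Type*} (φ : A →ₙₐ[K] A') (ψ : B →ₙₐ[K] B')
    (x : MvPowerSeries σ A) (y : MvPowerSeries σ B) :
    pmap (tensorMap φ ψ) (tser K x y) = tser K (pmap φ x) (pmap ψ y) :=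
  pmap_map_tser K (φ : A →ₗ[K] A') (ψ : B →ₗ[K] B') x y

theorem commute_tmul_of_commute {a : A} {b : B} (ha : ∀ x, Commute a x) (hb : ∀ y, Commute b y)
    (z : A ⊗[K] B) : Commute (a ⊗ₜ[K] b) z := by
  induction z using TensorProduct.induction_on with
  | zero => exact Commute.zero_right _
  | add z w hz hw => exact hz.add_right hw
  | tmul x y =>
    rw [Commute, SemiconjBy, Algebra.TensorProduct.tmul_mul_tmul,
      Algebra.TensorProduct.tmul_mul_tmul, (ha x).eq, (hb y).eq]

theorem commute_coeff_tser {σ : Type*} {x : MvPowerSeries σ A} {y : MvPowerSeries σ B}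
    (hx : ∀ d a, Commute (x d) a) (hy : ∀ d b, Commute (y d) b) (d : σ →₀ ℕ) (z : A ⊗[K] B) :
    Commute (tser K x y d) z := by
  rw [← MvPowerSeries.coeff_apply (tser K x y), coeff_tser]
  exact Commute.sum_left _ _ _ fun p _ => commute_tmul_of_commute (hx _) (hy _) z

variable (K A) in
/-- The associativity isomorphism of the tensor product as a homomorphism of non-unital algebras. -/
noncomputable def assocHom : (A ⊗[K] A) ⊗[K] A →ₙₐ[K] A ⊗[K] (A ⊗[K] A) :=
  nonUnital (Algebra.TensorProduct.assoc K K K A A A).toAlgHom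

theorem pmap_assocHom_tser {σ : Type*} (x y z : MvPowerSeries σ A) :
    pmap (assocHom K A) (tser K (tser K x y) z) = tser K x (tser K y z) := pmap_assoc_tser K x y z

end TensorMap

/-! ### The defining relations for the coproduct -/

section RepCoproduct

open MvPowerSeries (coeff C)

variable {π : Type*} [Groupoid π] [Fintype π] [∀ a b : π, Fintype (a ⟶ b)] [Quiver.IsThin π]
  {X : Type*} [Fintype X] {deg : X → Arr π} {K : Type*} [CommRing K] {A : Type*} [Ring A]
  [Algebra K A]

/-- The coassociativity of the coproduct on the components of the unit: both sides are the sum over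
all chains of three composable arrows with composition `f`. -/
theorem coassoc_copUnit {e : Arr π → A} {Δ : A →ₙₐ[K] A ⊗[K] A} (hΔ : ∀ f, Δ (e f) = copUnit K e f)
    (f : Arr π) : assocHom K A
      (tensorMap Δ (.id K A) (Δ (e f))) = tensorMap (.id K A) Δ (Δ (e f)) := by
  have chain : ∀ g k m : Arr π,
      (∃ h : Arr π, Arr.IsComp h m f ∧ Arr.IsComp g k h) ↔
        ∃ h : Arr π, Arr.IsComp g h f ∧ Arr.IsComp k m h := by
    intro g k m
    simp only [Arr.isComp_iff]
    constructor
    · rintro ⟨h, ⟨h₁, h₂, h₃⟩, h₄, h₅, h₆⟩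
      refine ⟨⟨k.src, m.tgt, k.hom ≫ eqToHom (h₆.symm.trans h₁) ≫ m.hom⟩, ?_⟩
      exact ⟨⟨h₄, h₂.trans h₅, h₃⟩, h₆.symm.trans h₁, rfl, rfl⟩
    · rintro ⟨h, ⟨h₁, h₂, h₃⟩, h₄, h₅, h₆⟩
      refine ⟨⟨g.src, k.tgt, g.hom ≫ eqToHom (h₁.trans h₅) ≫ k.hom⟩, ?_⟩
      exact ⟨⟨h₄, h₂, h₃.trans h₆⟩, h₁.trans h₅, rfl, rfl⟩
  have uniq : ∀ (p : Arr π → Prop) [DecidablePred p] (x : A ⊗[K] (A ⊗[K] A)),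
      (∀ h h', p h → p h' → h = h') →
      ∑ h, (if p h then x else 0) = if ∃ h, p h then x else 0 := by
    intro p _ x hp
    split_ifs with h
    · obtain ⟨h, hh⟩ := h
      rw [Finset.sum_eq_single h, if_pos hh]
      · intro h' _ hne
        exact if_neg fun hh' => hne (hp _ _ hh' hh)
      · simp
    · exact Finset.sum_eq_zero fun h' _ => if_neg fun hh => h ⟨h', hh⟩
  have hL : assocHom K A
      (tensorMap Δ (.id K A) (Δ (e f))) = ∑ h, ∑ m, ∑ g, ∑ k,
        if Arr.IsComp h m f ∧ Arr.IsComp g k h then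
          e g ⊗ₜ[K] (e k ⊗ₜ[K] e m) else 0 := by
    rw [hΔ, copUnit, map_sum, map_sum]
    refine Finset.sum_congr rfl fun h _ => ?_
    rw [map_sum, map_sum]
    refine Finset.sum_congr rfl fun m _ => ?_
    split_ifs with hf
    · rw [tensorMap_tmul, hΔ, copUnit, TensorProduct.sum_tmul, map_sum]
      refine Finset.sum_congr rfl fun g _ => ?_
      rw [TensorProduct.sum_tmul, map_sum]
      refine Finset.sum_congr rfl fun k _ => ?_
      by_cases hg : Arr.IsComp g k h
      · rw [if_pos hg, if_pos ⟨hf, hg⟩]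
        rfl
      · rw [if_neg hg, if_neg fun h' => hg h'.2, zero_tmul, map_zero]
    · rw [map_zero, map_zero]
      simp [hf]
  have hR : tensorMap (.id K A) Δ (Δ (e f)) = ∑ g, ∑ h, ∑ k, ∑ m,
        if Arr.IsComp g h f ∧ Arr.IsComp k m h then
          e g ⊗ₜ[K] (e k ⊗ₜ[K] e m) else 0 := by
    rw [hΔ, copUnit, map_sum]
    refine Finset.sum_congr rfl fun g _ => ?_
    rw [map_sum]
    refine Finset.sum_congr rfl fun h _ => ?_
    split_ifs with hf
    · rw [tensorMap_tmul, hΔ, copUnit, TensorProduct.tmul_sum]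
      refine Finset.sum_congr rfl fun k _ => ?_
      rw [TensorProduct.tmul_sum]
      refine Finset.sum_congr rfl fun m _ => ?_
      by_cases hg : Arr.IsComp k m h
      · rw [if_pos hg, if_pos ⟨hf, hg⟩]
        rfl
      · rw [if_neg hg, if_neg fun h' => hg h'.2, tmul_zero]
    · rw [map_zero]
      simp [hf]
  have hswap : ∀ t : Arr π → Arr π → Arr π → Arr π → A ⊗[K] (A ⊗[K] A),
      ∑ h, ∑ m, ∑ g, ∑ k, t h m g k = ∑ g, ∑ k, ∑ m, ∑ h, t h m g k := by
    intro t
    calc _ = ∑ m, ∑ h, ∑ g, ∑ k, t h m g k := Finset.sum_comm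
      _ = ∑ m, ∑ g, ∑ h, ∑ k, t h m g k :=
        Finset.sum_congr rfl fun m _ => Finset.sum_comm
      _ = ∑ g, ∑ m, ∑ h, ∑ k, t h m g k := Finset.sum_comm
      _ = ∑ g, ∑ m, ∑ k, ∑ h, t h m g k :=
        Finset.sum_congr rfl fun g _ => Finset.sum_congr rfl fun m _ => Finset.sum_comm
      _ = _ := Finset.sum_congr rfl fun g _ => Finset.sum_comm
  have hswap' : ∀ t : Arr π → Arr π → Arr π → A ⊗[K] (A ⊗[K] A),
      ∑ h, ∑ k, ∑ m, t h k m = ∑ k, ∑ m, ∑ h, t h k m := by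
    intro t
    rw [Finset.sum_comm]
    exact Finset.sum_congr rfl fun k _ => Finset.sum_comm
  rw [hL, hR, hswap]
  refine Finset.sum_congr rfl fun g _ => ?_
  conv_rhs => rw [hswap']
  refine Finset.sum_congr rfl fun k _ => Finset.sum_congr rfl fun m _ => ?_
  rw [uniq fun h => Arr.IsComp h m f ∧ Arr.IsComp g k h,
    uniq fun h => Arr.IsComp g h f ∧ Arr.IsComp k m h]
  · simp only [chain]
  · rintro h h' ⟨-, h₁⟩ ⟨-, h₂⟩
    rw [Arr.isComp_iff] at h₁ h₂
    exact Arr.ext_of_thin (h₁.2.1.trans h₂.2.1.symm) (h₁.2.2.trans h₂.2.2.symm)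
  · rintro h h' ⟨-, h₁⟩ ⟨-, h₂⟩
    rw [Arr.isComp_iff] at h₁ h₂
    exact Arr.ext_of_thin (h₁.2.1.trans h₂.2.1.symm) (h₁.2.2.trans h₂.2.2.symm)

variable [Algebra ℂ K] {P : Pairing deg} {L lam : ℂ}
  {cVV cVsV cVsVs : Coeff X (MvPowerSeries (Fin 2) ℂ)}

/-- The defining relations are stable under the matrix coproduct. -/
theorem IsRep.cop {D : RepData π X A} (hD : IsRep K P L lam cVV cVsV cVsVs D)
    (hxi : ∀ s a x, Commute (D.xi s a) x) : IsRep K P L lam cVV cVsV cVsVs (D.cop K) := by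
  have hu : IsUnits (copE K D.e) (copUnit K D.e) := isUnits_copUnit K hD.units
  have hT := isHomog_copMat K hD.units hD.homT
  have hTs := isHomog_copMat K hD.units hD.homTs
  have hc : ∀ s d (z : A ⊗[K] A), Commute (tser K (D.xi s) (D.xi s) d) z := fun s =>
    commute_coeff_tser (hxi s) (hxi s)
  have hc' : ∀ s (z : MvPowerSeries (Fin 2) (A ⊗[K] A)),
      Commute (tser K (D.xi s) (D.xi s)) z := fun s z => commute_of_coeff fun a b => hc s a _
  have hz : ∀ s (x : MvPowerSeries (Fin 2) A), Commute (D.xi s) x := fun s x =>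
    commute_of_coeff fun a b => hxi s a _
  -- The series `Δ ξ₂^±` are central only in the corner with unit `copE`.
  have key : ∀ s d (z : A ⊗[K] A), copE K D.e * z = z → z * copE K D.e = z →
      Commute ((D.cop K).xi s d) z := fun s d z h₁ h₂ => by
    have : (D.cop K).xi s d = copE K D.e * tser K (D.xi s) (D.xi s) d :=
      MvPowerSeries.coeff_C_mul _ _ _
    rw [this, Commute, SemiconjBy, mul_assoc, (hc s d z).eq, ← mul_assoc, ← mul_assoc, h₁, h₂]
  have hC : ∀ {F : MvPowerSeries (Fin 2) (A ⊗[K] A)} {b}, C b * F = F → ∀ d, b * F d = F d := by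
    intro F b hF d
    conv_rhs => rw [← hF]
    exact (MvPowerSeries.coeff_C_mul _ _ _).symm
  have hC' : ∀ {F : MvPowerSeries (Fin 2) (A ⊗[K] A)} {b}, F * C b = F → ∀ d, F d * b = F d := by
    intro F b hF d
    conv_rhs => rw [← hF]
    exact (MvPowerSeries.coeff_mul_C _ _ _).symm
  have hE : C (copE K D.e) * C (copE K D.e) =
      (C (copE K D.e) : MvPowerSeries (Fin 2) (A ⊗[K] A)) := by
    rw [← map_mul, hu.E_mul_E]
  have hEx : ∀ s, C (copE K D.e) * (D.cop K).xi s = (D.cop K).xi s := fun s => by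
    change C (copE K _) * (C (copE K _) * _) = C (copE K _) * _
    rw [← mul_assoc, hE]
  have hxE : ∀ s, (D.cop K).xi s * C (copE K D.e) = (D.cop K).xi s := fun s => by
    change (C (copE K _) * _) * C (copE K _) = C (copE K _) * _
    rw [mul_assoc, (hc' s _).eq, ← mul_assoc, hE]
  refine
    { units := hu
      homT := hT
      homTs := hTs
      E_xi := hEx
      comm_e := fun s a f => key s a _ (hu.E_mul f) (hu.mul_E f)
      comm_T := fun s a i j b => key s a _ (hC (hT.E_mul hu i j) b) (hC' (hT.mul_E hu i j) b)
      comm_Ts := fun s a i j b => key s a _ (hC (hTs.E_mul hu i j) b) (hC' (hTs.mul_E hu i j) b)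
      comm_xi := fun s a s' b => key s a _ (hC (hEx s') b) (hC' (hxE s') b)
      xi_mul := fun s => ?_
      rtt_VV := exchange_copMat K hD.rtt_VV
      rtt_VsVs := exchange_copMat K hD.rtt_VsVs
      rtt_VsV := exchange_copMat K hD.rtt_VsV
      om_inv := ?_
      omStar_inv := ?_
      sg_inv := ?_
      sgStar_inv := ?_ }
  · change (C (copE K _) * tser K (D.xi s) (D.xi s)) *
      (C (copE K _) * tser K (D.xi (!s)) (D.xi (!s))) = C (copE K _)
    rw [mul_assoc, ← mul_assoc (tser K _ _), (hc' s _).eq, mul_assoc, tser_mul, hD.xi_mul, tser_C,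
      ← mul_assoc, hE, ← map_mul, copE, Finset.sum_mul]
    simp only [Algebra.TensorProduct.tmul_mul_tmul, hD.units.tgtU_mul_E, hD.units.srcU_mul_E]
  · have h := inversion_copMat K hD.units P.om (fun i => (deg i).src) (hz true)
      (N := D.Ts) (fun i j k hw => ?_) hD.om_inv
    · rw [← map_shift_copMat] at h
      exact h
    · rw [P.graded i j hw]
      exact hD.homTs.mul_tgt k j
  · have h := inversion_copMat K hD.units P.omStar (fun i => (deg i).tgt) Commute.one_left
      (M := D.Ts.map (shift K L lam)) (N := D.T) (fun i j k hw => ?_) ?_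
    · rw [← map_shift_copMat] at h
      refine h.trans ?_
      ext1 i j
      change _ * (C (srcU (copUnit K _) _) * _) = _ * C (srcU (copUnit K _) _)
      rw [← map_one C, tser_C, ← Algebra.TensorProduct.one_def, map_one, mul_one, ← map_mul,
        hu.srcU_mul_E]
    · rw [P.omStar_graded i j hw]
      exact hD.homT.mul_tgt k j
    · simp only [mul_one]
      exact hD.omStar_inv
  · have h := inversion_copMat' K hD.units P.sg (fun i => (deg i).tgt) (hz true)
      (N := D.Ts) (fun i k => hD.homTs.src_mul i k) hD.sg_inv
    rw [← map_shift_copMat] at h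
    exact h
  · have h := inversion_copMat' K hD.units P.sgStar (fun i => (deg i).src) Commute.one_left
      (M := D.Ts.map (shift K L lam)) (N := D.T) (fun i k => hD.homT.src_mul i k) ?_
    · rw [← map_shift_copMat] at h
      refine h.trans ?_
      ext1 i j
      change _ * (C (tgtU (copUnit K _) _) * _) = _ * C (tgtU (copUnit K _) _)
      rw [← map_one C, tser_C, ← Algebra.TensorProduct.one_def, map_one, mul_one, ← map_mul,
        hu.tgtU_mul_E]
    · simp only [mul_one]
      exact hD.sgStar_inv

end RepCoproduct

/-! ### The coproduct -/

section RQACoproduct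

open MvPowerSeries (coeff C)

variable {π : Type*} [Groupoid π] [Fintype π] [∀ a b : π, Fintype (a ⟶ b)] {X : Type*} [Fintype X]
  {deg : X → Arr π} {K : Type*} [CommRing K] [Algebra ℂ K] {P : Pairing deg} {L lam : ℂ}
  {cVV cVsV cVsVs : Coeff X (MvPowerSeries (Fin 2) ℂ)}

namespace RQA

local notation "𝓐" => RQA K P L lam cVV cVsV cVsVs
local notation "𝔤" => gen K P L lam cVV cVsV cVsVs
local notation "𝓒" => component K P L lam cVV cVsV cVsVs
local notation "𝓓" => data K P L lam cVV cVsV cVsVs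

theorem commute_xi (s : Bool) (x : MvPowerSeries (Fin 2) 𝓐) : Commute (serXi 𝔤 s) x :=
  commute_of_coeff fun a _ => xi_central s a _

variable [Quiver.IsThin π]

theorem isRep_cop : IsRep K P L lam cVV cVsV cVsVs (RepData.cop K 𝓓) :=
  isRep.cop xi_central

variable (K P L lam cVV cVsV cVsVs) in
/-- The coproduct. It does not map `1` to `1`, but to the unit of `A ⊗_h A`. -/
noncomputable def cop : 𝓐 →ₙₐ[K] 𝓐 ⊗[K] 𝓐 := (exists_hom isRep_cop).choose

local notation "Δ" => cop K P L lam cVV cVsV cVsVs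

theorem cop_one : Δ 1 = copE K fun f => 𝔤 (.e f) := (exists_hom isRep_cop).choose_spec.1

theorem cop_e (f : Arr π) : Δ (𝔤 (.e f)) = copUnit K (fun f => 𝔤 (.e f)) f :=
  (exists_hom isRep_cop).choose_spec.2.1 f

theorem cop_T (i j : X) : pmap Δ (serT 𝔤 i j) = ∑ k, tser K (serT 𝔤 i k) (serT 𝔤 k j) :=
  ((exists_hom isRep_cop).choose_spec.2.2.1 i j).trans (copMat_apply K _ _ _)

theorem cop_Ts (i j : X) : pmap Δ (serTs 𝔤 i j) = ∑ k, tser K (serTs 𝔤 i k) (serTs 𝔤 k j) :=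
  ((exists_hom isRep_cop).choose_spec.2.2.2.1 i j).trans (copMat_apply K _ _ _)

theorem cop_xi (s : Bool) : pmap Δ (serXi 𝔤 s) =
    C (copE K fun f => 𝔤 (.e f)) * tser K (serXi 𝔤 s) (serXi 𝔤 s) :=
  (exists_hom isRep_cop).choose_spec.2.2.2.2 s

theorem cop_e_mul_xi (f : Arr π) (s : Bool) : pmap Δ (C (𝔤 (.e f)) * serXi 𝔤 s) =
    C (copUnit K (fun f => 𝔤 (.e f)) f) * tser K (serXi 𝔤 s) (serXi 𝔤 s) := by
  rw [pmap_mul, pmap_C, cop_e, cop_xi, ← mul_assoc, ← map_mul, (isUnits_copUnit K units).mul_E]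

/-- Both sides are homomorphisms, so they are compared on the components of the unit and on the
generating series. -/
theorem cop_coassoc (x : 𝓐) :
    assocHom K 𝓐 (tensorMap Δ (.id K 𝓐) (Δ x)) =
      tensorMap (.id K 𝓐) Δ (Δ x) := by
  let φ :=
    (assocHom K 𝓐).comp
      ((tensorMap Δ (.id K 𝓐)).comp Δ)
  let ψ := (tensorMap (A' := 𝓐) (B' := 𝓐 ⊗[K] 𝓐) (.id K 𝓐) Δ).comp Δ
  have hφ : ∀ F : MvPowerSeries (Fin 2) 𝓐, pmap φ F =
    pmap (assocHom K 𝓐) (pmap (tensorMap Δ (.id K 𝓐)) (pmap Δ F)) :=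
      fun _ => rfl
  have hψ : ∀ F : MvPowerSeries (Fin 2) 𝓐, pmap ψ F = pmap (tensorMap (.id K 𝓐) Δ) (pmap Δ F) :=
      fun _ => rfl
  have hid : ∀ F : MvPowerSeries (Fin 2) 𝓐, pmap (NonUnitalAlgHom.id K 𝓐) F = F := fun _ => rfl
  have he : ∀ f, φ (𝔤 (.e f)) = ψ (𝔤 (.e f)) := fun f => coassoc_copUnit cop_e f
  have h1 : φ 1 = ψ 1 := by
    rw [← units.sum, map_sum, map_sum]
    exact Finset.sum_congr rfl fun f _ => he f
  refine nonUnital_ext (φ := φ) (ψ := ψ) he (fun i j => ?_) (fun i j => ?_) (fun s => ?_) x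
  · rw [hφ, hψ, cop_T]
    simp only [pmap_sum, pmap_tensorMap_tser, cop_T, hid, tser_sum_left, tser_sum_right,
      pmap_assocHom_tser]
    exact Finset.sum_comm
  · rw [hφ, hψ, cop_Ts]
    simp only [pmap_sum, pmap_tensorMap_tser, cop_Ts, hid, tser_sum_left, tser_sum_right,
      pmap_assocHom_tser]
    exact Finset.sum_comm
  -- Both iterated coproducts of `ξ₂^±` are `ξ₂^± ⊗ ξ₂^± ⊗ ξ₂^±`, cut by the image of `1`.
  · have hl : pmap φ (serXi 𝔤 s) =
        C (φ 1) * tser K (serXi 𝔤 s) (tser K (serXi 𝔤 s) (serXi 𝔤 s)) := by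
      have : ∀ z, tser K (C (copE K fun f => 𝔤 (.e f)) * z) (serXi 𝔤 s) =
          C (tensorMap Δ (.id K 𝓐) (1 ⊗ₜ[K] 1)) * tser K z (serXi 𝔤 s) := fun z => by
        rw [tensorMap_tmul, cop_one, ← tser_C, tser_mul]
        simp
      rw [hφ, cop_xi, pmap_mul, pmap_tensorMap_tser, hid, cop_xi, this, pmap_C, ← mul_assoc,
        ← map_mul, ← map_mul, ← Algebra.TensorProduct.one_def, mul_one, pmap_mul, pmap_C,
        pmap_assocHom_tser, ← cop_one]
      rfl
    have hr : pmap ψ (serXi 𝔤 s) =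
        C (ψ 1) * tser K (serXi 𝔤 s) (tser K (serXi 𝔤 s) (serXi 𝔤 s)) := by
      have : ∀ z, tser K (serXi 𝔤 s) (C (copE K fun f => 𝔤 (.e f)) * z) =
          C (tensorMap (.id K 𝓐) Δ (1 ⊗ₜ[K] 1)) * tser K (serXi 𝔤 s) z := fun z => by
        rw [tensorMap_tmul, cop_one, ← tser_C, tser_mul]
        simp
      rw [hψ, cop_xi, pmap_mul, pmap_tensorMap_tser, hid, cop_xi, this, pmap_C, ← mul_assoc,
        ← map_mul, ← map_mul, ← Algebra.TensorProduct.one_def, mul_one, ← cop_one]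
      rfl
    rw [hl, hr, h1]

theorem e_tmul_mul_mem_tensorH {γ : Sq π} {g h g' h' : Arr π} (h₁ : Arr.IsComp g h γ.topArr)
    (h₂ : Arr.IsComp g' h' γ.botArr) (z : 𝓐 ⊗[K] 𝓐) :
    (𝔤 (.e g) ⊗ₜ[K] 𝔤 (.e h)) * z * (𝔤 (.e g') ⊗ₜ[K] 𝔤 (.e h')) ∈ tensorH 𝓒 γ := by
  induction z using TensorProduct.induction_on with
  | zero => simp
  | add z w hz hw =>
    rw [mul_add, add_mul]
    exact add_mem hz hw
  | tmul x y =>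
    rw [Algebra.TensorProduct.tmul_mul_tmul, Algebra.TensorProduct.tmul_mul_tmul]
    have hx := e_mul_mul_e_mem x g g'
    have hy := e_mul_mul_e_mem y h h'
    by_cases hα : ∃ α : Sq π, α.topArr = g ∧ α.botArr = g'
    · by_cases hβ : ∃ β : Sq π, β.topArr = h ∧ β.botArr = h'
      · obtain ⟨α, rfl, rfl⟩ := hα
        obtain ⟨β, rfl, rfl⟩ := hβ
        rw [boundary_eq] at hx hy
        refine Submodule.mem_iSup_of_mem α (Submodule.mem_iSup_of_mem β
          (Submodule.mem_iSup_of_mem (isHComp_of_isComp h₁ h₂) ⟨⟨_, hx⟩ ⊗ₜ ⟨_, hy⟩, rfl⟩))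
      · rw [boundary_eq_bot (not_exists.mp hβ), Submodule.mem_bot] at hy
        rw [hy, tmul_zero]
        exact zero_mem _
    · rw [boundary_eq_bot (not_exists.mp hα), Submodule.mem_bot] at hx
      rw [hx, zero_tmul]
      exact zero_mem _

/-- The coproduct preserves the degree: `Δ x` is cut by `Δ (e f)`, with `f` the top or bottom side
of the square, into terms whose top sides and bottom sides are composable. -/
theorem cop_mem_tensorH {γ : Sq π} {x : 𝓐} (hx : x ∈ 𝓒 γ) : Δ x ∈ tensorH 𝓒 γ := by
  rw [← top_mul_of_mem hx, ← mul_bot_of_mem hx, ← mul_assoc, map_mul, map_mul, cop_e, cop_e]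
  simp only [copUnit, Finset.sum_mul, Finset.mul_sum]
  refine Submodule.sum_mem _ fun g _ => Submodule.sum_mem _ fun h _ => Submodule.sum_mem _
    fun g' _ => Submodule.sum_mem _ fun h' _ => ?_
  split_ifs
  · exact e_tmul_mul_mem_tensorH (by assumption) (by assumption) _
  all_goals simp

end RQA

end RQACoproduct

/-! ### Sums over arrows -/

section ArrowSums

variable {π : Type*} [Groupoid π] [Fintype π] [∀ a b : π, Fintype (a ⟶ b)]
  {M : Type*} [Ring M]

theorem sum_arr_one (H : π → M) :
    ∑ f : Arr π, (if f = Arr.one f.src then H f.src else 0) = ∑ a, H a := by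
  have : ∀ f : Arr π, (if f = Arr.one f.src then H f.src else 0) =
      ∑ a, if f = Arr.one a then H a else 0 := fun f => by
    rw [Finset.sum_eq_single f.src]
    · intro a _ ha
      refine if_neg fun h => ha ?_
      rw [h]
      rfl
    · simp
  simp only [this]
  rw [Finset.sum_comm]
  simp

variable [Quiver.IsThin π]

/-- In a thin groupoid a sum over arrows is a sum over pairs of objects. -/
theorem sum_arr (H : π → π → M) (hH : ∀ a b, IsEmpty (a ⟶ b) → H a b = 0) :
    ∑ u : Arr π, H u.src u.tgt = ∑ a, ∑ b, H a b := by
  rw [Fintype.sum_sigma]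
  refine Finset.sum_congr rfl fun a _ => ?_
  rw [Fintype.sum_sigma]
  exact Finset.sum_congr rfl fun b _ => sum_hom_const (H a b) (hH a b)

theorem sum_arr_between (H : M) (a b : π) (hH : IsEmpty (a ⟶ b) → H = 0) :
    ∑ u : Arr π, (if u.src = a ∧ u.tgt = b then H else 0) = H := by
  rw [sum_arr (fun a' b' => if a' = a ∧ b' = b then H else 0)]
  · rw [Finset.sum_eq_single a, Finset.sum_eq_single b] <;> simp +contextual
  · intro a' b' h
    split_ifs with h'
    · obtain ⟨rfl, rfl⟩ := h'
      exact hH h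
    · rfl

end ArrowSums

/-! ### The defining relations for the counit -/

section CounitRep

theorem sum_single_self {π : Type*} [Fintype π] (K : Type*) [CommRing K] :
    ∑ a : π, (Matrix.single a a 1 : Matrix π π K) = 1 := by
  ext a b
  rw [Matrix.sum_apply, Matrix.one_apply]
  split_ifs with h
  · subst h
    rw [Finset.sum_eq_single a] <;> simp +contextual
  · exact Finset.sum_eq_zero fun c _ => by
      rw [Matrix.single_apply, if_neg]
      rintro ⟨rfl, rfl⟩
      exact h rfl

open MvPowerSeries (coeff C)

variable {π : Type*} [Groupoid π] {X : Type*} (K : Type*) [CommRing K]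

/-- The matrix unit at an arrow. Under the counit the series `T_i^j` goes to `δ_ij` times the matrix
unit at `deg i`. -/
noncomputable def arrUnit (u : Arr π) : Matrix π π K := Matrix.single u.src u.tgt 1

variable (π) in
/-- The images in the algebra of matrices over `π` of the components of the unit. -/
noncomputable def counitUnit (f : Arr π) : Matrix π π K :=
  if f = Arr.one f.src then Matrix.single f.src f.src 1 else 0

variable [Fintype π]

/-- The diagonal matrix of the matrix units at the arrows `d i`. -/
noncomputable def arrDiag (d : X → Arr π) :
    Matrix X X (MvPowerSeries (Fin 2) (Matrix π π K)) :=
  Matrix.diagonal fun i => C (arrUnit K (d i))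

/-- The images of the generating series under the counit, with values in the convolution algebra of
the pair groupoid, which is the algebra of matrices over the set of objects. -/
noncomputable def counitData (deg : X → Arr π) : RepData π X (Matrix π π K) where
  E := 1
  e := counitUnit π K
  T := arrDiag K deg
  Ts := arrDiag K fun i => (deg i).inv
  xi _ := 1

theorem arrUnit_mul_of_eq {u v w : Arr π} (h : u.tgt = v.src) (h₁ : w.src = u.src)
    (h₂ : w.tgt = v.tgt) : arrUnit K u * arrUnit K v = arrUnit K w := by
  rw [arrUnit, arrUnit, arrUnit, ← h, Matrix.single_mul_single_same, h₁, h₂, mul_one]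

theorem counitUnit_mul (f f' : Arr π) : counitUnit π K f * counitUnit π K f' =
    if f = f' then counitUnit π K f else 0 := by
  rw [counitUnit, counitUnit]
  by_cases h : f = Arr.one f.src
  · by_cases h' : f' = Arr.one f'.src
    · rw [if_pos h, if_pos h']
      split_ifs with hf
      · rw [hf, Matrix.single_mul_single_same, mul_one]
      · rw [Matrix.single_mul_single_of_ne]
        intro hs
        rw [h, h'] at hf
        exact hf (congrArg _ hs)
    · rw [if_neg h', mul_zero, if_neg]
      rintro rfl
      exact h' h
  · rw [if_neg h, zero_mul, ite_self]

theorem pairMat_arrDiag (d d' : X → Arr π) : pairMat (arrDiag K d) (arrDiag K d') =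
    Matrix.diagonal fun p => C (arrUnit K (d p.1) * arrUnit K (d' p.2)) := by
  ext1 p q
  simp only [pairMat, Matrix.of_apply, arrDiag, Matrix.diagonal_apply]
  by_cases h₁ : p.1 = q.1 <;> by_cases h₂ : p.2 = q.2
  · rw [if_pos h₁, if_pos h₂, if_pos (Prod.ext h₁ h₂), at1_C, at2_C, map_mul]
  all_goals
    rw [if_neg (c := p = q) (by rintro rfl; simp_all)]
    simp only [h₁, h₂, if_false]
  · exact (congrArg _ (map_zero at2Hom)).trans (mul_zero _)
  · exact (congrArg (· * _) (map_zero at1Hom)).trans (zero_mul _)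
  · exact (congrArg (· * _) (map_zero at1Hom)).trans (zero_mul _)

theorem pairMat'_arrDiag (d d' : X → Arr π) : pairMat' (arrDiag K d) (arrDiag K d') =
    Matrix.diagonal fun p => C (arrUnit K (d' p.1) * arrUnit K (d p.2)) := by
  ext1 p q
  simp only [pairMat', Matrix.of_apply, arrDiag, Matrix.diagonal_apply]
  by_cases h₁ : p.1 = q.1 <;> by_cases h₂ : p.2 = q.2
  · rw [if_pos h₁, if_pos h₂, if_pos (Prod.ext h₁ h₂), at1_C, at2_C, map_mul]
  all_goals
    rw [if_neg (c := p = q) (by rintro rfl; simp_all)]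
    simp only [h₁, h₂, if_false]
  · exact (congrArg _ (map_zero at1Hom)).trans (mul_zero _)
  · exact (congrArg (· * _) (map_zero at2Hom)).trans (zero_mul _)
  · exact (congrArg (· * _) (map_zero at2Hom)).trans (zero_mul _)

/-- The exchange relations hold for the diagonal matrices of the counit, because a nonzero
coefficient forces the two products of matrix units to agree. -/
theorem exchange_arrDiag [Fintype X] [Algebra ℂ K] {d d' : X → Arr π}
    {c : Coeff X (MvPowerSeries (Fin 2) ℂ)}
    (hc : IsGradedCoeff d d' c) :
    pairMat (arrDiag K d) (arrDiag K d') * coeffMat K c =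
      coeffMat K c * pairMat' (arrDiag K d) (arrDiag K d') := by
  rw [pairMat_arrDiag, pairMat'_arrDiag]
  ext1 p q
  rw [Matrix.diagonal_mul, Matrix.mul_diagonal]
  by_cases h : c p.1 p.2 q.1 q.2 = 0
  · rw [show coeffMat K c p q = 0 by rw [coeffMat, Matrix.of_apply, h, map_zero, at12_zero],
      mul_zero, zero_mul]
  · obtain ⟨h₁, h₂, h₃, h₄⟩ := hc _ _ _ _ h
    have hx : arrUnit K (d p.1) * arrUnit K (d' p.2) = arrUnit K (d' q.1) * arrUnit K (d q.2) := by
      rw [arrUnit, arrUnit, arrUnit, arrUnit, ← h₁, ← h₂, h₃, h₄, Matrix.single_mul_single_same,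
        Matrix.single_mul_single_same]
    rw [hx]
    exact (commute_at12_scal K _ _).eq.symm

/-- The inversion relations hold for the diagonal matrices of the counit. Constant series are
invariant under translation of the spectral parameter. -/
theorem inversion_arrDiag [Fintype X] [Algebra ℂ K] (L lam : ℂ) {d d' : X → Arr π}
    (w : X → X → ℂ) (z : X → Matrix π π K)
    (h : ∀ i j, w i j ≠ 0 → arrUnit K (d i) * arrUnit K (d' j) = z i) :
    (arrDiag K d).map (shift K L lam) * scalMat K w * arrDiag K d' =
      Matrix.of fun i j => C (scal K _ (w i j)) * C (z i) := by
  ext1 i j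
  have : (arrDiag K d).map (shift K L lam) = arrDiag K d := by
    ext1 i j
    rw [Matrix.map_apply, arrDiag, Matrix.diagonal_apply]
    split_ifs
    · exact shift_C K L lam _
    · exact map_zero (shiftHom K L lam)
  rw [this, arrDiag, arrDiag, Matrix.mul_diagonal, Matrix.diagonal_mul, scalMat, Matrix.of_apply,
    Matrix.of_apply]
  by_cases hw : w i j = 0
  · rw [hw, map_zero, map_zero, mul_zero, zero_mul, zero_mul]
  · rw [← (commute_C_scal K _ _).eq, mul_assoc, ← map_mul C (arrUnit K (d i)), h i j hw]

variable [∀ a b : π, Fintype (a ⟶ b)]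

theorem srcU_counitUnit [Quiver.IsThin π] (a : π) :
    srcU (counitUnit π K) a = Matrix.single a a 1 := by
  have := sum_arr_one fun b : π => if b = a then (Matrix.single b b 1 : Matrix π π K) else 0
  rw [Finset.sum_ite_eq' Finset.univ a, if_pos (Finset.mem_univ a)] at this
  refine Eq.trans (Finset.sum_congr rfl fun f _ => ?_) this
  rw [counitUnit]
  split_ifs <;> rfl

theorem tgtU_counitUnit [Quiver.IsThin π] (a : π) :
    tgtU (counitUnit π K) a = Matrix.single a a 1 := by
  rw [← srcU_counitUnit]
  refine Finset.sum_congr rfl fun f _ => ?_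
  rw [counitUnit]
  by_cases h : f = Arr.one f.src
  · have : f.tgt = f.src := by
      conv_lhs => rw [h]
      rfl
    rw [this]
  · rw [if_neg h, ite_self, ite_self]

theorem isUnits_counitUnit [Quiver.IsThin π] : IsUnits 1 (counitUnit π K) where
  mul_self f := by rw [counitUnit_mul, if_pos rfl]
  orth f f' h := by rw [counitUnit_mul, if_neg h]
  sum := (sum_arr_one fun a => (Matrix.single a a 1 : Matrix π π K)).trans (sum_single_self K)

theorem isHomog_arrDiag [Quiver.IsThin π] (d : X → Arr π) :
    IsHomog (counitUnit π K) d (arrDiag K d) := by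
  constructor <;> intro i j <;> rw [arrDiag, Matrix.diagonal_apply] <;> split_ifs with h <;>
    (try simp only [mul_zero, zero_mul]) <;> subst h <;> rw [← map_mul]
  · rw [srcU_counitUnit, arrUnit, Matrix.single_mul_single_same, one_mul]
  · rw [tgtU_counitUnit, arrUnit, Matrix.single_mul_single_same, one_mul]
  · rw [srcU_counitUnit, arrUnit, Matrix.single_mul_single_same, one_mul]
  · rw [tgtU_counitUnit, arrUnit, Matrix.single_mul_single_same, one_mul]

variable {K} [Algebra ℂ K] [Fintype X] {deg : X → Arr π} {P : Pairing deg} {L lam : ℂ}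
  {cVV cVsV cVsVs : Coeff X (MvPowerSeries (Fin 2) ℂ)}

/-- The defining relations hold for the counit, because the coefficients of the exchange relations
preserve the degree. -/
theorem isRep_counitData [Quiver.IsThin π] (hVV : IsGradedCoeff deg deg cVV)
    (hVsV : IsGradedCoeff (fun i => (deg i).inv) deg cVsV)
    (hVsVs : IsGradedCoeff (fun i => (deg i).inv) (fun i => (deg i).inv) cVsVs) :
    IsRep K P L lam cVV cVsV cVsVs (counitData K deg) := by
  have h1 : ∀ a (x : Matrix π π K), Commute ((1 : MvPowerSeries (Fin 2) (Matrix π π K)) a) x := by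
    intro a x
    rw [← MvPowerSeries.coeff_apply (1 : MvPowerSeries (Fin 2) _), MvPowerSeries.coeff_one]
    split_ifs
    · exact Commute.one_left x
    · exact Commute.zero_left x
  have hT : (arrDiag K deg).transpose = arrDiag K deg := Matrix.diagonal_transpose _
  have hTs : (arrDiag K fun i => (deg i).inv).transpose = arrDiag K fun i => (deg i).inv :=
    Matrix.diagonal_transpose _
  have hsh' : ∀ d : X → Arr π, (arrDiag K d).map (shift K L lam) = arrDiag K d := fun d => by
    ext1 i j
    rw [Matrix.map_apply, arrDiag, Matrix.diagonal_apply]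
    split_ifs
    · exact shift_C K L lam _
    · exact map_zero (shiftHom K L lam)
  exact
    { units := isUnits_counitUnit K
      homT := isHomog_arrDiag K deg
      homTs := isHomog_arrDiag K fun i => (deg i).inv
      E_xi := fun s => mul_one _
      comm_e := fun s a f => h1 a _
      comm_T := fun s a i j b => h1 a _
      comm_Ts := fun s a i j b => h1 a _
      comm_xi := fun s a s' b => h1 a _
      xi_mul := fun s => (mul_one _).trans (map_one C).symm
      rtt_VV := exchange_arrDiag K hVV
      rtt_VsVs := exchange_arrDiag K hVsVs
      rtt_VsV := exchange_arrDiag K hVsV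
      om_inv := by
        change (arrDiag K deg).map _ * _ * (arrDiag K fun i => (deg i).inv).transpose = _
        rw [hTs, inversion_arrDiag K L lam P.om fun i => srcU (counitUnit π K) (deg i).src]
        · refine Matrix.ext fun i j => ?_
          rw [Matrix.of_apply, Matrix.of_apply]
          exact congrArg _ (mul_one _).symm
        · intro i j hw
          rw [P.graded i j hw, srcU_counitUnit]
          exact arrUnit_mul_of_eq K (w := Arr.one (deg j).src) rfl rfl rfl
      omStar_inv := by
        change (arrDiag K fun i => (deg i).inv).map _ * _ * (arrDiag K deg).transpose = _
        rw [hT, inversion_arrDiag K L lam P.omStar fun i => srcU (counitUnit π K) (deg i).tgt]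
        · rfl
        · intro i j hw
          rw [P.omStar_graded i j hw, srcU_counitUnit]
          exact arrUnit_mul_of_eq K (w := Arr.one (deg j).tgt) rfl rfl rfl
      sg_inv := by
        change (arrDiag K fun i => (deg i).inv).transpose * _ * (arrDiag K deg).map _ = _
        rw [hTs, hsh', ← hsh' fun i => (deg i).inv,
          inversion_arrDiag K L lam P.sg fun i => tgtU (counitUnit π K) (deg i).tgt]
        · refine Matrix.ext fun i j => ?_
          rw [Matrix.of_apply, Matrix.of_apply]
          exact congrArg _ (mul_one _).symm
        · intro i j hw
          rw [P.sg_graded i j hw, tgtU_counitUnit]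
          exact arrUnit_mul_of_eq K (w := Arr.one (deg j).tgt) rfl rfl rfl
      sgStar_inv := by
        change (arrDiag K deg).transpose * _ * (arrDiag K fun i => (deg i).inv).map _ = _
        rw [hT, hsh', ← hsh' deg,
          inversion_arrDiag K L lam P.sgStar fun i => tgtU (counitUnit π K) (deg i).src]
        · rfl
        · intro i j hw
          rw [P.sgStar_graded i j hw, tgtU_counitUnit]
          exact arrUnit_mul_of_eq K (w := Arr.one (deg j).src) rfl rfl rfl }

end CounitRep

/-! ### Evaluation of one tensor factor -/

section Evaluation

open MvPowerSeries (coeff C)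

variable {n : Type*} [Fintype n] {K : Type*} [CommRing K] {A B : Type*} [Ring A] [Algebra K A]
  [Ring B] [Algebra K B]

/-- Apply a matrix representation to the left factor of `A ⊗ B`. -/
noncomputable def evalLeft (ε : A →ₙₐ[K] Matrix n n K) : A ⊗[K] B →ₙₐ[K] Matrix n n B :=
  { TensorProduct.lift (LinearMap.mk₂ K
      (fun x y => (Matrix.of fun a b => ε x a b • y : Matrix n n B))
      (fun x x' y => by ext; simp [add_smul]) (fun r x y => by ext; simp [mul_smul])
      (fun x y y' => by ext; simp) (fun r x y => by
        ext a b
        exact smul_comm (ε x a b) r y)) with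
    map_zero' := map_zero _
    map_mul' := fun z w => by
      change TensorProduct.lift _ (z * w) = TensorProduct.lift _ z * TensorProduct.lift _ w
      induction z using TensorProduct.induction_on with
      | zero => simp
      | add z z' hz hz' => rw [add_mul, map_add, hz, hz', map_add, add_mul]
      | tmul x y =>
        induction w using TensorProduct.induction_on with
        | zero => simp
        | add w w' hw hw' => rw [mul_add, map_add, hw, hw', map_add, mul_add]
        | tmul x' y' =>
          ext a b
          simp only [Algebra.TensorProduct.tmul_mul_tmul, TensorProduct.lift.tmul,
            LinearMap.mk₂_apply, map_mul, Matrix.mul_apply, Matrix.of_apply, Finset.sum_smul,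
            smul_mul_smul_comm] }

/-- Apply a matrix representation to the right factor of `A ⊗ B`. -/
noncomputable def evalRight (ε : B →ₙₐ[K] Matrix n n K) : A ⊗[K] B →ₙₐ[K] Matrix n n A :=
  (evalLeft ε).comp (nonUnital (Algebra.TensorProduct.comm K A B).toAlgHom)

theorem evalLeft_tmul (ε : A →ₙₐ[K] Matrix n n K) (x : A) (y : B) (a b : n) :
    evalLeft ε (x ⊗ₜ[K] y) a b = ε x a b • y := rfl

theorem evalRight_tmul (ε : B →ₙₐ[K] Matrix n n K) (x : A) (y : B) (a b : n) :
    evalRight ε (x ⊗ₜ[K] y) a b = ε y a b • x := rfl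

theorem pmap_evalLeft_tser {σ : Type*} (ε : A →ₙₐ[K] Matrix n n K) {x : MvPowerSeries σ A}
    {m : Matrix n n K} (hx : pmap ε x = C m) (y : MvPowerSeries σ B) (d : σ →₀ ℕ) (a b : n) :
    pmap (evalLeft ε) (tser K x y) d a b = m a b • y d := by
  rw [← MvPowerSeries.coeff_apply (pmap _ _), coeff_pmap, coeff_tser, map_sum, Matrix.sum_apply]
  simp only [evalLeft_tmul, ← coeff_pmap ε, hx, MvPowerSeries.coeff_C]
  rw [Finset.sum_eq_single (0, d)]
  · rw [if_pos rfl]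
    rfl
  · intro p hp hne
    rw [Finset.HasAntidiagonal.mem_antidiagonal] at hp
    rw [if_neg, Matrix.zero_apply, zero_smul]
    intro h0
    rw [h0, zero_add] at hp
    exact hne (Prod.ext h0 hp)
  · intro h
    exact absurd (Finset.HasAntidiagonal.mem_antidiagonal.mpr (zero_add d)) h

theorem pmap_evalRight_tser {σ : Type*} (ε : B →ₙₐ[K] Matrix n n K) (x : MvPowerSeries σ A)
    {y : MvPowerSeries σ B} {m : Matrix n n K} (hy : pmap ε y = C m) (d : σ →₀ ℕ) (a b : n) :
    pmap (evalRight ε) (tser K x y) d a b = m a b • x d := by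
  rw [← MvPowerSeries.coeff_apply (pmap _ _), coeff_pmap, coeff_tser, map_sum, Matrix.sum_apply]
  simp only [evalRight_tmul, ← coeff_pmap ε, hy, MvPowerSeries.coeff_C]
  rw [Finset.sum_eq_single (d, 0)]
  · rw [if_pos rfl]
    rfl
  · intro p hp hne
    rw [Finset.HasAntidiagonal.mem_antidiagonal] at hp
    rw [if_neg, Matrix.zero_apply, zero_smul]
    intro h0
    rw [h0, add_zero] at hp
    exact hne (Prod.ext hp h0)
  · intro h
    exact absurd (Finset.HasAntidiagonal.mem_antidiagonal.mpr (add_zero d)) h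

variable (K) in
/-- The Peirce decomposition of an algebra with respect to a decomposition of `1` as a sum of
orthogonal idempotents, as a homomorphism to matrices. -/
noncomputable def peirce (u : n → A) (hu : ∀ a b, u a * u b = if a = b then u a else 0)
    (h1 : ∑ a, u a = 1) : A →ₙₐ[K] Matrix n n A where
  toFun x := Matrix.of fun a b => u a * x * u b
  map_smul' r x := by ext; simp
  map_zero' := by ext; simp
  map_add' x y := by ext; simp [mul_add, add_mul]
  map_mul' x y := by
    ext a b
    rw [Matrix.mul_apply]
    have : ∀ c, u a * x * u c * (u c * y * u b) = u a * x * u c * (y * u b) := fun c => by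
      rw [mul_assoc (u c), ← mul_assoc _ (u c) (y * _), mul_assoc _ (u c) (u c), hu, if_pos rfl]
    simp only [Matrix.of_apply, this]
    rw [← Finset.sum_mul, ← Finset.mul_sum, h1, mul_one]
    simp only [mul_assoc]

end Evaluation

theorem counitUnit_apply {π : Type*} [Groupoid π] (K : Type*) [CommRing K] (f : Arr π) (a b : π) :
    counitUnit π K f a b = if f = Arr.one a ∧ a = b then 1 else 0 := by
  rw [counitUnit]
  by_cases h : f = Arr.one f.src
  · rw [if_pos h, Matrix.single_apply]
    congr 1
    rw [eq_iff_iff]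
    constructor
    · rintro ⟨rfl, rfl⟩
      exact ⟨h, rfl⟩
    · rintro ⟨rfl, rfl⟩
      exact ⟨rfl, rfl⟩
  · rw [if_neg h, if_neg]
    · rfl
    · rintro ⟨rfl, -⟩
      exact h rfl

/-! ### The counit -/

section RQACounit

open MvPowerSeries (coeff C)

variable {π : Type*} [Groupoid π] [Fintype π] [∀ a b : π, Fintype (a ⟶ b)] {X : Type*} [Fintype X]
  {deg : X → Arr π} {K : Type*} [CommRing K] [Algebra ℂ K] {P : Pairing deg} {L lam : ℂ}
  {cVV cVsV cVsVs : Coeff X (MvPowerSeries (Fin 2) ℂ)}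

namespace RQA

local notation "𝓐" => RQA K P L lam cVV cVsV cVsVs
local notation "𝔤" => gen K P L lam cVV cVsV cVsVs
local notation "𝓒" => component K P L lam cVV cVsV cVsVs
local notation "Δ" => cop K P L lam cVV cVsV cVsVs

/-- The counit as a homomorphism to the convolution algebra of the pair groupoid. -/
structure IsCounit (ε : 𝓐 →ₙₐ[K] Matrix π π K) : Prop where
  apply_one : ε 1 = 1
  map_e : ∀ f, ε (𝔤 (.e f)) = counitUnit π K f
  map_T : ∀ i j, pmap ε (serT 𝔤 i j) = if i = j then C (arrUnit K (deg i)) else 0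
  map_Ts : ∀ i j, pmap ε (serTs 𝔤 i j) = if i = j then C (arrUnit K (deg i).inv) else 0
  map_xi : ∀ s, pmap ε (serXi 𝔤 s) = 1

theorem exists_counit [Quiver.IsThin π] (hVV : IsGradedCoeff deg deg cVV)
    (hVsV : IsGradedCoeff (fun i => (deg i).inv) deg cVsV)
    (hVsVs : IsGradedCoeff (fun i => (deg i).inv) (fun i => (deg i).inv) cVsVs) :
    ∃ ε : 𝓐 →ₙₐ[K] Matrix π π K, IsCounit ε := by
  obtain ⟨ε, h1, he, hT, hTs, hxi⟩ := exists_hom (isRep_counitData (P := P) (L := L) (lam := lam)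
    (K := K) hVV hVsV hVsVs)
  exact ⟨ε, h1, he, fun i j => (hT i j).trans (Matrix.diagonal_apply _ _ _),
    fun i j => (hTs i j).trans (Matrix.diagonal_apply _ _ _), hxi⟩

/-- The counit as a linear map to the unit of the horizontal tensor product. -/
noncomputable def counitMap (ε : 𝓐 →ₙₐ[K] Matrix π π K) : 𝓐 →ₗ[K] (Arr π → K) where
  toFun x u := ε x u.src u.tgt
  map_add' x y := by
    funext u
    simp
  map_smul' r x := by
    funext u
    simp

namespace IsCounit

variable {ε : RQA K P L lam cVV cVsV cVsVs →ₙₐ[K] Matrix π π K}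
  (hε : IsCounit ε)
include hε

theorem apply_T (i j : X) (d) : ε (serT 𝔤 i j d) =
    if i = j ∧ d = 0 then arrUnit K (deg i) else 0 := by
  have h := congrArg (coeff d) (hε.map_T i j)
  rw [coeff_pmap, apply_ite (coeff d), MvPowerSeries.coeff_C, map_zero, ← ite_and] at h
  exact h

theorem apply_Ts (i j : X) (d) : ε (serTs 𝔤 i j d) =
    if i = j ∧ d = 0 then arrUnit K (deg i).inv else 0 := by
  have h := congrArg (coeff d) (hε.map_Ts i j)
  rw [coeff_pmap, apply_ite (coeff d), MvPowerSeries.coeff_C, map_zero, ← ite_and] at h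
  exact h

theorem apply_xi (s : Bool) (d) : ε (serXi 𝔤 s d) = if d = 0 then 1 else 0 := by
  have h := congrArg (coeff d) (hε.map_xi s)
  rw [coeff_pmap, MvPowerSeries.coeff_one] at h
  exact h

variable [Quiver.IsThin π]

/-- The counit takes values in matrices supported on pairs of objects that are connected by an
arrow. -/
theorem apply_eq_zero (x : 𝓐) : ∀ a b : π, IsEmpty (a ⟶ b) → ε x a b = 0 := by
  have harr : ∀ (u : Arr π) (a b : π), IsEmpty (a ⟶ b) → arrUnit K u a b = 0 := by
    intro u a b h
    rw [arrUnit, Matrix.single_apply, if_neg]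
    rintro ⟨rfl, rfl⟩
    exact h.elim u.hom
  induction x using induction_ser with
  | zero => simp
  | add x y hx hy =>
    intro a b h
    rw [map_add, Matrix.add_apply, hx a b h, hy a b h, add_zero]
  | smul r x hx =>
    intro a b h
    rw [map_smul, Matrix.smul_apply, hx a b h, smul_zero]
  | mul x y hx hy =>
    intro a b h
    rw [map_mul, Matrix.mul_apply]
    refine Finset.sum_eq_zero fun c _ => ?_
    rcases isEmpty_or_nonempty (a ⟶ c) with h₁ | ⟨⟨u⟩⟩
    · rw [hx a c h₁, zero_mul]
    · rw [hy c b ⟨fun v => h.elim (u ≫ v)⟩, mul_zero]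
  | e f =>
    intro a b h
    rw [hε.map_e, counitUnit]
    split_ifs
    · exact harr (Arr.one f.src) a b h
    · rfl
  | T i j d =>
    intro a b h
    rw [hε.apply_T]
    split_ifs
    · exact harr _ a b h
    · rfl
  | Ts i j d =>
    intro a b h
    rw [hε.apply_Ts]
    split_ifs
    · exact harr _ a b h
    · rfl
  | xi s d =>
    intro a b h
    rw [hε.apply_xi]
    split_ifs
    · refine Matrix.one_apply_ne ?_
      rintro rfl
      exact h.elim (𝟙 a)
    · rfl

theorem mul_apply (x y : 𝓐) (w : Arr π) : ε (x * y) w.src w.tgt =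
    ∑ u : Arr π, ∑ v : Arr π,
      if Arr.IsComp u v w then ε x u.src u.tgt * ε y v.src v.tgt else 0 := by
  have h₁ : ∀ u : Arr π, (∑ v : Arr π,
      if Arr.IsComp u v w then ε x u.src u.tgt * ε y v.src v.tgt else 0) =
      if w.src = u.src then ε x w.src u.tgt * ε y u.tgt w.tgt else 0 := fun u => by
    split_ifs with h
    · rw [← sum_arr_between (ε x w.src u.tgt * ε y u.tgt w.tgt) u.tgt w.tgt]
      · refine Finset.sum_congr rfl fun v _ => ?_
        simp only [Arr.isComp_iff]
        split_ifs with h₁ h₂ h₂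
        · rw [h, h₁.1, h₁.2.2]
        · exact absurd ⟨h₁.1.symm, h₁.2.2.symm⟩ h₂
        · exact absurd ⟨h₂.1.symm, h, h₂.2.symm⟩ h₁
        · rfl
      · intro he
        rw [hε.apply_eq_zero y _ _ he, mul_zero]
    · refine Finset.sum_eq_zero fun v _ => if_neg ?_
      rw [Arr.isComp_iff]
      exact fun h' => h h'.2.1
  simp only [h₁]
  rw [sum_arr fun a b => if w.src = a then ε x w.src b * ε y b w.tgt else 0]
  · rw [Finset.sum_eq_single w.src]
    · simp only [if_true]
      rw [map_mul, Matrix.mul_apply]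
    · intro a _ ha
      simp [ha.symm]
    · simp
  · intro a b he
    split_ifs with h
    · rw [hε.apply_eq_zero x w.src b (h ▸ he), zero_mul]
    · rfl

theorem apply_e (f w : Arr π) : ε (𝔤 (.e f)) w.src w.tgt =
    (if f = Arr.one f.src then Pi.single f 1 else 0 : Arr π → K) w := by
  rw [hε.map_e, counitUnit]
  split_ifs with h
  · rw [Matrix.single_apply, Pi.single_apply]
    congr 1
    rw [eq_iff_iff]
    constructor
    · rintro ⟨h₁, h₂⟩
      rw [h]
      exact Arr.ext_of_thin h₁.symm h₂.symm
    · intro hw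
      rw [hw, h]
      exact ⟨rfl, rfl⟩
  · rfl

/-- The counit preserves the degree: it vanishes on `x = e f * x * e f'` unless both `f` and `f'`
are identities, that is, unless the square is an identity square. -/
theorem apply_eq_zero_of_mem {γ : Sq π} {x : 𝓐} {u : Arr π} (hx : x ∈ 𝓒 γ) (hu : γ ≠ Sq.hid u) :
    ε x u.src u.tgt = 0 := by
  by_contra hne
  apply hu
  rw [← top_mul_of_mem hx, ← mul_bot_of_mem hx, map_mul, map_mul, hε.map_e, hε.map_e, counitUnit,
    counitUnit] at hne
  by_cases h₁ : γ.topArr = Arr.one γ.topArr.src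
  · by_cases h₂ : γ.botArr = Arr.one γ.botArr.src
    · rw [if_pos h₁, if_pos h₂] at hne
      have h₃ : γ.topArr.src = u.src := by
        by_contra h
        rw [Matrix.single_mul_apply_of_ne _ _ _ _ _ (Ne.symm h)] at hne
        exact hne rfl
      have h₄ : γ.botArr.src = u.tgt := by
        by_contra h
        rw [← mul_assoc, Matrix.mul_single_apply_of_ne _ _ _ _ _ (Ne.symm h)] at hne
        exact hne rfl
      exact Sq.ext_of_thin (h₁.trans (congrArg Arr.one h₃)) (h₂.trans (congrArg Arr.one h₄))
    · rw [if_neg h₂, mul_zero, mul_zero] at hne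
      exact absurd rfl hne
  · rw [if_neg h₁, zero_mul] at hne
    exact absurd rfl hne

theorem sumForm_counitMap (x : 𝓐) : sumForm K (counitMap ε x) = ∑ a, ∑ b, ε x a b := by
  rw [← sum_arr _ (hε.apply_eq_zero x)]
  simp [sumForm, counitMap]

theorem lid_eq_sum (z : 𝓐 ⊗[K] 𝓐) :
    TensorProduct.lid K 𝓐 ((sumForm K ∘ₗ counitMap ε).rTensor 𝓐 z) =
      ∑ a, ∑ b, evalLeft ε z a b := by
  induction z using TensorProduct.induction_on with
  | zero => simp
  | add z w hz hw => simp only [map_add, hz, hw, Matrix.add_apply, Finset.sum_add_distrib]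
  | tmul x y =>
    rw [LinearMap.rTensor_tmul, TensorProduct.lid_tmul, LinearMap.comp_apply,
      hε.sumForm_counitMap]
    simp only [evalLeft_tmul, Finset.sum_smul]

theorem rid_eq_sum (z : 𝓐 ⊗[K] 𝓐) :
    TensorProduct.rid K 𝓐 ((sumForm K ∘ₗ counitMap ε).lTensor 𝓐 z) =
      ∑ a, ∑ b, evalRight ε z a b := by
  induction z using TensorProduct.induction_on with
  | zero => simp
  | add z w hz hw => simp only [map_add, hz, hw, Matrix.add_apply, Finset.sum_add_distrib]
  | tmul x y =>
    rw [LinearMap.lTensor_tmul, TensorProduct.rid_tmul, LinearMap.comp_apply,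
      hε.sumForm_counitMap]
    simp only [evalRight_tmul, Finset.sum_smul]

theorem evalLeft_cop_e (f : Arr π) (a b : π) : evalLeft ε (Δ (𝔤 (.e f))) a b =
    srcU (fun f => 𝔤 (.e f)) a * 𝔤 (.e f) * srcU (fun f => 𝔤 (.e f)) b := by
  rw [units.srcU_mul, cop_e, copUnit, map_sum, Matrix.sum_apply, Finset.sum_eq_single (Arr.one a),
    map_sum, Matrix.sum_apply, Finset.sum_eq_single f]
  · by_cases ha : f.src = a
    · subst ha
      have hf : Arr.IsComp (Arr.one f.src) f f := Arr.isComp_iff.mpr ⟨rfl, rfl, rfl⟩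
      rw [if_pos hf, evalLeft_tmul, hε.map_e, counitUnit_apply,
        if_pos rfl, units.mul_srcU]
      by_cases hb : f.src = b
      · rw [if_pos ⟨rfl, hb⟩, if_pos hb, one_smul]
      · rw [if_neg fun h => hb h.2, if_neg hb, zero_smul]
    · rw [if_neg fun h => ha (Arr.isComp_iff.mp h).2.1, if_neg ha, map_zero, zero_mul]
      rfl
  · intro h _ hh
    rw [if_neg, map_zero, Matrix.zero_apply]
    intro h'
    rw [Arr.isComp_iff] at h'
    exact hh (Arr.ext_of_thin (h'.1.symm.trans h'.2.1.symm) h'.2.2.symm)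
  · simp
  · intro g _ hg
    rw [map_sum, Matrix.sum_apply]
    refine Finset.sum_eq_zero fun h _ => ?_
    split_ifs
    · rw [evalLeft_tmul, hε.map_e, counitUnit_apply, if_neg fun h' => hg h'.1, zero_smul]
    · rw [map_zero, Matrix.zero_apply]
  · simp

theorem evalRight_cop_e (f : Arr π) (a b : π) : evalRight ε (Δ (𝔤 (.e f))) a b =
    tgtU (fun f => 𝔤 (.e f)) a * 𝔤 (.e f) * tgtU (fun f => 𝔤 (.e f)) b := by
  rw [units.tgtU_mul, cop_e, copUnit, Finset.sum_comm, map_sum, Matrix.sum_apply,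
    Finset.sum_eq_single (Arr.one a), map_sum, Matrix.sum_apply, Finset.sum_eq_single f]
  · by_cases ha : f.tgt = a
    · subst ha
      have hf : Arr.IsComp f (Arr.one f.tgt) f := Arr.isComp_iff.mpr ⟨rfl, rfl, rfl⟩
      rw [if_pos hf, evalRight_tmul, hε.map_e, counitUnit_apply,
        if_pos rfl, units.mul_tgtU]
      by_cases hb : f.tgt = b
      · rw [if_pos ⟨rfl, hb⟩, if_pos hb, one_smul]
      · rw [if_neg fun h => hb h.2, if_neg hb, zero_smul]
    · rw [if_neg fun h => ha (Arr.isComp_iff.mp h).2.2, if_neg ha, map_zero, zero_mul]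
      rfl
  · intro h _ hh
    rw [if_neg, map_zero, Matrix.zero_apply]
    intro h'
    rw [Arr.isComp_iff] at h'
    exact hh (Arr.ext_of_thin h'.2.1.symm (h'.1.trans h'.2.2.symm))
  · simp
  · intro g _ hg
    rw [map_sum, Matrix.sum_apply]
    refine Finset.sum_eq_zero fun h _ => ?_
    split_ifs
    · rw [evalRight_tmul, hε.map_e, counitUnit_apply, if_neg fun h' => hg h'.1, zero_smul]
    · rw [map_zero, Matrix.zero_apply]
  · simp

/-- Evaluation of the left tensor factor of the coproduct by the counit gives the Peirce matrix with
respect to the sources. Both sides are homomorphisms, so it suffices to compare them on generators;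
the sum of the entries is the left counit axiom. -/
theorem evalLeft_cop (x : 𝓐) (a b : π) : evalLeft ε (Δ x) a b =
    srcU (fun f => 𝔤 (.e f)) a * x * srcU (fun f => 𝔤 (.e f)) b := by
  let φ := (evalLeft (B := 𝓐) ε).comp Δ
  let ψ := peirce K (srcU fun f => 𝔤 (.e f)) units.srcU_mul_srcU units.sum_srcU
  suffices h : φ x = ψ x from congrFun (congrFun h a) b
  have he : ∀ f, φ (𝔤 (.e f)) = ψ (𝔤 (.e f)) := fun f => by
    ext a b
    exact hε.evalLeft_cop_e f a b
  have hhom : ∀ (d : X → Arr π) (F : Matrix X X (MvPowerSeries (Fin 2) 𝓐)),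
      IsHomog (fun f => 𝔤 (.e f)) d F →
      (∀ i j, pmap ε (F i j) = if i = j then C (arrUnit K (d i)) else 0) →
      (∀ i j, pmap Δ (F i j) = ∑ k, tser K (F i k) (F k j)) →
      ∀ i j, pmap φ (F i j) = pmap ψ (F i j) := by
    intro d F hF hFε hFΔ i j
    have : pmap φ (F i j) = pmap (evalLeft ε) (∑ k, tser K (F i k) (F k j)) := by
      rw [← hFΔ]
      rfl
    rw [this, pmap_sum]
    ext c a b
    rw [map_sum, Matrix.sum_apply, Finset.sum_eq_single i]
    · rw [MvPowerSeries.coeff_apply, pmap_evalLeft_tser ε ((hFε i i).trans (if_pos rfl)), arrUnit,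
        Matrix.single_apply]
      have h₁ := congrArg (coeff c) (hF.src_mul_eq units i j a)
      have h₂ := congrArg (coeff c) (hF.mul_src_eq units i j b)
      rw [MvPowerSeries.coeff_C_mul, MvPowerSeries.coeff_apply] at h₁
      rw [MvPowerSeries.coeff_mul_C, MvPowerSeries.coeff_apply] at h₂
      change _ = srcU _ a * F i j c * srcU _ b
      rw [h₁]
      by_cases ha : a = (d i).src
      · rw [if_pos ha, MvPowerSeries.coeff_apply, h₂]
        by_cases hb : (d i).tgt = b
        · rw [if_pos hb, if_pos ⟨ha.symm, hb⟩, one_smul]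
          rfl
        · rw [if_neg hb, if_neg fun h => hb h.2, zero_smul, map_zero]
      · rw [if_neg ha, if_neg fun h => ha h.1.symm, zero_smul, map_zero, zero_mul]
    · intro k _ hk
      rw [MvPowerSeries.coeff_apply, pmap_evalLeft_tser ε (m := 0), Matrix.zero_apply, zero_smul]
      rw [hFε, if_neg hk.symm, map_zero]
    · simp
  refine nonUnital_ext (φ := φ) (ψ := ψ) he (hhom deg _ homT hε.map_T cop_T)
    (hhom (fun i => (deg i).inv) _ homTs hε.map_Ts cop_Ts) (fun s => ?_) x
  have h1 : φ 1 = ψ 1 := by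
    rw [← units.sum, map_sum, map_sum]
    exact Finset.sum_congr rfl fun f _ => he f
  have : pmap φ (serXi 𝔤 s) =
      C (φ 1) * pmap (evalLeft ε) (tser K (serXi 𝔤 s) (serXi 𝔤 s)) := by
    have h : φ 1 = evalLeft ε (copE K fun f => 𝔤 (.e f)) := congrArg (evalLeft ε) cop_one
    rw [h, ← pmap_C, ← pmap_mul, ← cop_xi]
    rfl
  rw [this, h1]
  ext c a b
  rw [MvPowerSeries.coeff_C_mul, Matrix.mul_apply, Finset.sum_eq_single b]
  · rw [MvPowerSeries.coeff_apply, pmap_evalLeft_tser ε ((hε.map_xi s).trans (map_one C).symm),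
      Matrix.one_apply_eq, one_smul]
    change srcU (fun f => 𝔤 (.e f)) a * 1 * srcU (fun f => 𝔤 (.e f)) b * serXi 𝔤 s c =
      srcU (fun f => 𝔤 (.e f)) a * serXi 𝔤 s c * srcU (fun f => 𝔤 (.e f)) b
    rw [mul_one, mul_assoc, mul_assoc, (xi_central s c _).eq]
  · intro b' _ hb
    rw [MvPowerSeries.coeff_apply, pmap_evalLeft_tser ε ((hε.map_xi s).trans (map_one C).symm),
      Matrix.one_apply_ne hb, zero_smul, mul_zero]
  · simp

theorem counit_cop (x : 𝓐) :
    TensorProduct.lid K 𝓐 ((sumForm K ∘ₗ counitMap ε).rTensor 𝓐 (Δ x)) = x := by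
  rw [hε.lid_eq_sum]
  simp only [hε.evalLeft_cop, ← Finset.mul_sum, ← Finset.sum_mul, units.sum_srcU, one_mul, mul_one]

/-- Evaluation of the right tensor factor of the coproduct by the counit gives the Peirce matrix
with respect to the targets. -/
theorem evalRight_cop (x : 𝓐) (a b : π) : evalRight ε (Δ x) a b =
    tgtU (fun f => 𝔤 (.e f)) a * x * tgtU (fun f => 𝔤 (.e f)) b := by
  let φ := (evalRight (A := 𝓐) ε).comp Δ
  let ψ := peirce K (tgtU fun f => 𝔤 (.e f)) units.tgtU_mul_tgtU units.sum_tgtU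
  suffices h : φ x = ψ x from congrFun (congrFun h a) b
  have he : ∀ f, φ (𝔤 (.e f)) = ψ (𝔤 (.e f)) := fun f => by
    ext a b
    exact hε.evalRight_cop_e f a b
  have hhom : ∀ (d : X → Arr π) (F : Matrix X X (MvPowerSeries (Fin 2) 𝓐)),
      IsHomog (fun f => 𝔤 (.e f)) d F →
      (∀ i j, pmap ε (F i j) = if i = j then C (arrUnit K (d i)) else 0) →
      (∀ i j, pmap Δ (F i j) = ∑ k, tser K (F i k) (F k j)) →
      ∀ i j, pmap φ (F i j) = pmap ψ (F i j) := by
    intro d F hF hFε hFΔ i j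
    have : pmap φ (F i j) = pmap (evalRight ε) (∑ k, tser K (F i k) (F k j)) := by
      rw [← hFΔ]
      rfl
    rw [this, pmap_sum]
    ext c a b
    rw [map_sum, Matrix.sum_apply, Finset.sum_eq_single j]
    · rw [MvPowerSeries.coeff_apply, pmap_evalRight_tser ε _ ((hFε j j).trans (if_pos rfl)),
        arrUnit, Matrix.single_apply]
      have h₁ := congrArg (coeff c) (hF.tgt_mul_eq units i j a)
      have h₂ := congrArg (coeff c) (hF.mul_tgt_eq units i j b)
      rw [MvPowerSeries.coeff_C_mul, MvPowerSeries.coeff_apply] at h₁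
      rw [MvPowerSeries.coeff_mul_C, MvPowerSeries.coeff_apply] at h₂
      change _ = tgtU _ a * F i j c * tgtU _ b
      rw [h₁]
      by_cases ha : a = (d j).src
      · rw [if_pos ha, MvPowerSeries.coeff_apply, h₂]
        by_cases hb : (d j).tgt = b
        · rw [if_pos hb, if_pos ⟨ha.symm, hb⟩, one_smul]
          rfl
        · rw [if_neg hb, if_neg fun h => hb h.2, zero_smul, map_zero]
      · rw [if_neg ha, if_neg fun h => ha h.1.symm, zero_smul, map_zero, zero_mul]
    · intro k _ hk
      rw [MvPowerSeries.coeff_apply, pmap_evalRight_tser ε _ (m := 0), Matrix.zero_apply, zero_smul]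
      rw [hFε, if_neg hk, map_zero]
    · simp
  refine nonUnital_ext (φ := φ) (ψ := ψ) he (hhom deg _ homT hε.map_T cop_T)
    (hhom (fun i => (deg i).inv) _ homTs hε.map_Ts cop_Ts) (fun s => ?_) x
  have h1 : φ 1 = ψ 1 := by
    rw [← units.sum, map_sum, map_sum]
    exact Finset.sum_congr rfl fun f _ => he f
  have : pmap φ (serXi 𝔤 s) =
      C (φ 1) * pmap (evalRight ε) (tser K (serXi 𝔤 s) (serXi 𝔤 s)) := by
    have h : φ 1 = evalRight ε (copE K fun f => 𝔤 (.e f)) := congrArg (evalRight ε) cop_one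
    rw [h, ← pmap_C, ← pmap_mul, ← cop_xi]
    rfl
  rw [this, h1]
  ext c a b
  rw [MvPowerSeries.coeff_C_mul, Matrix.mul_apply, Finset.sum_eq_single b]
  · rw [MvPowerSeries.coeff_apply, pmap_evalRight_tser ε _ ((hε.map_xi s).trans (map_one C).symm),
      Matrix.one_apply_eq, one_smul]
    change tgtU (fun f => 𝔤 (.e f)) a * 1 * tgtU (fun f => 𝔤 (.e f)) b * serXi 𝔤 s c =
      tgtU (fun f => 𝔤 (.e f)) a * serXi 𝔤 s c * tgtU (fun f => 𝔤 (.e f)) b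
    rw [mul_one, mul_assoc, mul_assoc, (xi_central s c _).eq]
  · intro b' _ hb
    rw [MvPowerSeries.coeff_apply, pmap_evalRight_tser ε _ ((hε.map_xi s).trans (map_one C).symm),
      Matrix.one_apply_ne hb, zero_smul, mul_zero]
  · simp

theorem cop_counit (x : 𝓐) :
    TensorProduct.rid K 𝓐 ((sumForm K ∘ₗ counitMap ε).lTensor 𝓐 (Δ x)) = x := by
  rw [hε.rid_eq_sum]
  simp only [hε.evalRight_cop, ← Finset.mul_sum, ← Finset.sum_mul, units.sum_tgtU, one_mul, mul_one]

end IsCounit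

end RQA

end RQACounit

/-! ### Series with coefficients in the opposite algebra -/

section Opposite

open MvPowerSeries (coeff C)

variable {X : Type*} {A : Type*} [Ring A]

theorem pmap_op_mul {σ : Type*} (x y : MvPowerSeries σ A) :
    pmap MulOpposite.op x * pmap MulOpposite.op y = pmap MulOpposite.op (y * x) := by
  have h := pmap_unop_mul (pmap MulOpposite.op x) (pmap MulOpposite.op y)
  exact congrArg (pmap MulOpposite.op) h

theorem pmap_op_sum {σ ι : Type*} (s : Finset ι) (x : ι → MvPowerSeries σ A) :
    pmap MulOpposite.op (∑ i ∈ s, x i) = ∑ i ∈ s, pmap MulOpposite.op (x i) :=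
  pmap_sum (MulOpposite.opAddEquiv (α := A)) s x

theorem pmap_op_C {σ : Type*} (x : A) :
    pmap MulOpposite.op (C x : MvPowerSeries σ A) = C (MulOpposite.op x) :=
  pmap_C (MulOpposite.opAddEquiv (α := A)) x

/-- A matrix of series, with coefficients in the opposite algebra. -/
def opMat (F : Matrix X X (MvPowerSeries (Fin 2) A)) :
    Matrix X X (MvPowerSeries (Fin 2) Aᵐᵒᵖ) := F.map (pmap MulOpposite.op)

/-- The matrix of the products `F'^{(2)}(u₂) F^{(1)}(u₁)`, where the entries of `F'` come first. -/
noncomputable def revPair (F F' : Matrix X X (MvPowerSeries (Fin 2) A)) :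
    Matrix (X × X) (X × X) (MvPowerSeries (Fin 3) A) :=
  Matrix.of fun p q => at2 (F' p.2 q.2) * at1 (F p.1 q.1)

/-- The matrix of the products `F^{(2)}(u₁) F'^{(1)}(u₂)`, where the entries of `F` come first. -/
noncomputable def revPair' (F F' : Matrix X X (MvPowerSeries (Fin 2) A)) :
    Matrix (X × X) (X × X) (MvPowerSeries (Fin 3) A) :=
  Matrix.of fun p q => at1 (F p.2 q.2) * at2 (F' p.1 q.1)

theorem pairMat_opMat (F F' : Matrix X X (MvPowerSeries (Fin 2) A)) :
    pairMat (opMat F) (opMat F') = (revPair F F').map (pmap MulOpposite.op) := by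
  ext1 p q
  rw [Matrix.map_apply, revPair, Matrix.of_apply, ← pmap_op_mul, ← at1_pmap _ rfl, ← at2_pmap _ rfl]
  rfl

theorem pairMat'_opMat (F F' : Matrix X X (MvPowerSeries (Fin 2) A)) :
    pairMat' (opMat F) (opMat F') = (revPair' F F').map (pmap MulOpposite.op) := by
  ext1 p q
  rw [Matrix.map_apply, revPair', Matrix.of_apply, ← pmap_op_mul, ← at1_pmap _ rfl,
    ← at2_pmap _ rfl]
  rfl

variable (K : Type*) [CommRing K] [Algebra ℂ K] [Algebra K A]

theorem op_scal (c : ℂ) : MulOpposite.op (scal K A c) = scal K Aᵐᵒᵖ c := rfl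

theorem pmap_op_coeffMat (c : Coeff X (MvPowerSeries (Fin 2) ℂ)) (p q : X × X) :
    pmap MulOpposite.op ((coeffMat K c : Matrix _ _ (MvPowerSeries (Fin 3) A)) p q) =
      coeffMat K c p q :=
  (at12_pmap MulOpposite.op rfl ((c p.1 p.2 q.1 q.2).map (scal K A))).symm

variable [Fintype X]

/-- Exchange relations for the opposite algebra. -/
theorem exchange_opMat {c : Coeff X (MvPowerSeries (Fin 2) ℂ)}
    {F F' : Matrix X X (MvPowerSeries (Fin 2) A)}
    (h : revPair F F' * coeffMat K c = coeffMat K c * revPair' F F') :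
    pairMat (opMat F) (opMat F') * coeffMat K c =
      coeffMat K c * pairMat' (opMat F) (opMat F') := by
  rw [pairMat_opMat, pairMat'_opMat]
  ext1 p q
  have h' := congrArg (pmap MulOpposite.op) (congrFun (congrFun h p) q)
  simp only [Matrix.mul_apply, pmap_op_sum] at h'
  simp only [Matrix.mul_apply, Matrix.map_apply, ← pmap_op_coeffMat, pmap_op_mul]
  refine Eq.trans (Finset.sum_congr rfl fun r _ => congrArg _ ?_)
    (h'.trans (Finset.sum_congr rfl fun r _ => congrArg _ ?_))
  · exact (commute_at12_scal K _ _).eq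
  · exact (commute_at12_scal K _ _).eq

/-- A product of matrices over the opposite algebra is the transpose of the reversed product. -/
theorem opMat_mul_scalMat_mul (F F' : Matrix X X (MvPowerSeries (Fin 2) A)) (w : X → X → ℂ)
    (i j : X) : (opMat F * scalMat K w * opMat F' : Matrix _ _ _) i j =
      pmap MulOpposite.op
        ((F'.transpose * scalMat K (fun i j => w j i) * F.transpose : Matrix _ _ _) j i) := by
  rw [mul_scalMat_mul_apply, mul_scalMat_mul_apply, Finset.sum_comm, pmap_op_sum]
  refine Finset.sum_congr rfl fun l _ => ?_
  rw [pmap_op_sum]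
  refine Finset.sum_congr rfl fun k _ => ?_
  rw [(commute_C_scal K (w k l) (F'.transpose j l * F.transpose k i)).eq, ← pmap_op_mul, pmap_op_C,
    ← pmap_op_mul]
  rfl

end Opposite

/-! ### Weak inverses of homogeneous matrices -/

section WeakInverse

open MvPowerSeries (coeff C)

variable {π : Type*} [Groupoid π] [Fintype π] [∀ a b : π, Fintype (a ⟶ b)] {X : Type*} [Fintype X]
  {A : Type*} [Ring A]

/-- The matrix `S` is a weak inverse of the homogeneous matrix `F`: the products `F S` and `S F` are
the diagonal matrices of the parts of the unit on which `F` is supported, and `S i j` has the degree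
of `F i j` turned around by the double inverse. -/
structure IsWeakInverse (e : Arr π → A) (d : X → Arr π)
    (F S : Matrix X X (MvPowerSeries (Fin 2) A)) : Prop where
  hom : IsHomog e d F
  mul_inv : F * S = Matrix.diagonal fun i => C (srcU e (d i).src)
  inv_mul : S * F = Matrix.diagonal fun i => C (tgtU e (d i).tgt)
  src_mul : ∀ i j, C (srcU e (d j).tgt) * S i j = S i j
  tgt_mul : ∀ i j, C (tgtU e (d i).tgt) * S i j = S i j
  mul_src : ∀ i j, S i j * C (srcU e (d j).src) = S i j
  mul_tgt : ∀ i j, S i j * C (tgtU e (d i).src) = S i j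

namespace IsWeakInverse

variable {E : A} {e : Arr π → A} (h : IsUnits E e) {d d' : X → Arr π}
  {F S F' S' : Matrix X X (MvPowerSeries (Fin 2) A)} (hF : IsWeakInverse e d F S)
  (hF' : IsWeakInverse e d' F' S')
include hF hF'

include h in
/-- The reversed product of weak inverses, multiplied by the product of the matrices. The two inner
factors are multiplied first; the part of the unit that they leave acts on the outer ones as `0` or
as the identity. -/
theorem revPair_mul_pairMat : revPair S S' * pairMat F F' = Matrix.diagonal fun p : X × X =>
    if (d p.1).tgt = (d' p.2).src then C (tgtU e (d' p.2).tgt) else 0 := by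
  have hSF : ∀ i j, ∑ k, at1 (S i k) * at1 (F k j) =
      if i = j then C (tgtU e (d j).tgt) else 0 := fun i j => by
    have := congrArg at1Hom (congrFun (congrFun hF.inv_mul i) j)
    rw [Matrix.mul_apply, map_sum, Matrix.diagonal_apply, apply_ite at1Hom, map_zero] at this
    simp only [map_mul] at this
    refine this.trans ?_
    split_ifs with hij
    · rw [hij]
      exact at1_C _
    · rfl
  have hSF' : ∀ i j, ∑ k, at2 (S' i k) * at2 (F' k j) =
      if i = j then C (tgtU e (d' j).tgt) else 0 := fun i j => by
    have := congrArg at2Hom (congrFun (congrFun hF'.inv_mul i) j)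
    rw [Matrix.mul_apply, map_sum, Matrix.diagonal_apply, apply_ite at2Hom, map_zero] at this
    simp only [map_mul] at this
    refine this.trans ?_
    split_ifs with hij
    · rw [hij]
      exact at2_C _
    · rfl
  have hmid : ∀ k j a, C (tgtU e a) * at2 (F' k j) = if a = (d' j).src then at2 (F' k j) else 0 :=
    fun k j a => by
      rw [← at2_C, ← at2_mul, hF'.hom.tgt_mul_eq h]
      split_ifs
      · rfl
      · exact map_zero at2Hom
  ext1 p q
  rw [Matrix.mul_apply, Fintype.sum_prod_type_right]
  have : ∀ r₂, ∑ r₁, revPair S S' p (r₁, r₂) * pairMat F F' (r₁, r₂) q =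
      if p.1 = q.1 then (if (d q.1).tgt = (d' q.2).src then
        at2 (S' p.2 r₂) * at2 (F' r₂ q.2) else 0) else 0 := fun r₂ => by
    have h1 : ∀ r₁, revPair S S' p (r₁, r₂) * pairMat F F' (r₁, r₂) q =
        at2 (S' p.2 r₂) * (at1 (S p.1 r₁) * at1 (F r₁ q.1)) * at2 (F' r₂ q.2) := fun r₁ => by
      simp only [revPair, pairMat, Matrix.of_apply, mul_assoc]
    simp only [h1]
    rw [← Finset.sum_mul, ← Finset.mul_sum, hSF]
    split_ifs with h2 h3
    · rw [mul_assoc, hmid, if_pos h3]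
    · rw [mul_assoc, hmid, if_neg h3, mul_zero]
    · rw [mul_zero, zero_mul]
  simp only [this]
  rw [Matrix.diagonal_apply]
  by_cases h₁ : p.1 = q.1
  · by_cases h₂ : (d q.1).tgt = (d' q.2).src
    · simp only [if_pos h₁, if_pos h₂]
      rw [hSF']
      by_cases h₃ : p.2 = q.2
      · rw [if_pos h₃, if_pos (Prod.ext h₁ h₃), h₁, h₃, if_pos h₂]
      · rw [if_neg h₃, if_neg fun h => h₃ (congrArg Prod.snd h)]
    · simp only [if_pos h₁, if_neg h₂, Finset.sum_const_zero]
      split_ifs with h₃ h₄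
      · rw [h₃] at h₄
        exact absurd h₄ h₂
      · rfl
      · rfl
  · simp only [if_neg h₁, Finset.sum_const_zero]
    rw [if_neg fun h => h₁ (congrArg Prod.fst h)]

include h in
/-- The analogue of `revPair_mul_pairMat` with the weak inverses on the right. -/
theorem pairMat'_mul_revPair' : pairMat' F F' * revPair' S S' = Matrix.diagonal fun p : X × X =>
    if (d' p.1).tgt = (d p.2).src then C (srcU e (d' p.1).src) else 0 := by
  have hFS : ∀ i j, ∑ k, at1 (F i k) * at1 (S k j) =
      if i = j then C (srcU e (d i).src) else 0 := fun i j => by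
    have := congrArg at1Hom (congrFun (congrFun hF.mul_inv i) j)
    rw [Matrix.mul_apply, map_sum, Matrix.diagonal_apply, apply_ite at1Hom, map_zero] at this
    simp only [map_mul] at this
    refine this.trans ?_
    split_ifs
    · exact at1_C _
    · rfl
  have hFS' : ∀ i j, ∑ k, at2 (F' i k) * at2 (S' k j) =
      if i = j then C (srcU e (d' i).src) else 0 := fun i j => by
    have := congrArg at2Hom (congrFun (congrFun hF'.mul_inv i) j)
    rw [Matrix.mul_apply, map_sum, Matrix.diagonal_apply, apply_ite at2Hom, map_zero] at this
    simp only [map_mul] at this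
    refine this.trans ?_
    split_ifs
    · exact at2_C _
    · rfl
  have hmid : ∀ i k a, at2 (F' i k) * C (srcU e a) = if (d' i).tgt = a then at2 (F' i k) else 0 :=
    fun i k a => by
      rw [← at2_C, ← at2_mul, hF'.hom.mul_src_eq h]
      split_ifs
      · rfl
      · exact map_zero at2Hom
  ext1 p q
  rw [Matrix.mul_apply, Fintype.sum_prod_type]
  have : ∀ r₁, ∑ r₂, pairMat' F F' p (r₁, r₂) * revPair' S S' (r₁, r₂) q =
      if p.2 = q.2 then (if (d' p.1).tgt = (d p.2).src then
        at2 (F' p.1 r₁) * at2 (S' r₁ q.1) else 0) else 0 := fun r₁ => by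
    have h1 : ∀ r₂, pairMat' F F' p (r₁, r₂) * revPair' S S' (r₁, r₂) q =
        at2 (F' p.1 r₁) * (at1 (F p.2 r₂) * at1 (S r₂ q.2)) * at2 (S' r₁ q.1) := fun r₂ => by
      simp only [revPair', pairMat', Matrix.of_apply, mul_assoc]
    simp only [h1]
    rw [← Finset.sum_mul, ← Finset.mul_sum, hFS]
    split_ifs with h2 h3
    · rw [hmid, if_pos h3]
    · rw [hmid, if_neg h3, zero_mul]
    · rw [mul_zero, zero_mul]
  simp only [this]
  rw [Matrix.diagonal_apply]
  by_cases h₁ : p.2 = q.2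
  · by_cases h₂ : (d' p.1).tgt = (d p.2).src
    · simp only [if_pos h₁, if_pos h₂]
      rw [hFS']
      by_cases h₃ : p.1 = q.1
      · rw [if_pos h₃, if_pos (Prod.ext h₃ h₁)]
      · rw [if_neg h₃, if_neg fun h => h₃ (congrArg Prod.fst h)]
    · simp only [if_pos h₁, if_neg h₂, Finset.sum_const_zero, ite_self]
  · simp only [if_neg h₁, Finset.sum_const_zero]
    rw [if_neg fun h => h₁ (congrArg Prod.snd h)]

variable {K : Type*} [CommRing K] [Algebra ℂ K] [Algebra K A]

/-- Exchange relations for two matrices imply those for their weak inverses, with reversed products.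
The exchange relation is multiplied by the weak inverses of both sides; the diagonal matrices that
appear instead of `1` act trivially because the coefficients of the relation preserve the degree. -/
theorem exchange (h : IsUnits E e) {c : Coeff X (MvPowerSeries (Fin 2) ℂ)}
    (hc : IsGradedCoeff d d' c)
    (hx : pairMat F F' * coeffMat K c = coeffMat K c * pairMat' F F') :
    revPair S S' * coeffMat K c = coeffMat K c * revPair' S S' := by
  have key := congrArg (fun M => revPair S S' * M * revPair' S S') hx
  have hc0 : ∀ p q : X × X, c p.1 p.2 q.1 q.2 = 0 →
      (coeffMat K c : Matrix _ _ (MvPowerSeries (Fin 3) A)) p q = 0 := fun p q h0 => by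
    rw [coeffMat, Matrix.of_apply, h0, map_zero, at12_zero]
  have hl : revPair S S' * (pairMat F F' * coeffMat K c) * revPair' S S' =
      coeffMat K c * revPair' S S' := by
    rw [← Matrix.mul_assoc, hF.revPair_mul_pairMat h hF']
    have h₁ : (Matrix.diagonal fun p : X × X =>
        if (d p.1).tgt = (d' p.2).src then (C (tgtU e (d' p.2).tgt) : MvPowerSeries (Fin 3) A)
        else 0) * coeffMat K c =
        coeffMat K c * Matrix.diagonal fun p : X × X => C (tgtU e (d p.2).tgt) := by
      ext1 p q
      rw [Matrix.diagonal_mul, Matrix.mul_diagonal]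
      by_cases h0 : c p.1 p.2 q.1 q.2 = 0
      · rw [hc0 p q h0, mul_zero, zero_mul]
      · obtain ⟨h₁, -, -, h₄⟩ := hc _ _ _ _ h0
        rw [if_pos h₁, h₄]
        exact (commute_at12_scal K _ _).eq.symm
    rw [h₁, Matrix.mul_assoc]
    congr 1
    ext1 p q
    rw [Matrix.diagonal_mul, revPair', Matrix.of_apply, ← mul_assoc, ← at1_C, ← at1_mul,
      hF.tgt_mul]
  have hr : revPair S S' * (coeffMat K c * pairMat' F F') * revPair' S S' =
      revPair S S' * coeffMat K c := by
    rw [Matrix.mul_assoc, Matrix.mul_assoc, hF.pairMat'_mul_revPair' h hF']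
    have h₁ : (coeffMat K c * Matrix.diagonal fun p : X × X =>
        if (d' p.1).tgt = (d p.2).src then (C (srcU e (d' p.1).src) : MvPowerSeries (Fin 3) A)
        else 0) = (Matrix.diagonal fun p : X × X => C (srcU e (d p.1).src)) * coeffMat K c := by
      ext1 p q
      rw [Matrix.diagonal_mul, Matrix.mul_diagonal]
      by_cases h0 : c p.1 p.2 q.1 q.2 = 0
      · rw [hc0 p q h0, mul_zero, zero_mul]
      · obtain ⟨-, h₂, h₃, -⟩ := hc _ _ _ _ h0
        rw [if_pos h₂, h₃]
        exact (commute_at12_scal K _ _).eq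
    rw [h₁, ← Matrix.mul_assoc]
    congr 1
    ext1 p q
    rw [Matrix.mul_diagonal, revPair, Matrix.of_apply, mul_assoc, ← at1_C, ← at1_mul, hF.mul_src]
  rw [hl, hr] at key
  exact key.symm

end IsWeakInverse

end WeakInverse

/-! ### The pairing -/

section Pairing

variable {π : Type*} [Groupoid π] {X : Type*} [Fintype X] {deg : X → Arr π} (P : Pairing deg)
  (K : Type*) [CommRing K] [Algebra ℂ K] (B : Type*) [Ring B] [Algebra K B]

namespace Pairing

/-- The quotient of the values of `G` at the source and the target of the degree of `e_i`. -/
noncomputable def ratio (i : X) : ℂ := P.G (deg i).src / P.G (deg i).tgt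

theorem ratio_ne_zero (i : X) : P.ratio i ≠ 0 := div_ne_zero (P.G_src_ne i) (P.G_tgt_ne i)

theorem omStar_eq (i j : X) : P.omStar i j = P.ratio j * P.om j i := rfl

theorem sgStar_eq (i j : X) : P.sgStar i j = (P.ratio i)⁻¹ * P.sg j i := by
  rw [ratio, inv_div, sgStar]

theorem omStar_sgStar (i j : X) : ∑ k, P.omStar i k * P.sgStar k j = if i = j then 1 else 0 := by
  rw [← (if_congr eq_comm rfl rfl : (if j = i then (1 : ℂ) else 0) = _), ← P.zigzag_dual]
  refine Finset.sum_congr rfl fun k _ => ?_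
  have := P.ratio_ne_zero k
  rw [omStar_eq, sgStar_eq]
  field_simp

theorem ratio_eq (i k : X) (h : deg i = deg k) : P.ratio i = P.ratio k := by
  rw [ratio, ratio, h]

theorem sgStar_omStar (i j : X) : ∑ k, P.sgStar i k * P.omStar k j = if i = j then 1 else 0 := by
  have h : ∀ k, P.sgStar i k * P.omStar k j =
      (P.ratio i)⁻¹ * P.ratio j * (P.om j k * P.sg k i) := fun k => by
    rw [omStar_eq, sgStar_eq]
    ring
  simp only [h]
  rw [← Finset.mul_sum, P.zigzag, if_congr eq_comm rfl rfl, mul_ite, mul_zero, mul_one]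
  split_ifs with hij
  · rw [hij, inv_mul_cancel₀ (P.ratio_ne_zero j)]
  · rfl

local notation "𝓢" => (scalMat K : (X → X → ℂ) → Matrix X X (MvPowerSeries (Fin 2) B))

theorem scalMat_om_sg : 𝓢 P.om * 𝓢 P.sg = 1 :=
  (scalMat_mul K _ _).trans (scalMat_one K _ P.zigzag)

theorem scalMat_sg_om : 𝓢 P.sg * 𝓢 P.om = 1 :=
  (scalMat_mul K _ _).trans (scalMat_one K _ P.zigzag_dual)

theorem scalMat_omStar_sgStar : 𝓢 P.omStar * 𝓢 P.sgStar = 1 :=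
  (scalMat_mul K _ _).trans (scalMat_one K _ P.omStar_sgStar)

theorem scalMat_sgStar_omStar : 𝓢 P.sgStar * 𝓢 P.omStar = 1 :=
  (scalMat_mul K _ _).trans (scalMat_one K _ P.sgStar_omStar)

end Pairing

end Pairing

/-! ### Complex matrices as matrices of series -/

section ScalarMatrices

open MvPowerSeries (C)

variable {X : Type*} {B : Type*} [Ring B] (K : Type*) [CommRing K] [Algebra ℂ K] [Algebra K B]

theorem shift_scalMat (L μ : ℂ) (w : X → X → ℂ) :
    (scalMat K w : Matrix X X (MvPowerSeries (Fin 2) B)).map (shift K L μ) = scalMat K w := by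
  ext1 i j
  exact shift_C K L μ _

theorem shift_matrix_shift (L μ ν : ℂ) (M : Matrix X X (MvPowerSeries (Fin 2) B)) :
    (M.map (shift K L ν)).map (shift K L μ) = M.map (shift K L (μ + ν)) := by
  ext1 i j
  exact shift_shift K L μ ν _

theorem shift_matrix_zero (L : ℂ) (M : Matrix X X (MvPowerSeries (Fin 2) B)) :
    M.map (shift K L 0) = M := by
  ext1 i j
  exact shift_zero K L _

theorem shift_diagonal (L μ : ℂ) (g : X → MvPowerSeries (Fin 2) B) :
    (Matrix.diagonal g).map (shift K L μ) = Matrix.diagonal fun i => shift K L μ (g i) :=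
  Matrix.diagonal_map (map_zero (shiftHom K L μ))

variable [Fintype X]

/-- The transposed matrices are inverse to each other in the reversed order. -/
theorem scalMat_transpose_mul {w w' : X → X → ℂ}
    (h : (scalMat K w * scalMat K w' : Matrix X X (MvPowerSeries (Fin 2) B)) = 1) :
    (scalMat K (fun i j => w' j i) * scalMat K (fun i j => w j i) :
      Matrix X X (MvPowerSeries (Fin 2) B)) = 1 := by
  rw [← Matrix.transpose_one, ← h]
  ext1 i j
  rw [Matrix.transpose_apply, Matrix.mul_apply, Matrix.mul_apply]
  exact Finset.sum_congr rfl fun k _ => (commute_C_scal K _ _).eq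

theorem scalMat_mul_mul_apply (M : Matrix X X (MvPowerSeries (Fin 2) B)) (w w' : X → X → ℂ)
    (i j : X) : (scalMat K w * M * scalMat K w' : Matrix _ _ _) i j =
      ∑ k, ∑ l, C (scal K B (w i k * w' l j)) * M k l := by
  simp only [Matrix.mul_apply, Finset.sum_mul]
  rw [Finset.sum_comm]
  refine Finset.sum_congr rfl fun k _ => Finset.sum_congr rfl fun l _ => ?_
  rw [scalMat, scalMat, Matrix.of_apply, Matrix.of_apply, ← (commute_C_scal K (w' l j) _).eq,
    mul_comm (w i k), map_mul, map_mul, mul_assoc]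

theorem transpose_scalMat_mul_mul (M : Matrix X X (MvPowerSeries (Fin 2) B)) (w w' : X → X → ℂ) :
    (scalMat K w * M * scalMat K w').transpose =
      scalMat K (fun i j => w' j i) * M.transpose * scalMat K (fun i j => w j i) := by
  ext1 i j
  rw [Matrix.transpose_apply, scalMat_mul_mul_apply, scalMat_mul_mul_apply, Finset.sum_comm]
  simp only [Matrix.transpose_apply, mul_comm (w j _)]

/-- A diagonal matrix commutes with a complex matrix whose blocks it respects. -/
theorem diagonal_mul_scalMat {w : X → X → ℂ} {g : X → MvPowerSeries (Fin 2) B}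
    (h : ∀ i j, w i j ≠ 0 → g i = g j) :
    Matrix.diagonal g * scalMat K w = scalMat K w * Matrix.diagonal g := by
  ext1 i j
  rw [Matrix.diagonal_mul, Matrix.mul_diagonal, scalMat, Matrix.of_apply,
    (commute_C_scal K (w i j) (g j)).eq]
  by_cases hw : w i j = 0
  · rw [hw, map_zero, map_zero, mul_zero, mul_zero]
  · rw [h i j hw]

theorem of_scal_mul (w : X → X → ℂ) (g : X → MvPowerSeries (Fin 2) B) :
    (Matrix.of fun i j => C (scal K B (w i j)) * g i) = Matrix.diagonal g * scalMat K w := by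
  ext1 i j
  rw [Matrix.diagonal_mul, Matrix.of_apply, scalMat, Matrix.of_apply,
    (commute_C_scal K (w i j) _).eq]

theorem shift_matrix_mul (L μ : ℂ) (M N : Matrix X X (MvPowerSeries (Fin 2) B)) :
    (M * N).map (shift K L μ) = M.map (shift K L μ) * N.map (shift K L μ) :=
  Matrix.map_mul (f := shiftHom K L μ)

end ScalarMatrices

/-! ### The antipode on the generating series -/

section Antipode

open MvPowerSeries (coeff C)

variable {π : Type*} [Groupoid π] {X : Type*} [Fintype X] {deg : X → Arr π}
  (K : Type*) [CommRing K] [Algebra ℂ K] (P : Pairing deg) (L lam : ℂ)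
  {B : Type*} [Ring B] [Algebra K B]

namespace RepData

variable (D : RepData π X B)

/-- The matrix of the series `ξ₂^-(u-λ) ∑ ω(e_i ⊗ e^k) (T^*)_{-l}^{-k}(u-λ) σ^{lj}`. -/
noncomputable def antT : Matrix X X (MvPowerSeries (Fin 2) B) :=
  Matrix.diagonal (fun _ => shift K L (-lam) (D.xi false)) *
    (scalMat K P.om * (D.Ts.map (shift K L (-lam))).transpose * scalMat K P.sg)

/-- The matrix of the series `∑ ω^*(e^i ⊗ e_k) T_l^k(u-λ) σ^{*lj}`. -/
noncomputable def antTs : Matrix X X (MvPowerSeries (Fin 2) B) :=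
  scalMat K P.omStar * (D.T.map (shift K L (-lam))).transpose * scalMat K P.sgStar

theorem antT_apply (i j : X) : D.antT K P L lam i j =
    shift K L (-lam) (D.xi false) *
      ∑ k, ∑ l, C (scal K B (P.om i k * P.sg l j)) * shift K L (-lam) (D.Ts l k) := by
  rw [antT, Matrix.diagonal_mul, scalMat_mul_mul_apply]
  rfl

theorem antTs_apply (i j : X) : D.antTs K P L lam i j =
    ∑ k, ∑ l, C (scal K B (P.omStar i k * P.sgStar l j)) * shift K L (-lam) (D.T l k) :=
  scalMat_mul_mul_apply K _ _ _ i j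

/-- The data in the opposite algebra that define the antipode. -/
noncomputable def antipode : RepData π X Bᵐᵒᵖ where
  E := 1
  e f := MulOpposite.op (D.e f.inv)
  T := opMat (D.antT K P L lam)
  Ts := opMat (D.antTs K P L lam)
  xi s := pmap MulOpposite.op (D.xi !s)

end RepData

theorem Arr.inv_inv {π : Type*} [Groupoid π] (f : Arr π) : f.inv.inv = f := by
  obtain ⟨a, b, f⟩ := f
  change (⟨a, b, Groupoid.inv (Groupoid.inv f)⟩ : Arr π) = _
  simp

variable [Fintype π] [∀ a b : π, Fintype (a ⟶ b)]

theorem sum_arr_inv {M : Type*} [AddCommMonoid M] (φ : Arr π → M) :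
    ∑ f : Arr π, φ f.inv = ∑ f : Arr π, φ f :=
  Fintype.sum_equiv ⟨Arr.inv, Arr.inv, Arr.inv_inv, Arr.inv_inv⟩ _ _ fun _ => rfl

theorem srcU_op_inv (e : Arr π → B) (a : π) :
    srcU (fun f => MulOpposite.op (e f.inv)) a = MulOpposite.op (tgtU e a) := by
  rw [tgtU, ← sum_arr_inv, Finset.op_sum]
  exact Finset.sum_congr rfl fun f _ => (apply_ite MulOpposite.op (f.src = a) _ _).symm

theorem tgtU_op_inv (e : Arr π → B) (a : π) :
    tgtU (fun f => MulOpposite.op (e f.inv)) a = MulOpposite.op (srcU e a) := by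
  rw [srcU, ← sum_arr_inv, Finset.op_sum]
  exact Finset.sum_congr rfl fun f _ => (apply_ite MulOpposite.op (f.tgt = a) _ _).symm

theorem isUnits_op_inv {e : Arr π → B} (h : IsUnits 1 e) :
    IsUnits 1 (fun f => MulOpposite.op (e f.inv)) where
  mul_self f := congrArg MulOpposite.op (h.mul_self f.inv)
  orth f f' hf := congrArg MulOpposite.op (h.orth f'.inv f.inv fun h' => hf <| by
    rw [← f.inv_inv, ← h', f'.inv_inv])
  sum := by
    rw [← Finset.op_sum, sum_arr_inv, h.sum, MulOpposite.op_one]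

namespace IsWeakInverse

variable {e : Arr π → B} {d : X → Arr π} {F S : Matrix X X (MvPowerSeries (Fin 2) B)}

/-- The antipode turns squares around by the double inverse, so a weak inverse is homogeneous of the
original degrees over the opposite algebra, with the components of the unit permuted by inversion.
-/
theorem isHomog_opMat (h : IsWeakInverse e d F S) :
    IsHomog (fun f => MulOpposite.op (e f.inv)) d (opMat S) where
  src_mul i j := by
    rw [srcU_op_inv, ← pmap_op_C]
    exact (pmap_op_mul _ _).trans (congrArg _ (h.mul_tgt i j))
  tgt_mul i j := by
    rw [tgtU_op_inv, ← pmap_op_C]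
    exact (pmap_op_mul _ _).trans (congrArg _ (h.mul_src i j))
  mul_src i j := by
    rw [srcU_op_inv, ← pmap_op_C]
    exact (pmap_op_mul _ _).trans (congrArg _ (h.tgt_mul i j))
  mul_tgt i j := by
    rw [tgtU_op_inv, ← pmap_op_C]
    exact (pmap_op_mul _ _).trans (congrArg _ (h.src_mul i j))

end IsWeakInverse

end Antipode

/-! ### Weak inverses of the generating matrices -/

section Antipode

open MvPowerSeries (coeff C)

variable {π : Type*} [Groupoid π] [Fintype π] [∀ a b : π, Fintype (a ⟶ b)] {X : Type*} [Fintype X]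
  {deg : X → Arr π} {K : Type*} [CommRing K] [Algebra ℂ K] {P : Pairing deg} {L lam : ℂ}
  {cVV cVsV cVsVs : Coeff X (MvPowerSeries (Fin 2) ℂ)} {B : Type*} [Ring B] [Algebra K B]

theorem C_mul_scal_shift {w : ℂ} {b : B} {F : MvPowerSeries (Fin 2) B} (h : w ≠ 0 → C b * F = F)
    (μ : ℂ) : C b * (C (scal K B w) * shift K L μ F) = C (scal K B w) * shift K L μ F := by
  by_cases hw : w = 0
  · rw [hw, map_zero, map_zero, zero_mul, mul_zero]
  · rw [← mul_assoc, ← (commute_C_scal K w (C b)).eq, mul_assoc]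
    congr 1
    rw [← shift_C K L μ, ← shift_mul, h hw]

theorem scal_shift_mul_C {w : ℂ} {b : B} {F : MvPowerSeries (Fin 2) B} (h : w ≠ 0 → F * C b = F)
    (μ : ℂ) : C (scal K B w) * shift K L μ F * C b = C (scal K B w) * shift K L μ F := by
  by_cases hw : w = 0
  · rw [hw, map_zero, map_zero, zero_mul, zero_mul]
  · rw [mul_assoc]
    congr 1
    rw [← shift_C K L μ, ← shift_mul, h hw]

namespace IsRep

variable {D : RepData π X B} (hD : IsRep K P L lam cVV cVsV cVsVs D)
include hD

/-- The inversion relation for `ω`, translated by `-λ` so that `T(u)` appears without translation.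
-/
theorem om_inv_shift : D.T * scalMat K P.om * (D.Ts.map (shift K L (-lam))).transpose =
    Matrix.diagonal (fun i => C (srcU D.e (deg i).src) * shift K L (-lam) (D.xi true)) *
      scalMat K P.om := by
  have h := congrArg (fun M => M.map (shift K L (-lam))) (hD.om_inv.trans (of_scal_mul K _ _))
  simpa only [shift_matrix_mul, shift_scalMat, shift_matrix_shift, neg_add_cancel,
    shift_matrix_zero, shift_diagonal, shift_mul, shift_C, ← Matrix.transpose_map] using h

/-- The inversion relation for `ω^*`, translated by `-λ`. -/
theorem omStar_inv_shift : D.Ts * scalMat K P.omStar * (D.T.map (shift K L (-lam))).transpose =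
    Matrix.diagonal (fun i => C (srcU D.e (deg i).tgt)) * scalMat K P.omStar := by
  have h := congrArg (fun M => M.map (shift K L (-lam))) (hD.omStar_inv.trans (of_scal_mul K _ _))
  simpa only [shift_matrix_mul, shift_scalMat, shift_matrix_shift, neg_add_cancel,
    shift_matrix_zero, shift_diagonal, shift_mul, shift_C, ← Matrix.transpose_map] using h

/-- The inversion relation for `σ`, translated by `-λ`. -/
theorem sg_inv_shift : (D.Ts.map (shift K L (-lam))).transpose * scalMat K P.sg * D.T =
    Matrix.diagonal (fun i => C (tgtU D.e (deg i).tgt) * shift K L (-lam) (D.xi true)) *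
      scalMat K P.sg := by
  have h := congrArg (fun M => M.map (shift K L (-lam))) (hD.sg_inv.trans (of_scal_mul K _ _))
  simpa only [shift_matrix_mul, shift_scalMat, shift_matrix_shift, neg_add_cancel,
    shift_matrix_zero, shift_diagonal, shift_mul, shift_C, ← Matrix.transpose_map] using h

/-- The inversion relation for `σ^*`, translated by `-λ`. -/
theorem sgStar_inv_shift : (D.T.map (shift K L (-lam))).transpose * scalMat K P.sgStar * D.Ts =
    Matrix.diagonal (fun i => C (tgtU D.e (deg i).src)) * scalMat K P.sgStar := by
  have h := congrArg (fun M => M.map (shift K L (-lam))) (hD.sgStar_inv.trans (of_scal_mul K _ _))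
  simpa only [shift_matrix_mul, shift_scalMat, shift_matrix_shift, neg_add_cancel,
    shift_matrix_zero, shift_diagonal, shift_mul, shift_C, ← Matrix.transpose_map] using h

variable (hE : D.E = 1) (hx : ∀ s a x, Commute (D.xi s a) x)

include hE in
theorem shift_xi_mul (μ : ℂ) (s : Bool) :
    shift K L μ (D.xi s) * shift K L μ (D.xi !s) = 1 := by
  rw [← shift_mul, hD.xi_mul, hE, shift_C, map_one]

omit [Fintype π] [∀ a b : π, Fintype (a ⟶ b)] [Fintype X] hD in
include hx in
theorem commute_shift_xi (μ : ℂ) (s : Bool) (x : MvPowerSeries (Fin 2) B) :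
    Commute (shift K L μ (D.xi s)) x :=
  commute_of_coeff fun a b => (hx s a (x b)).smul_left _

omit [Fintype π] [∀ a b : π, Fintype (a ⟶ b)] hD in
include hx in
theorem commute_diagonal_xi (μ : ℂ) (s : Bool) (M : Matrix X X (MvPowerSeries (Fin 2) B)) :
    Commute (Matrix.diagonal fun _ => shift K L μ (D.xi s)) M := by
  ext1 i j
  rw [Matrix.diagonal_mul, Matrix.mul_diagonal]
  exact (commute_shift_xi hx μ s _).eq

include hE hx in
/-- The factor `ξ₂^-(u-λ)` in `S(T(u))` cancels the factor `ξ₂^+(u-λ)` in the translated inversion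
relations. -/
theorem diagonal_xi_mul (g : X → B) : (Matrix.diagonal fun _ : X => shift K L (-lam) (D.xi false)) *
    (Matrix.diagonal fun i => C (g i) * shift K L (-lam) (D.xi true)) =
      Matrix.diagonal fun i => C (g i) := by
  rw [Matrix.diagonal_mul_diagonal]
  congr 1
  funext i
  rw [← (commute_shift_xi hx _ true (C (g i))).eq, ← mul_assoc]
  exact (congrArg (· * C (g i)) (hD.shift_xi_mul hE (-lam) false)).trans (one_mul _)

/-- The matrix `S(T(u))` is inverse to `T(u)`. -/
theorem isWeakInverse_antT (hE : D.E = 1) (hx : ∀ s a x, Commute (D.xi s a) x) :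
    IsWeakInverse D.e deg D.T (D.antT K P L lam) where
  hom := hD.homT
  mul_inv := by
    rw [RepData.antT, ← mul_assoc, ← (commute_diagonal_xi hx (-lam) false D.T).eq, mul_assoc,
      ← mul_assoc D.T, ← mul_assoc D.T, hD.om_inv_shift, mul_assoc, P.scalMat_om_sg, mul_one,
      hD.diagonal_xi_mul hE hx]
  inv_mul := by
    rw [RepData.antT, mul_assoc, mul_assoc (scalMat K P.om), mul_assoc (scalMat K P.om),
      hD.sg_inv_shift, ← mul_assoc (scalMat K P.om), ← diagonal_mul_scalMat, mul_assoc,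
      P.scalMat_om_sg, mul_one, hD.diagonal_xi_mul hE hx]
    intro i j h
    rw [P.graded i j h]
  src_mul i j := by
    rw [RepData.antT_apply, ← mul_assoc, ← (commute_shift_xi hx _ false (C _)).eq, mul_assoc]
    simp only [Finset.mul_sum]
    refine Finset.sum_congr rfl fun k _ => Finset.sum_congr rfl fun l _ => congrArg _ <|
      C_mul_scal_shift (fun h => ?_) (-lam)
    rw [← P.sg_graded l j (right_ne_zero_of_mul h)]
    exact hD.homTs.src_mul l k
  tgt_mul i j := by
    rw [RepData.antT_apply, ← mul_assoc, ← (commute_shift_xi hx _ false (C _)).eq, mul_assoc]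
    simp only [Finset.mul_sum]
    refine Finset.sum_congr rfl fun k _ => Finset.sum_congr rfl fun l _ => congrArg _ <|
      C_mul_scal_shift (fun h => ?_) (-lam)
    rw [P.graded i k (left_ne_zero_of_mul h)]
    exact hD.homTs.tgt_mul l k
  mul_src i j := by
    rw [RepData.antT_apply, mul_assoc]
    simp only [Finset.mul_sum, Finset.sum_mul]
    refine Finset.sum_congr rfl fun k _ => Finset.sum_congr rfl fun l _ => congrArg _ <|
      scal_shift_mul_C (fun h => ?_) (-lam)
    rw [← P.sg_graded l j (right_ne_zero_of_mul h)]
    exact hD.homTs.mul_src l k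
  mul_tgt i j := by
    rw [RepData.antT_apply, mul_assoc]
    simp only [Finset.mul_sum, Finset.sum_mul]
    refine Finset.sum_congr rfl fun k _ => Finset.sum_congr rfl fun l _ => congrArg _ <|
      scal_shift_mul_C (fun h => ?_) (-lam)
    rw [P.graded i k (left_ne_zero_of_mul h)]
    exact hD.homTs.mul_tgt l k

/-- The matrix `S(T^*(u))` is inverse to `T^*(u)`. -/
theorem isWeakInverse_antTs :
    IsWeakInverse D.e (fun i => (deg i).inv) D.Ts (D.antTs K P L lam) where
  hom := hD.homTs
  mul_inv := by
    rw [RepData.antTs, ← mul_assoc, ← mul_assoc, hD.omStar_inv_shift, mul_assoc,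
      P.scalMat_omStar_sgStar, mul_one]
    rfl
  inv_mul := by
    rw [RepData.antTs, mul_assoc (scalMat K P.omStar), mul_assoc (scalMat K P.omStar),
      hD.sgStar_inv_shift, ← mul_assoc (scalMat K P.omStar), ← diagonal_mul_scalMat, mul_assoc,
      P.scalMat_omStar_sgStar, mul_one]
    · rfl
    · intro i j h
      rw [P.omStar_graded i j h]
  src_mul i j := by
    rw [RepData.antTs_apply]
    simp only [Finset.mul_sum]
    refine Finset.sum_congr rfl fun k _ => Finset.sum_congr rfl fun l _ =>
      C_mul_scal_shift (fun h => ?_) (-lam)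
    rw [← P.sgStar_graded l j (right_ne_zero_of_mul h)]
    exact hD.homT.src_mul l k
  tgt_mul i j := by
    rw [RepData.antTs_apply]
    simp only [Finset.mul_sum]
    refine Finset.sum_congr rfl fun k _ => Finset.sum_congr rfl fun l _ =>
      C_mul_scal_shift (fun h => ?_) (-lam)
    rw [P.omStar_graded i k (left_ne_zero_of_mul h)]
    exact hD.homT.tgt_mul l k
  mul_src i j := by
    rw [RepData.antTs_apply]
    simp only [Finset.sum_mul]
    refine Finset.sum_congr rfl fun k _ => Finset.sum_congr rfl fun l _ =>
      scal_shift_mul_C (fun h => ?_) (-lam)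
    rw [← P.sgStar_graded l j (right_ne_zero_of_mul h)]
    exact hD.homT.mul_src l k
  mul_tgt i j := by
    rw [RepData.antTs_apply]
    simp only [Finset.sum_mul]
    refine Finset.sum_congr rfl fun k _ => Finset.sum_congr rfl fun l _ =>
      scal_shift_mul_C (fun h => ?_) (-lam)
    rw [P.omStar_graded i k (left_ne_zero_of_mul h)]
    exact hD.homT.mul_tgt l k

end IsRep

end Antipode

/-- In the product of `a x b`, `w` and `c y d` the inner factors `w c` cancel. If `x b y = v b`,
where `b` is inverse to `a`, what remains is `v d`. With generating matrices for `x`, `y` and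
matrices of the pairing for the other factors, this turns an inversion relation into one for the
antipode. -/
theorem mul_inner_left {M : Type*} [Monoid M] {a x b w c y d v : M} (hwc : w * c = 1)
    (hx : x * b * y = v * b) (ha : v * a = a * v) (hab : a * b = 1) :
    a * x * b * w * (c * y * d) = v * d := by
  calc a * x * b * w * (c * y * d) = a * x * b * (w * c) * y * d := by simp only [mul_assoc]
    _ = a * (x * b * y) * d := by rw [hwc, mul_one]; simp only [mul_assoc]
    _ = a * v * b * d := by rw [hx]; simp only [mul_assoc]
    _ = v * (a * b) * d := by rw [← ha]; simp only [mul_assoc]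
    _ = v * d := by rw [hab, mul_one]

/-- The mirror image of `mul_inner_left`. -/
theorem mul_inner_right {M : Type*} [Monoid M] {a x b w c y d v : M} (hbw : b * w = 1)
    (hx : x * c * y = v * c) (ha : v * a = a * v) (hcd : c * d = 1) :
    a * x * b * w * (c * y * d) = v * a := by
  calc a * x * b * w * (c * y * d) = a * x * (b * w) * c * y * d := by simp only [mul_assoc]
    _ = a * (x * c * y) * d := by rw [hbw, mul_one]; simp only [mul_assoc]
    _ = a * v * (c * d) := by rw [hx]; simp only [mul_assoc]
    _ = v * a := by rw [hcd, mul_one, ha]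

/-! ### The defining relations for the antipode -/

section Antipode

open MvPowerSeries (coeff C)

variable {π : Type*} [Groupoid π] [Fintype π] [∀ a b : π, Fintype (a ⟶ b)] {X : Type*} [Fintype X]
  {deg : X → Arr π} {K : Type*} [CommRing K] [Algebra ℂ K] {P : Pairing deg} {L lam : ℂ}
  {cVV cVsV cVsVs : Coeff X (MvPowerSeries (Fin 2) ℂ)} {B : Type*} [Ring B] [Algebra K B]

namespace IsRep

variable {D : RepData π X B} (hD : IsRep K P L lam cVV cVsV cVsVs D)

omit [Fintype π] [∀ a b : π, Fintype (a ⟶ b)] in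
theorem shift_antT : (D.antT K P L lam).map (shift K L lam) =
    Matrix.diagonal (fun _ => D.xi false) *
      (scalMat K P.om * D.Ts.transpose * scalMat K P.sg) := by
  simp only [RepData.antT, shift_matrix_mul, shift_diagonal, shift_scalMat, Matrix.transpose_map,
    shift_matrix_shift, shift_shift, add_neg_cancel, shift_matrix_zero, shift_zero]

omit [Fintype π] [∀ a b : π, Fintype (a ⟶ b)] in
theorem shift_antTs : (D.antTs K P L lam).map (shift K L lam) =
    scalMat K P.omStar * D.T.transpose * scalMat K P.sgStar := by
  simp only [RepData.antTs, shift_matrix_mul, shift_scalMat, Matrix.transpose_map,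
    shift_matrix_shift, add_neg_cancel, shift_matrix_zero]

variable (hE : D.E = 1) (hx : ∀ s a x, Commute (D.xi s a) x)

omit [Fintype π] [∀ a b : π, Fintype (a ⟶ b)] in
theorem transpose_shift_antT : ((D.antT K P L lam).map (shift K L lam)).transpose =
    Matrix.diagonal (fun _ => D.xi false) * (scalMat K (fun i j => P.sg j i) * D.Ts *
      scalMat K (fun i j => P.om j i)) := by
  rw [shift_antT, ← Matrix.transpose_transpose D.Ts, ← transpose_scalMat_mul_mul]
  ext1 i j
  rw [Matrix.transpose_apply, Matrix.diagonal_mul, Matrix.diagonal_mul]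
  rfl

omit [Fintype π] [∀ a b : π, Fintype (a ⟶ b)] in
theorem transpose_shift_antTs : ((D.antTs K P L lam).map (shift K L lam)).transpose =
    scalMat K (fun i j => P.sgStar j i) * D.T * scalMat K (fun i j => P.omStar j i) := by
  rw [shift_antTs, transpose_scalMat_mul_mul, Matrix.transpose_transpose]

omit [Fintype π] [∀ a b : π, Fintype (a ⟶ b)] in
include hx in
theorem mul_diagonal_xi (M N : Matrix X X (MvPowerSeries (Fin 2) B)) :
    M * (Matrix.diagonal (fun _ => D.xi false) * N) =
      Matrix.diagonal (fun _ => D.xi false) * (M * N) := by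
  have h : Commute (Matrix.diagonal fun _ => D.xi false) M := by
    ext1 i j
    rw [Matrix.diagonal_mul, Matrix.mul_diagonal]
    exact (commute_of_coeff fun a b => hx false a (M i j b) : Commute _ (M i j)).eq
  rw [← mul_assoc, ← h.eq, mul_assoc]

include hD

include hx in
/-- The inversion relation for `ω` in the opposite algebra, transposed. It follows from the relation
for `σ^*`. -/
theorem antipode_om_inv : D.antTs K P L lam * scalMat K (fun i j => P.om j i) *
    ((D.antT K P L lam).map (shift K L lam)).transpose =
      Matrix.diagonal (fun i => D.xi false * C (tgtU D.e (deg i).src)) *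
        scalMat K (fun i j => P.om j i) := by
  rw [transpose_shift_antT, mul_diagonal_xi hx, RepData.antTs, mul_inner_left
    (scalMat_transpose_mul K (P.scalMat_sg_om K B)) hD.sgStar_inv_shift
    (diagonal_mul_scalMat K fun i j h => by rw [P.omStar_graded i j h])
    (P.scalMat_omStar_sgStar K B), ← mul_assoc, Matrix.diagonal_mul_diagonal]

include hE hx in
/-- The inversion relation for `ω^*` in the opposite algebra, transposed. It follows from the
relation for `σ`. -/
theorem antipode_omStar_inv : D.antT K P L lam * scalMat K (fun i j => P.omStar j i) *
    ((D.antTs K P L lam).map (shift K L lam)).transpose =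
      Matrix.diagonal (fun i => C (tgtU D.e (deg i).tgt)) *
        scalMat K (fun i j => P.omStar j i) := by
  rw [transpose_shift_antTs, RepData.antT, mul_assoc, mul_assoc, ← mul_assoc (_ * _ * _),
    mul_inner_left
    (scalMat_transpose_mul K (P.scalMat_sgStar_omStar K B)) hD.sg_inv_shift
    (diagonal_mul_scalMat K fun i j h => by rw [P.graded i j h]) (P.scalMat_om_sg K B),
    ← mul_assoc, hD.diagonal_xi_mul hE hx]

/-- The inversion relation for `σ` in the opposite algebra, transposed. It follows from the relation
for `ω^*`. -/
theorem antipode_sg_inv : ((D.antT K P L lam).map (shift K L lam)).transpose *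
    scalMat K (fun i j => P.sg j i) * D.antTs K P L lam =
      Matrix.diagonal (fun i => D.xi false * C (srcU D.e (deg i).tgt)) *
        scalMat K (fun i j => P.sg j i) := by
  rw [transpose_shift_antT, RepData.antTs, mul_assoc, mul_assoc, ← mul_assoc (_ * _ * _),
    mul_inner_right
    (scalMat_transpose_mul K (P.scalMat_sg_om K B)) hD.omStar_inv_shift
    (diagonal_mul_scalMat K fun i j h => by rw [P.sg_graded j i h]) (P.scalMat_omStar_sgStar K B),
    ← mul_assoc, Matrix.diagonal_mul_diagonal]

include hE hx in
/-- The inversion relation for `σ^*` in the opposite algebra, transposed. It follows from the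
relation for `ω`. -/
theorem antipode_sgStar_inv : ((D.antTs K P L lam).map (shift K L lam)).transpose *
    scalMat K (fun i j => P.sgStar j i) * D.antT K P L lam =
      Matrix.diagonal (fun i => C (srcU D.e (deg i).src)) *
        scalMat K (fun i j => P.sgStar j i) := by
  rw [transpose_shift_antTs, RepData.antT, ← mul_assoc,
    ← (commute_diagonal_xi hx (-lam) false (_ : Matrix X X (MvPowerSeries (Fin 2) B))).eq,
    mul_assoc, mul_inner_right
    (scalMat_transpose_mul K (P.scalMat_sgStar_omStar K B)) hD.om_inv_shift
    (diagonal_mul_scalMat K fun i j h => by rw [P.sgStar_graded j i h]) (P.scalMat_om_sg K B),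
    ← mul_assoc, hD.diagonal_xi_mul hE hx]

variable (hVV : IsGradedCoeff deg deg cVV) (hVsV : IsGradedCoeff (fun i => (deg i).inv) deg cVsV)
  (hVsVs : IsGradedCoeff (fun i => (deg i).inv) (fun i => (deg i).inv) cVsVs)
include hE hx hVV hVsV hVsVs

/-- The matrices `S(T(u))`, `S(T^*(u))` and the series `S(ξ₂^±(u))` satisfy the defining relations
in the opposite algebra. -/
theorem antipode : IsRep K P L lam cVV cVsV cVsVs (D.antipode K P L lam) := by
  have hU : IsUnits 1 D.e := hE ▸ hD.units
  have wT := hD.isWeakInverse_antT hE hx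
  have wTs := hD.isWeakInverse_antTs
  have hc : ∀ s a y, Commute ((D.antipode K P L lam).xi s a) y := fun s a y =>
    congrArg MulOpposite.op (hx (!s) a y.unop).eq.symm
  have hsc : ∀ (w : X → X → ℂ) (g : X → MvPowerSeries (Fin 2) B) (i j : X),
      (w i j ≠ 0 → g i = g j) →
      pmap MulOpposite.op
        ((Matrix.diagonal g * scalMat K (fun i j => w j i) : Matrix X X _) j i) =
      C (scal K Bᵐᵒᵖ (w i j)) * pmap MulOpposite.op (g i) := fun w g i j h => by
    rw [Matrix.diagonal_mul, scalMat, Matrix.of_apply, ← op_scal, ← pmap_op_C, pmap_op_mul]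
    by_cases hw : w i j = 0
    · rw [hw, map_zero, map_zero, mul_zero, mul_zero]
    · rw [h hw]
  exact
  { units := isUnits_op_inv hU
    homT := wT.isHomog_opMat
    homTs := wTs.isHomog_opMat
    E_xi := fun s => (congrArg (· * _) (map_one C)).trans (one_mul _)
    comm_e := fun s a f => hc s a _
    comm_T := fun s a i j b => hc s a _
    comm_Ts := fun s a i j b => hc s a _
    comm_xi := fun s a s' b => hc s a _
    xi_mul := fun s => by
      refine (pmap_op_mul _ _).trans ?_
      rw [Bool.not_not, hD.xi_mul, hE]
      exact pmap_op_C _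
    rtt_VV := exchange_opMat K (wT.exchange wT hU hVV hD.rtt_VV)
    rtt_VsVs := exchange_opMat K (wTs.exchange wTs hU hVsVs hD.rtt_VsVs)
    rtt_VsV := exchange_opMat K (wTs.exchange wT hU hVsV hD.rtt_VsV)
    om_inv := by
      ext1 i j
      refine (opMat_mul_scalMat_mul K _ ((D.antTs K P L lam).transpose) P.om i j).trans ?_
      rw [Matrix.transpose_transpose]
      refine (congrArg (pmap MulOpposite.op)
        (congrFun (congrFun (hD.antipode_om_inv hx) j) i)).trans ?_
      rw [hsc P.om _ i j fun h => by rw [P.graded i j h]]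
      refine congrArg _ ((pmap_op_mul _ _).symm.trans ?_)
      exact congrArg (· * _) ((pmap_op_C _).trans (congrArg C (srcU_op_inv D.e _).symm))
    omStar_inv := by
      ext1 i j
      refine (opMat_mul_scalMat_mul K _ ((D.antT K P L lam).transpose) P.omStar i j).trans ?_
      rw [Matrix.transpose_transpose]
      refine (congrArg (pmap MulOpposite.op)
        (congrFun (congrFun (hD.antipode_omStar_inv hE hx) j) i)).trans ?_
      rw [hsc P.omStar _ i j fun h => by rw [P.omStar_graded i j h]]
      exact congrArg _ ((pmap_op_C _).trans (congrArg C (srcU_op_inv D.e _).symm))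
    sg_inv := by
      ext1 i j
      refine (opMat_mul_scalMat_mul K ((D.antTs K P L lam).transpose) _ P.sg i j).trans ?_
      rw [Matrix.transpose_transpose]
      refine (congrArg (pmap MulOpposite.op)
        (congrFun (congrFun hD.antipode_sg_inv j) i)).trans ?_
      rw [hsc P.sg _ i j fun h => by rw [P.sg_graded i j h]]
      refine congrArg _ ((pmap_op_mul _ _).symm.trans ?_)
      exact congrArg (· * _) ((pmap_op_C _).trans (congrArg C (tgtU_op_inv D.e _).symm))
    sgStar_inv := by
      ext1 i j
      refine (opMat_mul_scalMat_mul K ((D.antT K P L lam).transpose) _ P.sgStar i j).trans ?_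
      rw [Matrix.transpose_transpose]
      refine (congrArg (pmap MulOpposite.op)
        (congrFun (congrFun (hD.antipode_sgStar_inv hE hx) j) i)).trans ?_
      rw [hsc P.sgStar _ i j fun h => by rw [P.sgStar_graded i j h]]
      exact congrArg _ ((pmap_op_C _).trans (congrArg C (tgtU_op_inv D.e _).symm)) }

end IsRep

end Antipode

/-- Central factors may be collected in front of a product. -/
theorem mul_mul_mul_central {M : Type*} [Semigroup M] {w b c' : M} (a c m n : M)
    (hw : ∀ y, w * y = y * w) (hb : ∀ y, b * y = y * b) (hc' : ∀ y, c' * y = y * c') :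
    w * (a * (c * m) * (b * (c' * n))) = a * b * (c * c' * (w * (m * n))) := by
  calc w * (a * (c * m) * (b * (c' * n))) = w * (a * (c * m * b) * (c' * n)) := by
        simp only [mul_assoc]
    _ = w * (a * (b * (c * m)) * (c' * n)) := by rw [hb]
    _ = w * (a * b * c * (m * c') * n) := by simp only [mul_assoc]
    _ = w * (a * b * c * (c' * m) * n) := by rw [hc']
    _ = w * (a * b * (c * c')) * (m * n) := by simp only [mul_assoc]
    _ = a * b * (c * c') * w * (m * n) := by rw [hw]
    _ = a * b * (c * c' * (w * (m * n))) := by simp only [mul_assoc]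

/-! ### Twists of matrices of series -/

section Twist

open MvPowerSeries (coeff C)

variable {X : Type*} {B : Type*} [Ring B] (K : Type*) [CommRing K] [Algebra ℂ K] [Algebra K B]

/-- The matrix `M`, conjugated by the diagonal matrix `r` and multiplied by the series `c`. -/
noncomputable def twist (r : X → ℂ) (c : MvPowerSeries (Fin 2) B)
    (M : Matrix X X (MvPowerSeries (Fin 2) B)) : Matrix X X (MvPowerSeries (Fin 2) B) :=
  Matrix.of fun i j => C (scal K B (r i / r j)) * (c * M i j)

theorem twist_apply (r : X → ℂ) (c : MvPowerSeries (Fin 2) B)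
    (M : Matrix X X (MvPowerSeries (Fin 2) B)) (i j : X) :
    twist K r c M i j = C (scal K B (r i / r j)) * (c * M i j) := rfl

theorem twist_transpose (r : X → ℂ) (c : MvPowerSeries (Fin 2) B)
    (M : Matrix X X (MvPowerSeries (Fin 2) B)) :
    (twist K r c M).transpose = twist K r⁻¹ c M.transpose := by
  ext1 i j
  rw [Matrix.transpose_apply, twist_apply, twist_apply, Pi.inv_apply, Pi.inv_apply, inv_div_inv,
    Matrix.transpose_apply]

theorem shift_twist (L μ : ℂ) (r : X → ℂ) (c : MvPowerSeries (Fin 2) B)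
    (M : Matrix X X (MvPowerSeries (Fin 2) B)) :
    (twist K r c M).map (shift K L μ) = twist K r (shift K L μ c) (M.map (shift K L μ)) := by
  ext1 i j
  rw [Matrix.map_apply, twist_apply, twist_apply, shift_mul, shift_mul, shift_C, Matrix.map_apply]

theorem IsHomog.twist_shift {π : Type*} [Groupoid π] [Fintype π] [∀ a b : π, Fintype (a ⟶ b)]
    {e : Arr π → B} {d : X → Arr π} {F : Matrix X X (MvPowerSeries (Fin 2) B)}
    (hF : IsHomog e d F) (L μ : ℂ) (r : X → ℂ) {c : MvPowerSeries (Fin 2) B}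
    (hc : ∀ x, Commute c x) : IsHomog e d (twist K r c (F.map (shift K L μ))) := by
  have hl : ∀ {b : B} {i j : X}, C b * F i j = F i j →
      C b * twist K r c (F.map (shift K L μ)) i j = twist K r c (F.map (shift K L μ)) i j := by
    intro b i j h
    rw [twist_apply, ← mul_assoc, ← (commute_C_scal K _ (C b)).eq, mul_assoc, ← mul_assoc (C b),
      ← (hc (C b)).eq, mul_assoc, Matrix.map_apply, ← shift_C K L μ b, ← shift_mul, h]
  have hr : ∀ {b : B} {i j : X}, F i j * C b = F i j →
      twist K r c (F.map (shift K L μ)) i j * C b = twist K r c (F.map (shift K L μ)) i j := by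
    intro b i j h
    rw [twist_apply, mul_assoc, mul_assoc, Matrix.map_apply, ← shift_C K L μ b, ← shift_mul, h]
  exact ⟨fun i j => hl (hF.src_mul i j), fun i j => hl (hF.tgt_mul i j),
    fun i j => hr (hF.mul_src i j), fun i j => hr (hF.mul_tgt i j)⟩

theorem pairMat_shift (L μ : ℂ) (F F' : Matrix X X (MvPowerSeries (Fin 2) B)) :
    pairMat (F.map (shift K L μ)) (F'.map (shift K L μ)) =
      (pairMat F F').map (shift₃ K L μ) := by
  ext1 p q
  simp only [pairMat, Matrix.of_apply, Matrix.map_apply, at1_shift, at2_shift, shift₃_mul]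

theorem pairMat'_shift (L μ : ℂ) (F F' : Matrix X X (MvPowerSeries (Fin 2) B)) :
    pairMat' (F.map (shift K L μ)) (F'.map (shift K L μ)) =
      (pairMat' F F').map (shift₃ K L μ) := by
  ext1 p q
  simp only [pairMat', Matrix.of_apply, Matrix.map_apply, at1_shift, at2_shift, shift₃_mul]

theorem commute_at1 {c : MvPowerSeries (Fin 2) B} (hc : ∀ a x, Commute (c a) x)
    (x : MvPowerSeries (Fin 3) B) : Commute (at1 c) x :=
  commute_of_coeff fun a b => by
    simp only [at1]
    split_ifs
    · exact hc _ _
    · exact Commute.zero_left _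

theorem commute_at2 {c : MvPowerSeries (Fin 2) B} (hc : ∀ a x, Commute (c a) x)
    (x : MvPowerSeries (Fin 3) B) : Commute (at2 c) x :=
  commute_of_coeff fun a b => by
    simp only [at2]
    split_ifs
    · exact hc _ _
    · exact Commute.zero_left _

/-- Twists by central series multiply the entries of `pairMat` by central factors. -/
theorem pairMat_twist (r r' : X → ℂ) {c c' : MvPowerSeries (Fin 2) B}
    (hc' : ∀ a x, Commute (c' a) x) (F F' : Matrix X X (MvPowerSeries (Fin 2) B)) (p q : X × X) :
    pairMat (twist K r c F) (twist K r' c' F') p q =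
      C (scal K B (r p.1 * r' p.2 / (r q.1 * r' q.2))) * (at1 c * at2 c' * pairMat F F' p q) := by
  simp only [pairMat, Matrix.of_apply, twist_apply, at1_mul, at2_mul, at1_C, at2_C,
    mul_div_mul_comm, map_mul]
  rw [mul_assoc, mul_assoc (at1 c), mul_assoc, mul_assoc]
  congr 1
  rw [← mul_assoc (at1 (F _ _)), ← (commute_C_scal K _ (at1 (F _ _))).eq, mul_assoc,
    ← mul_assoc (at1 c), ← (commute_C_scal K _ (at1 c)).eq, mul_assoc]
  congr 2
  rw [← mul_assoc, ← mul_assoc, (commute_at2 hc' _).eq]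

theorem pairMat'_twist (r r' : X → ℂ) {c c' : MvPowerSeries (Fin 2) B}
    (hc : ∀ a x, Commute (c a) x) (F F' : Matrix X X (MvPowerSeries (Fin 2) B)) (p q : X × X) :
    pairMat' (twist K r c F) (twist K r' c' F') p q =
      C (scal K B (r' p.1 * r p.2 / (r' q.1 * r q.2))) * (at1 c * at2 c' * pairMat' F F' p q) := by
  simp only [pairMat', Matrix.of_apply, twist_apply, at1_mul, at2_mul, at1_C, at2_C,
    mul_div_mul_comm, map_mul]
  rw [mul_assoc, mul_assoc, mul_assoc]
  congr 1
  rw [← mul_assoc (at2 (F' _ _)), ← (commute_C_scal K _ (at2 (F' _ _))).eq, mul_assoc,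
    ← mul_assoc (at2 c'), ← (commute_C_scal K _ (at2 c')).eq, mul_assoc]
  congr 1
  rw [(commute_at1 hc (at2 c')).eq, mul_assoc, ← mul_assoc (at1 c), (commute_at1 hc (at2 _)).eq,
    mul_assoc]

variable [Fintype X]

/-- The exchange relations depend only on `u₁ - u₂`, so they are stable under simultaneous
translation of both parameters. -/
theorem exchange_shift {c : Coeff X (MvPowerSeries (Fin 2) ℂ)}
    {F F' : Matrix X X (MvPowerSeries (Fin 2) B)}
    (h : pairMat F F' * coeffMat K c = coeffMat K c * pairMat' F F') (L μ : ℂ) :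
    pairMat (F.map (shift K L μ)) (F'.map (shift K L μ)) * coeffMat K c =
      coeffMat K c * pairMat' (F.map (shift K L μ)) (F'.map (shift K L μ)) := by
  rw [pairMat_shift, pairMat'_shift]
  ext1 p q
  have h' := congrArg (shift₃ K L μ) (congrFun (congrFun h p) q)
  simpa only [Matrix.mul_apply, shift₃_sum, shift₃_mul, coeffMat, Matrix.of_apply, shift₃_at12,
    Matrix.map_apply] using h'

/-- The exchange relations are stable under central factors, and under conjugation by diagonal
matrices that are compatible with the coefficients of the relation. -/
theorem exchange_twist {c : Coeff X (MvPowerSeries (Fin 2) ℂ)}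
    {F F' : Matrix X X (MvPowerSeries (Fin 2) B)}
    (h : pairMat F F' * coeffMat K c = coeffMat K c * pairMat' F F') {r r' : X → ℂ}
    (hrc : ∀ p q : X × X, c p.1 p.2 q.1 q.2 ≠ 0 → r p.1 * r' p.2 = r' q.1 * r q.2)
    {x x' : MvPowerSeries (Fin 2) B} (hx : ∀ a y, Commute (x a) y) (hx' : ∀ a y, Commute (x' a) y) :
    pairMat (twist K r x F) (twist K r' x' F') * coeffMat K c =
      coeffMat K c * pairMat' (twist K r x F) (twist K r' x' F') := by
  ext1 p q
  have h' := congrArg (fun y => C (scal K B (r p.1 * r' p.2 / (r' q.1 * r q.2))) *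
    (at1 x * at2 x' * y)) (congrFun (congrFun h p) q)
  have hz : ∀ y, Commute (at1 x * at2 x') y := fun y =>
    (commute_at1 hx y).mul_left (commute_at2 hx' y)
  have hc0 : ∀ p q : X × X, c p.1 p.2 q.1 q.2 = 0 →
      (coeffMat K c : Matrix _ _ (MvPowerSeries (Fin 3) B)) p q = 0 := fun p q h0 => by
    rw [coeffMat, Matrix.of_apply, h0, map_zero, at12_zero]
  simp only [Matrix.mul_apply, Finset.mul_sum] at h' ⊢
  refine Eq.trans (Finset.sum_congr rfl fun s _ => ?_)
    (h'.trans (Finset.sum_congr rfl fun s _ => ?_))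
  · rw [pairMat_twist K r r' hx']
    by_cases h0 : c s.1 s.2 q.1 q.2 = 0
    · simp only [hc0 s q h0, mul_zero]
    · rw [hrc s q h0]
      simp only [mul_assoc]
  · rw [pairMat'_twist K r r' hx]
    by_cases h0 : c p.1 p.2 s.1 s.2 = 0
    · simp only [hc0 p s h0, zero_mul, mul_zero]
    · rw [hrc p s h0, ← mul_assoc (coeffMat K c p s), ← (commute_C_scal K _ (coeffMat K c p s)).eq,
        mul_assoc (C _), ← mul_assoc (coeffMat K c p s), ← (hz (coeffMat K c p s)).eq,
        mul_assoc (at1 x * at2 x')]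

/-- A twist is multiplicative across a complex matrix whose blocks `r` respects, because the two
inner factors of the conjugation cancel. -/
theorem twist_mul_scalMat_mul_twist {r : X → ℂ} (hr : ∀ i, r i ≠ 0) {w : X → X → ℂ}
    (hw : ∀ i j, w i j ≠ 0 → r i = r j) {c c' : MvPowerSeries (Fin 2) B}
    (hc' : ∀ x, Commute c' x) (M N : Matrix X X (MvPowerSeries (Fin 2) B)) :
    twist K r c M * scalMat K w * twist K r c' N = twist K r (c * c') (M * scalMat K w * N) := by
  ext1 i j
  rw [mul_scalMat_mul_apply, twist_apply, mul_scalMat_mul_apply]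
  simp only [Finset.mul_sum]
  refine Finset.sum_congr rfl fun k _ => Finset.sum_congr rfl fun l _ => ?_
  by_cases h0 : w k l = 0
  · simp only [h0, map_zero, zero_mul, mul_zero]
  · rw [twist_apply, twist_apply, hw k l h0,
      show r i / r j = r i / r l * (r l / r j) by
        rw [div_mul_div_cancel₀ (hr l)]]
    rw [map_mul, map_mul]
    exact mul_mul_mul_central _ _ _ _ (fun y => (commute_C_scal K _ y).eq)
      (fun y => (commute_C_scal K _ y).eq) fun y => (hc' y).eq

theorem twist_diagonal_mul_scalMat {r : X → ℂ} (hr : ∀ i, r i ≠ 0) {w : X → X → ℂ}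
    (hw : ∀ i j, w i j ≠ 0 → r i = r j) (c : MvPowerSeries (Fin 2) B)
    (g : X → MvPowerSeries (Fin 2) B) :
    twist K r c (Matrix.diagonal g * scalMat K w) =
      Matrix.diagonal (fun i => c * g i) * scalMat K w := by
  ext1 i j
  rw [twist_apply, Matrix.diagonal_mul, Matrix.diagonal_mul, scalMat, Matrix.of_apply]
  by_cases h0 : w i j = 0
  · simp only [h0, map_zero, mul_zero]
  · rw [hw i j h0, div_self (hr j), map_one, map_one, one_mul, mul_assoc]

end Twist

/-! ### The inverse of the square of the antipode -/

section SquareInverse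

/-- The product of the quotients `G(s)/G(t)` for two composable arrows telescopes, so it depends
only on the outer end points. -/
theorem div_mul_div_of_ends {π : Type*} [Groupoid π] {G : π → ℂ} {f g f' g' : Arr π}
    (hg : G g.src ≠ 0) (hg' : G g'.src ≠ 0) (h₁ : f.tgt = g.src) (h₂ : f'.tgt = g'.src)
    (h₃ : f.src = f'.src) (h₄ : g.tgt = g'.tgt) :
    G f.src / G f.tgt * (G g.src / G g.tgt) = G f'.src / G f'.tgt * (G g'.src / G g'.tgt) := by
  rw [h₁, h₂, h₃, h₄, div_mul_div_cancel₀ hg, div_mul_div_cancel₀ hg']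

open MvPowerSeries (coeff C)

variable {π : Type*} [Groupoid π] [Fintype π] [∀ a b : π, Fintype (a ⟶ b)] {X : Type*} [Fintype X]
  {deg : X → Arr π} {K : Type*} [CommRing K] [Algebra ℂ K] {P : Pairing deg} {L lam : ℂ}
  {cVV cVsV cVsVs : Coeff X (MvPowerSeries (Fin 2) ℂ)} {B : Type*} [Ring B] [Algebra K B]

variable (K P L lam) in
/-- The images of the generating series under the inverse of the square of the antipode. -/
noncomputable def RepData.sqInv (D : RepData π X B) : RepData π X B where
  E := D.E
  e := D.e
  T := twist K P.ratio (shift K L lam (D.xi false)) (D.T.map (shift K L (lam + lam)))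
  Ts := twist K P.ratio⁻¹ (D.xi true) (D.Ts.map (shift K L (lam + lam)))
  xi := D.xi

namespace IsRep

variable {D : RepData π X B} (hD : IsRep K P L lam cVV cVsV cVsVs D)
  (hE : D.E = 1) (hx : ∀ s a x, Commute (D.xi s a) x)
  (hVV : IsGradedCoeff deg deg cVV) (hVsV : IsGradedCoeff (fun i => (deg i).inv) deg cVsV)
  (hVsVs : IsGradedCoeff (fun i => (deg i).inv) (fun i => (deg i).inv) cVsVs)
include hD hE hx hVV hVsV hVsVs

/-- The twisted series satisfy the defining relations: the ratios `G(s)/G(t)` are multiplicative on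
composable degrees, hence compatible with degree-preserving coefficients, and the powers of `ξ₂^±`
in the twists cancel in the inversion relations. -/
theorem sqInv : IsRep K P L lam cVV cVsV cVsVs (D.sqInv K P L lam) := by
  have hr := P.ratio_ne_zero
  have hr' : ∀ i, P.ratio⁻¹ i ≠ 0 := fun i => inv_ne_zero (hr i)
  have hc : ∀ a x, Commute (shift K L lam (D.xi false) a) x := fun a x =>
    (hx false a x).smul_left _
  have hc1 : ∀ x, Commute (shift K L lam (D.xi false)) x := commute_shift_xi hx _ false
  have hc2 : ∀ x, Commute (D.xi true) x := fun x => commute_of_coeff fun a b => hx true a (x b)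
  have hc3 : ∀ x, Commute (shift K L lam (shift K L lam (D.xi false))) x := fun x => by
    rw [shift_shift]
    exact commute_shift_xi hx _ false x
  have hc4 : ∀ x, Commute (shift K L lam (D.xi true)) x := commute_shift_xi hx _ true
  have hs : ∀ μ ν (w : X → X → ℂ) (M N : Matrix X X (MvPowerSeries (Fin 2) B)),
      M.map (shift K L (μ + ν)) * scalMat K w * N.map (shift K L μ) =
        (M.map (shift K L ν) * scalMat K w * N).map (shift K L μ) := fun μ ν w M N => by
    rw [shift_matrix_mul, shift_matrix_mul, shift_scalMat, shift_matrix_shift]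
  have hs' : ∀ μ ν (w : X → X → ℂ) (M N : Matrix X X (MvPowerSeries (Fin 2) B)),
      M.map (shift K L μ) * scalMat K w * N.map (shift K L (μ + ν)) =
        (M * scalMat K w * N.map (shift K L ν)).map (shift K L μ) := fun μ ν w M N => by
    rw [shift_matrix_mul, shift_matrix_mul, shift_scalMat, shift_matrix_shift]
  have hd : ∀ μ (w : X → X → ℂ) (g : X → MvPowerSeries (Fin 2) B),
      (Matrix.of fun i j => C (scal K B (w i j)) * g i).map (shift K L μ) =
        Matrix.diagonal (fun i => shift K L μ (g i)) * scalMat K w := fun μ w g => by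
    rw [of_scal_mul, shift_matrix_mul, shift_scalMat, shift_diagonal]
  have hinv1 : shift K L lam (D.xi true) * shift K L lam (D.xi false) = 1 :=
    hD.shift_xi_mul hE lam true
  have hinv1' : shift K L lam (D.xi false) * shift K L lam (D.xi true) = 1 :=
    hD.shift_xi_mul hE lam false
  have hinv2 : shift K L (lam + lam) (D.xi false) * shift K L (lam + lam) (D.xi true) = 1 :=
    hD.shift_xi_mul hE _ false
  have hratio' : ∀ {w : X → X → ℂ}, (∀ i j, w i j ≠ 0 → deg i = deg j) → ∀ i j, w i j ≠ 0 →
      P.ratio⁻¹ i = P.ratio⁻¹ j := fun h i j hw => by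
    rw [Pi.inv_apply, Pi.inv_apply, P.ratio_eq i j (h i j hw)]
  have hri : ∀ i, P.ratio⁻¹ i = P.G (deg i).inv.src / P.G (deg i).inv.tgt := fun i => inv_div _ _
  have hxi : ∀ b : B, shift K L (lam + lam) (D.xi false) * D.xi true *
      shift K L (lam + lam) (C b * D.xi true) = C b * D.xi true := fun b => by
    rw [shift_mul, shift_C, ← (commute_shift_xi hx _ true (C b)).eq, mul_assoc,
      ← mul_assoc (D.xi true), ← (commute_shift_xi hx _ true (D.xi true)).eq, mul_assoc,
      ← mul_assoc, hinv2, one_mul, (hc2 _).eq]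
  exact
  { units := hD.units
    homT := hD.homT.twist_shift K L _ _ hc1
    homTs := hD.homTs.twist_shift K L _ _ hc2
    E_xi := hD.E_xi
    comm_e := hD.comm_e
    comm_T := fun s a i j b => hx s a _
    comm_Ts := fun s a i j b => hx s a _
    comm_xi := hD.comm_xi
    xi_mul := hD.xi_mul
    rtt_VV := exchange_twist K (exchange_shift K hD.rtt_VV L _) (fun p q h => by
      obtain ⟨h₁, h₂, h₃, h₄⟩ := hVV _ _ _ _ h
      exact div_mul_div_of_ends (P.G_src_ne _) (P.G_src_ne _) h₁ h₂ h₃ h₄) hc hc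
    rtt_VsVs := exchange_twist K (exchange_shift K hD.rtt_VsVs L _) (fun p q h => by
      obtain ⟨h₁, h₂, h₃, h₄⟩ := hVsVs _ _ _ _ h
      rw [hri, hri, hri, hri]
      exact div_mul_div_of_ends (P.G_tgt_ne _) (P.G_tgt_ne _) h₁ h₂ h₃ h₄) (hx true) (hx true)
    rtt_VsV := exchange_twist K (exchange_shift K hD.rtt_VsV L _) (fun p q h => by
      obtain ⟨h₁, h₂, h₃, h₄⟩ := hVsV _ _ _ _ h
      rw [hri, hri]
      exact div_mul_div_of_ends (P.G_src_ne _) (P.G_tgt_ne _) h₁ h₂ h₃ h₄) (hx true) hc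
    om_inv := by
      change (twist K _ _ _).map _ * _ * (twist K _ _ _).transpose = _
      rw [shift_twist, twist_transpose, inv_inv, twist_mul_scalMat_mul_twist K hr
        (fun i j h => P.ratio_eq i j (P.graded i j h)) hc2, shift_matrix_shift,
        ← Matrix.transpose_map, add_comm lam (lam + lam), hs, hD.om_inv, hd, shift_shift,
        twist_diagonal_mul_scalMat K hr fun i j h => P.ratio_eq i j (P.graded i j h), of_scal_mul]
      simp only [hxi]
      rfl
    omStar_inv := by
      change (twist K _ _ _).map _ * _ * (twist K _ _ _).transpose = _
      rw [shift_twist, twist_transpose, twist_mul_scalMat_mul_twist K hr'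
        (hratio' P.omStar_graded) hc1, shift_matrix_shift,
        ← Matrix.transpose_map, add_comm lam (lam + lam), hs, hD.omStar_inv, hd, hinv1,
        twist_diagonal_mul_scalMat K hr' (hratio' P.omStar_graded), of_scal_mul]
      simp only [one_mul, shift_C]
      rfl
    sg_inv := by
      change (twist K _ _ _).transpose * _ * (twist K _ _ _).map _ = _
      rw [shift_twist, twist_transpose, inv_inv, twist_mul_scalMat_mul_twist K hr
        (fun i j h => P.ratio_eq i j (P.sg_graded i j h)) hc3, shift_matrix_shift,
        ← Matrix.transpose_map, add_comm lam (lam + lam), hs', hD.sg_inv, hd, shift_shift,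
        twist_diagonal_mul_scalMat K hr fun i j h => P.ratio_eq i j (P.sg_graded i j h),
        of_scal_mul]
      rw [(hc2 _).eq]
      simp only [hxi]
      rfl
    sgStar_inv := by
      change (twist K _ _ _).transpose * _ * (twist K _ _ _).map _ = _
      rw [shift_twist, twist_transpose, twist_mul_scalMat_mul_twist K hr'
        (hratio' P.sgStar_graded) hc4, shift_matrix_shift,
        ← Matrix.transpose_map, add_comm lam (lam + lam), hs', hD.sgStar_inv, hd, hinv1',
        twist_diagonal_mul_scalMat K hr' (hratio' P.sgStar_graded), of_scal_mul]
      simp only [one_mul, shift_C]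
      rfl }

end IsRep

end SquareInverse

/-! ### The square of the antipode -/

section AntipodeMap

open MvPowerSeries (coeff C)

variable {π : Type*} [Groupoid π] {X : Type*} [Fintype X]
  {deg : X → Arr π} {K : Type*} [CommRing K] [Algebra ℂ K] {P : Pairing deg} {L lam : ℂ}
  {B : Type*} [Ring B] [Algebra K B]

variable (K P L lam) in
/-- `S` is an antihomomorphism of algebras with the values of the antipode on the generators. -/
structure IsAntipode (D : RepData π X B) (S : B →ₗ[K] B) : Prop where
  apply_one : S 1 = 1
  apply_mul : ∀ x y, S (x * y) = S y * S x
  apply_e : ∀ f, S (D.e f) = D.e f.inv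
  pmap_T : ∀ i j, pmap S (D.T i j) = D.antT K P L lam i j
  pmap_Ts : ∀ i j, pmap S (D.Ts i j) = D.antTs K P L lam i j
  pmap_xi : ∀ s, pmap S (D.xi s) = D.xi !s

/-- A matrix enclosed by products of complex matrices that combine to diagonal ones is rescaled
entry by entry. -/
theorem conj_scalMat_apply {a b c d : X → X → ℂ} {u v : X → ℂ}
    (hu : ∀ i j, ∑ k, a i k * b k j = if i = j then u i else 0)
    (hv : ∀ i j, ∑ k, c i k * d k j = if i = j then v i else 0)
    (M : Matrix X X (MvPowerSeries (Fin 2) B)) (i j : X) :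
    (scalMat K a * (scalMat K b * M * scalMat K c) * scalMat K d : Matrix _ _ _) i j =
      C (scal K B (u i * v j)) * M i j := by
  have h : ∀ {a b : X → X → ℂ} {u : X → ℂ},
      (∀ i j, ∑ k, a i k * b k j = if i = j then u i else 0) →
      (scalMat K a * scalMat K b : Matrix X X (MvPowerSeries (Fin 2) B)) =
        Matrix.diagonal fun i => C (scal K B (u i)) := fun hu => by
    rw [scalMat_mul]
    ext1 i j
    rw [scalMat, Matrix.of_apply, hu, Matrix.diagonal_apply]
    split_ifs
    · rfl
    · rw [map_zero, map_zero]
  rw [← mul_assoc, ← mul_assoc, mul_assoc _ (scalMat K c), h hu, h hv, Matrix.mul_diagonal,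
    Matrix.diagonal_mul, ← (commute_C_scal K (v j) _).eq, ← mul_assoc, ← map_mul, ← map_mul,
    mul_comm (v j)]

namespace IsAntipode

variable {D : RepData π X B} {S : B →ₗ[K] B} (hS : IsAntipode K P L lam D S)
include hS

/-- An antihomomorphism reverses products of series, coefficient by coefficient. -/
theorem pmap_mul_rev {σ : Type*} (x y : MvPowerSeries σ B) :
    pmap S (x * y) = pmap S y * pmap S x := by
  have h : pmap S (x * y) = pmap MulOpposite.unop (pmap (fun x => MulOpposite.op (S x)) (x * y)) :=
    rfl
  let φ : B →ₙₐ[K] Bᵐᵒᵖ :=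
    { toFun := fun x => MulOpposite.op (S x)
      map_smul' := fun r x => congrArg MulOpposite.op (map_smul S r x)
      map_zero' := congrArg MulOpposite.op (map_zero S)
      map_add' := fun x y => congrArg MulOpposite.op (map_add S x y)
      map_mul' := fun x y => congrArg MulOpposite.op (hS.apply_mul x y) }
  exact h.trans ((congrArg _ (pmap_mul φ x y)).trans (pmap_unop_mul _ _))

omit hS in
theorem pmap_C_scal_mul_linear {σ : Type*} (c : ℂ) (x : MvPowerSeries σ B) :
    pmap S (C (scal K B c) * x) = C (scal K B c) * pmap S x := by
  ext d
  rw [coeff_pmap, MvPowerSeries.coeff_C_mul, MvPowerSeries.coeff_C_mul, coeff_pmap,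
    scal_mul_eq_smul, scal_mul_eq_smul, map_smul]

variable (hx : ∀ s a x, Commute (D.xi s a) x)
include hx

/-- The square of the antipode on the coefficients of `T(u)`. -/
theorem pmap_pmap_T (i j : X) : pmap S (pmap S (D.T i j)) =
    twist K P.ratio⁻¹ (shift K L (-lam) (D.xi true)) (D.T.map (shift K L (-(lam + lam)))) i j := by
  have h1 : pmap S (pmap S (D.T i j)) =
      (scalMat K P.om * ((D.antTs K P L lam).map (shift K L (-lam))).transpose *
        scalMat K P.sg : Matrix X X _) i j * shift K L (-lam) (D.xi true) := by
    rw [hS.pmap_T, RepData.antT_apply, hS.pmap_mul_rev, scalMat_mul_mul_apply, ← shift_pmap,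
      hS.pmap_xi, pmap_sum]
    simp only [pmap_sum, pmap_C_scal_mul_linear, ← shift_pmap, hS.pmap_Ts]
    rfl
  have h2 : ((D.antTs K P L lam).map (shift K L (-lam))).transpose =
      scalMat K (fun i j => P.sgStar j i) * D.T.map (shift K L (-(lam + lam))) *
        scalMat K (fun i j => P.omStar j i) := by
    rw [RepData.antTs, shift_matrix_mul, shift_matrix_mul, shift_scalMat, shift_scalMat,
      transpose_scalMat_mul_mul, Matrix.transpose_map, Matrix.transpose_transpose,
      shift_matrix_shift, neg_add]
  rw [h1, h2, conj_scalMat_apply (u := P.ratio⁻¹) (v := P.ratio)]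
  · rw [twist_apply, ← (IsRep.commute_shift_xi hx _ true (_ * _)).eq, Pi.inv_apply, Pi.inv_apply,
      div_inv_eq_mul, ← mul_assoc, ← mul_assoc, (IsRep.commute_shift_xi hx _ true (C _)).eq]
  · intro i j
    have h : ∀ k, P.om i k * P.sgStar j k = (P.ratio j)⁻¹ * (P.om i k * P.sg k j) := fun k => by
      rw [P.sgStar_eq]
      ring
    simp only [h]
    rw [← Finset.mul_sum, P.zigzag, mul_ite, mul_one, mul_zero]
    split_ifs with hij
    · rw [hij]
      rfl
    · rfl
  · intro i j
    have h : ∀ k, P.omStar k i * P.sg k j = P.ratio i * (P.om i k * P.sg k j) := fun k => by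
      rw [P.omStar_eq]
      ring
    simp only [h]
    rw [← Finset.mul_sum, P.zigzag, mul_ite, mul_one, mul_zero]

/-- The square of the antipode on the coefficients of `T^*(u)`. -/
theorem pmap_pmap_Ts (i j : X) : pmap S (pmap S (D.Ts i j)) =
    twist K P.ratio (shift K L (-(lam + lam)) (D.xi false))
      (D.Ts.map (shift K L (-(lam + lam)))) i j := by
  have h1 : pmap S (pmap S (D.Ts i j)) =
      (scalMat K P.omStar * ((D.antT K P L lam).map (shift K L (-lam))).transpose *
        scalMat K P.sgStar : Matrix X X _) i j := by
    rw [hS.pmap_Ts, RepData.antTs_apply, scalMat_mul_mul_apply]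
    simp only [pmap_sum, pmap_C_scal_mul_linear, ← shift_pmap, hS.pmap_T]
    rfl
  have h2 : ((D.antT K P L lam).map (shift K L (-lam))).transpose =
      scalMat K (fun i j => P.sg j i) * (Matrix.diagonal (fun _ =>
        shift K L (-(lam + lam)) (D.xi false)) * D.Ts.map (shift K L (-(lam + lam)))) *
        scalMat K (fun i j => P.om j i) := by
    rw [← mul_assoc (scalMat K _), ← (IsRep.commute_diagonal_xi hx _ false (scalMat K _)).eq,
      mul_assoc, mul_assoc, ← mul_assoc (scalMat K _), RepData.antT, shift_matrix_mul,
      shift_diagonal, shift_matrix_mul, shift_matrix_mul, shift_scalMat, shift_scalMat,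
      Matrix.transpose_map,
      shift_matrix_shift, shift_shift, neg_add,
      ← Matrix.transpose_transpose (D.Ts.map (shift K L (-lam + -lam))),
      ← transpose_scalMat_mul_mul]
    ext1 i j
    rw [Matrix.transpose_apply, Matrix.diagonal_mul, Matrix.diagonal_mul]
    rfl
  rw [h1, h2, conj_scalMat_apply (u := P.ratio) (v := P.ratio⁻¹)]
  · rw [twist_apply, Matrix.diagonal_mul, Pi.inv_apply, div_eq_mul_inv]
  · intro i j
    have h : ∀ k, P.omStar i k * P.sg j k = P.ratio j * (P.sg j k * P.om k i) := fun k => by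
      by_cases h0 : P.sg j k = 0
      · rw [h0, mul_zero, zero_mul, mul_zero]
      · rw [P.omStar_eq, P.ratio_eq j k (P.sg_graded j k h0)]
        ring
    simp only [h]
    rw [← Finset.mul_sum, P.zigzag_dual, mul_ite, mul_one, mul_zero]
    simp only [eq_comm (a := j)]
    split_ifs with hij
    · rw [hij]
    · rfl
  · intro i j
    have h : ∀ k, P.om k i * P.sgStar k j = (P.ratio j)⁻¹ * (P.sg j k * P.om k i) := fun k => by
      by_cases h0 : P.sg j k = 0
      · rw [P.sgStar_eq, h0, mul_zero, mul_zero, zero_mul, mul_zero]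
      · rw [P.sgStar_eq, P.ratio_eq j k (P.sg_graded j k h0)]
        ring
    simp only [h]
    rw [← Finset.mul_sum, P.zigzag_dual, mul_ite, mul_one, mul_zero]
    simp only [eq_comm (a := j)]
    split_ifs with hij
    · rw [hij]
      rfl
    · rfl

omit hx

/-- The square of the antipode. -/
def sq : B →ₙₐ[K] B :=
  { S ∘ₗ S with
    map_zero' := map_zero (S ∘ₗ S)
    map_mul' := fun x y =>
      (congrArg S (hS.apply_mul x y)).trans (hS.apply_mul (S y) (S x)) }

end IsAntipode

omit [Fintype X] in
/-- A homomorphism that acts on the entries of `M` by a twist has the opposite twist as inverse. -/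
theorem pmap_twist_eq (φ : B →ₙₐ[K] B) {M : Matrix X X (MvPowerSeries (Fin 2) B)} {r : X → ℂ}
    (hr : ∀ i, r i ≠ 0) {c c' : MvPowerSeries (Fin 2) B} {μ ν : ℂ} (hμν : ν + μ = 0)
    (hM : ∀ i j, pmap φ (M i j) = twist K r c (M.map (shift K L μ)) i j)
    (hc : pmap φ c' * shift K L ν c = 1) (i j : X) :
    pmap φ (twist K r⁻¹ c' (M.map (shift K L ν)) i j) = M i j := by
  rw [twist_apply, pmap_C_scal_mul, pmap_mul, Matrix.map_apply, ← shift_pmap, hM, twist_apply,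
    shift_mul, shift_mul, Matrix.map_apply, shift_shift, hμν, shift_zero, shift_C,
    ← mul_assoc (pmap φ c'), ← (commute_C_scal K _ (pmap φ c')).eq, mul_assoc,
    ← mul_assoc (pmap φ c'), hc, one_mul, ← mul_assoc, ← map_mul, ← map_mul, Pi.inv_apply,
    Pi.inv_apply, inv_div_inv, div_mul_div_cancel₀ (hr i), div_self (hr j), map_one, map_one,
    one_mul]

end AntipodeMap

/-! ### Existence and bijectivity of the antipode -/

section RQAAntipode

open MvPowerSeries (coeff C)

variable {π : Type*} [Groupoid π] [Fintype π] [∀ a b : π, Fintype (a ⟶ b)] {X : Type*} [Fintype X]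
  {deg : X → Arr π} {K : Type*} [CommRing K] [Algebra ℂ K] {P : Pairing deg} {L lam : ℂ}
  {cVV cVsV cVsVs : Coeff X (MvPowerSeries (Fin 2) ℂ)}

namespace RQA

local notation "𝓐" => RQA K P L lam cVV cVsV cVsVs
local notation "𝔤" => gen K P L lam cVV cVsV cVsVs
local notation "𝓒" => component K P L lam cVV cVsV cVsVs
local notation "𝓓" => data K P L lam cVV cVsV cVsVs
local notation "Δ" => cop K P L lam cVV cVsV cVsVs

variable [Quiver.IsThin π] (hVV : IsGradedCoeff deg deg cVV)
  (hVsV : IsGradedCoeff (fun i => (deg i).inv) deg cVsV)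
  (hVsVs : IsGradedCoeff (fun i => (deg i).inv) (fun i => (deg i).inv) cVsVs)
include hVV hVsV hVsVs

/-- The universal property, applied to the images of the generating series in the opposite algebra.
-/
theorem exists_antipode :
    ∃ S : 𝓐 →ₗ[K] 𝓐, IsAntipode K P L lam 𝓓 S := by
  obtain ⟨φ, h1, he, hT, hTs, hxi⟩ := exists_hom
    ((isRep (K := K) (P := P) (L := L) (lam := lam)).antipode rfl xi_central hVV hVsV hVsVs)
  have hop : ∀ {F : MvPowerSeries (Fin 2) 𝓐} {G : MvPowerSeries (Fin 2) 𝓐},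
      pmap φ F = pmap MulOpposite.op G → pmap (fun x => MulOpposite.unop (φ x)) F = G :=
    fun h => congrArg (pmap MulOpposite.unop) h
  refine ⟨(MulOpposite.opLinearEquiv K).symm.toLinearMap ∘ₗ (φ : 𝓐 →ₗ[K] 𝓐ᵐᵒᵖ),
    ?_, ?_, ?_, ?_, ?_, ?_⟩
  · exact congrArg MulOpposite.unop h1
  · exact fun x y => congrArg MulOpposite.unop (map_mul φ x y)
  · exact fun f => congrArg MulOpposite.unop (he f)
  · exact fun i j => hop (hT i j)
  · exact fun i j => hop (hTs i j)
  · exact fun s => hop (hxi s)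

/-- The square of the antipode is invertible, because it acts on the generating series by central
factors, translations of the spectral parameter and nonzero complex numbers. -/
theorem bijective_antipode {S : 𝓐 →ₗ[K] 𝓐} (hS : IsAntipode K P L lam 𝓓 S) :
    Function.Bijective S := by
  obtain ⟨φ, h1, he, hT, hTs, hxi⟩ := exists_hom
    ((isRep (K := K) (P := P) (L := L) (lam := lam)).sqInv rfl xi_central hVV hVsV hVsVs)
  have hr : ∀ i, P.ratio i ≠ 0 := P.ratio_ne_zero
  have hr' : ∀ i, P.ratio⁻¹ i ≠ 0 := fun i => inv_ne_zero (hr i)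
  have hxiS : ∀ s, pmap hS.sq (serXi 𝔤 s) = serXi 𝔤 s := fun s =>
    (congrArg (pmap S) (hS.pmap_xi s)).trans ((hS.pmap_xi (!s)).trans
      (congrArg _ (Bool.not_not s)))
  have heS : ∀ f, hS.sq (𝔤 (.e f)) = 𝔤 (.e f) := fun f =>
    (congrArg S (hS.apply_e f)).trans ((hS.apply_e f.inv).trans
      (congrArg (fun f => 𝔤 (.e f)) f.inv_inv))
  have hTS : ∀ i j, pmap hS.sq (serT 𝔤 i j) = twist K P.ratio⁻¹ (shift K L (-lam) (serXi 𝔤 true))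
      (Matrix.map (serT 𝔤) (shift K L (-(lam + lam)))) i j := hS.pmap_pmap_T xi_central
  have hTsS : ∀ i j, pmap hS.sq (serTs 𝔤 i j) =
      twist K P.ratio (shift K L (-(lam + lam)) (serXi 𝔤 false))
      (Matrix.map (serTs 𝔤) (shift K L (-(lam + lam)))) i j := hS.pmap_pmap_Ts xi_central
  have hxx : ∀ s μ, shift K L μ (serXi 𝔤 s) * shift K L μ (serXi 𝔤 !s) = 1 := fun s μ =>
    isRep.shift_xi_mul rfl μ s
  have hT' : ∀ i j, pmap φ (serT 𝔤 i j) = twist K P.ratio (shift K L lam (serXi 𝔤 false))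
      (Matrix.map (serT 𝔤) (shift K L (lam + lam))) i j := hT
  have hTs' : ∀ i j, pmap φ (serTs 𝔤 i j) = twist K P.ratio⁻¹ (serXi 𝔤 true)
      (Matrix.map (serTs 𝔤) (shift K L (lam + lam))) i j := hTs
  -- The homomorphism `φ` is inverse to `S ∘ S` on the generating series: the translations by `2λ`
  -- and `-2λ`, the factors `ξ₂^±` and the ratios of values of `G` cancel in both orders.
  have hl : ∀ x, φ (S (S x)) = x := by
    refine nonUnital_ext (φ := φ.comp hS.sq) (ψ := .id K 𝓐) ?_ ?_ ?_ ?_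
    · intro f
      exact (congrArg φ (heS f)).trans (he f)
    · intro i j
      change pmap φ (pmap hS.sq (serT 𝔤 i j)) = _
      rw [hTS]
      refine pmap_twist_eq φ hr (neg_add_cancel _) hT ?_ i j
      rw [← shift_pmap, hxi]
      change shift K L (-lam) (serXi 𝔤 true) * shift K L _ (shift K L lam (serXi 𝔤 false)) = 1
      rw [shift_shift, show -(lam + lam) + lam = -lam by ring]
      exact hxx true _
    · intro i j
      change pmap φ (pmap hS.sq (serTs 𝔤 i j)) = _
      rw [hTsS, ← inv_inv P.ratio]
      refine pmap_twist_eq φ hr' (neg_add_cancel _) hTs ?_ i j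
      rw [← shift_pmap, hxi]
      exact hxx false _
    · intro s
      exact (congrArg (pmap φ) (hxiS s)).trans (hxi s)
  have hrt : ∀ x, S (S (φ x)) = x := by
    refine nonUnital_ext (φ := hS.sq.comp φ) (ψ := .id K 𝓐) ?_ ?_ ?_ ?_
    · intro f
      exact (congrArg hS.sq (he f)).trans (heS f)
    · intro i j
      change pmap hS.sq (pmap φ (serT 𝔤 i j)) = _
      rw [hT', ← inv_inv P.ratio]
      refine pmap_twist_eq hS.sq hr' (add_neg_cancel _) hTS ?_ i j
      rw [← shift_pmap, hxiS, shift_shift, show lam + lam + -lam = lam by ring]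
      exact hxx false _
    · intro i j
      change pmap hS.sq (pmap φ (serTs 𝔤 i j)) = _
      rw [hTs']
      refine pmap_twist_eq hS.sq hr (add_neg_cancel _) hTsS ?_ i j
      rw [hxiS, shift_shift, add_neg_cancel, ← shift_zero K L (serXi _ true)]
      exact hxx true 0
    · intro s
      exact (congrArg (pmap hS.sq) (hxi s)).trans (hxiS s)
  exact ⟨fun x y h => by rw [← hl x, h, hl], fun x => ⟨S (φ x), hrt x⟩⟩

theorem exists_antipode_equiv : ∃ S : 𝓐 ≃ₐ[K] 𝓐ᵐᵒᵖ, IsAntipode K P L lam 𝓓 (opLin S) := by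
  obtain ⟨S, hS⟩ := exists_antipode (K := K) (P := P) (L := L) (lam := lam) hVV hVsV hVsVs
  have hb := bijective_antipode hVV hVsV hVsVs hS
  let φ : 𝓐 →ₐ[K] 𝓐ᵐᵒᵖ := AlgHom.ofLinearMap ((MulOpposite.opLinearEquiv K).toLinearMap ∘ₗ S)
    (congrArg MulOpposite.op hS.apply_one)
    fun x y => congrArg MulOpposite.op (hS.apply_mul x y)
  exact ⟨AlgEquiv.ofBijective φ ((MulOpposite.opLinearEquiv K).bijective.comp hb), hS⟩

end RQA

end RQAAntipode

/-! ### Contractions with the antipode -/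

section Contraction

open MvPowerSeries (coeff C)

variable {K : Type*} [CommRing K] {A : Type*} [Ring A] [Algebra K A] (S : A →ₗ[K] A)

/-- The linear map `x ⊗ y ↦ S(x) c y`. -/
noncomputable def contractLeft (c : A) : A ⊗[K] A →ₗ[K] A :=
  LinearMap.mul' K A ∘ₗ (LinearMap.mulRight K c ∘ₗ S).rTensor A

/-- The linear map `x ⊗ y ↦ x c S(y)`. -/
noncomputable def contractRight (c : A) : A ⊗[K] A →ₗ[K] A :=
  LinearMap.mul' K A ∘ₗ (LinearMap.mulLeft K c ∘ₗ S).lTensor A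

theorem contractLeft_tmul (c x y : A) : contractLeft S c (x ⊗ₜ[K] y) = S x * c * y := rfl

theorem contractRight_tmul (c x y : A) : contractRight S c (x ⊗ₜ[K] y) = x * (c * S y) := rfl

theorem contractLeft_one (z : A ⊗[K] A) :
    contractLeft S 1 z = LinearMap.mul' K A (S.rTensor A z) := by
  rw [contractLeft, LinearMap.mulRight_one, LinearMap.id_comp]
  rfl

theorem contractRight_one (z : A ⊗[K] A) :
    contractRight S 1 z = LinearMap.mul' K A (S.lTensor A z) := by
  rw [contractRight, LinearMap.mulLeft_one, LinearMap.id_comp]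
  rfl

theorem contractLeft_sum {ι : Type*} (s : Finset ι) (c : ι → A) (z : A ⊗[K] A) :
    contractLeft S (∑ i ∈ s, c i) z = ∑ i ∈ s, contractLeft S (c i) z := by
  induction z using TensorProduct.induction_on with
  | zero => simp
  | add z w hz hw => simp only [map_add, hz, hw, Finset.sum_add_distrib]
  | tmul x y => simp only [contractLeft_tmul, Finset.mul_sum, Finset.sum_mul]

theorem contractLeft_smul (r : K) (c : A) (z : A ⊗[K] A) :
    contractLeft S (r • c) z = r • contractLeft S c z := by
  induction z using TensorProduct.induction_on with
  | zero => simp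
  | add z w hz hw => simp only [map_add, hz, hw, smul_add]
  | tmul x y => simp only [contractLeft_tmul, mul_smul_comm, smul_mul_assoc]

theorem contractRight_sum {ι : Type*} (s : Finset ι) (c : ι → A) (z : A ⊗[K] A) :
    contractRight S (∑ i ∈ s, c i) z = ∑ i ∈ s, contractRight S (c i) z := by
  induction z using TensorProduct.induction_on with
  | zero => simp
  | add z w hz hw => simp only [map_add, hz, hw, Finset.sum_add_distrib]
  | tmul x y => simp only [contractRight_tmul, Finset.mul_sum, Finset.sum_mul]

theorem contractRight_smul (r : K) (c : A) (z : A ⊗[K] A) :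
    contractRight S (r • c) z = r • contractRight S c z := by
  induction z using TensorProduct.induction_on with
  | zero => simp
  | add z w hz hw => simp only [map_add, hz, hw, smul_add]
  | tmul x y => simp only [contractRight_tmul, mul_smul_comm, smul_mul_assoc]

/-- Since `S` reverses products, contraction of a product is iterated contraction. -/
theorem contractLeft_mul (hS : ∀ x y, S (x * y) = S y * S x) (c : A) (z w : A ⊗[K] A) :
    contractLeft S c (z * w) = contractLeft S (contractLeft S c z) w := by
  induction w using TensorProduct.induction_on with
  | zero => simp
  | add w w' hw hw' => rw [mul_add, map_add, map_add, hw, hw']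
  | tmul x' y' =>
    induction z using TensorProduct.induction_on with
    | zero => simp [contractLeft_tmul]
    | add z z' hz hz' =>
      rw [add_mul, map_add, hz, hz', map_add, contractLeft_tmul, contractLeft_tmul,
        contractLeft_tmul, mul_add, add_mul]
    | tmul x y =>
      simp only [Algebra.TensorProduct.tmul_mul_tmul, contractLeft_tmul, hS, mul_assoc]

/-- Contraction of a product is iterated contraction, from the inside out. -/
theorem contractRight_mul (hS : ∀ x y, S (x * y) = S y * S x) (c : A) (z w : A ⊗[K] A) :
    contractRight S c (z * w) = contractRight S (contractRight S c w) z := by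
  induction z using TensorProduct.induction_on with
  | zero => simp
  | add z z' hz hz' => rw [add_mul, map_add, map_add, hz, hz']
  | tmul x y =>
    induction w using TensorProduct.induction_on with
    | zero => simp [contractRight_tmul]
    | add w w' hw hw' =>
      rw [mul_add, map_add, hw, hw', map_add, contractRight_tmul, contractRight_tmul,
        contractRight_tmul, add_mul, mul_add]
    | tmul x' y' =>
      simp only [Algebra.TensorProduct.tmul_mul_tmul, contractRight_tmul, hS, mul_assoc]

theorem pmap_contractLeft_tser {σ : Type*} (c : A) (x y : MvPowerSeries σ A) :
    pmap (contractLeft S c) (tser K x y) = pmap S x * (C c * y) := by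
  ext d
  rw [coeff_pmap, coeff_tser, map_sum, MvPowerSeries.coeff_mul]
  refine Finset.sum_congr rfl fun p _ => ?_
  rw [contractLeft_tmul, MvPowerSeries.coeff_C_mul, coeff_pmap, mul_assoc]

theorem pmap_contractRight_tser {σ : Type*} (c : A) (x y : MvPowerSeries σ A) :
    pmap (contractRight S c) (tser K x y) = x * (C c * pmap S y) := by
  ext d
  rw [coeff_pmap, coeff_tser, map_sum, MvPowerSeries.coeff_mul]
  refine Finset.sum_congr rfl fun p _ => ?_
  rw [contractRight_tmul, MvPowerSeries.coeff_C_mul, coeff_pmap]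

variable {π : Type*} [Groupoid π] [Fintype π] [∀ a b : π, Fintype (a ⟶ b)] {e : Arr π → A}
  (h : IsUnits 1 e) (hSe : ∀ f, S (e f) = e f.inv)
include h hSe

/-- Here `S` exchanges the parts of the unit of given source and of given target. -/
theorem contractLeft_copE (c : π) : contractLeft S (tgtU e c) (copE K e) = tgtU e c := by
  have hS : ∀ b, S (tgtU e b) = srcU e b := fun b => by
    rw [tgtU_map, srcU, ← sum_arr_inv]
    exact Finset.sum_congr rfl fun f _ => by simp only [hSe]; rfl
  rw [copE, map_sum]
  simp only [contractLeft_tmul, hS, (h.commute_srcU_tgtU _ c).eq]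
  simp only [mul_assoc, h.srcU_mul_srcU, if_true]
  rw [← Finset.mul_sum, h.sum_srcU, mul_one]

theorem contractRight_copE (c : π) : contractRight S (srcU e c) (copE K e) = srcU e c := by
  have hS : ∀ b, S (srcU e b) = tgtU e b := fun b => by
    rw [srcU_map, tgtU, ← sum_arr_inv]
    exact Finset.sum_congr rfl fun f _ => by simp only [hSe]; rfl
  rw [copE, map_sum]
  simp only [contractRight_tmul, hS, (h.commute_srcU_tgtU c _).eq]
  simp only [← mul_assoc, h.tgtU_mul_tgtU, if_true]
  rw [← Finset.sum_mul, h.sum_tgtU, one_mul]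

variable [Quiver.IsThin π]

/-- The left antipode axiom for the components of the unit: `S(e g) = e g⁻¹` leaves only the pairs
`g = h⁻¹`, whose composition is an identity. -/
theorem contractLeft_copUnit (c : π) (f : Arr π) :
    contractLeft S (tgtU e c) (copUnit K e f) = if f = Arr.one c then tgtU e c else 0 := by
  have hf : ∀ k : Arr π, (f = Arr.one c ∧ k.tgt = c) ↔
      Arr.IsComp k.inv k f ∧ k.tgt = c := fun k => by
    rw [Arr.isComp_iff]
    constructor
    · rintro ⟨rfl, rfl⟩
      exact ⟨⟨rfl, rfl, rfl⟩, rfl⟩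
    · rintro ⟨⟨-, h₁, h₂⟩, rfl⟩
      exact ⟨Arr.ext_of_thin h₁ h₂, rfl⟩
  have hk : ∀ k : Arr π, (∑ g : Arr π,
      if Arr.IsComp g k f then S (e g) * tgtU e c * e k else 0) =
        if f = Arr.one c ∧ k.tgt = c then e k else 0 := fun k => by
    rw [Finset.sum_eq_single k.inv, hSe, Arr.inv_inv, mul_assoc, h.tgtU_mul,
      if_congr (hf k) rfl rfl]
    · simp only [mul_ite, mul_zero, h.mul_self, ← ite_and]
    · intro g _ hg
      rw [mul_assoc, h.tgtU_mul, hSe, mul_ite, mul_zero, h.orth, ite_self, ite_self]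
      rintro rfl
      exact hg g.inv_inv.symm
    · simp
  rw [copUnit, Finset.sum_comm, map_sum]
  simp only [map_sum, apply_ite (contractLeft S _), map_zero, contractLeft_tmul, hk]
  split_ifs with h1
  · simp only [h1, true_and]
    rfl
  · simp [h1]

/-- The right antipode axiom for the components of the unit. -/
theorem contractRight_copUnit (c : π) (f : Arr π) :
    contractRight S (srcU e c) (copUnit K e f) = if f = Arr.one c then srcU e c else 0 := by
  have hf : ∀ k : Arr π, (f = Arr.one c ∧ k.src = c) ↔
      Arr.IsComp k k.inv f ∧ k.src = c := fun k => by
    rw [Arr.isComp_iff]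
    constructor
    · rintro ⟨rfl, rfl⟩
      exact ⟨⟨rfl, rfl, rfl⟩, rfl⟩
    · rintro ⟨⟨-, h₁, h₂⟩, rfl⟩
      exact ⟨Arr.ext_of_thin h₁ h₂, rfl⟩
  have hk : ∀ k : Arr π, (∑ g : Arr π,
      if Arr.IsComp k g f then e k * (srcU e c * S (e g)) else 0) =
        if f = Arr.one c ∧ k.src = c then e k else 0 := fun k => by
    rw [Finset.sum_eq_single k.inv, hSe, Arr.inv_inv, ← mul_assoc, h.mul_srcU,
      if_congr (hf k) rfl rfl]
    · simp only [ite_mul, zero_mul, h.mul_self, ← ite_and]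
    · intro g _ hg
      rw [← mul_assoc, h.mul_srcU, hSe, ite_mul, zero_mul, h.orth, ite_self, ite_self]
      rintro rfl
      exact hg g.inv_inv.symm
    · simp
  rw [copUnit, map_sum]
  simp only [map_sum, apply_ite (contractRight S _), map_zero, contractRight_tmul, hk]
  split_ifs with h1
  · simp only [h1, true_and]
    rfl
  · simp [h1]

end Contraction

/-! ### The antipode axioms -/

section HopfAxioms

open MvPowerSeries (coeff C)

section Units

variable {π : Type*} [Groupoid π] [Fintype π] {X : Type*} [Fintype X] {K : Type*} [CommRing K]
  {A : Type*} [Ring A] [Algebra K A]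

theorem sum_arrUnit_smul (u : Arr π) (c : π) (y : π → A) :
    ∑ b, (arrUnit K u) c b • y b = if c = u.src then y u.tgt else 0 := by
  rw [Finset.sum_eq_single u.tgt]
  · rw [arrUnit, Matrix.single_apply]
    simp only [and_true, eq_comm (a := u.src)]
    rw [ite_smul, one_smul, zero_smul]
  · intro b _ hb
    rw [arrUnit, Matrix.single_apply, if_neg fun h => hb h.2.symm, zero_smul]
  · simp

theorem sum_arrUnit_smul' (u : Arr π) (c : π) (y : π → A) :
    ∑ a, (arrUnit K u) a c • y a = if c = u.tgt then y u.src else 0 := by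
  rw [Finset.sum_eq_single u.src]
  · rw [arrUnit, Matrix.single_apply]
    simp only [true_and, eq_comm (a := u.tgt)]
    rw [ite_smul, one_smul, zero_smul]
  · intro b _ hb
    rw [arrUnit, Matrix.single_apply, if_neg fun h => hb h.1.symm, zero_smul]
  · simp

omit [Groupoid π] in
theorem sum_one_smul (c : π) (y : π → A) : ∑ b, (1 : Matrix π π K) c b • y b = y c := by
  simp [Matrix.one_apply]

omit [Groupoid π] in
theorem sum_one_smul' (c : π) (y : π → A) : ∑ a, (1 : Matrix π π K) a c • y a = y c := by
  simp [Matrix.one_apply]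

variable [∀ a b : π, Fintype (a ⟶ b)]
  {E : A} {e : Arr π → A} (h : IsUnits E e) {F : X → X → MvPowerSeries (Fin 2) A}
  {d : X → Arr π} (hF : IsHomog e d F)
include h hF

/-- The coefficients of `∑ₖ S(Fᵢᵏ) 1_c Fₖʲ`, where `∑ₖ S(Fᵢᵏ) Fₖʲ = δᵢⱼ z` and `1_c` is the part
of the unit of target `c`. -/
theorem coeff_sum_mul_tgtU_mul {S : A →ₗ[K] A} {i j : X}
    (hz : ∑ k, pmap S (F i k) * F k j = if i = j then C (tgtU e (d i).tgt) else 0)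
    (c : π) (n : Fin 2 →₀ ℕ) :
    coeff n (∑ k, pmap S (F i k) * (C (tgtU e c) * F k j)) =
      ∑ b, (if i = j ∧ n = 0 then arrUnit K (d i) else 0) c b • tgtU e b := by
  simp only [hF.tgt_mul_eq h]
  by_cases hij : i = j
  · subst hij
    rw [if_pos rfl] at hz
    by_cases hn : n = 0
    · subst hn
      simp only [and_self, if_true, sum_arrUnit_smul]
      split_ifs with hc
      · rw [hz, MvPowerSeries.coeff_C, if_pos rfl]
      · simp
    · simp only [hn, and_false, if_false, Matrix.zero_apply, zero_smul, Finset.sum_const_zero]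
      split_ifs with hc
      · rw [hz, MvPowerSeries.coeff_C, if_neg hn]
      · simp
  · rw [if_neg hij] at hz
    simp only [hij, false_and, if_false, Matrix.zero_apply, zero_smul, Finset.sum_const_zero]
    split_ifs with hc
    · rw [hz, map_zero]
    · simp

/-- The coefficients of `∑ₖ Fᵢᵏ 1_c S(Fₖʲ)`, where `∑ₖ Fᵢᵏ S(Fₖʲ) = δᵢⱼ z` and `1_c` is the part
of the unit of source `c`. -/
theorem coeff_sum_mul_srcU_mul {S : A →ₗ[K] A} {i j : X}
    (hz : ∑ k, F i k * pmap S (F k j) = if i = j then C (srcU e (d i).src) else 0)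
    (c : π) (n : Fin 2 →₀ ℕ) :
    coeff n (∑ k, F i k * (C (srcU e c) * pmap S (F k j))) =
      ∑ a, (if i = j ∧ n = 0 then arrUnit K (d i) else 0) a c • srcU e a := by
  simp only [← mul_assoc, hF.mul_src_eq h]
  by_cases hij : i = j
  · subst hij
    rw [if_pos rfl] at hz
    by_cases hn : n = 0
    · subst hn
      simp only [and_self, if_true, sum_arrUnit_smul', eq_comm (a := c)]
      split_ifs with hc
      · rw [hz, MvPowerSeries.coeff_C, if_pos rfl]
      · simp
    · simp only [hn, and_false, if_false, Matrix.zero_apply, zero_smul, Finset.sum_const_zero]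
      split_ifs with hc
      · rw [hz, MvPowerSeries.coeff_C, if_neg hn]
      · simp
  · rw [if_neg hij] at hz
    simp only [hij, false_and, if_false, Matrix.zero_apply, zero_smul, Finset.sum_const_zero]
    split_ifs with hc
    · rw [hz, map_zero]
    · simp

end Units

variable {π : Type*} [Groupoid π] [Fintype π] [∀ a b : π, Fintype (a ⟶ b)] {X : Type*} [Fintype X]
  {deg : X → Arr π} {K : Type*} [CommRing K] [Algebra ℂ K] {P : Pairing deg} {L lam : ℂ}
  {cVV cVsV cVsVs : Coeff X (MvPowerSeries (Fin 2) ℂ)}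

namespace RQA

local notation "𝓐" => RQA K P L lam cVV cVsV cVsVs
local notation "𝔤" => gen K P L lam cVV cVsV cVsVs
local notation "𝓒" => component K P L lam cVV cVsV cVsVs
local notation "𝓓" => data K P L lam cVV cVsV cVsVs
local notation "Δ" => cop K P L lam cVV cVsV cVsVs
local notation "𝓮" => fun f => gen K P L lam cVV cVsV cVsVs (Gen.e f)

variable [Quiver.IsThin π]
  {S : RQA K P L lam cVV cVsV cVsVs →ₗ[K] RQA K P L lam cVV cVsV cVsVs}
  (hS : IsAntipode K P L lam (data K P L lam cVV cVsV cVsVs) S)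
include hS

/-- The antipode maps `e f * x * e f'` to `e f'⁻¹ * S x * e f⁻¹`, so it turns squares around by the
double inverse. -/
theorem antipode_mem {α : Sq π} {x : 𝓐} (hx : x ∈ 𝓒 α) : S x ∈ 𝓒 α.iota := by
  rw [← top_mul_of_mem hx, ← mul_bot_of_mem hx, ← mul_assoc, hS.apply_mul, hS.apply_mul]
  have h₁ : S (𝔤 (.e α.botArr)) = 𝔤 (.e α.iota.topArr) := hS.apply_e _
  have h₂ : S (𝔤 (.e α.topArr)) = 𝔤 (.e α.iota.botArr) := hS.apply_e _
  rw [h₁, h₂, ← mul_assoc]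
  exact e_mul_mul_e_mem_component _ _

omit [Quiver.IsThin π] in
/-- `S(T)` is a weak inverse of `T`; likewise for `T^*` and for products in the other order below.
-/
theorem sum_antipode_T_mul (i j : X) : ∑ k, pmap S (serT 𝔤 i k) * serT 𝔤 k j =
    if i = j then C (tgtU 𝓮 (deg i).tgt) else 0 := by
  have h := congrFun (congrFun (isRep (K := K) (P := P) (L := L) (lam := lam) (cVV := cVV)
    (cVsV := cVsV) (cVsVs := cVsVs)
    |>.isWeakInverse_antT rfl xi_central).inv_mul i) j
  rw [Matrix.mul_apply, Matrix.diagonal_apply] at h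
  simp only [← hS.pmap_T] at h
  exact h

omit [Quiver.IsThin π] in
theorem sum_antipode_Ts_mul (i j : X) : ∑ k, pmap S (serTs 𝔤 i k) * serTs 𝔤 k j =
    if i = j then C (tgtU 𝓮 (deg i).inv.tgt) else 0 := by
  have h := congrFun (congrFun (isRep (K := K) (P := P) (L := L) (lam := lam) (cVV := cVV)
    (cVsV := cVsV) (cVsVs := cVsVs)
    |>.isWeakInverse_antTs).inv_mul i) j
  rw [Matrix.mul_apply, Matrix.diagonal_apply] at h
  simp only [← hS.pmap_Ts] at h
  exact h

omit [Quiver.IsThin π] in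
theorem sum_mul_antipode_T (i j : X) : ∑ k, serT 𝔤 i k * pmap S (serT 𝔤 k j) =
    if i = j then C (srcU 𝓮 (deg i).src) else 0 := by
  have h := congrFun (congrFun (isRep (K := K) (P := P) (L := L) (lam := lam) (cVV := cVV)
    (cVsV := cVsV) (cVsVs := cVsVs)
    |>.isWeakInverse_antT rfl xi_central).mul_inv i) j
  rw [Matrix.mul_apply, Matrix.diagonal_apply] at h
  simp only [← hS.pmap_T] at h
  exact h

omit [Quiver.IsThin π] in
theorem sum_mul_antipode_Ts (i j : X) : ∑ k, serTs 𝔤 i k * pmap S (serTs 𝔤 k j) =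
    if i = j then C (srcU 𝓮 (deg i).inv.src) else 0 := by
  have h := congrFun (congrFun (isRep (K := K) (P := P) (L := L) (lam := lam) (cVV := cVV)
    (cVsV := cVsV) (cVsVs := cVsVs)
    |>.isWeakInverse_antTs).mul_inv i) j
  rw [Matrix.mul_apply, Matrix.diagonal_apply] at h
  simp only [← hS.pmap_Ts] at h
  exact h

omit [Quiver.IsThin π] in
theorem antipode_xi_mul (s : Bool) : pmap S (serXi 𝔤 s) * serXi 𝔤 s = 1 := by
  have h := (isRep (K := K) (P := P) (L := L) (lam := lam) (cVV := cVV)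
    (cVsV := cVsV) (cVsVs := cVsVs)).xi_mul (!s)
  rw [Bool.not_not] at h
  exact (congrArg (· * _) (hS.pmap_xi s)).trans (h.trans (map_one C))

variable {ε : RQA K P L lam cVV cVsV cVsVs →ₙₐ[K] Matrix π π K} (hε : IsCounit ε)
include hε

/-- The left antipode axiom in a form that is stable under products. -/
theorem contractLeft_cop (x : 𝓐) : ∀ c : π,
    contractLeft S (tgtU 𝓮 c) (Δ x) = ∑ b, ε x c b • tgtU 𝓮 b := by
  induction x using induction_ser with
  | zero => simp
  | add x y hx hy =>
    intro c
    rw [map_add, map_add, hx, hy, map_add]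
    simp only [Matrix.add_apply, add_smul, Finset.sum_add_distrib]
  | smul r x hx =>
    intro c
    rw [map_smul, map_smul, hx, map_smul]
    simp only [Matrix.smul_apply, smul_assoc, Finset.smul_sum]
  | mul x y hx hy =>
    intro c
    rw [map_mul, contractLeft_mul S hS.apply_mul, hx, contractLeft_sum, map_mul]
    simp only [contractLeft_smul, hy, Matrix.mul_apply, Finset.sum_smul, Finset.smul_sum, mul_smul]
    exact Finset.sum_comm
  | e f =>
    intro c
    rw [cop_e, contractLeft_copUnit S units hS.apply_e, hε.map_e]
    rw [Finset.sum_eq_single c]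
    · rw [counitUnit_apply]
      simp only [and_true]
      rw [ite_smul, one_smul, zero_smul]
    · intro b _ hb
      rw [counitUnit_apply, if_neg fun h => hb h.2.symm, zero_smul]
    · simp
  | T i j d =>
    intro c
    change coeff d (pmap (contractLeft S _) (pmap Δ (serT 𝔤 i j))) = _
    rw [cop_T, pmap_sum, hε.apply_T]
    simp only [pmap_contractLeft_tser]
    exact coeff_sum_mul_tgtU_mul units homT (sum_antipode_T_mul hS i j) c d
  | Ts i j d =>
    intro c
    change coeff d (pmap (contractLeft S _) (pmap Δ (serTs 𝔤 i j))) = _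
    rw [cop_Ts, pmap_sum, hε.apply_Ts]
    simp only [pmap_contractLeft_tser]
    exact coeff_sum_mul_tgtU_mul units homTs (sum_antipode_Ts_mul hS i j) c d
  | xi s d =>
    intro c
    change coeff d (pmap (contractLeft S _) (pmap Δ (serXi 𝔤 s))) = _
    have h : pmap (contractLeft S (tgtU 𝓮 c)) (pmap Δ (serXi 𝔤 s)) = C (tgtU 𝓮 c) := by
      rw [cop_xi]
      have h₁ : pmap (contractLeft S (tgtU 𝓮 c)) (C (copE K 𝓮) * tser K (serXi 𝔤 s) (serXi 𝔤 s)) =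
          pmap (contractLeft S (tgtU 𝓮 c)) (tser K (serXi 𝔤 s) (serXi 𝔤 s)) := by
        ext d
        rw [coeff_pmap, MvPowerSeries.coeff_C_mul, contractLeft_mul S hS.apply_mul,
          contractLeft_copE S units hS.apply_e, coeff_pmap]
      rw [h₁, pmap_contractLeft_tser, (commute_xi s _).symm.eq, ← mul_assoc,
        antipode_xi_mul hS, one_mul]
    rw [h, hε.apply_xi, MvPowerSeries.coeff_C]
    split_ifs
    · exact (sum_one_smul c _).symm
    · simp

/-- The right antipode axiom in a form that is stable under products. -/
theorem contractRight_cop (x : 𝓐) : ∀ c : π,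
    contractRight S (srcU 𝓮 c) (Δ x) = ∑ a, ε x a c • srcU 𝓮 a := by
  induction x using induction_ser with
  | zero => simp
  | add x y hx hy =>
    intro c
    rw [map_add, map_add, hx, hy, map_add]
    simp only [Matrix.add_apply, add_smul, Finset.sum_add_distrib]
  | smul r x hx =>
    intro c
    rw [map_smul, map_smul, hx, map_smul]
    simp only [Matrix.smul_apply, smul_assoc, Finset.smul_sum]
  | mul x y hx hy =>
    intro c
    rw [map_mul, contractRight_mul S hS.apply_mul, hy, contractRight_sum, map_mul]
    simp only [contractRight_smul, hx, Matrix.mul_apply, Finset.sum_smul, Finset.smul_sum,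
      smul_smul]
    rw [Finset.sum_comm]
    simp only [mul_comm]
  | e f =>
    intro c
    rw [cop_e, contractRight_copUnit S units hS.apply_e, hε.map_e]
    rw [Finset.sum_eq_single c]
    · rw [counitUnit_apply]
      simp only [and_true]
      rw [ite_smul, one_smul, zero_smul]
    · intro b _ hb
      rw [counitUnit_apply, if_neg fun h => hb h.2, zero_smul]
    · simp
  | T i j d =>
    intro c
    change coeff d (pmap (contractRight S _) (pmap Δ (serT 𝔤 i j))) = _
    rw [cop_T, pmap_sum, hε.apply_T]
    simp only [pmap_contractRight_tser]
    exact coeff_sum_mul_srcU_mul units homT (sum_mul_antipode_T hS i j) c d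
  | Ts i j d =>
    intro c
    change coeff d (pmap (contractRight S _) (pmap Δ (serTs 𝔤 i j))) = _
    rw [cop_Ts, pmap_sum, hε.apply_Ts]
    simp only [pmap_contractRight_tser]
    exact coeff_sum_mul_srcU_mul units homTs (sum_mul_antipode_Ts hS i j) c d
  | xi s d =>
    intro c
    change coeff d (pmap (contractRight S _) (pmap Δ (serXi 𝔤 s))) = _
    have h : pmap (contractRight S (srcU 𝓮 c)) (pmap Δ (serXi 𝔤 s)) = C (srcU 𝓮 c) := by
      have hcomm : pmap Δ (serXi 𝔤 s) = tser K (serXi 𝔤 s) (serXi 𝔤 s) * C (copE K 𝓮) := by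
        rw [cop_xi]
        exact (commute_of_coeff fun a _ => ((commute_coeff_tser (fun d => xi_central s d)
          (fun d => xi_central s d)) a _)).symm.eq
      rw [hcomm]
      have h₁ : pmap (contractRight S (srcU 𝓮 c)) (tser K (serXi 𝔤 s) (serXi 𝔤 s) * C (copE K 𝓮)) =
          pmap (contractRight S (srcU 𝓮 c)) (tser K (serXi 𝔤 s) (serXi 𝔤 s)) := by
        ext d
        rw [coeff_pmap, MvPowerSeries.coeff_mul_C, contractRight_mul S hS.apply_mul,
          contractRight_copE S units hS.apply_e, coeff_pmap]
      rw [h₁, pmap_contractRight_tser, (commute_xi s _).eq, mul_assoc,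
        antipode_xi_mul hS, mul_one]
    rw [h, hε.apply_xi, MvPowerSeries.coeff_C]
    split_ifs
    · exact (sum_one_smul' c _).symm
    · simp

/-- The left antipode axiom is the sum of `contractLeft_cop` over all objects, because `1` is the
sum of its parts of given target. -/
theorem antipode_left (x : 𝓐) : LinearMap.mul' K 𝓐 (S.rTensor 𝓐 (Δ x)) =
    ∑ u : Arr π, counitMap ε x u • tgtU 𝓮 u.tgt := by
  rw [← contractLeft_one, ← units.sum_tgtU, contractLeft_sum]
  simp only [contractLeft_cop hS hε]
  exact (sum_arr (fun a b => ε x a b • tgtU 𝓮 b) fun a b hab => by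
    rw [hε.apply_eq_zero x a b hab, zero_smul]).symm

/-- The right antipode axiom is the sum of `contractRight_cop` over all objects. -/
theorem antipode_right (x : 𝓐) : LinearMap.mul' K 𝓐 (S.lTensor 𝓐 (Δ x)) =
    ∑ u : Arr π, counitMap ε x u • srcU 𝓮 u.src := by
  rw [← contractRight_one, ← units.sum_srcU, contractRight_sum]
  simp only [contractRight_cop hS hε]
  rw [Finset.sum_comm]
  exact (sum_arr (fun a b => ε x a b • srcU 𝓮 a) fun a b hab => by
    rw [hε.apply_eq_zero x a b hab, zero_smul]).symm

end RQA

end HopfAxioms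

/-! ### The Hopf algebra structure -/

section HopfAlgebra

theorem arrUnit_apply_src_tgt {π : Type*} [Groupoid π] [Quiver.IsThin π] {K : Type*} [CommRing K]
    (u w : Arr π) :
    arrUnit K u w.src w.tgt = (Pi.single u 1 : Arr π → K) w := by
  rw [arrUnit, Matrix.single_apply, Pi.single_apply]
  refine if_congr ⟨?_, ?_⟩ rfl rfl
  · rintro ⟨h₁, h₂⟩
    exact Arr.ext_of_thin h₁.symm h₂.symm
  · rintro rfl
    exact ⟨rfl, rfl⟩

open MvPowerSeries (coeff C)

variable {π : Type*} [Groupoid π] [Fintype π] [∀ a b : π, Fintype (a ⟶ b)] {X : Type*} [Fintype X]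
  {deg : X → Arr π} {K : Type*} [CommRing K] [Algebra ℂ K] {P : Pairing deg} {L lam : ℂ}
  {cVV cVsV cVsVs : Coeff X (MvPowerSeries (Fin 2) ℂ)}

namespace RQA

local notation "𝓐" => RQA K P L lam cVV cVsV cVsVs
local notation "𝔤" => gen K P L lam cVV cVsV cVsVs
local notation "𝓒" => component K P L lam cVV cVsV cVsVs
local notation "𝓓" => data K P L lam cVV cVsV cVsVs
local notation "Δ" => cop K P L lam cVV cVsV cVsVs

theorem e_mem_component (f : Arr π) : 𝔤 (.e f) ∈ 𝓒 (Sq.vid f) :=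
  Submodule.subset_span (HasDegree.e f)

variable [Quiver.IsThin π]

/-- The bialgebra structure given by the coproduct `cop` and a counit. -/
noncomputable def bialgebra {ε : 𝓐 →ₙₐ[K] Matrix π π K} (hε : IsCounit ε) :
    GradedBialgebra K π 𝓐 where
  grading := 𝓒
  eta f := 𝔤 (.e f)
  comul := (Δ : 𝓐 →ₗ[K] 𝓐 ⊗[K] 𝓐)
  counit := counitMap ε
  isInternal := isInternal_component
  mul_mem := mul_mem_component
  mul_eq_zero := mul_eq_zero_of_not_isVComp
  eta_mem := e_mem_component
  sum_eta := units.sum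
  comul_mem := cop_mem_tensorH
  counit_eq_zero := hε.apply_eq_zero_of_mem
  coassoc := cop_coassoc
  counit_comul := hε.counit_cop
  comul_counit := hε.cop_counit
  comul_mul := map_mul Δ
  comul_eta := cop_e
  counit_mul := hε.mul_apply
  counit_eta f := funext (hε.apply_e f)

/-- The Hopf algebra structure given by the coproduct `cop`, a counit and an antipode. -/
noncomputable def hopfAlgebra {ε : 𝓐 →ₙₐ[K] Matrix π π K} (hε : IsCounit ε) {S : 𝓐 ≃ₐ[K] 𝓐ᵐᵒᵖ}
    (hS : IsAntipode K P L lam 𝓓 (opLin S)) : GradedHopfAlgebra K π 𝓐 where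
  toGradedBialgebra := bialgebra hε
  antipode := S
  antipode_mem := antipode_mem hS
  antipode_left := antipode_left hS hε
  antipode_right := antipode_right hS hε

theorem coeff_cop_e_mul_xi (s : Bool) (f : Arr π) (d) :
    Δ (coeff d (C (𝔤 (.e f)) * serXi 𝔤 s)) =
      coeff d (∑ f₁ : Arr π, ∑ f₂ : Arr π, if Arr.IsComp f₁ f₂ f then
        tensorSer K (C (𝔤 (.e f₁)) * serXi 𝔤 s) (C (𝔤 (.e f₂)) * serXi 𝔤 s) else 0) := by
  refine (congrArg (coeff d) (cop_e_mul_xi f s)).trans (congrArg (coeff d) ?_)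
  rw [copUnit, map_sum, Finset.sum_mul]
  refine Finset.sum_congr rfl fun f₁ _ => ?_
  rw [map_sum, Finset.sum_mul]
  refine Finset.sum_congr rfl fun f₂ _ => ?_
  split_ifs
  · rw [tensorSer_eq, ← tser_mul, tser_C]
  · rw [map_zero, zero_mul]

section Counit

variable {ε : RQA K P L lam cVV cVsV cVsVs →ₙₐ[K] Matrix π π K} (hε : IsCounit ε)
include hε

theorem counitMap_T (i j : X) (d) : counitMap ε (coeff d (serT 𝔤 i j)) =
    if i = j ∧ d = 0 then Pi.single (deg i) 1 else 0 := by
  funext w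
  refine (congrArg (fun m : Matrix π π K => m w.src w.tgt) (hε.apply_T i j d)).trans ?_
  split_ifs
  · exact arrUnit_apply_src_tgt _ w
  · rfl

theorem counitMap_Ts (i j : X) (d) : counitMap ε (coeff d (serTs 𝔤 i j)) =
    if i = j ∧ d = 0 then Pi.single (deg i).inv 1 else 0 := by
  funext w
  refine (congrArg (fun m : Matrix π π K => m w.src w.tgt) (hε.apply_Ts i j d)).trans ?_
  split_ifs
  · exact arrUnit_apply_src_tgt _ w
  · rfl

theorem counitMap_e_mul_xi (s : Bool) (f : Arr π) (d) :
    counitMap ε (coeff d (C (𝔤 (.e f)) * serXi 𝔤 s)) =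
      if f = Arr.one f.src ∧ d = 0 then Pi.single f 1 else 0 := by
  funext w
  rw [MvPowerSeries.coeff_C_mul]
  change ε (𝔤 (.e f) * serXi 𝔤 s d) w.src w.tgt = _
  rw [map_mul, hε.apply_xi]
  by_cases hd : d = 0
  · simp only [hd, if_true, and_true]
    refine Eq.trans ?_ (hε.apply_e f w)
    exact congrArg (fun m : Matrix π π K => m w.src w.tgt) (mul_one _)
  · simp only [hd, if_false, and_false]
    exact congrArg (fun m : Matrix π π K => m w.src w.tgt) (mul_zero _)

end Counit

end RQA

end HopfAlgebra

end DG

open DG MvPowerSeries in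
open scoped Classical in
theorem mainTheorem2 {π : Type*} [Groupoid π] [Quiver.IsThin π] [Fintype π]
    [∀ a b : π, Fintype (a ⟶ b)] {X : Type*} [Fintype X] (deg : X → Arr π)
    (K : Type*) [CommRing K] [Algebra ℂ K] (L lam : ℂ) (hL : L ≠ 0)
    (R : UpperHalfPlane → ℂ → Coeff X ℂ) (hR : ∀ τ, IsRMatrix deg (R τ))
    (P : Pairing deg) (hcross : ∀ τ, P.IsCrossingSymmetric lam (R τ))
    (cVV cVsV cVsVs : Coeff X (MvPowerSeries (Fin 2) ℂ))
    (hVV : ∀ i j k l, HasExpansion L (fun τ u => R τ u i j k l) (cVV i j k l))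
    (hVsV : ∀ i j k l, HasExpansion L (fun τ u => P.rotVsV lam (R τ) u i j k l) (cVsV i j k l))
    (hVsVs : ∀ i j k l,
      HasExpansion L (fun τ u => P.rotVsVs lam (R τ) u i j k l) (cVsVs i j k l)) :
    let g := RQA.gen K P L lam cVV cVsV cVsVs
    ∃ H : GradedHopfAlgebra K π (RQA K P L lam cVV cVsV cVsVs),
      H.grading = RQA.component K P L lam cVV cVsV cVsVs ∧
      (∀ f, H.eta f = g (.e f)) ∧
      -- the coproduct
      (∀ i j d, H.comul (coeff d (serT g i j)) =
        coeff d (∑ k, tensorSer K (serT g i k) (serT g k j))) ∧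
      (∀ i j d, H.comul (coeff d (serTs g i j)) =
        coeff d (∑ k, tensorSer K (serTs g i k) (serTs g k j))) ∧
      (∀ s f d, H.comul (coeff d (C (g (.e f)) * serXi g s)) =
        coeff d (∑ f₁ : Arr π, ∑ f₂ : Arr π, if Arr.IsComp f₁ f₂ f then
          tensorSer K (C (g (.e f₁)) * serXi g s) (C (g (.e f₂)) * serXi g s) else 0)) ∧
      -- the counit
      (∀ i j d, H.counit (coeff d (serT g i j)) =
        if i = j ∧ d = 0 then Pi.single (deg i) 1 else 0) ∧
      (∀ i j d, H.counit (coeff d (serTs g i j)) =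
        if i = j ∧ d = 0 then Pi.single (deg i).inv 1 else 0) ∧
      (∀ s f d, H.counit (coeff d (C (g (.e f)) * serXi g s)) =
        if f = Arr.one f.src ∧ d = 0 then Pi.single f 1 else 0) ∧
      -- the antipode
      (∀ i j d, opLin H.antipode (coeff d (serT g i j)) =
        coeff d (shift K L (-lam) (serXi g false) * ∑ k, ∑ l, C (scal K _ (P.om i k * P.sg l j)) *
          shift K L (-lam) (serTs g l k))) ∧
      (∀ i j d, opLin H.antipode (coeff d (serTs g i j)) =
        coeff d (∑ k, ∑ l, C (scal K _ (P.omStar i k * P.sgStar l j)) *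
          shift K L (-lam) (serT g l k))) ∧
      (∀ s d, opLin H.antipode (coeff d (serXi g s)) = coeff d (serXi g (!s))) ∧
      (∀ f, opLin H.antipode (H.eta f) = H.eta f.inv) := by
  intro g
  have gVV := IsGradedCoeff.of_hasExpansion hL (fun τ u => (hR τ).isGradedCoeff u) hVV
  have gVsV := IsGradedCoeff.of_hasExpansion hL
    (fun τ u => P.rotVsV_graded lam (fun v => (hR τ).isGradedCoeff v) u) hVsV
  have gVsVs := IsGradedCoeff.of_hasExpansion hL
    (fun τ u => P.rotVsVs_graded lam (fun v => (hR τ).isGradedCoeff v) u) hVsVs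
  obtain ⟨ε, hε⟩ := RQA.exists_counit (K := K) (P := P) (L := L) (lam := lam) gVV gVsV gVsVs
  obtain ⟨S, hS⟩ :=
    RQA.exists_antipode_equiv (K := K) (P := P) (L := L) (lam := lam) gVV gVsV gVsVs
  refine ⟨RQA.hopfAlgebra hε hS, rfl, fun _ => rfl, ?_, ?_, RQA.coeff_cop_e_mul_xi,
    RQA.counitMap_T hε, RQA.counitMap_Ts hε, RQA.counitMap_e_mul_xi hε, ?_, ?_, ?_, hS.apply_e⟩
  · exact fun i j d => congrArg (coeff d) (RQA.cop_T i j)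
  · exact fun i j d => congrArg (coeff d) (RQA.cop_Ts i j)
  · exact fun i j d => congrArg (coeff d) ((hS.pmap_T i j).trans (RepData.antT_apply ..))
  · exact fun i j d => congrArg (coeff d) ((hS.pmap_Ts i j).trans (RepData.antTs_apply ..))
  · exact fun s d => congrArg (coeff d) (hS.pmap_xi s)
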